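/- Let $k=\mathbb F_q$ be a finite field and let $\mathcal A$ be an abelian $k$-category with finite $\operatorname{Hom}$ and $\operatorname{Ext}^1$ spaces which is hereditary ($\operatorname{Ext}^n=0$ for $n\ge 2$). Write $\hat A\in K_0(\mathcal A)$ for the class of an object, $\langle \hat A,\hat B\rangle=|\operatorname{Hom}(A,B)|/|\operatorname{Ext}^1(A,B)|$ and $(\alpha,\beta)=\langle\alpha,\beta\rangle\langle\beta,\alpha\rangle$ for the induced multiplicative forms on $K_0(\mathcal A)$, and $a_A=|\operatorname{Aut}A|$. All algebras are over $\mathbb C$, and square roots are positive. In a finitary abelian category put $[L]\diamond[M]=\sum_{[X]}\frac{|\operatorname{Ext}^1(L,M)_X|}{|\operatorname{Hom}(L,M)|}[X]$, where $\operatorname{Ext}^1(L,M)_X$ is the set of classes of extensions $0\to M\to X\to L\to 0$ with middle term isomorphic to $X$. **Modified Ringel–Hall algebra.** Let $\mathcal C$ be the category of $\mathbb Z/2$-graded complexes $M^0\rightleftarrows M^1$ over $\mathcal A$, with differentials $d^0:M^0\to M^1$ and $d^1:M^1\to M^0$. Let $\mathcal H(\mathcal C)$ be the algebra with basis the isomorphism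 classes of objects of $\mathcal C$ and product $\diamond$, let $I$ be its two-sided ideal generated by all $[L]-[K\oplus M]$ with $0\to K\to L\to M\to 0$ exact and $K$ acyclic, and let $S=\{c[K] : c\in\mathbb C^\times,\ K \text{ acyclic}\}\subset\mathcal H(\mathcal C)/I$. Let $\mathcal{MH}$ be the universal $S$-inverting algebra of $\mathcal H(\mathcal C)/I$. It is graded by $K_0(\mathcal A)\times K_0(\mathcal A)$, with $[M]$ of degree $(\widehat{M^0},\widehat{M^1})$, and $\mathcal{MH}_{tw}$ is $\mathcal{MH}$ with the twisted product $x*y=\sqrt{\langle\alpha_0,\beta_0\rangle\langle\alpha_1,\beta_1\rangle}\;x\diamond y$ for $x,y$ homogeneous of degrees $(\alpha_0,\alpha_1),(\beta_0,\beta_1)$. For $X\in\mathcal A$ let $C_X$ (resp. $C_X^*$) be the complex with $X$ in degree $1$ (resp. $0$) and zero elsewhere, and let $K_X$ (resp. $K_X^*$) be the complex with $X$ in both degrees and $d^0=1,\ d^1=0$ (resp. $d^0=0,\ d^1=1$). **Twisted extended Ringel–Hall algebra.** $\mathcal H^e_{tw}(\mathcal A)$ has basis $[A]*k_\alpha$ ($[A]$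 an isomorphism class of objects of $\mathcal A$, $\alpha\in K_0(\mathcal A)$) and product determined by $[A]*[B]=\sqrt{\langle\hat A,\hat B\rangle}\,[A]\diamond[B]$, $k_\alpha*k_\beta=k_{\alpha+\beta}$, $k_\alpha*[B]=\sqrt{(\alpha,\hat B)}\,[B]*k_\alpha$, with unit $1=[0]=k_0$. Its coproduct, with values in the completed tensor square, is $$\Delta([A]*k_\alpha)=\sum_{[B],[C]}\sqrt{\langle\hat B,\hat C\rangle}\,\frac{|\operatorname{Ext}^1(B,C)_A|}{|\operatorname{Hom}(B,C)|}\,\frac{a_A}{a_Ba_C}\,([B]*k_{\hat C+\alpha})\otimes([C]*k_\alpha),$$ and $\varphi([M]*k_\alpha,[N]*k_\beta)=\sqrt{(\alpha,\beta)}\,\delta_{[M],[N]}\,a_M$ is its Hopf pairing. **Drinfeld double.** This is an associative algebra structure on $\mathcal H^e_{tw}(\mathcal A)\otimes_{\mathbb C}\mathcal H^e_{tw}(\mathcal A)$, with unit $1\otimes1$, such that * (D1) $a\mapsto a\otimes 1$ and $b\mapsto 1\otimes b$ are injective algebra homomorphisms; * (D2) $(a\otimes1)(1\otimes b)=a\otimes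 b$ for all $a,b$; * (D3) for all $a,b$, in Sweedler notation $\Delta(a)=\sum a_{(1)}\otimes a_{(2)}$, $\Delta(b)=\sum b_{(1)}\otimes b_{(2)}$ with terms indexed by pairs of elements of the basis $[A]*k_\alpha$, $$\sum\varphi(a_{(2)},b_{(1)})\,a_{(1)}\otimes b_{(2)}=\sum\varphi(a_{(1)},b_{(2)})\,(1\otimes b_{(1)})(a_{(2)}\otimes 1),$$ where both sums have only finitely many nonzero terms. **Theorem.** The algebra $\mathcal{MH}$ is the right localization of $\mathcal H(\mathcal C)/I$ at $S$: writing $i$ for the canonical map, every $i(s)$ with $s\in S$ is a unit, every element has the form $i(a)i(s)^{-1}$ with $s\in S$, and $i(a)=i(b)$ if and only if $as=bs$ for some $s\in S$. The Drinfeld double structure exists and is unique. In $\mathcal{MH}_{tw}$ the elements $[K_X]$ and $[K_X^*]$ are invertible, and there are algebra homomorphisms $I_+,I_-:\mathcal H^e_{tw}(\mathcal A)\to\mathcal{MH}_{tw}$ with $$I_+([X])=[C_X],\quad I_+(k_{\hat X-\hat Y})=[K_X]*[K_Y]^{-1},\qquad I_-([X])=[C_X^*],\quad I_-(k_{\hat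 X-\hat Y})=[K_X^*]*[K_Y^*]^{-1}$$ for all $X,Y\in\mathcal A$. The linear map $a\otimes b\mapsto I_+(a)*I_-(b)$ is an isomorphism of algebras from the Drinfeld double of $\mathcal H^e_{tw}(\mathcal A)$ onto $\mathcal{MH}_{tw}$. -/

import Mathlib

open CategoryTheory CategoryTheory.Limits CategoryTheory.Abelian

namespace ModifiedHall

universe v u

attribute [local instance] HasExt.standard

section ShortExactSequences

variable {C : Type u} [Category.{v} C] [Abelian C]

/-- The sequence `0 ⟶ M ⟶ X ⟶ L ⟶ 0` given by `f` and `g` is short exact. -/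
def IsSES {M X L : C} (f : M ⟶ X) (g : X ⟶ L) : Prop :=
  ∃ w : f ≫ g = 0, (ShortComplex.mk f g w).ShortExact

/-- `Ext¹(L, M)_X`: the classes in `Ext¹(L, M)` of the extensions
`0 ⟶ M ⟶ X ⟶ L ⟶ 0` with middle term (isomorphic to) `X`. -/
def extWithMiddle (L M X : C) : Set (Ext L M 1) :=
  {e | ∃ (f : M ⟶ X) (g : X ⟶ L) (w : f ≫ g = 0)
    (h : (ShortComplex.mk f g w).ShortExact), h.extClass = e}

/-- The set of all short exact sequences `0 ⟶ M ⟶ X ⟶ L ⟶ 0` with fixed terms. -/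
def SESPairs (L M X : C) : Type v := {p : (M ⟶ X) × (X ⟶ L) // IsSES p.1 p.2}

lemma IsSES.mono {M X L : C} {f : M ⟶ X} {g : X ⟶ L} (h : IsSES f g) : Mono f := h.2.mono_f

lemma IsSES.epi {M X L : C} {f : M ⟶ X} {g : X ⟶ L} (h : IsSES f g) : Epi g := h.2.epi_g

lemma IsSES.zero {M X L : C} {f : M ⟶ X} {g : X ⟶ L} (h : IsSES f g) : f ≫ g = 0 := h.1

lemma IsSES.lift {M X L : C} {f : M ⟶ X} {g : X ⟶ L} (h : IsSES f g) {T : C} (t : T ⟶ X)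
    (ht : t ≫ g = 0) : ∃ s : T ⟶ M, s ≫ f = t := by
  obtain ⟨w, h⟩ := h
  have := h.mono_f
  exact ⟨h.exact.lift t ht, h.exact.lift_f t ht⟩

lemma IsSES.desc {M X L : C} {f : M ⟶ X} {g : X ⟶ L} (h : IsSES f g) {T : C} (t : X ⟶ T)
    (ht : f ≫ t = 0) : ∃ s : L ⟶ T, g ≫ s = t := by
  obtain ⟨w, h⟩ := h
  have := h.epi_g
  exact ⟨h.exact.desc t ht, h.exact.g_desc t ht⟩

lemma isSES_of_lift {M X L : C} {f : M ⟶ X} {g : X ⟶ L} (hf : Mono f) (hg : Epi g)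
    (w : f ≫ g = 0) (hl : ∀ {T : C} (t : T ⟶ X), t ≫ g = 0 → ∃ s : T ⟶ M, s ≫ f = t) :
    IsSES f g := by
  refine ⟨w, ?_⟩
  have hex : (ShortComplex.mk f g w).Exact := by
    apply ShortComplex.exact_of_f_is_kernel
    exact KernelFork.IsLimit.ofι' _ _ (fun t ht => ⟨(hl t ht).choose, (hl t ht).choose_spec⟩)
  exact { exact := hex, mono_f := hf, epi_g := hg }

lemma isSES_of_desc {M X L : C} {f : M ⟶ X} {g : X ⟶ L} (hf : Mono f) (hg : Epi g)
    (w : f ≫ g = 0) (hl : ∀ {T : C} (t : X ⟶ T), f ≫ t = 0 → ∃ s : L ⟶ T, g ≫ s = t) :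
    IsSES f g := by
  refine ⟨w, ?_⟩
  have hex : (ShortComplex.mk f g w).Exact := by
    apply ShortComplex.exact_of_g_is_cokernel
    exact CokernelCofork.IsColimit.ofπ' _ _ (fun t ht => ⟨(hl t ht).choose, (hl t ht).choose_spec⟩)
  exact { exact := hex, mono_f := hf, epi_g := hg }

/-- Morphisms of extensions with identity outer terms are isomorphisms. -/
lemma isIso_of_isSES {M X X' L : C} {f : M ⟶ X} {g : X ⟶ L} {f' : M ⟶ X'} {g' : X' ⟶ L}
    (h : IsSES f g) (h' : IsSES f' g') (ν : X ⟶ X') (h₁ : f ≫ ν = f') (h₂ : ν ≫ g' = g) :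
    IsIso ν := by
  let φ : ShortComplex.mk f g h.1 ⟶ ShortComplex.mk f' g' h'.1 :=
    { τ₁ := 𝟙 _, τ₂ := ν, τ₃ := 𝟙 _
      comm₁₂ := by simp [h₁]
      comm₂₃ := by simp [h₂] }
  have : IsIso φ.τ₁ := by dsimp [φ]; infer_instance
  have : IsIso φ.τ₃ := by dsimp [φ]; infer_instance
  exact ShortComplex.isIso₂_of_shortExact_of_isIso₁₃ φ h.2 h'.2

/-- Two extensions with the same class are equivalent. -/
lemma exists_of_extClass_eq {M X X' L : C} {f : M ⟶ X} {g : X ⟶ L} {f' : M ⟶ X'} {g' : X' ⟶ L}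
    (h : IsSES f g) (h' : IsSES f' g') (he : h.2.extClass = h'.2.extClass) :
    ∃ ν : X ≅ X', f ≫ ν.hom = f' ∧ ν.hom ≫ g' = g := by
  obtain ⟨w, h1⟩ := h
  obtain ⟨w', h1'⟩ := h'
  dsimp only at he
  obtain ⟨x, hx⟩ := Ext.contravariant_sequence_exact₁ h1 X' (Ext.mk₀ f') (add_zero 1)
    (by rw [he]; exact h1'.extClass_comp)
  obtain ⟨ν, rfl⟩ := Ext.mk₀_bijective _ _ |>.2 x
  have hν : f ≫ ν = f' := by
    dsimp only at hx
    rw [Ext.mk₀_comp_mk₀] at hx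
    exact (Ext.mk₀_bijective _ _).1 hx
  obtain ⟨t, ht⟩ := IsSES.desc ⟨w, h1⟩ (ν ≫ g') (by rw [← Category.assoc, hν, w'])
  let φ : ShortComplex.mk f g w ⟶ ShortComplex.mk f' g' w' :=
    { τ₁ := 𝟙 _, τ₂ := ν, τ₃ := t
      comm₁₂ := by simp [hν]
      comm₂₃ := by simp [ht] }
  have hn := ShortComplex.ShortExact.extClass_naturality h1 h1' φ
  dsimp only [φ] at hn
  rw [Ext.comp_mk₀_id, he] at hn
  have hz : (Ext.mk₀ (𝟙 L - t)).comp h1'.extClass (zero_add 1) = 0 := by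
    have : Ext.mk₀ (𝟙 L - t) = Ext.mk₀ (𝟙 L) - Ext.mk₀ t := by
      rw [sub_eq_add_neg, Ext.mk₀_add, Ext.mk₀_neg, sub_eq_add_neg]
    rw [this, sub_eq_add_neg, Ext.add_comp, Ext.neg_comp, ← hn, Ext.mk₀_id_comp, add_neg_cancel]
  obtain ⟨y, hy⟩ := Ext.covariant_sequence_exact₃ L h1' (Ext.mk₀ (𝟙 L - t)) (zero_add 1) hz
  obtain ⟨s, rfl⟩ := Ext.mk₀_bijective _ _ |>.2 y
  have hs : s ≫ g' = 𝟙 L - t := by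
    dsimp only at hy
    rw [Ext.mk₀_comp_mk₀] at hy
    exact (Ext.mk₀_bijective _ _).1 hy
  have e1 : f ≫ (ν + g ≫ s) = f' := by
    rw [Preadditive.comp_add, hν, ← Category.assoc, w, zero_comp, add_zero]
  have e2 : (ν + g ≫ s) ≫ g' = g := by
    rw [Preadditive.add_comp, Category.assoc, hs, ← ht, Preadditive.comp_sub, Category.comp_id]
    abel
  have := isIso_of_isSES ⟨w, h1⟩ ⟨w', h1'⟩ _ e1 e2
  exact ⟨asIso (ν + g ≫ s), e1, e2⟩

lemma IsSES.comp_iso {M X X' L : C} {f : M ⟶ X} {g : X ⟶ L} (h : IsSES f g) (ν : X ≅ X') :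
    IsSES (f ≫ ν.hom) (ν.inv ≫ g) := by
  have := h.mono
  have := h.epi
  refine isSES_of_lift inferInstance inferInstance (by simp [h.zero]) fun t ht => ?_
  obtain ⟨s, hs⟩ := h.lift (t ≫ ν.inv) (by simpa using ht)
  exact ⟨s, by rw [← Category.assoc, hs]; simp⟩

lemma extClass_comp_iso {M X X' L : C} {f : M ⟶ X} {g : X ⟶ L} (h : IsSES f g) (ν : X ≅ X') :
    (h.comp_iso ν).2.extClass = h.2.extClass := by
  let φ : ShortComplex.mk f g h.1 ⟶ ShortComplex.mk _ _ (h.comp_iso ν).1 :=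
    { τ₁ := 𝟙 _, τ₂ := ν.hom, τ₃ := 𝟙 _
      comm₁₂ := by simp
      comm₂₃ := by simp }
  have hn := ShortComplex.ShortExact.extClass_naturality h.2 (h.comp_iso ν).2 φ
  dsimp only [φ] at hn
  rw [Ext.comp_mk₀_id, Ext.mk₀_id_comp] at hn
  exact hn.symm

/-- Riedtmann's formula, the link between `Ext¹(L, M)_X` and short exact sequences. -/
lemma card_SESPairs (L M X : C) :
    Nat.card (SESPairs L M X) * Nat.card (L ⟶ M) =
      Nat.card (extWithMiddle L M X) * Nat.card (Aut X) := by
  classical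
  have hch : ∀ e : extWithMiddle L M X, ∃ p : SESPairs L M X, p.2.2.extClass = e.1 := by
    rintro ⟨e, f, g, w, h, rfl⟩
    exact ⟨⟨(f, g), w, h⟩, rfl⟩
  choose c hc using hch
  let φ : extWithMiddle L M X × Aut X → SESPairs L M X := fun x =>
    ⟨((c x.1).1.1 ≫ x.2.hom, x.2.inv ≫ (c x.1).1.2), (c x.1).2.comp_iso x.2⟩
  have hφ : ∀ x, (φ x).2.2.extClass = x.1.1 := fun x => by
    rw [← hc x.1]; exact extClass_comp_iso (c x.1).2 x.2
  have key : ∀ p : SESPairs L M X, Nonempty ({x // φ x = p} ≃ (L ⟶ M)) := by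
    intro p
    let e : extWithMiddle L M X := ⟨p.2.2.extClass, p.1.1, p.1.2, p.2.1, p.2.2, rfl⟩
    obtain ⟨ν₀, hν₁, hν₂⟩ := exists_of_extClass_eq (c e).2 p.2 (hc e)
    have hmem : ∀ x : extWithMiddle L M X × Aut X, φ x = p →
        x.1 = e := by
      rintro x rfl
      exact Subtype.ext (hφ x).symm
    have hmem2 : ∀ ν : Aut X, (φ (e, ν) = p ↔
        ((c e).1.1 ≫ ν.hom = p.1.1 ∧ ν.hom ≫ p.1.2 = (c e).1.2)) := by
      intro ν
      constructor
      · rintro h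
        rw [← h]
        exact ⟨rfl, Iso.hom_inv_id_assoc (self := ν) _⟩
      · rintro ⟨h1, h2⟩
        apply Subtype.ext
        refine Prod.ext h1 ?_
        change ν.inv ≫ (c e).1.2 = p.1.2
        rw [← h2]
        exact Iso.inv_hom_id_assoc (self := ν) _
    let ψ : (L ⟶ M) → {x // φ x = p} := fun s =>
      have e1 : (c e).1.1 ≫ (ν₀.hom + (c e).1.2 ≫ s ≫ p.1.1) = p.1.1 := by
        rw [Preadditive.comp_add, hν₁, ← Category.assoc, (c e).2.1, zero_comp, add_zero]
      have e2 : (ν₀.hom + (c e).1.2 ≫ s ≫ p.1.1) ≫ p.1.2 = (c e).1.2 := by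
        rw [Preadditive.add_comp, hν₂]; simp [p.2.1]
      have := isIso_of_isSES (c e).2 p.2 _ e1 e2
      ⟨(e, asIso (ν₀.hom + (c e).1.2 ≫ s ≫ p.1.1)), (hmem2 _).2 ⟨e1, e2⟩⟩
    refine ⟨(Equiv.ofBijective ψ ⟨?_, ?_⟩).symm⟩
    · intro s s' hs
      have h1 : ν₀.hom + (c e).1.2 ≫ s ≫ p.1.1 = ν₀.hom + (c e).1.2 ≫ s' ≫ p.1.1 :=
        congrArg (fun x : {x // φ x = p} => x.1.2.hom) hs
      have h2 := add_left_cancel h1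
      have := (c e).2.epi
      have := p.2.mono
      rwa [cancel_epi, cancel_mono] at h2
    · rintro ⟨⟨e', ν⟩, hx⟩
      obtain rfl : e' = e := hmem _ hx
      obtain ⟨h1, h2⟩ := (hmem2 ν).1 hx
      obtain ⟨t, ht⟩ := (c e).2.desc (ν.hom - ν₀.hom) (by
        rw [Preadditive.comp_sub, h1, hν₁, sub_self])
      have := (c e).2.epi
      obtain ⟨s, hs⟩ := p.2.lift t (by
        rw [← cancel_epi (c e).1.2, ← Category.assoc, ht, Preadditive.sub_comp, h2, hν₂]; simp)
      refine ⟨s, Subtype.ext (Prod.ext rfl (Iso.ext ?_))⟩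
      change ν₀.hom + (c e).1.2 ≫ s ≫ p.1.1 = ν.hom
      rw [hs, ht]; abel
  rw [← Nat.card_prod, ← Nat.card_prod]
  refine Nat.card_congr (((Equiv.sigmaFiberEquiv φ).symm.trans
    ((Equiv.sigmaCongrRight fun p => (key p).some).trans (Equiv.sigmaEquivProd _ _))).symm)

end ShortExactSequences

section IsoClasses

/-- The isomorphism classes of objects of `C`. -/
def IsoClass (C : Type u) [Category.{v} C] : Type u := Quotient (isIsomorphicSetoid C)

variable {C : Type u} [Category.{v} C]

/-- The isomorphism class `[X]`. -/
def isoCls (X : C) : IsoClass C := Quotient.mk (isIsomorphicSetoid C) X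

/-- A chosen object in an isomorphism class. -/
noncomputable def IsoClass.rep (x : IsoClass C) : C := Quotient.out x

lemma isoCls_rep (x : IsoClass C) : isoCls x.rep = x := Quotient.out_eq x

lemma isoCls_eq_iff {X Y : C} : isoCls X = isoCls Y ↔ Nonempty (X ≅ Y) :=
  Quotient.eq (r := isIsomorphicSetoid C)

lemma rep_isoCls (X : C) : Nonempty ((isoCls X).rep ≅ X) :=
  isoCls_eq_iff.1 (isoCls_rep _)

end IsoClasses

section HallNumbers

/-- The finiteness needed to form the Ringel-Hall algebra: there are finitely many morphisms
between two objects, and finitely many isomorphism classes of extensions of one object by another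
(the latter holds as soon as `Ext¹` is finite). -/
class HallFinite (C : Type u) [Category.{v} C] [Abelian C] : Prop where
  finite_hom : ∀ X Y : C, Finite (X ⟶ Y)
  finite_middle : ∀ L M : C,
    {x : IsoClass C | ∃ (f : M ⟶ x.rep) (g : x.rep ⟶ L), IsSES f g}.Finite

attribute [instance] HallFinite.finite_hom

variable {C : Type u} [Category.{v} C] [Abelian C]

/-- The structure constants `|Ext¹(L, M)_X| / |Hom(L, M)|` of the Ringel-Hall algebra, for
objects `L`, `M`, `X` in given isomorphism classes. -/
noncomputable def hallNum (a b x : IsoClass C) : ℂ :=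
  (Nat.card (extWithMiddle a.rep b.rep x.rep) : ℂ) / (Nat.card (a.rep ⟶ b.rep) : ℂ)

/-- The order of the automorphism group of an object in the given isomorphism class. -/
noncomputable def autNum (a : IsoClass C) : ℂ := (Nat.card (Aut a.rep) : ℂ)

/-- Kernels of a fixed epimorphism, as isomorphisms with the chosen kernel. -/
lemma card_kernels (X : C) {Y A : C} (e : Y ⟶ A) [Epi e] :
    Nat.card {f : X ⟶ Y // IsSES f e} = Nat.card (X ≅ kernel e) := by
  have hk : IsSES (kernel.ι e) e := isSES_of_lift inferInstance inferInstance (by simp)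
    fun t ht => ⟨kernel.lift e t ht, by simp⟩
  symm
  refine Nat.card_congr (Equiv.ofBijective
    (fun i : X ≅ kernel e => ⟨i.hom ≫ kernel.ι e, ?_⟩) ⟨?_, ?_⟩)
  · refine isSES_of_lift inferInstance inferInstance (by simp) fun t ht => ?_
    exact ⟨kernel.lift e t ht ≫ i.inv, by simp⟩
  · intro i j h
    have := congrArg Subtype.val h
    exact Iso.ext (by simpa [cancel_mono] using this)
  · rintro ⟨f, hf⟩
    have := hf.mono
    obtain ⟨s, hs⟩ := hf.lift (kernel.ι e) (by simp)
    refine ⟨⟨kernel.lift e f hf.zero, s, ?_, ?_⟩, ?_⟩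
    · rw [← cancel_mono f]; simp [hs]
    · rw [← cancel_mono (kernel.ι e)]; simp [hs]
    · simp

lemma card_cokernels (X : C) {Y A : C} (m : A ⟶ Y) [Mono m] :
    Nat.card {g : Y ⟶ X // IsSES m g} = Nat.card (X ≅ cokernel m) := by
  symm
  refine Nat.card_congr (Equiv.ofBijective
    (fun i : X ≅ cokernel m => ⟨cokernel.π m ≫ i.inv, ?_⟩) ⟨?_, ?_⟩)
  · refine isSES_of_desc inferInstance inferInstance (by simp) fun t ht => ?_
    exact ⟨i.hom ≫ cokernel.desc m t ht, by simp⟩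
  · intro i j h
    have h' : i.inv = j.inv := by
      have := congrArg Subtype.val h
      simpa [cancel_epi] using this
    have h2 : i.symm = j.symm := Iso.ext h'
    have := congrArg Iso.symm h2
    simpa using this
  · rintro ⟨f, hf⟩
    have := hf.epi
    obtain ⟨s, hs⟩ := hf.desc (cokernel.π m) (by simp)
    refine ⟨⟨s, cokernel.desc m f hf.zero, ?_, ?_⟩, ?_⟩
    · rw [← cancel_epi f, ← Category.assoc, hs]; simp
    · rw [← cancel_epi (cokernel.π m)]; simp [hs]
    · simp

lemma exists_left {A B X Y L X' : C} {f₁ : B ⟶ X} {g₁ : X ⟶ A} (h₁ : IsSES f₁ g₁) {f₂ : L ⟶ Y}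
    {g₂ : Y ⟶ X} (h₂ : IsSES f₂ g₂) {f : X' ⟶ Y} (h : IsSES f (g₂ ≫ g₁)) :
    ∃ (f' : L ⟶ X') (g' : X' ⟶ B), IsSES f' g' ∧ f' ≫ f = f₂ ∧ g' ≫ f₁ = f ≫ g₂ := by
  have := h.mono
  have := h₁.mono
  have := h₂.mono
  have := h₂.epi
  obtain ⟨f', hf'⟩ := h.lift f₂ (by rw [← Category.assoc, h₂.zero, zero_comp])
  obtain ⟨g', hg'⟩ := h₁.lift (f ≫ g₂) (by rw [Category.assoc, h.zero])
  refine ⟨f', g', isSES_of_lift ?_ ?_ ?_ ?_, hf', hg'⟩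
  · have : Mono (f' ≫ f) := by rw [hf']; infer_instance
    exact mono_of_mono f' f
  · rw [epi_iff_surjective_up_to_refinements]
    intro T y
    obtain ⟨T', π, hπ, z, hz⟩ := surjective_up_to_refinements_of_epi g₂ (y ≫ f₁)
    obtain ⟨w, hw⟩ := h.lift z (by rw [← Category.assoc, ← hz]; simp [h₁.zero])
    refine ⟨T', π, hπ, w, ?_⟩
    rw [← cancel_mono f₁, Category.assoc, Category.assoc, hg', ← Category.assoc w, hw, hz]
  · rw [← cancel_mono f₁, Category.assoc, hg', ← Category.assoc, hf', h₂.zero, zero_comp]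
  · intro T t ht
    obtain ⟨s, hs⟩ := h₂.lift (t ≫ f) (by
      rw [Category.assoc, ← hg', ← Category.assoc, ht, zero_comp])
    exact ⟨s, by rw [← cancel_mono f, Category.assoc, hf', hs]⟩

lemma exists_right {A B X Y L X' : C} {f₁ : L ⟶ X'} {g₁ : X' ⟶ B} (h₁ : IsSES f₁ g₁) {f₂ : X' ⟶ Y}
    {g₂ : Y ⟶ A} (h₂ : IsSES f₂ g₂) {g : Y ⟶ X} (h : IsSES (f₁ ≫ f₂) g) :
    ∃ (f' : B ⟶ X) (g' : X ⟶ A), IsSES f' g' ∧ g ≫ g' = g₂ ∧ g₁ ≫ f' = f₂ ≫ g := by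
  have := h.epi
  have := h₁.epi
  have := h₂.epi
  have := h₂.mono
  obtain ⟨g', hg'⟩ := h.desc g₂ (by rw [Category.assoc, h₂.zero, comp_zero])
  obtain ⟨f', hf'⟩ := h₁.desc (f₂ ≫ g) (by rw [← Category.assoc, h.zero])
  refine ⟨f', g', isSES_of_desc ?_ ?_ ?_ ?_, hg', hf'⟩
  · apply Preadditive.mono_of_cancel_zero
    intro T t ht
    obtain ⟨T', π, hπ, w, hw⟩ := surjective_up_to_refinements_of_epi g₁ t
    obtain ⟨s, hs⟩ := h.lift (w ≫ f₂) (by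
      rw [Category.assoc, ← hf', ← Category.assoc, ← hw, Category.assoc, ht, comp_zero])
    have hs' : s ≫ f₁ = w := by rw [← cancel_mono f₂, Category.assoc, hs]
    rw [← cancel_epi π, hw, ← hs', Category.assoc, h₁.zero, comp_zero, comp_zero]
  · have : Epi (g ≫ g') := by rw [hg']; infer_instance
    exact epi_of_epi g g'
  · rw [← cancel_epi g₁, ← Category.assoc, hf', Category.assoc, hg', h₂.zero, comp_zero]
  · intro T t ht
    obtain ⟨s, hs⟩ := h₂.desc (g ≫ t) (by
      rw [← Category.assoc, ← hf', Category.assoc, ht, comp_zero])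
    exact ⟨s, by rw [← cancel_epi g, ← Category.assoc, hg', hs]⟩

/-- Compatible pairs of two-step filtrations. -/
def Compat {A B L X X' Y : C} (p : SESPairs A B X × SESPairs X L Y)
    (q : SESPairs B L X' × SESPairs A X' Y) : Prop :=
  q.1.1.1 ≫ q.2.1.1 = p.2.1.1 ∧ p.2.1.2 ≫ p.1.1.2 = q.2.1.2 ∧ q.1.1.2 ≫ p.1.1.1 = q.2.1.1 ≫ p.2.1.2

lemma card_compat_left {A B L X X' Y : C} (p : SESPairs A B X × SESPairs X L Y) :
    Nat.card {q : SESPairs B L X' × SESPairs A X' Y // Compat p q} =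
      Nat.card {f : X' ⟶ Y // IsSES f (p.2.1.2 ≫ p.1.1.2)} := by
  refine Nat.card_congr (Equiv.ofBijective (fun q => ⟨q.1.2.1.1, ?_⟩) ⟨?_, ?_⟩)
  · rw [q.2.2.1]; exact q.1.2.2
  · rintro ⟨⟨q₁, q₂⟩, h⟩ ⟨⟨q₁', q₂'⟩, h'⟩ he
    have he' : q₂.1.1 = q₂'.1.1 := congrArg Subtype.val he
    obtain ⟨h1, h2, h3⟩ := h
    obtain ⟨h1', h2', h3'⟩ := h'
    dsimp only at h1 h2 h3 h1' h2' h3'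
    have := q₂'.2.mono
    have := p.1.2.mono
    have e2 : q₂ = q₂' := Subtype.ext (Prod.ext he' (h2.symm.trans h2'))
    subst e2
    have e1 : q₁ = q₁' := by
      refine Subtype.ext (Prod.ext ?_ ?_)
      · rw [← cancel_mono q₂.1.1, h1, h1']
      · rw [← cancel_mono p.1.1.1, h3, h3']
    subst e1
    rfl
  · rintro ⟨f, hf⟩
    obtain ⟨f', g', h, h1, h2⟩ := exists_left p.1.2 p.2.2 hf
    exact ⟨⟨(⟨(f', g'), h⟩, ⟨(f, _), hf⟩), h1, rfl, h2⟩, rfl⟩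

lemma card_compat_right {A B L X X' Y : C} (q : SESPairs B L X' × SESPairs A X' Y) :
    Nat.card {p : SESPairs A B X × SESPairs X L Y // Compat p q} =
      Nat.card {g : Y ⟶ X // IsSES (q.1.1.1 ≫ q.2.1.1) g} := by
  refine Nat.card_congr (Equiv.ofBijective (fun p => ⟨p.1.2.1.2, ?_⟩) ⟨?_, ?_⟩)
  · rw [p.2.1]; exact p.1.2.2
  · rintro ⟨⟨p₁, p₂⟩, h⟩ ⟨⟨p₁', p₂'⟩, h'⟩ he
    have he' : p₂.1.2 = p₂'.1.2 := congrArg Subtype.val he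
    obtain ⟨h1, h2, h3⟩ := h
    obtain ⟨h1', h2', h3'⟩ := h'
    dsimp only at h1 h2 h3 h1' h2' h3'
    have := p₂'.2.epi
    have := q.1.2.epi
    have e2 : p₂ = p₂' := Subtype.ext (Prod.ext (h1.symm.trans h1') he')
    subst e2
    have e1 : p₁ = p₁' := by
      refine Subtype.ext (Prod.ext ?_ ?_)
      · rw [← cancel_epi q.1.1.2, h3, h3']
      · rw [← cancel_epi p₂.1.2, h2, h2']
    subst e1
    rfl
  · rintro ⟨g, hg⟩
    obtain ⟨f', g', h, h1, h2⟩ := exists_right q.1.2 q.2.2 hg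
    exact ⟨⟨(⟨(f', g'), h⟩, ⟨(_, g), hg⟩), rfl, h1, h2⟩, rfl⟩

variable [HallFinite C]

instance finite_iso (X Y : C) : Finite (X ≅ Y) :=
  Finite.of_injective (fun e : X ≅ Y => e.hom) fun _ _ h => Iso.ext h

instance finite_aut (X : C) : Finite (Aut X) := finite_iso X X

instance finite_SESPairs (L M X : C) : Finite (SESPairs L M X) :=
  inferInstanceAs (Finite {p : (M ⟶ X) × (X ⟶ L) // IsSES p.1 p.2})

lemma autNum_ne_zero (a : IsoClass C) : autNum a ≠ 0 := by
  have : Nonempty (Aut a.rep) := ⟨1⟩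
  rw [autNum]
  exact_mod_cast (Nat.card_pos (α := Aut a.rep)).ne'

lemma hallNum_eq (a b x : IsoClass C) :
    hallNum a b x = (Nat.card (SESPairs a.rep b.rep x.rep) : ℂ) / autNum x := by
  have h := card_SESPairs a.rep b.rep x.rep
  have h1 : (Nat.card (a.rep ⟶ b.rep) : ℂ) ≠ 0 := by
    have : Nonempty (a.rep ⟶ b.rep) := ⟨0⟩
    exact_mod_cast (Nat.card_pos (α := a.rep ⟶ b.rep)).ne'
  rw [hallNum, div_eq_div_iff h1 (autNum_ne_zero x), autNum]
  exact_mod_cast h.symm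

lemma hallNum_ne_zero_iff (a b x : IsoClass C) :
    hallNum a b x ≠ 0 ↔ ∃ (f : b.rep ⟶ x.rep) (g : x.rep ⟶ a.rep), IsSES f g := by
  rw [hallNum_eq, div_ne_zero_iff, and_iff_left (autNum_ne_zero x), Nat.cast_ne_zero,
    Nat.card_ne_zero, and_iff_left (finite_SESPairs _ _ _)]
  exact ⟨fun ⟨p⟩ => ⟨p.1.1, p.1.2, p.2⟩, fun ⟨f, g, h⟩ => ⟨⟨(f, g), h⟩⟩⟩

lemma hallNum_support_finite (a b : IsoClass C) : (Function.support (hallNum a b)).Finite := by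
  refine (HallFinite.finite_middle a.rep b.rep).subset fun x hx => ?_
  exact (hallNum_ne_zero_iff a b x).1 hx

open Classical in
lemma card_iso (x : IsoClass C) (Z : C) :
    (Nat.card (x.rep ≅ Z) : ℂ) / autNum x = if x = isoCls Z then 1 else 0 := by
  split_ifs with h
  · subst h
    obtain ⟨e⟩ := rep_isoCls Z
    have : Nat.card ((isoCls Z).rep ≅ Z) = Nat.card (Aut (isoCls Z).rep) :=
      Nat.card_congr
        { toFun := fun i => i ≪≫ e.symm
          invFun := fun i => Iso.trans i e
          left_inv := fun i => by simp
          right_inv := fun i => Iso.ext (by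
            change (Iso.hom (X := (isoCls Z).rep) i ≫ e.hom) ≫ e.inv = Iso.hom i
            simp) }
    rw [this]
    exact div_self (autNum_ne_zero _)
  · have : IsEmpty (x.rep ≅ Z) :=
      ⟨fun e => h (by rw [← isoCls_rep x]; exact isoCls_eq_iff.2 ⟨e⟩)⟩
    simp

lemma card_subtype_prod {α β : Type*} [Finite α] [Finite β] (r : α → β → Prop) (S : α → ℕ)
    (h : ∀ a, Nat.card {b // r a b} = S a) [Fintype α] :
    Nat.card {x : α × β // r x.1 x.2} = ∑ a, S a := by
  rw [Nat.card_congr (Equiv.subtypeProdEquivSigmaSubtype r), Nat.card_sigma]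
  exact Finset.sum_congr rfl fun a _ => h a

open Classical in
lemma card_left_sum (a b c x y : IsoClass C) (F : Finset (IsoClass C))
    (hF : ∀ z, hallNum b c z ≠ 0 → z ∈ F) :
    ∑ z ∈ F, (Nat.card {t : (SESPairs a.rep b.rep x.rep × SESPairs x.rep c.rep y.rep) ×
      (SESPairs b.rep c.rep z.rep × SESPairs a.rep z.rep y.rep) // Compat t.1 t.2} : ℂ) / autNum z =
    (Nat.card (SESPairs a.rep b.rep x.rep) : ℂ) * Nat.card (SESPairs x.rep c.rep y.rep) := by
  have : Fintype (SESPairs a.rep b.rep x.rep × SESPairs x.rep c.rep y.rep) := Fintype.ofFinite _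
  have h1 : ∀ z : IsoClass C, _ := fun z => card_subtype_prod (Compat (X' := z.rep)) _
    fun p : SESPairs a.rep b.rep x.rep × SESPairs x.rep c.rep y.rep => card_compat_left p
  simp_rw [h1, Nat.cast_sum, Finset.sum_div]
  rw [Finset.sum_comm, ← Nat.cast_mul, ← Nat.card_prod, Nat.card_eq_fintype_card,
    Fintype.card, Finset.card_eq_sum_ones, Nat.cast_sum]
  refine Finset.sum_congr rfl fun p _ => ?_
  have := p.1.2.epi
  have := p.2.2.epi
  simp_rw [card_kernels, card_iso]
  rw [Finset.sum_ite_eq', if_pos, Nat.cast_one]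
  apply hF
  rw [hallNum_ne_zero_iff]
  obtain ⟨e⟩ := rep_isoCls (kernel (p.2.1.2 ≫ p.1.1.2))
  have hk : IsSES (e.hom ≫ kernel.ι (p.2.1.2 ≫ p.1.1.2)) (p.2.1.2 ≫ p.1.1.2) :=
    isSES_of_lift inferInstance inferInstance (by simp)
      fun t ht => ⟨kernel.lift _ t ht ≫ e.inv, by simp⟩
  obtain ⟨f', g', h, -⟩ := exists_left p.1.2 p.2.2 hk
  exact ⟨f', g', h⟩

open Classical in
lemma card_right_sum (a b c x y : IsoClass C) (F : Finset (IsoClass C))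
    (hF : ∀ z, hallNum a b z ≠ 0 → z ∈ F) :
    ∑ z ∈ F, (Nat.card {t : (SESPairs a.rep b.rep z.rep × SESPairs z.rep c.rep y.rep) ×
      (SESPairs b.rep c.rep x.rep × SESPairs a.rep x.rep y.rep) // Compat t.1 t.2} : ℂ) / autNum z =
    (Nat.card (SESPairs b.rep c.rep x.rep) : ℂ) * Nat.card (SESPairs a.rep x.rep y.rep) := by
  have : Fintype (SESPairs b.rep c.rep x.rep × SESPairs a.rep x.rep y.rep) := Fintype.ofFinite _
  have h0 : ∀ z : IsoClass C,
      Nat.card {t : (SESPairs a.rep b.rep z.rep × SESPairs z.rep c.rep y.rep) ×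
      (SESPairs b.rep c.rep x.rep × SESPairs a.rep x.rep y.rep) // Compat t.1 t.2} =
      Nat.card {t : (SESPairs b.rep c.rep x.rep × SESPairs a.rep x.rep y.rep) ×
      (SESPairs a.rep b.rep z.rep × SESPairs z.rep c.rep y.rep) // Compat t.2 t.1} := fun z =>
    Nat.card_congr ((Equiv.prodComm _ _).subtypeEquiv fun t => Iff.rfl)
  have h1 : ∀ z : IsoClass C, _ := fun z => card_subtype_prod (fun q p => Compat (X := z.rep) p q) _
    fun q : SESPairs b.rep c.rep x.rep × SESPairs a.rep x.rep y.rep => card_compat_right q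
  simp_rw [h0, h1, Nat.cast_sum, Finset.sum_div]
  rw [Finset.sum_comm, ← Nat.cast_mul, ← Nat.card_prod, Nat.card_eq_fintype_card,
    Fintype.card, Finset.card_eq_sum_ones, Nat.cast_sum]
  refine Finset.sum_congr rfl fun p _ => ?_
  have := p.1.2.mono
  have := p.2.2.mono
  simp_rw [card_cokernels, card_iso]
  rw [Finset.sum_ite_eq', if_pos, Nat.cast_one]
  apply hF
  rw [hallNum_ne_zero_iff]
  obtain ⟨e⟩ := rep_isoCls (cokernel (p.1.1.1 ≫ p.2.1.1))
  have hk : IsSES (p.1.1.1 ≫ p.2.1.1) (cokernel.π (p.1.1.1 ≫ p.2.1.1) ≫ e.inv) :=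
    isSES_of_desc inferInstance inferInstance (by simp)
      fun t ht => ⟨e.hom ≫ cokernel.desc _ t ht, by simp⟩
  obtain ⟨f', g', h, -⟩ := exists_right p.1.2 p.2.2 hk
  exact ⟨f', g', h⟩

/-- The associativity of the Hall product, on structure constants. -/
lemma hallNum_assoc (a b c y : IsoClass C) (F G : Finset (IsoClass C))
    (hF : ∀ z, hallNum a b z ≠ 0 → z ∈ F) (hG : ∀ z, hallNum b c z ≠ 0 → z ∈ G) :
    ∑ x ∈ F, hallNum a b x * hallNum x c y = ∑ x ∈ G, hallNum b c x * hallNum a x y := by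
  simp_rw [hallNum_eq, div_mul_div_comm]
  simp_rw [← card_left_sum a b c _ y G hG, ← card_right_sum a b c _ y F hF, Finset.sum_div]
  rw [Finset.sum_comm]
  refine Finset.sum_congr rfl fun z _ => Finset.sum_congr rfl fun x _ => ?_
  rw [div_div, div_div]
  ring

open Classical ZeroObject in
lemma hallNum_zero_left (b x : IsoClass C) :
    hallNum (isoCls (0 : C)) b x = if x = b then 1 else 0 := by
  have hz : IsZero (isoCls (0 : C)).rep := (isZero_zero C).of_iso (rep_isoCls (0 : C)).some
  rw [hallNum_eq]
  conv_rhs => rw [← isoCls_rep b, ← card_iso x b.rep]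
  congr 2
  refine Nat.card_congr (Equiv.ofBijective (fun i : x.rep ≅ b.rep =>
    (⟨(i.inv, 0), ?_⟩ : SESPairs _ _ _)) ⟨?_, ?_⟩).symm
  · have : Epi (0 : x.rep ⟶ (isoCls (0 : C)).rep) := ⟨fun _ _ _ => hz.eq_of_src _ _⟩
    exact isSES_of_lift inferInstance this (by simp) fun t _ => ⟨t ≫ i.hom, by simp⟩
  · intro i j h
    have h' : i.inv = j.inv := congrArg (fun p : SESPairs _ _ _ => p.1.1) h
    have h2 : i.symm = j.symm := Iso.ext h'
    simpa using congrArg Iso.symm h2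
  · rintro ⟨⟨f, g⟩, h⟩
    have := h.mono
    obtain ⟨s, hs⟩ := h.lift (𝟙 _) (hz.eq_of_tgt _ _)
    refine ⟨⟨s, f, hs, ?_⟩, Subtype.ext (Prod.ext rfl (hz.eq_of_tgt _ _))⟩
    dsimp only at hs ⊢
    rw [← cancel_mono f, Category.assoc, hs]; simp

open Classical ZeroObject in
lemma hallNum_zero_right (b x : IsoClass C) :
    hallNum b (isoCls (0 : C)) x = if x = b then 1 else 0 := by
  have hz : IsZero (isoCls (0 : C)).rep := (isZero_zero C).of_iso (rep_isoCls (0 : C)).some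
  rw [hallNum_eq]
  conv_rhs => rw [← isoCls_rep b, ← card_iso x b.rep]
  congr 2
  refine Nat.card_congr (Equiv.ofBijective (fun i : x.rep ≅ b.rep =>
    (⟨(0, i.hom), ?_⟩ : SESPairs _ _ _)) ⟨?_, ?_⟩).symm
  · have : Mono (0 : (isoCls (0 : C)).rep ⟶ x.rep) := ⟨fun _ _ _ => hz.eq_of_tgt _ _⟩
    exact isSES_of_desc this inferInstance (by simp) fun t _ => ⟨i.inv ≫ t, by simp⟩
  · intro i j h
    exact Iso.ext (congrArg (fun p : SESPairs _ _ _ => p.1.2) h)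
  · rintro ⟨⟨f, g⟩, h⟩
    have := h.epi
    obtain ⟨s, hs⟩ := h.desc (𝟙 _) (hz.eq_of_src _ _)
    refine ⟨⟨g, s, hs, ?_⟩, Subtype.ext (Prod.ext (hz.eq_of_src _ _) rfl)⟩
    dsimp only at hs ⊢
    rw [← cancel_epi g, ← Category.assoc, hs]; simp

end HallNumbers

section StructureConstants

/-- Structure constants of an associative unital complex algebra in a basis indexed by `ι`,
the unit being a basis element. -/
structure AlgConst (ι : Type*) where
  mul : ι → ι → ι →₀ ℂ
  one : ι
  one_mul : ∀ a, mul one a = Finsupp.single a 1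
  mul_one : ∀ a, mul a one = Finsupp.single a 1
  assoc : ∀ a b c, ((mul a b).sum fun x r => r • mul x c) = (mul b c).sum fun x r => r • mul a x

/-- The complex vector space with basis `ι`, on which the structure constants `S` define a
multiplication. -/
def AlgConst.Alg {ι : Type*} (_ : AlgConst ι) : Type _ := ι →₀ ℂ

namespace AlgConst

variable {ι : Type*} (S : AlgConst ι)

noncomputable instance : AddCommGroup S.Alg := inferInstanceAs (AddCommGroup (ι →₀ ℂ))

noncomputable instance : Module ℂ S.Alg := inferInstanceAs (Module ℂ (ι →₀ ℂ))

/-- The element of the algebra with given coordinates. -/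
noncomputable def ofCoords : (ι →₀ ℂ) ≃ₗ[ℂ] S.Alg := LinearEquiv.refl ℂ (ι →₀ ℂ)

/-- The basis of the algebra. -/
noncomputable def basis : Module.Basis ι ℂ S.Alg := Module.Basis.ofRepr S.ofCoords.symm

/-- The bilinear multiplication with the given structure constants. -/
noncomputable def mulLin : S.Alg →ₗ[ℂ] S.Alg →ₗ[ℂ] S.Alg :=
  S.basis.constr ℂ fun a => S.basis.constr ℂ fun b => S.ofCoords (S.mul a b)

lemma mulLin_basis (a b : ι) : S.mulLin (S.basis a) (S.basis b) = S.ofCoords (S.mul a b) := by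
  rw [mulLin, Module.Basis.constr_basis, Module.Basis.constr_basis]

lemma ofCoords_single (a : ι) (r : ℂ) : S.ofCoords (Finsupp.single a r) = r • S.basis a := by
  have : S.basis a = S.ofCoords (Finsupp.single a 1) := by
    simp [basis, Module.Basis.coe_ofRepr]
  rw [this, ← map_smul, Finsupp.smul_single_one]

lemma ofCoords_eq_sum (x : ι →₀ ℂ) : S.ofCoords x = x.sum fun a r => r • S.basis a := by
  conv_lhs => rw [← Finsupp.sum_single x]
  rw [map_finsuppSum]
  simp_rw [ofCoords_single]

@[elab_as_elim]
lemma induction {P : S.Alg → Prop} (hadd : ∀ x y, P x → P y → P (x + y))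
    (hsmul : ∀ (r : ℂ) x, P x → P (r • x)) (hb : ∀ a, P (S.basis a)) (x : S.Alg) : P x := by
  have h0 : ∀ a : ι, P ((0 : ℂ) • S.basis a) := fun a => hsmul _ _ (hb a)
  refine Submodule.span_induction (p := fun x _ => P x ∨ x = 0) (s := Set.range S.basis) ?_ ?_ ?_ ?_
    (S.basis.mem_span x) |>.elim id ?_
  · rintro _ ⟨a, rfl⟩
    exact Or.inl (hb a)
  · exact Or.inr rfl
  · rintro x y - - (hx | rfl) (hy | rfl)
    · exact Or.inl (hadd _ _ hx hy)
    · exact Or.inl (by simpa using hx)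
    · exact Or.inl (by simpa using hy)
    · exact Or.inr (by simp)
  · rintro r x - (hx | rfl)
    · exact Or.inl (hsmul _ _ hx)
    · exact Or.inr (by simp)
  · rintro rfl
    simpa using h0 S.one

lemma basis_mulLin_sum (x : ι →₀ ℂ) (z : S.Alg) :
    S.mulLin (S.ofCoords x) z = x.sum fun a r => r • S.mulLin (S.basis a) z := by
  rw [ofCoords_eq_sum, Finsupp.sum, map_sum, LinearMap.sum_apply]
  simp [Finsupp.sum]

lemma mulLin_basis_sum (x : ι →₀ ℂ) (z : S.Alg) :
    S.mulLin z (S.ofCoords x) = x.sum fun a r => r • S.mulLin z (S.basis a) := by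
  rw [ofCoords_eq_sum, map_finsuppSum]
  simp

lemma mulLin_assoc (x y z : S.Alg) :
    S.mulLin (S.mulLin x y) z = S.mulLin x (S.mulLin y z) := by
  induction x using S.induction with
  | hadd x x' h1 h2 => simp [h1, h2]
  | hsmul r x h1 => simp [h1]
  | hb a =>
  induction y using S.induction with
  | hadd x x' h1 h2 => simp [h1, h2]
  | hsmul r x h1 => simp [h1]
  | hb b =>
  induction z using S.induction with
  | hadd x x' h1 h2 => simp [h1, h2]
  | hsmul r x h1 => simp [h1]
  | hb c =>
  rw [mulLin_basis, mulLin_basis, basis_mulLin_sum, mulLin_basis_sum]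
  simp_rw [mulLin_basis, ← map_smul, ← map_finsuppSum]
  rw [S.assoc a b c]

lemma one_mulLin (x : S.Alg) : S.mulLin (S.basis S.one) x = x := by
  induction x using S.induction with
  | hadd x x' h1 h2 => simp [h1, h2]
  | hsmul r x h1 => simp [h1]
  | hb a => rw [mulLin_basis, S.one_mul, ofCoords_single, one_smul]

lemma mulLin_one (x : S.Alg) : S.mulLin x (S.basis S.one) = x := by
  induction x using S.induction with
  | hadd x x' h1 h2 => simp [h1, h2]
  | hsmul r x h1 => simp [h1]
  | hb a => rw [mulLin_basis, S.mul_one, ofCoords_single, one_smul]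

noncomputable instance : Ring S.Alg where
  mul x y := S.mulLin x y
  one := S.basis S.one
  zero_mul x := LinearMap.map_zero₂ _ _
  mul_zero x := map_zero (S.mulLin x)
  left_distrib x y z := map_add (S.mulLin x) _ _
  right_distrib x y z := LinearMap.map_add₂ _ _ _ _
  mul_assoc := S.mulLin_assoc
  one_mul := S.one_mulLin
  mul_one := S.mulLin_one
  neg_add_cancel := neg_add_cancel
  zsmul := fun n x => n • x
  zsmul_zero' := SubNegMonoid.zsmul_zero'
  zsmul_succ' := SubNegMonoid.zsmul_succ'
  zsmul_neg' := SubNegMonoid.zsmul_neg'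
  sub_eq_add_neg := sub_eq_add_neg

noncomputable instance : Algebra ℂ S.Alg :=
  Algebra.ofModule (fun r x y => LinearMap.map_smul₂ S.mulLin r x y)
    (fun r x y => map_smul (S.mulLin x) r y)

lemma basis_mul_basis (a b : ι) : S.basis a * S.basis b = S.ofCoords (S.mul a b) :=
  S.mulLin_basis a b

end AlgConst

end StructureConstants

section HallAlgebra

variable (C : Type u) [Category.{v} C] [Abelian C] [HallFinite C]

open ZeroObject in
/-- The structure constants of the Ringel-Hall algebra of `C` in the basis of the isomorphism
classes: `[L] ⋄ [M] = ∑_X |Ext¹(L, M)_X| / |Hom(L, M)| [X]`, with unit `[0]`. -/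
noncomputable def hallConst : AlgConst (IsoClass C) where
  mul a b := Finsupp.ofSupportFinite (hallNum a b) (hallNum_support_finite a b)
  one := isoCls (0 : C)
  one_mul a := by
    ext x
    classical
    rw [Finsupp.ofSupportFinite_coe, hallNum_zero_left, Finsupp.single_apply]
    simp_rw [eq_comm (a := a)]
  mul_one a := by
    ext x
    classical
    rw [Finsupp.ofSupportFinite_coe, hallNum_zero_right, Finsupp.single_apply]
    simp_rw [eq_comm (a := a)]
  assoc a b c := by
    ext y
    rw [Finsupp.sum_apply, Finsupp.sum_apply]
    exact hallNum_assoc a b c y _ _ (fun z hz => Finsupp.mem_support_iff.2 hz)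
      (fun z hz => Finsupp.mem_support_iff.2 hz)

/-- The (untwisted) Ringel-Hall algebra of `C`. -/
abbrev HallAlg : Type u := (hallConst C).Alg

variable {C}

/-- The basis element `[X]` of the Ringel-Hall algebra. -/
noncomputable def hallCls (X : C) : HallAlg C := (hallConst C).basis (isoCls X)

end HallAlgebra

section Localization

/-- The relations defining the universal `ℂ`-algebra over `R` in which the elements of `S` become
invertible. The generator `Sum.inr s` is the inverse of `s`. -/
inductive UnivLocRel (R : Type*) [Ring R] [Algebra ℂ R] (S : Set R) :
    FreeAlgebra ℂ (R ⊕ S) → FreeAlgebra ℂ (R ⊕ S) → Prop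
  | add (x y : R) : UnivLocRel R S (FreeAlgebra.ι ℂ (Sum.inl (x + y)))
      (FreeAlgebra.ι ℂ (Sum.inl x) + FreeAlgebra.ι ℂ (Sum.inl y))
  | mul (x y : R) : UnivLocRel R S (FreeAlgebra.ι ℂ (Sum.inl (x * y)))
      (FreeAlgebra.ι ℂ (Sum.inl x) * FreeAlgebra.ι ℂ (Sum.inl y))
  | scalar (c : ℂ) : UnivLocRel R S (FreeAlgebra.ι ℂ (Sum.inl (algebraMap ℂ R c)))
      (algebraMap ℂ _ c)
  | mul_inv (s : S) : UnivLocRel R S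
      (FreeAlgebra.ι ℂ (Sum.inl (s : R)) * FreeAlgebra.ι ℂ (Sum.inr s)) 1
  | inv_mul (s : S) : UnivLocRel R S
      (FreeAlgebra.ι ℂ (Sum.inr s) * FreeAlgebra.ι ℂ (Sum.inl (s : R))) 1

/-- The localization of `R` at `S`: the universal `ℂ`-algebra over `R` in which the elements
of `S` are invertible. -/
abbrev UnivLoc (R : Type*) [Ring R] [Algebra ℂ R] (S : Set R) : Type _ := RingQuot (UnivLocRel R S)

namespace UnivLoc

variable {R : Type*} [Ring R] [Algebra ℂ R] (S : Set R)

/-- The canonical map to the localization. -/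
noncomputable def of : R →ₐ[ℂ] UnivLoc R S :=
  let f : R → UnivLoc R S := fun x => RingQuot.mkAlgHom ℂ (UnivLocRel R S)
    (FreeAlgebra.ι ℂ (Sum.inl x))
  have hmul : ∀ x y, f (x * y) = f x * f y := fun x y => by
    rw [← map_mul]; exact RingQuot.mkAlgHom_rel ℂ (.mul x y)
  have hadd : ∀ x y, f (x + y) = f x + f y := fun x y => by
    rw [← map_add]; exact RingQuot.mkAlgHom_rel ℂ (.add x y)
  have hsc : ∀ c, f (algebraMap ℂ R c) = algebraMap ℂ _ c := fun c => by
    rw [← AlgHom.commutes (RingQuot.mkAlgHom ℂ (UnivLocRel R S))]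
    exact RingQuot.mkAlgHom_rel ℂ (.scalar c)
  { toFun := f
    map_one' := by simpa using hsc 1
    map_mul' := hmul
    map_zero' := by simpa using hsc 0
    map_add' := hadd
    commutes' := hsc }

/-- The inverse of an element of `S` in the localization. -/
noncomputable def inv (s : S) : UnivLoc R S :=
  RingQuot.mkAlgHom ℂ (UnivLocRel R S) (FreeAlgebra.ι ℂ (Sum.inr s))

lemma of_mul_inv (s : S) : of S (s : R) * inv S s = 1 := by
  change RingQuot.mkAlgHom ℂ (UnivLocRel R S) _ * RingQuot.mkAlgHom ℂ (UnivLocRel R S) _ = 1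
  rw [← map_mul, RingQuot.mkAlgHom_rel ℂ (UnivLocRel.mul_inv s), map_one]

lemma inv_mul_of (s : S) : inv S s * of S (s : R) = 1 := by
  change RingQuot.mkAlgHom ℂ (UnivLocRel R S) _ * RingQuot.mkAlgHom ℂ (UnivLocRel R S) _ = 1
  rw [← map_mul, RingQuot.mkAlgHom_rel ℂ (UnivLocRel.inv_mul s), map_one]

lemma isUnit_of (s : S) : IsUnit (of S (s : R)) :=
  ⟨⟨_, inv S s, of_mul_inv S s, inv_mul_of S s⟩, rfl⟩

variable {T : Type*} [Semiring T] [Algebra ℂ T]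

/-- The universal property of the localization: existence. -/
noncomputable def lift (f : R →ₐ[ℂ] T) (hf : ∀ s ∈ S, IsUnit (f s)) : UnivLoc R S →ₐ[ℂ] T :=
  RingQuot.liftAlgHom ℂ ⟨FreeAlgebra.lift ℂ
    (Sum.elim f fun s => (((hf s.1 s.2).unit⁻¹ : Tˣ) : T)), by
      intro x y h
      induction h <;> simp⟩

lemma lift_of (f : R →ₐ[ℂ] T) (hf : ∀ s ∈ S, IsUnit (f s)) (x : R) :
    lift S f hf (of S x) = f x := by
  change RingQuot.liftAlgHom ℂ _ (RingQuot.mkAlgHom ℂ _ _) = _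
  rw [RingQuot.liftAlgHom_mkAlgHom_apply]
  simp

variable {S} in
/-- The universal property of the localization: uniqueness. -/
lemma hom_ext {f g : UnivLoc R S →ₐ[ℂ] T} (h : ∀ x, f (of S x) = g (of S x)) : f = g := by
  apply RingQuot.ringQuot_ext' ℂ
  apply FreeAlgebra.hom_ext
  funext x
  obtain x | s := x
  · exact h x
  · change f (inv S s) = g (inv S s)
    have h1 := congrArg f (of_mul_inv S s)
    have h2 := congrArg g (inv_mul_of S s)
    rw [map_mul, map_one] at h1 h2
    rw [← h] at h2
    exact (left_inv_eq_right_inv h2 h1).symm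

end UnivLoc

/-- `i : R → T` is a right localization of `R` at `S`. -/
structure IsRightLocalization {R T : Type*} [Ring R] [Ring T] (S : Set R) (i : R →+* T) :
    Prop where
  isUnit : ∀ s ∈ S, IsUnit (i s)
  surj : ∀ t : T, ∃ a : R, ∃ s ∈ S, t = i a * Ring.inverse (i s)
  eq_iff : ∀ a b : R, i a = i b ↔ ∃ s ∈ S, a * s = b * s

end Localization

section Grading

/-- A grading of the algebra `R` by the abelian group `G`, given as a coaction
`x ↦ ∑_g x_g ⊗ g` of the group algebra of `G`, where `x_g` is the component of degree `g`.
The homogeneous elements of degree `g` are those with `x ↦ x ⊗ g`; they have to span `R`. -/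
structure Grading (R : Type*) [Ring R] [Algebra ℂ R] (G : Type*) [AddCommGroup G] where
  coact : R →ₐ[ℂ] AddMonoidAlgebra R G
  mem_span : ∀ x, x ∈ Submodule.span ℂ {y | ∃ g, coact y = AddMonoidAlgebra.single g y}

/-- A bimultiplicative function with values in the nonzero complex numbers. -/
structure Bichar (G : Type*) [AddCommGroup G] where
  toFun : G → G → ℂ
  zero_left : ∀ h, toFun 0 h = 1
  zero_right : ∀ g, toFun g 0 = 1
  add_left : ∀ g g' h, toFun (g + g') h = toFun g h * toFun g' h
  add_right : ∀ g h h', toFun g (h + h') = toFun g h * toFun g h'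

variable {R : Type*} [Ring R] [Algebra ℂ R] {G : Type*} [AddCommGroup G]

namespace Grading

variable {D : Grading R G}

/-- `x` is homogeneous of degree `g`. -/
def Homog (D : Grading R G) (g : G) (x : R) : Prop :=
  D.coact x = AddMonoidAlgebra.single g x

@[elab_as_elim]
lemma induction (D : Grading R G) {P : R → Prop} (h0 : P 0)
    (hadd : ∀ x y, P x → P y → P (x + y))
    (hom : ∀ g x, D.Homog g x → P x) (x : R) : P x := by
  induction D.mem_span x using Submodule.closure_induction with
  | zero => exact h0
  | add x y _ _ hx hy => exact hadd _ _ hx hy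
  | smul_mem c x h =>
    obtain ⟨g, hg⟩ := h
    exact hom g _ (by rw [Grading.Homog, map_smul, hg, AddMonoidAlgebra.smul_single])

lemma Homog.mul {g h : G} {x y : R} (hx : D.Homog g x)
    (hy : D.Homog h y) : D.Homog (g + h) (x * y) := by
  rw [Homog] at *
  rw [map_mul, hx, hy, AddMonoidAlgebra.single_mul_single]

lemma Homog.smul {g : G} {x : R} (hx : D.Homog g x) (c : ℂ) :
    D.Homog g (c • x) := by
  rw [Homog] at *
  rw [map_smul, hx, AddMonoidAlgebra.smul_single]

lemma homog_one (D : Grading R G) : D.Homog 0 1 := by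
  rw [Grading.Homog, map_one, AddMonoidAlgebra.one_def]

end Grading

/-- The twist of a graded algebra by a bicharacter `σ`: the same vector space with the
multiplication `x * y = σ(g, h) x y` for `x`, `y` homogeneous of degrees `g`, `h`. -/
def Twisted (_ : Grading R G) (_ : Bichar G) : Type _ := R

namespace Twisted

variable (D : Grading R G) (σ : Bichar G)

noncomputable instance : AddCommGroup (Twisted D σ) := inferInstanceAs (AddCommGroup R)

noncomputable instance : Module ℂ (Twisted D σ) := inferInstanceAs (Module ℂ R)

/-- The identity map to the twisted algebra. -/
def mk : R ≃ₗ[ℂ] Twisted D σ := LinearEquiv.refl ℂ R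

/-- The twisted multiplication. -/
noncomputable def tmul (x y : R) : R :=
  (D.coact x).coeff.sum fun g r => (D.coact y).coeff.sum fun h s => σ.toFun g h • (r * s)

lemma tmul_add (x y y' : R) : tmul D σ x (y + y') = tmul D σ x y + tmul D σ x y' := by
  simp only [tmul, map_add, AddMonoidAlgebra.coeff_add]
  rw [← Finsupp.sum_add]
  refine Finsupp.sum_congr fun g _ => ?_
  exact Finsupp.sum_add_index' (by simp) (by simp [mul_add])

lemma add_tmul (x x' y : R) : tmul D σ (x + x') y = tmul D σ x y + tmul D σ x' y := by
  simp only [tmul, map_add, AddMonoidAlgebra.coeff_add]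
  exact Finsupp.sum_add_index' (by simp) (by simp [add_mul, Finsupp.sum_add])

variable {D} in
lemma tmul_homog {g h : G} {x y : R} (hx : D.Homog g x) (hy : D.Homog h y) :
    tmul D σ x y = σ.toFun g h • (x * y) := by
  rw [Grading.Homog] at hx hy
  rw [tmul, hx, hy, AddMonoidAlgebra.coeff_single, AddMonoidAlgebra.coeff_single,
    Finsupp.sum_single_index (by simp), Finsupp.sum_single_index (by simp)]

lemma tmul_zero (x : R) : tmul D σ x 0 = 0 := by simp [tmul]

lemma zero_tmul (x : R) : tmul D σ 0 x = 0 := by simp [tmul]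

lemma tmul_smul (c : ℂ) (x y : R) : tmul D σ x (c • y) = c • tmul D σ x y := by
  induction x using D.induction with
  | h0 => simp [zero_tmul]
  | hadd x x' h1 h2 => simp [add_tmul, h1, h2]
  | hom g x hx =>
  induction y using D.induction with
  | h0 => simp [tmul_zero]
  | hadd x x' h1 h2 => simp [tmul_add, h1, h2]
  | hom h y hy => rw [tmul_homog σ hx hy, tmul_homog σ hx (hy.smul c), mul_smul_comm, smul_comm]

lemma smul_tmul (c : ℂ) (x y : R) : tmul D σ (c • x) y = c • tmul D σ x y := by
  induction x using D.induction with
  | h0 => simp [zero_tmul]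
  | hadd x x' h1 h2 => simp [add_tmul, h1, h2]
  | hom g x hx =>
  induction y using D.induction with
  | h0 => simp [tmul_zero]
  | hadd x x' h1 h2 => simp [tmul_add, h1, h2]
  | hom h y hy => rw [tmul_homog σ hx hy, tmul_homog σ (hx.smul c) hy, smul_mul_assoc, smul_comm]

lemma tmul_assoc (x y z : R) : tmul D σ (tmul D σ x y) z = tmul D σ x (tmul D σ y z) := by
  induction x using D.induction with
  | h0 => simp [zero_tmul]
  | hadd x x' h1 h2 => simp [add_tmul, h1, h2]
  | hom g x hx =>
  induction y using D.induction with
  | h0 => simp [tmul_zero, zero_tmul]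
  | hadd x x' h1 h2 => simp [add_tmul, tmul_add, h1, h2]
  | hom h y hy =>
  induction z using D.induction with
  | h0 => simp [tmul_zero]
  | hadd x x' h1 h2 => simp [tmul_add, h1, h2]
  | hom k z hz =>
  rw [tmul_homog σ hx hy, tmul_homog σ hy hz, tmul_smul, smul_tmul,
    tmul_homog σ (hx.mul hy) hz, tmul_homog σ hx (hy.mul hz), σ.add_left, σ.add_right, smul_smul,
    smul_smul, mul_assoc]
  congr 1
  ring

lemma one_tmul (x : R) : tmul D σ 1 x = x := by
  induction x using D.induction with
  | h0 => simp [tmul_zero]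
  | hadd x x' h1 h2 => simp [tmul_add, h1, h2]
  | hom g x hx => rw [tmul_homog σ D.homog_one hx, σ.zero_left, one_mul, one_smul]

lemma tmul_one (x : R) : tmul D σ x 1 = x := by
  induction x using D.induction with
  | h0 => simp [zero_tmul]
  | hadd x x' h1 h2 => simp [add_tmul, h1, h2]
  | hom g x hx => rw [tmul_homog σ hx D.homog_one, σ.zero_right, mul_one, one_smul]

noncomputable instance : Ring (Twisted D σ) where
  mul x y := mk D σ (tmul D σ ((mk D σ).symm x) ((mk D σ).symm y))
  one := mk D σ 1
  zero_mul x := zero_tmul D σ x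
  mul_zero x := tmul_zero D σ x
  left_distrib x y z := tmul_add D σ x y z
  right_distrib x y z := add_tmul D σ x y z
  mul_assoc x y z := tmul_assoc D σ x y z
  one_mul x := one_tmul D σ x
  mul_one x := tmul_one D σ x
  neg_add_cancel := neg_add_cancel
  zsmul := fun n x => n • x
  zsmul_zero' := SubNegMonoid.zsmul_zero'
  zsmul_succ' := SubNegMonoid.zsmul_succ'
  zsmul_neg' := SubNegMonoid.zsmul_neg'
  sub_eq_add_neg := sub_eq_add_neg

noncomputable instance : Algebra ℂ (Twisted D σ) :=
  Algebra.ofModule (fun r x y => smul_tmul D σ r x y) (fun r x y => tmul_smul D σ r x y)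

end Twisted

end Grading

section Finiteness

/-- Hereditary abelian categories with finite morphism and extension groups. -/
class HereditaryFinite (A : Type u) [Category.{v} A] [Abelian A] : Prop where
  finite_hom : ∀ X Y : A, Finite (X ⟶ Y)
  finite_ext : ∀ X Y : A, Finite (Ext X Y 1)
  hereditary : ∀ (X Y : A) (n : ℕ), 2 ≤ n → Subsingleton (Ext X Y n)

/-- The category of `ℤ/2`-graded complexes `M⁰ ⇄ M¹`. -/
abbrev Cpx (A : Type u) [Category.{v} A] [Abelian A] : Type (max u v) :=
  HomologicalComplex A (ComplexShape.up (ZMod 2))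

variable {A : Type u} [Category.{v} A] [Abelian A]

lemma IsSES.eval {M X L : Cpx A} {f : M ⟶ X} {g : X ⟶ L} (h : IsSES f g) (i : ZMod 2) :
    IsSES (f.f i) (g.f i) :=
  ⟨by rw [← HomologicalComplex.comp_f, h.1, HomologicalComplex.zero_f],
    (HomologicalComplex.shortExact_iff_degreewise_shortExact _).1 h.2 i⟩

variable [HereditaryFinite A]

instance HereditaryFinite.hallFinite : HallFinite A where
  finite_hom := HereditaryFinite.finite_hom
  finite_middle L M := by
    have := HereditaryFinite.finite_ext L M
    rw [← Set.finite_coe_iff]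
    let φ : {x : IsoClass A | ∃ (f : M ⟶ x.rep) (g : x.rep ⟶ L), IsSES f g} → Ext L M 1 :=
      fun x => x.2.choose_spec.choose_spec.2.extClass
    refine Finite.of_injective φ fun x y h => Subtype.ext ?_
    obtain ⟨ν, -⟩ := exists_of_extClass_eq x.2.choose_spec.choose_spec
      y.2.choose_spec.choose_spec h
    rw [← isoCls_rep x.1, ← isoCls_rep y.1]
    exact isoCls_eq_iff.2 ⟨ν⟩

instance : HallFinite (Cpx A) where
  finite_hom X Y := by
    refine Finite.of_injective (fun (f : X ⟶ Y) (i : ZMod 2) => f.f i) fun f g h => ?_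
    ext i
    exact congrFun h i
  finite_middle L M := by
    classical
    let T : Set (ZMod 2 → IsoClass A) := {P | ∀ i, P i ∈
      {x : IsoClass A | ∃ (f : M.X i ⟶ x.rep) (g : x.rep ⟶ L.X i), IsSES f g}}
    have hT : T.Finite := Set.Finite.pi' fun i => HallFinite.finite_middle _ _
    have : Finite T := hT
    let D : Type _ := Σ P : T, {d : ∀ i j : ZMod 2, (P.1 i).rep ⟶ (P.1 j).rep //
      (∀ i j, ¬ (ComplexShape.up (ZMod 2)).Rel i j → d i j = 0) ∧
      ∀ i j k, (ComplexShape.up (ZMod 2)).Rel i j → (ComplexShape.up (ZMod 2)).Rel j k →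
        d i j ≫ d j k = 0}
    let F : D → IsoClass (Cpx A) := fun p => isoCls
      { X := fun i => (p.1.1 i).rep
        d := p.2.1
        shape := p.2.2.1
        d_comp_d' := p.2.2.2 }
    refine (Set.finite_range F).subset ?_
    rintro x ⟨f, g, h⟩
    let e : ∀ i, (isoCls (x.rep.X i)).rep ≅ x.rep.X i := fun i => (rep_isoCls _).some
    refine ⟨⟨⟨fun i => isoCls (x.rep.X i), fun i => ⟨_, _, (h.eval i).comp_iso (e i).symm⟩⟩,
      fun i j => (e i).hom ≫ x.rep.d i j ≫ (e j).inv, fun i j hij => ?_,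
      fun i j k _ _ => by simp⟩, ?_⟩
    · beta_reduce
      rw [x.rep.shape i j hij]; simp
    · refine Eq.trans ?_ (isoCls_rep x)
      exact isoCls_eq_iff.2 ⟨HomologicalComplex.Hom.isoOfComponents e fun i j _ => by simp⟩

end Finiteness

section GrothendieckGroup

/-- The subgroup of relations of the Grothendieck group. -/
def K0Rel (C : Type u) [Category.{v} C] [Abelian C] : AddSubgroup (FreeAbelianGroup C) :=
  AddSubgroup.closure {x | ∃ (M X L : C) (f : M ⟶ X) (g : X ⟶ L), IsSES f g ∧
    x = FreeAbelianGroup.of X - (FreeAbelianGroup.of M + FreeAbelianGroup.of L)}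

/-- The Grothendieck group of an abelian category. -/
abbrev K0 (C : Type u) [Category.{v} C] [Abelian C] : Type u := FreeAbelianGroup C ⧸ K0Rel C

variable {C : Type u} [Category.{v} C] [Abelian C]

/-- The class of an object in the Grothendieck group. -/
def k0Cls (X : C) : K0 C := QuotientAddGroup.mk' (K0Rel C) (FreeAbelianGroup.of X)

lemma k0Cls_of_isSES {M X L : C} {f : M ⟶ X} {g : X ⟶ L} (h : IsSES f g) :
    k0Cls X = k0Cls M + k0Cls L := by
  rw [k0Cls, k0Cls, k0Cls, ← map_add, ← sub_eq_zero, ← map_sub]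
  exact (QuotientAddGroup.eq_zero_iff _).2 (AddSubgroup.subset_closure ⟨M, X, L, f, g, h, rfl⟩)

/-- An additive function on objects induces a homomorphism on the Grothendieck group. -/
def k0Lift {G : Type*} [AddCommGroup G] (φ : C → G)
    (hφ : ∀ {M X L : C} (f : M ⟶ X) (g : X ⟶ L), IsSES f g → φ X = φ M + φ L) : K0 C →+ G :=
  QuotientAddGroup.lift _ (FreeAbelianGroup.lift φ) (by
    rw [K0Rel, AddSubgroup.closure_le]
    rintro _ ⟨M, X, L, f, g, h, rfl⟩
    simp [hφ f g h])

lemma k0Lift_k0Cls {G : Type*} [AddCommGroup G] (φ : C → G)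
    (hφ : ∀ {M X L : C} (f : M ⟶ X) (g : X ⟶ L), IsSES f g → φ X = φ M + φ L) (X : C) :
    k0Lift φ hφ (k0Cls X) = φ X := by
  change FreeAbelianGroup.lift φ (FreeAbelianGroup.of X) = φ X
  simp

@[elab_as_elim]
lemma k0_induction {P : K0 C → Prop} (h0 : P 0) (hof : ∀ X, P (k0Cls X))
    (hneg : ∀ x, P x → P (-x)) (hadd : ∀ x y, P x → P y → P (x + y)) (x : K0 C) : P x := by
  obtain ⟨x, rfl⟩ := QuotientAddGroup.mk'_surjective _ x
  induction x using FreeAbelianGroup.induction_on with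
  | zero => exact h0
  | of X => exact hof X
  | neg X h => exact hneg _ h
  | add x y hx hy => exact hadd _ _ hx hy

lemma isSES_id_zero {X Y Z : C} (e : X ≅ Y) (hZ : IsZero Z) : IsSES (0 : Z ⟶ X) e.hom := by
  have : Mono (0 : Z ⟶ X) := ⟨fun _ _ _ => hZ.eq_of_tgt _ _⟩
  refine isSES_of_lift this inferInstance (by simp) fun t ht => ⟨0, ?_⟩
  rw [← cancel_mono e.hom, ht]; simp

lemma k0Cls_zero {Z : C} (hZ : IsZero Z) : k0Cls Z = 0 := by
  have := k0Cls_of_isSES (isSES_id_zero (Iso.refl Z) hZ)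
  simpa using this

lemma k0Cls_iso {X Y : C} (e : X ≅ Y) : k0Cls X = k0Cls Y := by
  open ZeroObject in
  have := k0Cls_of_isSES (isSES_id_zero e (isZero_zero C))
  rwa [k0Cls_zero (isZero_zero C), zero_add] at this

end GrothendieckGroup

section EulerForm

lemma card_ker_range {G H : Type*} [AddCommGroup G] [AddCommGroup H] [Finite G]
    (f : G →+ H) : Nat.card G = Nat.card f.ker * Nat.card f.range := by
  rw [AddSubgroup.card_eq_card_quotient_mul_card_addSubgroup f.ker,
    Nat.card_congr (QuotientAddGroup.quotientKerEquivRange f).toEquiv, mul_comm]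

lemma card_six {G₁ G₂ G₃ G₄ G₅ G₆ : Type*} [AddCommGroup G₁] [AddCommGroup G₂] [AddCommGroup G₃]
    [AddCommGroup G₄] [AddCommGroup G₅] [AddCommGroup G₆] [Finite G₁] [Finite G₂] [Finite G₃]
    [Finite G₄] [Finite G₅] (f₁ : G₁ →+ G₂) (f₂ : G₂ →+ G₃)
    (f₃ : G₃ →+ G₄) (f₄ : G₄ →+ G₅) (f₅ : G₅ →+ G₆) (h₁ : Function.Injective f₁)
    (h₂ : f₂.ker = f₁.range) (h₃ : f₃.ker = f₂.range) (h₄ : f₄.ker = f₃.range)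
    (h₅ : f₅.ker = f₄.range) (h₆ : Function.Surjective f₅) :
    Nat.card G₂ * (Nat.card G₄ * Nat.card G₆) = Nat.card G₁ * Nat.card G₃ * Nat.card G₅ := by
  have e1 : Nat.card G₁ = Nat.card f₁.range :=
    Nat.card_congr (AddMonoidHom.ofInjective h₁).toEquiv
  have e6 : Nat.card G₆ = Nat.card f₅.range := by
    rw [AddMonoidHom.range_eq_top.2 h₆]
    exact (Nat.card_congr AddSubgroup.topEquiv.toEquiv).symm
  rw [e1, e6, card_ker_range f₂, card_ker_range f₃, card_ker_range f₄, card_ker_range f₅,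
    h₂, h₃, h₄, h₅]
  ring

lemma ker_eq_range {G₁ G₂ G₃ : Type*} [AddCommGroup G₁] [AddCommGroup G₂] [AddCommGroup G₃]
    (f : G₁ →+ G₂) (g : G₂ →+ G₃) (h : ∀ x, g (f x) = 0) (h' : ∀ y, g y = 0 → ∃ x, f x = y) :
    g.ker = f.range := by
  ext y
  rw [AddMonoidHom.mem_ker, AddMonoidHom.mem_range]
  exact ⟨h' y, by rintro ⟨x, rfl⟩; exact h x⟩

variable {A : Type u} [Category.{v} A] [Abelian A]

lemma card_ext_zero (X Y : A) : Nat.card (X ⟶ Y) = Nat.card (Ext X Y 0) :=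
  Nat.card_congr (Equiv.ofBijective _ (Ext.mk₀_bijective X Y))

variable [HereditaryFinite A]

instance finite_ext_zero (X Y : A) : Finite (Ext X Y 0) :=
  Finite.of_surjective _ (Ext.mk₀_bijective X Y).2

instance finite_ext_one (X Y : A) : Finite (Ext X Y 1) := HereditaryFinite.finite_ext X Y

instance subsingleton_ext_two (X Y : A) : Subsingleton (Ext X Y 2) :=
  HereditaryFinite.hereditary X Y 2 le_rfl

lemma card_contravariant {M X L : A} {f : M ⟶ X} {g : X ⟶ L} (h : IsSES f g) (Y : A) :
    Nat.card (X ⟶ Y) * (Nat.card (Ext L Y 1) * Nat.card (Ext M Y 1)) =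
      Nat.card (L ⟶ Y) * Nat.card (M ⟶ Y) * Nat.card (Ext X Y 1) := by
  obtain ⟨w, h⟩ := h
  have := h.epi_g
  simp_rw [card_ext_zero]
  refine card_six ((Ext.mk₀ g).precomp Y (zero_add 0)) ((Ext.mk₀ f).precomp Y (zero_add 0))
    (h.extClass.precomp Y (add_zero 1)) ((Ext.mk₀ g).precomp Y (zero_add 1))
    ((Ext.mk₀ f).precomp Y (zero_add 1)) (Ext.precomp_mk₀_injective_of_epi Y g)
    (ker_eq_range _ _ (fun x => ?_) (Ext.contravariant_sequence_exact₂ h Y))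
    (ker_eq_range _ _ (fun x => ?_) fun x => Ext.contravariant_sequence_exact₁ h Y x (add_zero 1))
    (ker_eq_range _ _ (fun x => ?_) fun x hx => Ext.contravariant_sequence_exact₃ h Y x hx (add_zero 1))
    (ker_eq_range _ _ (fun x => ?_) (Ext.contravariant_sequence_exact₂ h Y))
    fun x => Ext.contravariant_sequence_exact₁ h Y x (by norm_num : 1 + 1 = 2)
      (Subsingleton.elim _ _)
  · simp [w]
  · exact h.extClass_comp_assoc x (h := add_zero 1)
  · exact h.comp_extClass_assoc x (add_zero 1)
  · simp [w]

lemma card_covariant {M X L : A} {f : M ⟶ X} {g : X ⟶ L} (h : IsSES f g) (Y : A) :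
    Nat.card (Y ⟶ X) * (Nat.card (Ext Y M 1) * Nat.card (Ext Y L 1)) =
      Nat.card (Y ⟶ M) * Nat.card (Y ⟶ L) * Nat.card (Ext Y X 1) := by
  obtain ⟨w, h⟩ := h
  have := h.mono_f
  simp_rw [card_ext_zero]
  refine card_six ((Ext.mk₀ f).postcomp Y (add_zero 0)) ((Ext.mk₀ g).postcomp Y (add_zero 0))
    (h.extClass.postcomp Y (zero_add 1)) ((Ext.mk₀ f).postcomp Y (add_zero 1))
    ((Ext.mk₀ g).postcomp Y (add_zero 1)) (Ext.postcomp_mk₀_injective_of_mono Y f)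
    (ker_eq_range _ _ (fun x => ?_) (Ext.covariant_sequence_exact₂ Y h))
    (ker_eq_range _ _ (fun x => ?_) fun x hx => Ext.covariant_sequence_exact₃ Y h x (zero_add 1) hx)
    (ker_eq_range _ _ (fun x => ?_) fun x hx => Ext.covariant_sequence_exact₁ Y h x hx (zero_add 1))
    (ker_eq_range _ _ (fun x => ?_) (Ext.covariant_sequence_exact₂ Y h))
    fun x => Ext.covariant_sequence_exact₃ Y h x (by norm_num : 1 + 1 = 2)
      (Subsingleton.elim _ _)
  · simp [w]
  · simp [h.comp_extClass]
  · simp [h.extClass_comp]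
  · simp [w]

/-- The logarithm of the multiplicative Euler form on objects. -/
noncomputable def logEulerObj (X Y : A) : ℝ :=
  Real.log (Nat.card (X ⟶ Y)) - Real.log (Nat.card (Ext X Y 1))

lemma card_hom_ne_zero (X Y : A) : (Nat.card (X ⟶ Y) : ℝ) ≠ 0 := by
  have : Nonempty (X ⟶ Y) := ⟨0⟩
  exact_mod_cast (Nat.card_pos (α := X ⟶ Y)).ne'

lemma card_ext_ne_zero (X Y : A) : (Nat.card (Ext X Y 1) : ℝ) ≠ 0 := by
  exact_mod_cast (Nat.card_pos (α := Ext X Y 1)).ne'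

lemma logEulerObj_left {M X L : A} {f : M ⟶ X} {g : X ⟶ L} (h : IsSES f g) (Y : A) :
    logEulerObj X Y = logEulerObj M Y + logEulerObj L Y := by
  have e : (Nat.card (X ⟶ Y) : ℝ) * (Nat.card (Ext L Y 1) * Nat.card (Ext M Y 1)) =
      Nat.card (L ⟶ Y) * Nat.card (M ⟶ Y) * Nat.card (Ext X Y 1) := by
    exact_mod_cast card_contravariant h Y
  have e' := congrArg Real.log e
  have n1 := card_hom_ne_zero (A := A)
  have n2 := card_ext_ne_zero (A := A)
  rw [Real.log_mul (n1 _ _) (mul_ne_zero (n2 _ _) (n2 _ _)), Real.log_mul (n2 _ _) (n2 _ _),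
    Real.log_mul (mul_ne_zero (n1 _ _) (n1 _ _)) (n2 _ _), Real.log_mul (n1 _ _) (n1 _ _)] at e'
  simp only [logEulerObj]
  linarith

lemma logEulerObj_right {M X L : A} {f : M ⟶ X} {g : X ⟶ L} (h : IsSES f g) (Y : A) :
    logEulerObj Y X = logEulerObj Y M + logEulerObj Y L := by
  have e : (Nat.card (Y ⟶ X) : ℝ) * (Nat.card (Ext Y M 1) * Nat.card (Ext Y L 1)) =
      Nat.card (Y ⟶ M) * Nat.card (Y ⟶ L) * Nat.card (Ext Y X 1) := by
    exact_mod_cast card_covariant h Y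
  have e' := congrArg Real.log e
  have n1 := card_hom_ne_zero (A := A)
  have n2 := card_ext_ne_zero (A := A)
  rw [Real.log_mul (n1 _ _) (mul_ne_zero (n2 _ _) (n2 _ _)), Real.log_mul (n2 _ _) (n2 _ _),
    Real.log_mul (mul_ne_zero (n1 _ _) (n1 _ _)) (n2 _ _), Real.log_mul (n1 _ _) (n1 _ _)] at e'
  simp only [logEulerObj]
  linarith

/-- The logarithm of the multiplicative Euler form, as an additive function of the second
argument. -/
noncomputable def logEulerRight (X : A) : K0 A →+ ℝ :=
  k0Lift (fun Y => logEulerObj X Y) fun _ _ h => logEulerObj_right h X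

lemma logEulerRight_add {M X L : A} (f : M ⟶ X) (g : X ⟶ L) (h : IsSES f g) :
    logEulerRight X = logEulerRight M + logEulerRight L := by
  refine DFunLike.ext _ _ fun x => ?_
  simp only [logEulerRight, AddMonoidHom.add_apply]
  induction x using k0_induction with
  | h0 => simp
  | hof Y => rw [k0Lift_k0Cls, k0Lift_k0Cls, k0Lift_k0Cls, logEulerObj_left h Y]
  | hneg x hx => rw [map_neg, map_neg, map_neg, hx]; ring
  | hadd x y hx hy => rw [map_add, map_add, map_add, hx, hy]; ring

variable (A) in
/-- The logarithm of the multiplicative Euler form, as a biadditive form on `K₀(A)`. -/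
noncomputable def logEuler : K0 A →+ K0 A →+ ℝ :=
  k0Lift (fun X => logEulerRight X) logEulerRight_add

/-- The multiplicative Euler form `⟨α, β⟩` on `K₀(A)`. -/
noncomputable def eulerForm (α β : K0 A) : ℝ := Real.exp (logEuler A α β)

lemma eulerForm_k0Cls (X Y : A) : eulerForm (k0Cls X) (k0Cls Y) =
    (Nat.card (X ⟶ Y) : ℝ) / Nat.card (Ext X Y 1) := by
  have : logEuler A (k0Cls X) (k0Cls Y) = logEulerObj X Y := by
    rw [logEuler, k0Lift_k0Cls (fun X : A => logEulerRight X) logEulerRight_add, logEulerRight,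
      k0Lift_k0Cls]
  rw [eulerForm, this, logEulerObj, Real.exp_sub, Real.exp_log, Real.exp_log]
  · exact (Nat.cast_nonneg _).lt_of_ne (card_ext_ne_zero _ _).symm
  · exact (Nat.cast_nonneg _).lt_of_ne (card_hom_ne_zero _ _).symm

/-- The symmetric Euler form `(α, β) = ⟨α, β⟩ ⟨β, α⟩` on `K₀(A)`. -/
noncomputable def symForm (α β : K0 A) : ℝ := eulerForm α β * eulerForm β α

/-- The square root `√⟨α, β⟩`, as a complex number. -/
noncomputable def sqrtEuler (α β : K0 A) : ℂ := (√(eulerForm α β) : ℝ)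

/-- The square root `√(α, β)`, as a complex number. -/
noncomputable def sqrtSym (α β : K0 A) : ℂ := (√(symForm α β) : ℝ)

lemma eulerForm_pos (α β : K0 A) : 0 < eulerForm α β := Real.exp_pos _

lemma eulerForm_add_left (α α' β : K0 A) :
    eulerForm (α + α') β = eulerForm α β * eulerForm α' β := by
  simp [eulerForm, Real.exp_add]

lemma eulerForm_add_right (α β β' : K0 A) :
    eulerForm α (β + β') = eulerForm α β * eulerForm α β' := by
  simp [eulerForm, Real.exp_add]

lemma eulerForm_zero_left (β : K0 A) : eulerForm 0 β = 1 := by simp [eulerForm]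

lemma eulerForm_zero_right (β : K0 A) : eulerForm β 0 = 1 := by simp [eulerForm]

lemma sqrtEuler_add_left (α α' β : K0 A) :
    sqrtEuler (α + α') β = sqrtEuler α β * sqrtEuler α' β := by
  rw [sqrtEuler, eulerForm_add_left, Real.sqrt_mul (eulerForm_pos _ _).le, Complex.ofReal_mul]
  rfl

lemma sqrtEuler_add_right (α β β' : K0 A) :
    sqrtEuler α (β + β') = sqrtEuler α β * sqrtEuler α β' := by
  rw [sqrtEuler, eulerForm_add_right, Real.sqrt_mul (eulerForm_pos _ _).le, Complex.ofReal_mul]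
  rfl

lemma sqrtEuler_zero_left (β : K0 A) : sqrtEuler 0 β = 1 := by simp [sqrtEuler, eulerForm_zero_left]

lemma sqrtEuler_zero_right (β : K0 A) : sqrtEuler β 0 = 1 := by
  simp [sqrtEuler, eulerForm_zero_right]

lemma sqrtSym_eq (α β : K0 A) : sqrtSym α β = sqrtEuler α β * sqrtEuler β α := by
  rw [sqrtSym, symForm, Real.sqrt_mul (eulerForm_pos _ _).le, Complex.ofReal_mul]
  rfl

end EulerForm

section GradingConstructions

variable {G : Type*}

lemma AlgConst.one_def {ι : Type*} (S : AlgConst ι) : (1 : S.Alg) = S.basis S.one := rfl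

lemma AlgConst.mul_def {ι : Type*} (S : AlgConst ι) (x y : S.Alg) : x * y = S.mulLin x y := rfl

/-- The coaction on an algebra with structure constants homogeneous for `deg`. -/
noncomputable def AlgConst.coactLin {ι : Type*} (S : AlgConst ι) (deg : ι → G) :
    S.Alg →ₗ[ℂ] AddMonoidAlgebra S.Alg G :=
  S.basis.constr ℂ fun a => AddMonoidAlgebra.single (deg a) (S.basis a)

lemma AlgConst.coactLin_basis {ι : Type*} (S : AlgConst ι) (deg : ι → G) (a : ι) :
    S.coactLin deg (S.basis a) = AddMonoidAlgebra.single (deg a) (S.basis a) :=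
  Module.Basis.constr_basis ..

variable [AddCommGroup G]

/-- The grading of an algebra with structure constants such that every basis element is
homogeneous. -/
noncomputable def AlgConst.grading {ι : Type*} (S : AlgConst ι) (deg : ι → G)
    (hone : deg S.one = 0) (hmul : ∀ a b x, S.mul a b x ≠ 0 → deg x = deg a + deg b) :
    Grading S.Alg G where
  coact := AlgHom.ofLinearMap (S.coactLin deg)
    (by rw [S.one_def, S.coactLin_basis, hone]; rfl)
    (fun x y => by
      induction x using S.induction with
      | hadd x x' h1 h2 => rw [add_mul, map_add, map_add, add_mul, h1, h2]
      | hsmul r x h1 => rw [smul_mul_assoc, map_smul, map_smul, smul_mul_assoc, h1]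
      | hb a =>
      induction y using S.induction with
      | hadd x x' h1 h2 => rw [mul_add, map_add, map_add, mul_add, h1, h2]
      | hsmul r x h1 => rw [mul_smul_comm, map_smul, map_smul, mul_smul_comm, h1]
      | hb b =>
      rw [S.basis_mul_basis, S.coactLin_basis, S.coactLin_basis,
        AddMonoidAlgebra.single_mul_single, S.basis_mul_basis, S.ofCoords_eq_sum, map_finsuppSum,
        Finsupp.sum, Finsupp.sum, ← AddMonoidAlgebra.singleAddHom_apply, map_sum]
      refine Finset.sum_congr rfl fun x hx => ?_
      rw [map_smul, S.coactLin_basis, hmul a b x (Finsupp.mem_support_iff.1 hx),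
        AddMonoidAlgebra.singleAddHom_apply, AddMonoidAlgebra.smul_single])
  mem_span x := by
    induction x using S.induction with
    | hadd x y hx hy => exact Submodule.add_mem _ hx hy
    | hsmul r x hx => exact Submodule.smul_mem _ _ hx
    | hb a => exact Submodule.subset_span ⟨deg a, S.coactLin_basis deg a⟩

lemma AlgConst.grading_homog {ι : Type*} (S : AlgConst ι) (deg : ι → G)
    (hone : deg S.one = 0) (hmul : ∀ a b x, S.mul a b x ≠ 0 → deg x = deg a + deg b) (a : ι) :
    (S.grading deg hone hmul).Homog (deg a) (S.basis a) :=
  S.coactLin_basis deg a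

variable {R : Type*} [Ring R] [Algebra ℂ R]

/-- The grading of a quotient by homogeneous relations. -/
noncomputable def Grading.ringQuot (D : Grading R G) (r : R → R → Prop)
    (hr : ∀ x y, r x y → ∃ g, D.Homog g x ∧ D.Homog g y) : Grading (RingQuot r) G where
  coact := RingQuot.liftAlgHom ℂ
    ⟨(AddMonoidAlgebra.mapAlgHom G (RingQuot.mkAlgHom ℂ r)).comp D.coact, fun x y h => by
      obtain ⟨g, hx, hy⟩ := hr x y h
      rw [Grading.Homog] at hx hy
      rw [AlgHom.comp_apply, AlgHom.comp_apply, hx, hy, AddMonoidAlgebra.mapAlgHom_single,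
        AddMonoidAlgebra.mapAlgHom_single, RingQuot.mkAlgHom_rel ℂ h]⟩
  mem_span x := by
    obtain ⟨x, rfl⟩ := RingQuot.mkAlgHom_surjective ℂ r x
    induction x using D.induction with
    | h0 => rw [map_zero]; exact Submodule.zero_mem _
    | hadd x y hx hy => rw [map_add]; exact Submodule.add_mem _ hx hy
    | hom g x hx =>
      rw [Grading.Homog] at hx
      refine Submodule.subset_span ⟨g, ?_⟩
      rw [RingQuot.liftAlgHom_mkAlgHom_apply, AlgHom.comp_apply, hx,
        AddMonoidAlgebra.mapAlgHom_single]

lemma Grading.ringQuot_homog {D : Grading R G} {r : R → R → Prop}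
    (hr : ∀ x y, r x y → ∃ g, D.Homog g x ∧ D.Homog g y) {g : G} {x : R} (hx : D.Homog g x) :
    (D.ringQuot r hr).Homog g (RingQuot.mkAlgHom ℂ r x) := by
  rw [Grading.Homog] at hx ⊢
  change RingQuot.liftAlgHom ℂ _ _ = _
  rw [RingQuot.liftAlgHom_mkAlgHom_apply, AlgHom.comp_apply, hx,
    AddMonoidAlgebra.mapAlgHom_single]

lemma isUnit_single {T : Type*} [Ring T] (g : G) {t : T} (ht : IsUnit t) :
    IsUnit (AddMonoidAlgebra.single g t) := by
  obtain ⟨u, rfl⟩ := ht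
  refine ⟨⟨AddMonoidAlgebra.single g (u : T), AddMonoidAlgebra.single (-g) (↑u⁻¹ : T), ?_, ?_⟩, rfl⟩
  · rw [AddMonoidAlgebra.single_mul_single, Units.mul_inv, add_neg_cancel]; rfl
  · rw [AddMonoidAlgebra.single_mul_single, Units.inv_mul, neg_add_cancel]; rfl

lemma univLoc_coact_isUnit (D : Grading R G) (S : Set R) (hS : ∀ s ∈ S, ∃ g, D.Homog g s) :
    ∀ s ∈ S, IsUnit (((AddMonoidAlgebra.mapAlgHom G (UnivLoc.of S)).comp D.coact) s) := by
  intro s hs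
  obtain ⟨g, hg⟩ := hS s hs
  rw [Grading.Homog] at hg
  rw [AlgHom.comp_apply, hg, AddMonoidAlgebra.mapAlgHom_single]
  exact isUnit_single g (UnivLoc.isUnit_of S ⟨s, hs⟩)

/-- The coaction on a localization at homogeneous elements. -/
noncomputable def univLocCoact (D : Grading R G) (S : Set R) (hS : ∀ s ∈ S, ∃ g, D.Homog g s) :
    UnivLoc R S →ₐ[ℂ] AddMonoidAlgebra (UnivLoc R S) G :=
  UnivLoc.lift S ((AddMonoidAlgebra.mapAlgHom G (UnivLoc.of S)).comp D.coact)
    (univLoc_coact_isUnit D S hS)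

lemma univLocCoact_of (D : Grading R G) (S : Set R) (hS : ∀ s ∈ S, ∃ g, D.Homog g s) {g : G}
    {x : R} (hx : D.Homog g x) :
    univLocCoact D S hS (UnivLoc.of S x) = AddMonoidAlgebra.single g (UnivLoc.of S x) := by
  rw [Grading.Homog] at hx
  rw [univLocCoact, UnivLoc.lift_of, AlgHom.comp_apply, hx, AddMonoidAlgebra.mapAlgHom_single]

lemma univLocCoact_inv (D : Grading R G) (S : Set R) (hS : ∀ s ∈ S, ∃ g, D.Homog g s) (s : S) :
    ∃ g, univLocCoact D S hS (UnivLoc.inv S s) = AddMonoidAlgebra.single g (UnivLoc.inv S s) := by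
  obtain ⟨g, hg⟩ := hS s s.2
  refine ⟨-g, ?_⟩
  have h1 : univLocCoact D S hS (UnivLoc.inv S s) * AddMonoidAlgebra.single g (UnivLoc.of S s) =
      1 := by
    rw [← univLocCoact_of D S hS hg, ← map_mul, UnivLoc.inv_mul_of, map_one]
  have h2 : AddMonoidAlgebra.single g (UnivLoc.of S (s : R)) *
      AddMonoidAlgebra.single (-g) (UnivLoc.inv S s) = 1 := by
    rw [AddMonoidAlgebra.single_mul_single, UnivLoc.of_mul_inv, add_neg_cancel]; rfl
  exact left_inv_eq_right_inv h1 h2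

/-- The grading of a localization at homogeneous elements. -/
noncomputable def Grading.univLoc (D : Grading R G) (S : Set R)
    (hS : ∀ s ∈ S, ∃ g, D.Homog g s) : Grading (UnivLoc R S) G where
  coact := univLocCoact D S hS
  mem_span x := by
    obtain ⟨x, rfl⟩ := RingQuot.mkAlgHom_surjective ℂ (UnivLocRel R S) x
    have hof : ∀ x : R, UnivLoc.of S x ∈ Submodule.span ℂ
        {y | ∃ g, univLocCoact D S hS y = AddMonoidAlgebra.single g y} := fun x => by
      induction x using D.induction with
      | h0 => rw [map_zero]; exact Submodule.zero_mem _
      | hadd x y hx hy => rw [map_add]; exact Submodule.add_mem _ hx hy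
      | hom g x hx => exact Submodule.subset_span ⟨g, univLocCoact_of D S hS hx⟩
    induction x using FreeAlgebra.induction with
    | grade0 r =>
      rw [AlgHom.commutes, Algebra.algebraMap_eq_smul_one]
      refine Submodule.smul_mem _ _ (Submodule.subset_span ⟨0, ?_⟩)
      rw [map_one]; rfl
    | grade1 x =>
      obtain x | s := x
      · exact hof x
      · exact Submodule.subset_span (univLocCoact_inv D S hS s)
    | mul x y hx hy =>
      rw [map_mul]
      refine Submodule.span_induction₂ (p := fun a b _ _ => a * b ∈ Submodule.span ℂ
        {y | ∃ g, univLocCoact D S hS y = AddMonoidAlgebra.single g y}) ?_ ?_ ?_ ?_ ?_ ?_ ?_ hx hy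
      · rintro a b ⟨g, hg⟩ ⟨h, hh⟩
        refine Submodule.subset_span ⟨g + h, ?_⟩
        rw [map_mul, hg, hh, AddMonoidAlgebra.single_mul_single]
      · intro a _; rw [zero_mul]; exact Submodule.zero_mem _
      · intro a _; rw [mul_zero]; exact Submodule.zero_mem _
      · intro a b c _ _ _ h1 h2; rw [add_mul]; exact Submodule.add_mem _ h1 h2
      · intro a b c _ _ _ h1 h2; rw [mul_add]; exact Submodule.add_mem _ h1 h2
      · intro r a b _ _ h1; rw [smul_mul_assoc]; exact Submodule.smul_mem _ _ h1
      · intro r a b _ _ h1; rw [mul_smul_comm]; exact Submodule.smul_mem _ _ h1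
    | add x y hx hy => rw [map_add]; exact Submodule.add_mem _ hx hy

end GradingConstructions

section ModifiedHallAlgebra

section

variable {A : Type u} [Category.{v} A] [Abelian A]

/-- The degree of a `ℤ/2`-graded complex: the classes of its components of degrees `0` and `1`. -/
noncomputable def cpxDeg (x : IsoClass (Cpx A)) : K0 A × K0 A :=
  (k0Cls (x.rep.X 0), k0Cls (x.rep.X 1))

lemma cpxDeg_isoCls (M : Cpx A) : cpxDeg (isoCls M) = (k0Cls (M.X 0), k0Cls (M.X 1)) := by
  obtain ⟨e⟩ := rep_isoCls M
  exact Prod.ext (k0Cls_iso ((HomologicalComplex.eval A _ 0).mapIso e))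
    (k0Cls_iso ((HomologicalComplex.eval A _ 1).mapIso e))

lemma cpxDeg_of_isSES {M X L : Cpx A} {f : M ⟶ X} {g : X ⟶ L} (h : IsSES f g) :
    cpxDeg (isoCls X) = cpxDeg (isoCls M) + cpxDeg (isoCls L) := by
  rw [cpxDeg_isoCls, cpxDeg_isoCls, cpxDeg_isoCls]
  exact Prod.ext (k0Cls_of_isSES (h.eval 0)) (k0Cls_of_isSES (h.eval 1))

open ZeroObject in
lemma cpxDeg_zero : cpxDeg (isoCls (0 : Cpx A)) = 0 := by
  rw [cpxDeg_isoCls]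
  have h : ∀ i, IsZero ((0 : Cpx A).X i) := fun i =>
    (HomologicalComplex.eval A _ i).map_isZero (isZero_zero (Cpx A))
  exact Prod.ext (k0Cls_zero (h 0)) (k0Cls_zero (h 1))

lemma isSES_biprod (K M : Cpx A) : IsSES (biprod.inl : K ⟶ K ⊞ M) biprod.snd := by
  refine isSES_of_lift inferInstance inferInstance (by simp) fun t ht => ⟨t ≫ biprod.fst, ?_⟩
  apply biprod.hom_ext <;> simp [ht]

/-- The stalk complex `C_X` with `X` in degree `1`. -/
noncomputable def cpxC (X : A) : Cpx A :=
  (HomologicalComplex.single A (ComplexShape.up (ZMod 2)) 1).obj X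

/-- The stalk complex `C_X^*` with `X` in degree `0`. -/
noncomputable def cpxCs (X : A) : Cpx A :=
  (HomologicalComplex.single A (ComplexShape.up (ZMod 2)) 0).obj X

lemma rel_zero_one : (ComplexShape.up (ZMod 2)).Rel 0 1 := by simp

lemma rel_one_zero : (ComplexShape.up (ZMod 2)).Rel 1 0 := by
  change (1 : ZMod 2) + 1 = 0
  decide

/-- The acyclic complex `K_X`, with `X` in both degrees, `d⁰ = 1` and `d¹ = 0`. -/
noncomputable def cpxK (X : A) : Cpx A := HomologicalComplex.double (𝟙 X) rel_zero_one

/-- The acyclic complex `K_X^*`, with `X` in both degrees, `d¹ = 1` and `d⁰ = 0`. -/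
noncomputable def cpxKs (X : A) : Cpx A := HomologicalComplex.double (𝟙 X) rel_one_zero

end

variable (A : Type u) [Category.{v} A] [Abelian A] [HereditaryFinite A]

/-- The Ringel-Hall algebra of the category of `ℤ/2`-graded complexes, graded by the classes of
the components. -/
noncomputable def cpxHallGrading : Grading (HallAlg (Cpx A)) (K0 A × K0 A) :=
  (hallConst (Cpx A)).grading cpxDeg cpxDeg_zero fun a b x h => by
    obtain ⟨f, g, hs⟩ := (hallNum_ne_zero_iff a b x).1 h
    have := cpxDeg_of_isSES hs
    rw [isoCls_rep, isoCls_rep, isoCls_rep] at this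
    rw [this, add_comm]

lemma cpxHallGrading_homog (M : Cpx A) :
    (cpxHallGrading A).Homog (cpxDeg (isoCls M)) (hallCls M) :=
  AlgConst.grading_homog _ _ _ _ _

/-- The relations `[L] = [K ⊕ M]`, for a short exact sequence `0 ⟶ K ⟶ L ⟶ M ⟶ 0` of
`ℤ/2`-graded complexes with `K` acyclic. -/
inductive AcyclicRel : HallAlg (Cpx A) → HallAlg (Cpx A) → Prop
  | mk {K L M : Cpx A} (f : K ⟶ L) (g : L ⟶ M) (h : IsSES f g) (hK : K.Acyclic) :
      AcyclicRel (hallCls L) (hallCls (K ⊞ M))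

lemma acyclicRel_homog (x y : HallAlg (Cpx A)) (h : AcyclicRel A x y) :
    ∃ g, (cpxHallGrading A).Homog g x ∧ (cpxHallGrading A).Homog g y := by
  obtain ⟨f, g, h, hK⟩ := h
  refine ⟨_, cpxHallGrading_homog A _, ?_⟩
  rw [cpxDeg_of_isSES h, ← cpxDeg_of_isSES (isSES_biprod _ _)]
  exact cpxHallGrading_homog A _

/-- The quotient of the Ringel-Hall algebra of `ℤ/2`-graded complexes by the two-sided ideal
generated by the differences `[L] - [K ⊕ M]`. -/
abbrev QuotHall : Type (max u v) := RingQuot (AcyclicRel A)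

variable {A} in
/-- The class of a complex in the quotient algebra. -/
noncomputable def quotCls (M : Cpx A) : QuotHall A := RingQuot.mkAlgHom ℂ (AcyclicRel A) (hallCls M)

/-- The nonzero multiples of the classes of the acyclic complexes. -/
def acyclicSet : Set (QuotHall A) :=
  {x | ∃ (c : ℂ) (K : Cpx A), c ≠ 0 ∧ K.Acyclic ∧ x = c • quotCls K}

/-- The grading of the quotient algebra. -/
noncomputable def quotGrading : Grading (QuotHall A) (K0 A × K0 A) :=
  (cpxHallGrading A).ringQuot (AcyclicRel A) (acyclicRel_homog A)

lemma acyclicSet_homog : ∀ s ∈ acyclicSet A, ∃ g, (quotGrading A).Homog g s := by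
  rintro s ⟨c, K, -, -, rfl⟩
  exact ⟨_, (Grading.ringQuot_homog _ (cpxHallGrading_homog A K)).smul c⟩

/-- The modified Ringel-Hall algebra: the localization of the quotient algebra at the classes
of the acyclic complexes. -/
abbrev ModHall : Type (max u v) := UnivLoc (QuotHall A) (acyclicSet A)

/-- The grading of the modified Ringel-Hall algebra by the classes of the components. -/
noncomputable def modHallGrading : Grading (ModHall A) (K0 A × K0 A) :=
  (quotGrading A).univLoc (acyclicSet A) (acyclicSet_homog A)

/-- The componentwise Euler form `√(⟨M⁰, N⁰⟩ ⟨M¹, N¹⟩)`. -/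
noncomputable def cwForm : Bichar (K0 A × K0 A) where
  toFun g h := (√(eulerForm g.1 h.1 * eulerForm g.2 h.2) : ℝ)
  zero_left h := by simp [eulerForm_zero_left]
  zero_right g := by simp [eulerForm_zero_right]
  add_left g g' h := by
    have h1 := fun x y => (eulerForm_pos (A := A) x y).le
    rw [← Complex.ofReal_mul, ← Real.sqrt_mul (mul_nonneg (h1 _ _) (h1 _ _))]
    simp only [Prod.fst_add, Prod.snd_add, eulerForm_add_left]
    congr 2
    ring
  add_right g h h' := by
    have h1 := fun x y => (eulerForm_pos (A := A) x y).le
    rw [← Complex.ofReal_mul, ← Real.sqrt_mul (mul_nonneg (h1 _ _) (h1 _ _))]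
    simp only [Prod.fst_add, Prod.snd_add, eulerForm_add_right]
    congr 2
    ring

/-- The twisted modified Ringel-Hall algebra. -/
abbrev ModHallTw : Type (max u v) := Twisted (modHallGrading A) (cwForm A)

variable {A} in
/-- The class `[M]` of a complex in the twisted modified Ringel-Hall algebra. -/
noncomputable def mhCls (M : Cpx A) : ModHallTw A :=
  Twisted.mk (modHallGrading A) (cwForm A) (UnivLoc.of (acyclicSet A) (quotCls M))

end ModifiedHallAlgebra

section ExtendedHallAlgebra

variable {A : Type u} [Category.{v} A] [Abelian A]

/-- The class in `K₀(A)` of an isomorphism class of objects. -/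
noncomputable def isoK0 (x : IsoClass A) : K0 A := k0Cls x.rep

lemma isoK0_isoCls (X : A) : isoK0 (isoCls X) = k0Cls X := k0Cls_iso (rep_isoCls X).some

variable [HereditaryFinite A]

lemma isoK0_of_hallNum (a b x : IsoClass A) (h : hallNum a b x ≠ 0) :
    isoK0 x = isoK0 a + isoK0 b := by
  obtain ⟨f, g, hs⟩ := (hallNum_ne_zero_iff a b x).1 h
  rw [isoK0, k0Cls_of_isSES hs, add_comm]
  rfl

/-- The twist `√(α, B) √⟨A, B⟩` in the product of `[A] * k_α` and `[B] * k_β`. -/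
noncomputable def extTwist (p q : IsoClass A × K0 A) : ℂ :=
  sqrtSym p.2 (isoK0 q.1) * sqrtEuler (isoK0 p.1) (isoK0 q.1)

open ZeroObject in
variable (A) in
/-- The structure constants of the twisted extended Ringel-Hall algebra in the basis of the
elements `[A] * k_α`:
`([A] * k_α) * ([B] * k_β) = √(α, B) √⟨A, B⟩ ∑_X |Ext¹(A, B)_X| / |Hom(A, B)| [X] * k_{α + β}`. -/
noncomputable def extHallConst : AlgConst (IsoClass A × K0 A) where
  mul p q := (extTwist p q • (hallConst A).mul p.1 q.1).mapDomain fun x => (x, p.2 + q.2)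
  one := (isoCls (0 : A), 0)
  one_mul a := by
    have : isoK0 (isoCls (0 : A)) = 0 := by rw [isoK0_isoCls, k0Cls_zero (isZero_zero A)]
    have h := (hallConst A).one_mul a.1
    change (hallConst A).mul (isoCls (0 : A)) a.1 = _ at h
    simp only [extTwist, this, sqrtSym_eq, sqrtEuler_zero_left, sqrtEuler_zero_right, h]
    simp
  mul_one a := by
    have : isoK0 (isoCls (0 : A)) = 0 := by rw [isoK0_isoCls, k0Cls_zero (isZero_zero A)]
    have h := (hallConst A).mul_one a.1
    change (hallConst A).mul a.1 (isoCls (0 : A)) = _ at h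
    simp only [extTwist, this, sqrtSym_eq, sqrtEuler_zero_left, sqrtEuler_zero_right, h]
    simp
  assoc a b c := by
    have hl : ∀ x : IsoClass A, hallNum a.1 b.1 x ≠ 0 →
        extTwist a b * extTwist (x, a.2 + b.2) c =
        extTwist a b * (extTwist a c * extTwist b c) := fun x hx => by
      simp only [extTwist, isoK0_of_hallNum _ _ _ hx, sqrtSym_eq, sqrtEuler_add_left,
        sqrtEuler_add_right]
      ring
    have hr : ∀ x : IsoClass A, hallNum b.1 c.1 x ≠ 0 →
        extTwist b c * extTwist a (x, b.2 + c.2) =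
        extTwist a b * (extTwist a c * extTwist b c) := fun x hx => by
      simp only [extTwist, isoK0_of_hallNum _ _ _ hx, sqrtSym_eq, sqrtEuler_add_left,
        sqrtEuler_add_right]
      ring
    have key := congrArg (fun z => (extTwist a b * (extTwist a c * extTwist b c)) •
      Finsupp.mapDomain (fun x => (x, a.2 + b.2 + c.2)) z) ((hallConst A).assoc a.1 b.1 c.1)
    simp only [Finsupp.sum, Finsupp.mapDomain_finsetSum, Finset.smul_sum,
      Finsupp.mapDomain_smul] at key
    rw [Finsupp.sum_mapDomain_index (by simp) (by simp [add_smul]),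
      Finsupp.sum_mapDomain_index (by simp) (by simp [add_smul]),
      Finsupp.sum_smul_index (by simp), Finsupp.sum_smul_index (by simp)]
    simp only [Finsupp.sum, Finsupp.mapDomain_smul]
    refine Eq.trans (Finset.sum_congr rfl fun x hx => ?_)
      (key.trans (Finset.sum_congr rfl fun x hx => ?_))
    · rw [← hl x (Finsupp.mem_support_iff.1 hx), smul_smul, smul_smul]
      congr 1
      ring
    · rw [← hr x (Finsupp.mem_support_iff.1 hx), smul_smul, smul_smul, add_assoc]
      congr 1
      ring

variable (A) in
/-- The twisted extended Ringel-Hall algebra of `A`. -/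
abbrev ExtHall : Type u := (extHallConst A).Alg

/-- The element `[X]` of the twisted extended Ringel-Hall algebra. -/
noncomputable def extCls (X : A) : ExtHall A := (extHallConst A).basis (isoCls X, 0)

open ZeroObject in
/-- The element `k_α` of the twisted extended Ringel-Hall algebra. -/
noncomputable def extK (α : K0 A) : ExtHall A := (extHallConst A).basis (isoCls (0 : A), α)

end ExtendedHallAlgebra

section DrinfeldDouble

variable (A : Type u) [Category.{v} A] [Abelian A] [HereditaryFinite A]

/-- The set indexing the basis `[A] * k_α` of the twisted extended Ringel-Hall algebra. -/
abbrev ExtIdx : Type u := IsoClass A × K0 A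

variable {A}

open Classical in
/-- The coefficient of `([B] * k_β) ⊗ ([C] * k_γ)` in the coproduct of `[A] * k_α`. It is
`√⟨B, C⟩ |Ext¹(B, C)_A| / |Hom(B, C)| · |Aut A| / (|Aut B| |Aut C|)` if `β = C + α` and
`γ = α`, and `0` otherwise. -/
noncomputable def coprodCoeff (p : ExtIdx A) (r : ExtIdx A × ExtIdx A) : ℂ :=
  if r.1.2 = isoK0 r.2.1 + p.2 ∧ r.2.2 = p.2 then
    sqrtEuler (isoK0 r.1.1) (isoK0 r.2.1) * hallNum r.1.1 r.2.1 p.1 *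
      (autNum p.1 / (autNum r.1.1 * autNum r.2.1))
  else 0

/-- The coproduct with values in the completed tensor square, that is, in the formal (possibly
infinite) linear combinations of the tensors of basis elements. -/
noncomputable def coprod : ExtHall A →ₗ[ℂ] (ExtIdx A × ExtIdx A → ℂ) :=
  (extHallConst A).basis.constr ℂ coprodCoeff

open Classical in
/-- The Hopf pairing `φ([M] * k_α, [N] * k_β) = √(α, β) δ_{[M], [N]} |Aut M|` of two basis
elements. -/
noncomputable def hopfPairing (p q : ExtIdx A) : ℂ :=
  if p.1 = q.1 then sqrtSym p.2 q.2 * autNum p.1 else 0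

open TensorProduct in
variable (A) in
/-- The tensor square of the twisted extended Ringel-Hall algebra, as a vector space. -/
abbrev ExtHall2 : Type u := ExtHall A ⊗[ℂ] ExtHall A

/-- The basis element `[A] * k_α` with a given index. -/
noncomputable def extB (p : ExtIdx A) : ExtHall A := (extHallConst A).basis p

open TensorProduct in
/-- The terms of the sum `∑ φ(a₍₂₎, b₍₁₎) a₍₁₎ ⊗ b₍₂₎`. -/
noncomputable def crossLeft (a b : ExtHall A)
    (r : (ExtIdx A × ExtIdx A) × (ExtIdx A × ExtIdx A)) : ExtHall2 A :=
  (coprod a r.1 * coprod b r.2 * hopfPairing r.1.2 r.2.1) • (extB r.1.1 ⊗ₜ[ℂ] extB r.2.2)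

open TensorProduct in
/-- The terms of the sum `∑ φ(a₍₁₎, b₍₂₎) (1 ⊗ b₍₁₎) (a₍₂₎ ⊗ 1)`, for a multiplication `μ`. -/
noncomputable def crossRight (μ : ExtHall2 A →ₗ[ℂ] ExtHall2 A →ₗ[ℂ] ExtHall2 A) (a b : ExtHall A)
    (r : (ExtIdx A × ExtIdx A) × (ExtIdx A × ExtIdx A)) : ExtHall2 A :=
  (coprod a r.1 * coprod b r.2 * hopfPairing r.1.1 r.2.2) •
    μ (1 ⊗ₜ[ℂ] extB r.2.1) (extB r.1.2 ⊗ₜ[ℂ] 1)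

open TensorProduct in
/-- `μ` is the multiplication of the Drinfeld double of the twisted extended Ringel-Hall algebra
on its tensor square. -/
structure IsDrinfeldDouble (μ : ExtHall2 A →ₗ[ℂ] ExtHall2 A →ₗ[ℂ] ExtHall2 A) : Prop where
  assoc : ∀ x y z, μ (μ x y) z = μ x (μ y z)
  one_left : ∀ x, μ (1 ⊗ₜ[ℂ] 1) x = x
  one_right : ∀ x, μ x (1 ⊗ₜ[ℂ] 1) = x
  left_mul : ∀ a a' : ExtHall A, μ (a ⊗ₜ[ℂ] 1) (a' ⊗ₜ[ℂ] 1) = (a * a') ⊗ₜ[ℂ] 1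
  left_injective : Function.Injective fun a : ExtHall A => (a ⊗ₜ[ℂ] 1 : ExtHall2 A)
  right_mul : ∀ b b' : ExtHall A, μ (1 ⊗ₜ[ℂ] b) (1 ⊗ₜ[ℂ] b') = 1 ⊗ₜ[ℂ] (b * b')
  right_injective : Function.Injective fun b : ExtHall A => (1 ⊗ₜ[ℂ] b : ExtHall2 A)
  left_mul_right : ∀ a b : ExtHall A, μ (a ⊗ₜ[ℂ] 1) (1 ⊗ₜ[ℂ] b) = a ⊗ₜ[ℂ] b
  cross_left_finite : ∀ a b : ExtHall A, (Function.support (crossLeft a b)).Finite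
  cross_right_finite : ∀ a b : ExtHall A, (Function.support (crossRight μ a b)).Finite
  cross : ∀ a b : ExtHall A, ∑ᶠ r, crossLeft a b r = ∑ᶠ r, crossRight μ a b r

end DrinfeldDouble

end ModifiedHall

open ModifiedHall
open scoped TensorProduct

/-! Everything rests on how an acyclic complex K multiplies. Over a hereditary category K has a
resolution by contractible complexes (`acyclic_resolution`). Contractible complexes are adjoint to
evaluations, so their Ext groups are Ext groups of the base category. Hence Ext²(K, -) and Ext²(-,
K) vanish, and |Ext¹|/|Hom| between K and any N depends only on the K₀ classes of the components of
N and of the boundaries of K (`card_div_of_acyclic_right`, `card_div_of_acyclic_left`). In the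
quotient algebra [M][K] is therefore a scalar times [K ⊕ M]. The product [K][M] is such a multiple
as well, but only modulo elements killed by an acyclic class. This yields the right Ore condition
and reversibility, so the universal localization is a right localization.

In the twisted localization the acyclic classes generate a commutative group of units, the image of
K₀ × K₀ under `mhK`. Every complex M is linked to its homology by a common cover with acyclic
kernels (`homology_resolution`), so [M] is a nonzero multiple of the class of its homology times a
unit (`mhCls_eq`). These normal forms span. They are independent because the localization acts on
the vector space with basis the triples of homology in degree 0, homology in degree 1 and boundary
classes (`modAct`); applying it to the invariants of the zero complex recovers the invariants of
each complex.

The stalk functors are exact and fully faithful with extension closed image, which gives the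
homomorphisms I₊ and I₋. An extension of a stalk in degree 1 by one in degree 0 is a single
differential, so [C_X] * [C_Y^*] is the sum over f : X ⟶ Y of the complexes with d¹ = f. Rewriting
by homology and boundaries, both sides of (D3) for [X] and [Y] become the sum of the classes of all
complexes with components Y and X, times one common factor (`stalkVal_cross`). On the other side,
the coproduct coefficients in (D3) count morphisms by kernel, image and cokernel
(`card_SESPairs_mul_card_SESPairs`).

In that sum the term f = 0 is the normal form attached to the pair, and every other f replaces (X,
Y) by (ker f, coker f), for which a numerical measure is smaller (`pairMeasure_lt`). So a ⊗ b ↦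
I₊(a) * I₋(b) is triangular with respect to the basis of normal forms, hence bijective. The double
is the multiplication transported along it, so associativity is free. Uniqueness follows by
induction on the same measure, since (D3) determines (1 ⊗ b)(a ⊗ 1) from smaller terms. -/

namespace ModifiedHall

universe v u w v' u'

attribute [local instance] HasExt.standard

/-! ### Effaceability of Ext, Yoneda induction and adjunctions -/

section ExtGroups

open HomologicalComplex in
/-- A quasi-isomorphism from a complex in degrees `≤ i` to an object placed in degree `i` is an
epimorphism in degree `i`. -/
lemma epi_of_quasiIsoAt_single {C : Type u} [Category.{v} C] [Abelian C]
    {P : C} {K : CochainComplex C ℤ} {i : ℤ}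
    (π : K ⟶ (HomologicalComplex.single C (ComplexShape.up ℤ) i).obj P) [K.IsStrictlyLE i] [QuasiIsoAt π i] :
    Epi (π.f i ≫ (singleObjXSelf (ComplexShape.up ℤ) i P).hom) := by
  let e := K.iCyclesIso i (i + 1) (by simp)
    ((K.isZero_of_isStrictlyLE i (i + 1) (by simp)).eq_of_tgt _ _)
  let α := e.inv ≫ K.homologyπ i ≫ homologyMap π i ≫ (singleObjHomologySelfIso _ _ _).hom
  have he : e.hom = K.iCycles i := rfl
  have : π.f i = α ≫ (singleObjXSelf (ComplexShape.up ℤ) i P).inv := by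
    rw [← cancel_epi e.hom]
    dsimp only [α]
    rw [Category.assoc, Category.assoc, Category.assoc, Iso.hom_inv_id_assoc,
      homologyπ_naturality_assoc, homologyπ_singleObjHomologySelfIso_hom_assoc,
      ← singleObjCyclesSelfIso_inv_iCycles, Iso.hom_inv_id_assoc, he, cyclesMap_i]
  rw [this, Category.assoc, Iso.inv_hom_id, Category.comp_id]
  infer_instance

-- Write φ as a fraction X ← K → L with K in degrees at most i. The epimorphism is the degree i
-- component of the quasi-isomorphism. It lifts to a map from K^i, placed in degree i, to K, and the
-- composite with K → L vanishes because L is zero in degree i.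
open DerivedCategory in
lemma exists_epi_map_comp_eq_zero {C : Type u} [Category.{v} C] [Abelian C]
    [HasDerivedCategory.{w} C] {X : C} {L : CochainComplex C ℤ} {i : ℤ}
    (φ : Q.obj ((CochainComplex.singleFunctor C i).obj X) ⟶ Q.obj L)
    (n : ℤ) (hn : n < i) [L.IsStrictlyLE n] :
    ∃ (X' : C) (p : X' ⟶ X), Epi p ∧
      Q.map ((CochainComplex.singleFunctor C i).map p) ≫ φ = 0 := by
  obtain ⟨K, _, π, h, g, rfl⟩ := right_fac_of_isStrictlyLE φ i
  have hq := h
  rw [isIso_Q_map_iff_quasiIso] at hq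
  let π' : K ⟶ (HomologicalComplex.single C (ComplexShape.up ℤ) i).obj X := π
  have : QuasiIsoAt π' i := hq.quasiIsoAt i
  refine ⟨K.X i, _, epi_of_quasiIsoAt_single π', ?_⟩
  let t : (HomologicalComplex.single C (ComplexShape.up ℤ) i).obj (K.X i) ⟶ K :=
    HomologicalComplex.mkHomFromSingle (𝟙 _) (by
      rintro _ rfl
      apply (K.isZero_of_isStrictlyLE i (i + 1) (by simp)).eq_of_tgt)
  have ht : t ≫ π' = (HomologicalComplex.single C (ComplexShape.up ℤ) i).map
      (π'.f i ≫ (HomologicalComplex.singleObjXSelf (ComplexShape.up ℤ) i X).hom) := by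
    apply HomologicalComplex.from_single_hom_ext
    rw [HomologicalComplex.comp_f, HomologicalComplex.single_map_f_self,
      HomologicalComplex.mkHomFromSingle_f, Category.comp_id, Category.assoc,
      Iso.hom_inv_id, Category.comp_id]
  have h₂ : t ≫ g = 0 := by
    apply HomologicalComplex.from_single_hom_ext
    apply (L.isZero_of_isStrictlyLE n i hn).eq_of_tgt
  have h₃ : IsIso (Q.map π') := h
  have h₄ : Q.map (t ≫ π') ≫ inv (Q.map π') ≫ Q.map g = 0 := by
    rw [Q.map_comp, Category.assoc, IsIso.hom_inv_id_assoc, ← Q.map_comp, h₂, Q.map_zero]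
  rw [ht] at h₄
  exact h₄

variable {C : Type u} [Category.{v} C] [Abelian C]

open DerivedCategory in
/-- Extension classes of positive degree are killed by the pullback along some epimorphism. -/
lemma ext_effaceable [HasExt.{w} C] {X Y : C} {n : ℕ} (e : Ext X Y (n + 1)) :
    ∃ (X' : C) (p : X' ⟶ X), Epi p ∧ (Ext.mk₀ p).comp e (zero_add (n + 1)) = 0 := by
  let := HasDerivedCategory.standard C
  -- A class in Ext^(n+1) is a map in the derived category from X in degree 0 to Y in degree -(n+1),
  -- which is strictly below 0.
  obtain ⟨X', p, hp, h⟩ := exists_epi_map_comp_eq_zero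
    (L := (CochainComplex.singleFunctor C (-(n + 1 : ℤ))).obj Y)
    (e.hom ≫ ((singleFunctors C).shiftIso (n + 1) (-(n + 1)) 0 (by lia)).hom.app Y)
    (n := -(n + 1)) (by lia)
  refine ⟨X', p, hp, ?_⟩
  apply Ext.homEquiv.injective
  simp only [← cancel_mono (((singleFunctors C).shiftIso (n + 1) (-(n + 1)) 0
    (by lia)).hom.app _)]
  change ((Ext.mk₀ p).comp e (zero_add (n + 1))).hom ≫ _ = (0 : Ext X' Y (n + 1)).hom ≫ _
  rw [← Ext.singleFunctor_map_comp_hom, Ext.zero_hom, zero_comp, Category.assoc]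
  exact h

/-- An epimorphism p that kills e exhibits e as the connecting image of a morphism from the kernel
of p to M. Pushing the extension given by p out along this morphism realizes e; no projective
objects are needed. -/
lemma ext_one_exists_isSES {L M : C} (e : Ext L M 1) :
    ∃ (X : C) (f : M ⟶ X) (g : X ⟶ L) (h : IsSES f g), h.2.extClass = e := by
  obtain ⟨L', p, hp, h⟩ := ext_effaceable e
  have hS : (ShortComplex.mk (kernel.ι p) p (kernel.condition p)).ShortExact :=
    { exact := ShortComplex.exact_of_f_is_kernel _ (kernelIsKernel p) }
  obtain ⟨x, hx⟩ := Ext.contravariant_sequence_exact₃ hS M e h (n₀ := 0) (add_zero 1)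
  obtain ⟨φ, rfl⟩ : ∃ φ : kernel p ⟶ M, Ext.mk₀ φ = x := (Ext.mk₀_bijective _ _).2 x
  let q : pushout (kernel.ι p) φ ⟶ L := pushout.desc p 0 (by simp)
  have hq : pushout.inl (kernel.ι p) φ ≫ q = p := pushout.inl_desc _ _ _
  have hq' : pushout.inr (kernel.ι p) φ ≫ q = 0 := pushout.inr_desc _ _ _
  have hs : IsSES (pushout.inr (kernel.ι p) φ) q := by
    refine isSES_of_desc inferInstance ?_ hq' fun t ht => ?_
    · have : Epi (pushout.inl (kernel.ι p) φ ≫ q) := by rw [hq]; exact hp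
      exact epi_of_epi (pushout.inl (kernel.ι p) φ) q
    · obtain ⟨s, hs⟩ := IsSES.desc ⟨kernel.condition p, hS⟩ (pushout.inl _ _ ≫ t) (by
        rw [pushout.condition_assoc, ht, comp_zero])
      refine ⟨s, ?_⟩
      apply pushout.hom_ext
      · rw [← Category.assoc, hq, hs]
      · rw [← Category.assoc, hq', ht, zero_comp]
  refine ⟨_, _, _, hs, ?_⟩
  let ψ : ShortComplex.mk (kernel.ι p) p (kernel.condition p) ⟶ ShortComplex.mk _ q hs.1 :=
    { τ₁ := φ, τ₂ := pushout.inl _ _, τ₃ := 𝟙 _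
      comm₁₂ := pushout.condition.symm
      comm₂₃ := by simp [hq] }
  have hn := ShortComplex.ShortExact.extClass_naturality hS hs.2 ψ
  dsimp only [ψ] at hn
  rw [Ext.mk₀_id_comp] at hn
  rw [← hn]
  exact hx

/-- Extension classes are Yoneda products of classes of short exact sequences and a morphism. -/
lemma ext_yoneda_induction {P : ∀ {n : ℕ} {X Y : C}, Ext X Y n → Prop}
    (h0 : ∀ {X Y : C} (f : X ⟶ Y), P (Ext.mk₀ f))
    (hs : ∀ {S : ShortComplex C} (hS : S.ShortExact) {Y : C} {n : ℕ} (e : Ext S.X₁ Y n), P e →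
      P (hS.extClass.comp e (add_comm 1 n))) {n : ℕ} {X Y : C} (e : Ext X Y n) : P e := by
  induction n generalizing X with
  | zero =>
    obtain ⟨f, rfl⟩ := (Ext.mk₀_bijective _ _).2 e
    exact h0 f
  | succ n ih =>
    obtain ⟨L', p, hp, h⟩ := ext_effaceable e
    have hS : (ShortComplex.mk (kernel.ι p) p (kernel.condition p)).ShortExact :=
      { exact := ShortComplex.exact_of_f_is_kernel _ (kernelIsKernel p) }
    obtain ⟨x, rfl⟩ := Ext.contravariant_sequence_exact₃ hS Y e h (add_comm 1 n)
    exact hs hS x (ih x)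

section Adjunction

variable {D : Type u'} [Category.{v'} D] [Abelian D] {F : C ⥤ D} {G : D ⥤ C}
  [F.Additive] [PreservesFiniteLimits F] [PreservesFiniteColimits F]
  [G.Additive] [PreservesFiniteLimits G] [PreservesFiniteColimits G]

/-- By Yoneda induction it is enough to treat morphisms, where this is naturality of the unit, and
classes of short exact sequences, where it is naturality of the extension class along the unit.
Together with its dual for the counit it extends the triangle identities to Ext. -/
lemma ext_unit_naturality (adj : F ⊣ G) {n : ℕ} {X Y : C} (e : Ext X Y n) :
    (Ext.mk₀ (adj.unit.app X)).comp ((e.mapExactFunctor F).mapExactFunctor G) (zero_add n) =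
      e.comp (Ext.mk₀ (adj.unit.app Y)) (add_zero n) := by
  induction e using ext_yoneda_induction with
  | h0 f =>
    rw [Ext.mapExactFunctor_mk₀, Ext.mapExactFunctor_mk₀, Ext.mk₀_comp_mk₀, Ext.mk₀_comp_mk₀]
    exact congrArg Ext.mk₀ (adj.unit.naturality f).symm
  | @hs S hS Y n e ih =>
    let φ : S ⟶ (S.map F).map G :=
      { τ₁ := adj.unit.app _, τ₂ := adj.unit.app _, τ₃ := adj.unit.app _
        comm₁₂ := (adj.unit.naturality S.f).symm
        comm₂₃ := (adj.unit.naturality S.g).symm }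
    have hn := ShortComplex.ShortExact.extClass_naturality hS
      ((hS.map_of_exact F).map_of_exact G) φ
    have h1 : (hS.extClass.mapExactFunctor F).mapExactFunctor G =
        ((hS.map_of_exact F).map_of_exact G).extClass :=
      (congrArg _ (Ext.mapExactFunctor_extClass F hS)).trans
        (Ext.mapExactFunctor_extClass G (hS.map_of_exact F))
    have h2 : (Ext.mk₀ (adj.unit.app S.X₃)).comp
        ((hS.extClass.mapExactFunctor F).mapExactFunctor G) (zero_add 1) =
        hS.extClass.comp (Ext.mk₀ (adj.unit.app S.X₁)) (add_zero 1) := by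
      rw [h1]; exact hn.symm
    rw [Ext.mapExactFunctor_comp, Ext.mapExactFunctor_comp, Ext.comp_assoc _ _ _ _ (add_zero n) (by lia), ← ih,
      ← Ext.comp_assoc _ _ _ (zero_add 1) (by lia) (by lia), h2,
      Ext.comp_assoc _ _ _ _ (zero_add n) (by lia)]

lemma ext_counit_naturality (adj : F ⊣ G) {n : ℕ} {X Y : D} (e : Ext X Y n) :
    ((e.mapExactFunctor G).mapExactFunctor F).comp (Ext.mk₀ (adj.counit.app Y)) (add_zero n) =
      (Ext.mk₀ (adj.counit.app X)).comp e (zero_add n) := by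
  induction e using ext_yoneda_induction with
  | h0 f =>
    rw [Ext.mapExactFunctor_mk₀, Ext.mapExactFunctor_mk₀, Ext.mk₀_comp_mk₀, Ext.mk₀_comp_mk₀]
    exact congrArg Ext.mk₀ (adj.counit.naturality f)
  | @hs S hS Y n e ih =>
    let φ : (S.map G).map F ⟶ S :=
      { τ₁ := adj.counit.app _, τ₂ := adj.counit.app _, τ₃ := adj.counit.app _
        comm₁₂ := (adj.counit.naturality S.f).symm
        comm₂₃ := (adj.counit.naturality S.g).symm }
    have hn := ShortComplex.ShortExact.extClass_naturality
      ((hS.map_of_exact G).map_of_exact F) hS φ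
    have h1 : (hS.extClass.mapExactFunctor G).mapExactFunctor F =
        ((hS.map_of_exact G).map_of_exact F).extClass :=
      (congrArg _ (Ext.mapExactFunctor_extClass G hS)).trans
        (Ext.mapExactFunctor_extClass F (hS.map_of_exact G))
    have h2 : ((hS.extClass.mapExactFunctor G).mapExactFunctor F).comp
        (Ext.mk₀ (adj.counit.app S.X₁)) (add_zero 1) =
        (Ext.mk₀ (adj.counit.app S.X₃)).comp hS.extClass (zero_add 1) := by
      rw [h1]; exact hn
    rw [Ext.mapExactFunctor_comp, Ext.mapExactFunctor_comp, Ext.comp_assoc _ _ _ _ (add_zero n) (by lia), ih,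
      ← Ext.comp_assoc _ _ _ (add_zero 1) (by lia) (by lia), h2,
      Ext.comp_assoc _ _ _ (zero_add 1) _ (by lia)]

/-- An adjunction of exact functors induces isomorphisms of extension groups. -/
noncomputable def extAdjEquiv (adj : F ⊣ G) (X : C) (Y : D) (n : ℕ) :
    Ext (F.obj X) Y n ≃ Ext X (G.obj Y) n where
  toFun e := (Ext.mk₀ (adj.unit.app X)).comp (e.mapExactFunctor G) (zero_add n)
  invFun e := (e.mapExactFunctor F).comp (Ext.mk₀ (adj.counit.app Y)) (add_zero n)
  left_inv e := by
    dsimp only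
    rw [Ext.mapExactFunctor_comp, Ext.mapExactFunctor_mk₀, Ext.comp_assoc _ _ _ _ (add_zero n) (by lia),
      ext_counit_naturality, ← Ext.comp_assoc _ _ _ (zero_add 0) (by lia) (by lia),
      Ext.mk₀_comp_mk₀, adj.left_triangle_components, Ext.mk₀_id_comp]
  right_inv e := by
    dsimp only
    rw [Ext.mapExactFunctor_comp, Ext.mapExactFunctor_mk₀,
      ← Ext.comp_assoc _ _ _ (zero_add n) (by lia) (by lia),
      ext_unit_naturality, Ext.comp_assoc _ _ _ _ (add_zero 0) (by lia),
      Ext.mk₀_comp_mk₀, adj.right_triangle_components, Ext.comp_mk₀_id]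

end Adjunction

end ExtGroups

/-! ### Hall products as sums over extension classes -/

section MiddleTerms

variable {C : Type u} [Category.{v} C] [Abelian C]

/-- A middle term of an extension with a given class. -/
noncomputable def extMid {L M : C} (e : Ext L M 1) : C := (ext_one_exists_isSES e).choose

lemma extMid_spec {L M : C} (e : Ext L M 1) : ∃ (f : M ⟶ extMid e) (g : extMid e ⟶ L)
    (h : IsSES f g), h.2.extClass = e := (ext_one_exists_isSES e).choose_spec

lemma extMid_iso {L M X : C} {e : Ext L M 1} {f : M ⟶ X} {g : X ⟶ L} (h : IsSES f g)
    (he : h.2.extClass = e) : Nonempty (extMid e ≅ X) := by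
  obtain ⟨f', g', h', he'⟩ := extMid_spec e
  obtain ⟨ν, -⟩ := exists_of_extClass_eq h' h (he'.trans he.symm)
  exact ⟨ν⟩

/-- This partitions Ext¹(L, M) by the isomorphism class of the middle term, which lets Hall products
be summed over extension classes instead of isomorphism classes. -/
lemma extWithMiddle_eq (L M X : C) :
    extWithMiddle L M X = {e | isoCls (extMid e) = isoCls X} := by
  ext e
  constructor
  · rintro ⟨f, g, w, h, he⟩
    exact isoCls_eq_iff.2 (extMid_iso ⟨w, h⟩ he)
  · intro h
    obtain ⟨ν⟩ := isoCls_eq_iff.1 h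
    obtain ⟨f, g, hs, he⟩ := extMid_spec e
    exact ⟨_, _, _, (hs.comp_iso ν).2, (extClass_comp_iso hs ν).trans he⟩

lemma IsSES.congr_outer {M X L M' L' : C} {f : M ⟶ X} {g : X ⟶ L} (h : IsSES f g) (i : M' ≅ M)
    (j : L ≅ L') : IsSES (i.hom ≫ f) (g ≫ j.hom) := by
  have := h.mono
  have := h.epi
  refine isSES_of_lift inferInstance inferInstance ?_ fun t ht => ?_
  · rw [Category.assoc, ← Category.assoc f, h.zero, zero_comp, comp_zero]
  · obtain ⟨s, hs⟩ := h.lift t (by rw [← cancel_mono j.hom, Category.assoc, ht, zero_comp])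
    exact ⟨s ≫ i.inv, by simp [hs]⟩

lemma card_SESPairs_congr {L M X L' M' X' : C} (i : L ≅ L') (j : M ≅ M') (k : X ≅ X') :
    Nat.card (SESPairs L M X) = Nat.card (SESPairs L' M' X') := by
  refine Nat.card_congr
    { toFun := fun p => ⟨(j.inv ≫ p.1.1 ≫ k.hom, (k.inv ≫ p.1.2) ≫ i.hom), ?_⟩
      invFun := fun p => ⟨(j.hom ≫ p.1.1 ≫ k.inv, (k.hom ≫ p.1.2) ≫ i.inv), ?_⟩
      left_inv := fun p => Subtype.ext (by simp)
      right_inv := fun p => Subtype.ext (by simp) }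
  · exact (p.2.comp_iso k).congr_outer j.symm i
  · exact (p.2.comp_iso k.symm).congr_outer j i.symm

lemma card_aut_congr {C : Type u} [Category.{v} C] {X Y : C} (e : X ≅ Y) : Nat.card (Aut X) = Nat.card (Aut Y) :=
  Nat.card_congr (Aut.autMulEquivOfIso e).toEquiv

lemma card_hom_eq_card_ext_zero (X Y : C) : Nat.card (X ⟶ Y) = Nat.card (Ext X Y 0) :=
  Nat.card_congr (Equiv.ofBijective _ (Ext.mk₀_bijective X Y))

/-- The pushout of an extension. -/
lemma isSES_extMid_comp {K L M N : C} {f : K ⟶ L} {g : L ⟶ M} (h : IsSES f g) (e : Ext N L 1) :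
    ∃ (a : K ⟶ extMid e) (b : extMid e ⟶ extMid (e.comp (Ext.mk₀ g) (add_zero 1))),
      IsSES a b := by
  obtain ⟨i, p, hs, he⟩ := extMid_spec e
  have := h.mono
  have := hs.mono
  have hc : IsSES (f ≫ i) (cokernel.π (f ≫ i)) :=
    isSES_of_desc inferInstance inferInstance (cokernel.condition _)
      fun t ht => ⟨cokernel.desc _ t ht, by simp⟩
  -- The middle term modulo K is an extension of N by M, and naturality shows that its class is the
  -- pushforward of e along g.
  obtain ⟨f', g', hs', h1, h2⟩ := exists_right h hs hc
  let φ : ShortComplex.mk i p hs.1 ⟶ ShortComplex.mk f' g' hs'.1 :=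
    { τ₁ := g, τ₂ := cokernel.π (f ≫ i), τ₃ := 𝟙 _
      comm₁₂ := h2
      comm₂₃ := by dsimp; rw [h1, Category.comp_id] }
  have hn := ShortComplex.ShortExact.extClass_naturality hs.2 hs'.2 φ
  dsimp only [φ] at hn
  rw [Ext.mk₀_id_comp, he] at hn
  obtain ⟨ν⟩ := extMid_iso hs' hn.symm
  exact ⟨_, _, hc.congr_outer (Iso.refl _) ν.symm⟩

/-- The pullback of an extension. -/
lemma isSES_extMid_precomp {K L M N : C} {f : M ⟶ L} {g : L ⟶ K} (h : IsSES f g)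
    (e : Ext L N 1) :
    ∃ (a : extMid ((Ext.mk₀ f).comp e (zero_add 1)) ⟶ extMid e) (b : extMid e ⟶ K),
      IsSES a b := by
  obtain ⟨i, p, hs, he⟩ := extMid_spec e
  have := h.epi
  have := hs.epi
  have hc : IsSES (kernel.ι (p ≫ g)) (p ≫ g) :=
    isSES_of_lift inferInstance inferInstance (kernel.condition _)
      fun t ht => ⟨kernel.lift _ t ht, by simp⟩
  obtain ⟨f', g', hs', h1, h2⟩ := exists_left h hs hc
  let φ : ShortComplex.mk f' g' hs'.1 ⟶ ShortComplex.mk i p hs.1 :=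
    { τ₁ := 𝟙 _, τ₂ := kernel.ι (p ≫ g), τ₃ := f
      comm₁₂ := by dsimp; rw [h1, Category.id_comp]
      comm₂₃ := h2.symm }
  have hn := ShortComplex.ShortExact.extClass_naturality hs'.2 hs.2 φ
  dsimp only [φ] at hn
  rw [Ext.comp_mk₀_id, he] at hn
  obtain ⟨ν⟩ := extMid_iso hs' hn
  exact ⟨_, _, hc.congr_outer ν (Iso.refl _)⟩

lemma autNum_isoCls {C : Type u} [Category.{v} C] (X : C) : autNum (isoCls X) = Nat.card (Aut X) := by
  rw [autNum, card_aut_congr (rep_isoCls X).some]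

variable [HallFinite C]

lemma hallNum_isoCls (L M X : C) : hallNum (isoCls L) (isoCls M) (isoCls X) =
    (Nat.card (SESPairs L M X) : ℂ) / Nat.card (Aut X) := by
  rw [hallNum_eq, autNum_isoCls, card_SESPairs_congr (rep_isoCls L).some (rep_isoCls M).some
    (rep_isoCls X).some]

instance finite_ext_zero_of_hallFinite (X Y : C) : Finite (Ext X Y 0) :=
  Finite.of_surjective _ (Ext.mk₀_bijective X Y).2

lemma card_hom_ne_zero' (X Y : C) : (Nat.card (X ⟶ Y) : ℂ) ≠ 0 := by
  have : Nonempty (X ⟶ Y) := ⟨0⟩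
  exact_mod_cast (Nat.card_pos (α := X ⟶ Y)).ne'

lemma hallNum_isoCls_eq_ext (L M X : C) : hallNum (isoCls L) (isoCls M) (isoCls X) =
    (Nat.card (extWithMiddle L M X) : ℂ) / Nat.card (L ⟶ M) := by
  have h := card_SESPairs L M X
  have h2 : (Nat.card (Aut X) : ℂ) ≠ 0 := by rw [← autNum_isoCls]; exact autNum_ne_zero _
  rw [hallNum_isoCls, div_eq_div_iff h2 (card_hom_ne_zero' _ _)]
  exact_mod_cast h

/-- There are finitely many possible middle terms, and for each of them a class comes from a pair of
morphisms in finite sets. This supplies the finiteness for complexes, where it is not an assumption.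
-/
instance finite_ext_one_of_hallFinite (L M : C) : Finite (Ext L M 1) := by
  have h1 := HallFinite.finite_middle L M
  have h2 : ∀ x : IsoClass C, (extWithMiddle L M x.rep).Finite := fun x => by
    refine (Set.finite_range fun p : SESPairs L M x.rep => p.2.2.extClass).subset ?_
    rintro e ⟨f, g, w, h, rfl⟩
    exact ⟨⟨(f, g), w, h⟩, rfl⟩
  refine Set.finite_univ_iff.1 ((h1.biUnion fun x _ => h2 x).subset fun e _ => ?_)
  obtain ⟨f, g, hs, he⟩ := extMid_spec e
  obtain ⟨ν⟩ := rep_isoCls (extMid e)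
  refine Set.mem_biUnion (x := isoCls (extMid e)) ?_ ?_
  · exact ⟨_, _, hs.comp_iso ν.symm⟩
  · rw [extWithMiddle_eq, isoCls_rep]
    rfl

lemma card_ext_one_ne_zero (X Y : C) : (Nat.card (Ext X Y 1) : ℂ) ≠ 0 := by
  exact_mod_cast (Nat.card_pos (α := Ext X Y 1)).ne'

lemma hallCls_eq_ofCoords (X : C) :
    hallCls X = (hallConst C).ofCoords (Finsupp.single (isoCls X) 1) := by
  rw [AlgConst.ofCoords_single, one_smul]
  rfl

lemma hallCls_congr {X Y : C} (e : X ≅ Y) : hallCls X = hallCls Y :=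
  congrArg (hallConst C).basis (isoCls_eq_iff.2 ⟨e⟩)

/-- The Hall product as a sum over the extension classes. -/
lemma hallCls_mul (L M : C) [Fintype (Ext L M 1)] : hallCls L * hallCls M =
    ((Nat.card (L ⟶ M) : ℂ)⁻¹) • ∑ e : Ext L M 1, hallCls (extMid e) := by
  classical
  rw [hallCls, hallCls, AlgConst.basis_mul_basis]
  simp_rw [hallCls_eq_ofCoords, ← map_sum, ← map_smul]
  congr 1
  ext x
  change hallNum (isoCls L) (isoCls M) x = _
  rw [← isoCls_rep x, hallNum_isoCls_eq_ext, Finsupp.smul_apply, Finsupp.finsetSum_apply]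
  simp_rw [Finsupp.single_apply]
  rw [Finset.sum_boole, smul_eq_mul, div_eq_mul_inv, mul_comm, extWithMiddle_eq,
    ← Fintype.card_subtype, ← Nat.card_eq_fintype_card]
  rfl

/-- The category of complexes need not be hereditary, so the six term count is needed with only the
one relevant Ext² group assumed to vanish. -/
lemma card_covariant_of_subsingleton {M X L : C} {f : M ⟶ X} {g : X ⟶ L} (h : IsSES f g) (Y : C)
    [Subsingleton (Ext Y M 2)] :
    Nat.card (Y ⟶ X) * (Nat.card (Ext Y M 1) * Nat.card (Ext Y L 1)) =
      Nat.card (Y ⟶ M) * Nat.card (Y ⟶ L) * Nat.card (Ext Y X 1) := by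
  obtain ⟨w, h⟩ := h
  have := h.mono_f
  simp_rw [card_hom_eq_card_ext_zero]
  refine card_six ((Ext.mk₀ f).postcomp Y (add_zero 0)) ((Ext.mk₀ g).postcomp Y (add_zero 0))
    (h.extClass.postcomp Y (zero_add 1)) ((Ext.mk₀ f).postcomp Y (add_zero 1))
    ((Ext.mk₀ g).postcomp Y (add_zero 1)) (Ext.postcomp_mk₀_injective_of_mono Y f)
    (ker_eq_range _ _ (fun x => ?_) (Ext.covariant_sequence_exact₂ Y h))
    (ker_eq_range _ _ (fun x => ?_) fun x hx => Ext.covariant_sequence_exact₃ Y h x (zero_add 1) hx)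
    (ker_eq_range _ _ (fun x => ?_) fun x hx => Ext.covariant_sequence_exact₁ Y h x hx (zero_add 1))
    (ker_eq_range _ _ (fun x => ?_) (Ext.covariant_sequence_exact₂ Y h))
    fun x => Ext.covariant_sequence_exact₃ Y h x (by norm_num : 1 + 1 = 2)
      (Subsingleton.elim _ _)
  · simp [w]
  · simp [h.comp_extClass]
  · simp [h.extClass_comp]
  · simp [w]

lemma card_contravariant_of_subsingleton {M X L : C} {f : M ⟶ X} {g : X ⟶ L} (h : IsSES f g)
    (Y : C) [Subsingleton (Ext L Y 2)] :
    Nat.card (X ⟶ Y) * (Nat.card (Ext L Y 1) * Nat.card (Ext M Y 1)) =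
      Nat.card (L ⟶ Y) * Nat.card (M ⟶ Y) * Nat.card (Ext X Y 1) := by
  obtain ⟨w, h⟩ := h
  have := h.epi_g
  simp_rw [card_hom_eq_card_ext_zero]
  refine card_six ((Ext.mk₀ g).precomp Y (zero_add 0)) ((Ext.mk₀ f).precomp Y (zero_add 0))
    (h.extClass.precomp Y (add_zero 1)) ((Ext.mk₀ g).precomp Y (zero_add 1))
    ((Ext.mk₀ f).precomp Y (zero_add 1)) (Ext.precomp_mk₀_injective_of_epi Y g)
    (ker_eq_range _ _ (fun x => ?_) (Ext.contravariant_sequence_exact₂ h Y))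
    (ker_eq_range _ _ (fun x => ?_) fun x => Ext.contravariant_sequence_exact₁ h Y x (add_zero 1))
    (ker_eq_range _ _ (fun x => ?_) fun x hx => Ext.contravariant_sequence_exact₃ h Y x hx (add_zero 1))
    (ker_eq_range _ _ (fun x => ?_) (Ext.contravariant_sequence_exact₂ h Y))
    fun x => Ext.contravariant_sequence_exact₁ h Y x (by norm_num : 1 + 1 = 2)
      (Subsingleton.elim _ _)
  · simp [w]
  · exact h.extClass_comp_assoc x (h := add_zero 1)
  · exact h.comp_extClass_assoc x (add_zero 1)
  · simp [w]

/-- All fibres of a surjective homomorphism are translates of its kernel, so each value of F is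
taken equally often. -/
lemma sum_comp_addMonoidHom {G H V : Type*} [AddCommGroup G] [AddCommGroup H] [Fintype G]
    [Fintype H] [AddCommGroup V] [Module ℂ V] (p : G →+ H) (hp : Function.Surjective p) (F : H → V) :
    ∑ g, F (p g) = ((Nat.card G : ℂ) / Nat.card H) • ∑ h, F h := by
  classical
  have hk : ∀ h : H, (Finset.univ.filter fun g => p g = h).card = Nat.card p.ker := fun h => by
    obtain ⟨g, rfl⟩ := hp h
    rw [← Fintype.card_subtype, ← Nat.card_eq_fintype_card]
    exact Nat.card_congr
      { toFun := fun x => ⟨x.1 - g, by rw [AddMonoidHom.mem_ker, map_sub, x.2, sub_self]⟩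
        invFun := fun x => ⟨x.1 + g, by rw [map_add, x.2, zero_add]⟩
        left_inv := fun x => Subtype.ext (by simp)
        right_inv := fun x => Subtype.ext (by simp) }
  have hc : (Nat.card G : ℂ) = Nat.card p.ker * Nat.card H := by
    rw [card_ker_range p, AddMonoidHom.range_eq_top.2 hp, Nat.cast_mul]
    congr 2
    exact Nat.card_congr AddSubgroup.topEquiv.toEquiv
  have hH : (Nat.card H : ℂ) ≠ 0 := by exact_mod_cast (Nat.card_pos (α := H)).ne'
  rw [hc, mul_div_cancel_right₀ _ hH, ← Finset.sum_fiberwise Finset.univ p, Finset.smul_sum]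
  refine Finset.sum_congr rfl fun h _ => ?_
  rw [Finset.sum_congr rfl (g := fun _ => F h) fun g hg => by rw [(Finset.mem_filter.1 hg).2],
    Finset.sum_const, hk, ← Nat.cast_smul_eq_nsmul ℂ]

variable {V : Type*} [AddCommGroup V] [Module ℂ V]

/-- Hall multiplication from the left, for a subobject which contributes as a direct summand. -/
lemma map_hallCls_mul_of_isSES {K L M N : C} {f : K ⟶ L} {g : L ⟶ M} (h : IsSES f g)
    [Subsingleton (Ext N K 2)] (φ ψ : HallAlg C →ₗ[ℂ] V)
    (hφ : ∀ {X Y : C} (f : K ⟶ X) (g : X ⟶ Y), IsSES f g → φ (hallCls X) = ψ (hallCls Y)) :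
    φ (hallCls N * hallCls L) =
      ((Nat.card (Ext N K 1) : ℂ) / Nat.card (N ⟶ K)) • ψ (hallCls N * hallCls M) := by
  have := Fintype.ofFinite (Ext N L 1)
  have := Fintype.ofFinite (Ext N M 1)
  have key : ∀ e : Ext N L 1, φ (hallCls (extMid e)) =
      ψ (hallCls (extMid ((Ext.mk₀ g).postcomp N (add_zero 1) e))) := fun e => by
    obtain ⟨a, b, hs⟩ := isSES_extMid_comp h e
    exact hφ a b hs
  -- Vanishing of Ext²(N, K) makes the pushforward surjective. Its fibres then have equal size,
  -- which the six term count turns into the stated factor.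
  have hsurj : Function.Surjective ((Ext.mk₀ g).postcomp N (add_zero 1)) := fun x =>
    Ext.covariant_sequence_exact₃ N h.2 x (by norm_num : 1 + 1 = 2) (Subsingleton.elim _ _)
  have hcard : (Nat.card (N ⟶ L) : ℂ) * (Nat.card (Ext N K 1) * Nat.card (Ext N M 1)) =
      Nat.card (N ⟶ K) * Nat.card (N ⟶ M) * Nat.card (Ext N L 1) := by
    exact_mod_cast card_covariant_of_subsingleton h N
  rw [hallCls_mul, hallCls_mul, map_smul, map_smul, map_sum, map_sum]
  simp_rw [key]
  rw [sum_comp_addMonoidHom _ hsurj fun e => ψ (hallCls (extMid e)), smul_smul, smul_smul]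
  congr 1
  have h1 := card_hom_ne_zero' N L
  have h2 := card_hom_ne_zero' N K
  have h3 := card_hom_ne_zero' N M
  have h4 := card_ext_one_ne_zero N M
  field_simp
  linear_combination -hcard

/-- Hall multiplication from the right, for a quotient which contributes as a direct summand. -/
lemma map_mul_hallCls_of_isSES {K L M N : C} {f : M ⟶ L} {g : L ⟶ K} (h : IsSES f g)
    [Subsingleton (Ext K N 2)] (φ ψ : HallAlg C →ₗ[ℂ] V)
    (hφ : ∀ {X Y : C} (f : Y ⟶ X) (g : X ⟶ K), IsSES f g → φ (hallCls X) = ψ (hallCls Y)) :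
    φ (hallCls L * hallCls N) =
      ((Nat.card (Ext K N 1) : ℂ) / Nat.card (K ⟶ N)) • ψ (hallCls M * hallCls N) := by
  have := Fintype.ofFinite (Ext L N 1)
  have := Fintype.ofFinite (Ext M N 1)
  have key : ∀ e : Ext L N 1, φ (hallCls (extMid e)) =
      ψ (hallCls (extMid ((Ext.mk₀ f).precomp N (zero_add 1) e))) := fun e => by
    obtain ⟨a, b, hs⟩ := isSES_extMid_precomp h e
    exact hφ a b hs
  have hsurj : Function.Surjective ((Ext.mk₀ f).precomp N (zero_add 1)) := fun x =>
    Ext.contravariant_sequence_exact₁ h.2 N x (by norm_num : 1 + 1 = 2) (Subsingleton.elim _ _)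
  have hcard : (Nat.card (L ⟶ N) : ℂ) * (Nat.card (Ext K N 1) * Nat.card (Ext M N 1)) =
      Nat.card (K ⟶ N) * Nat.card (M ⟶ N) * Nat.card (Ext L N 1) := by
    exact_mod_cast card_contravariant_of_subsingleton h N
  rw [hallCls_mul, hallCls_mul, map_smul, map_smul, map_sum, map_sum]
  simp_rw [key]
  rw [sum_comp_addMonoidHom _ hsurj fun e => ψ (hallCls (extMid e)), smul_smul, smul_smul]
  congr 1
  have h1 := card_hom_ne_zero' L N
  have h2 := card_hom_ne_zero' K N
  have h3 := card_hom_ne_zero' M N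
  have h4 := card_ext_one_ne_zero M N
  field_simp
  linear_combination -hcard

end MiddleTerms

/-! ### Two-periodic complexes and contractible complexes -/

section TwoPeriodicComplexes

lemma zmod_two_ne_add_one (i : ZMod 2) : i ≠ i + 1 := by decide +revert

lemma zmod_two_eq_or (i k : ZMod 2) : k = i ∨ k = i + 1 := by decide +revert

lemma zmod_two_add_one_add_one (i : ZMod 2) : i + 1 + 1 = i := by decide +revert

lemma rel_add_one (i : ZMod 2) : (ComplexShape.up (ZMod 2)).Rel i (i + 1) := rfl

lemma rel_add_one' (i : ZMod 2) : (ComplexShape.up (ZMod 2)).Rel (i + 1) i :=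
  zmod_two_add_one_add_one i

variable {A : Type u} [Category.{v} A] [Abelian A]

lemma cpx_hom_ext {M N : Cpx A} (i : ZMod 2) {f g : M ⟶ N} (h₀ : f.f i = g.f i)
    (h₁ : f.f (i + 1) = g.f (i + 1)) : f = g := by
  ext k
  obtain rfl | rfl := zmod_two_eq_or i k <;> assumption

/-- A morphism of `ℤ/2`-graded complexes from its two components. -/
noncomputable def cpxHomMk {M N : Cpx A} (i : ZMod 2) (f₀ : M.X i ⟶ N.X i)
    (f₁ : M.X (i + 1) ⟶ N.X (i + 1)) (h₀ : f₀ ≫ N.d i (i + 1) = M.d i (i + 1) ≫ f₁)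
    (h₁ : f₁ ≫ N.d (i + 1) i = M.d (i + 1) i ≫ f₀) : M ⟶ N where
  f k := if h : k = i then eqToHom (by rw [h]) ≫ f₀ ≫ eqToHom (by rw [h]) else
    eqToHom (by rw [(zmod_two_eq_or i k).resolve_left h]) ≫ f₁ ≫
      eqToHom (by rw [(zmod_two_eq_or i k).resolve_left h])
  comm' k l hkl := by
    have hl : k + 1 = l := hkl
    subst hl
    obtain rfl | rfl := zmod_two_eq_or i k
    · rw [dif_pos rfl, dif_neg (zmod_two_ne_add_one k).symm]
      simpa using h₀
    · rw [dif_neg (zmod_two_ne_add_one i).symm]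
      -- For a variable i the degrees i + 1 + 1 and i agree only propositionally, so the target
      -- degree is generalized before it is substituted.
      have : ∀ (l : ZMod 2) (hl : l = i), eqToHom rfl ≫ f₁ ≫ eqToHom rfl ≫ N.d (i + 1) l =
          M.d (i + 1) l ≫ if h : l = i then eqToHom (by rw [h]) ≫ f₀ ≫ eqToHom (by rw [h]) else
            eqToHom (by rw [(zmod_two_eq_or i l).resolve_left h]) ≫ f₁ ≫
              eqToHom (by rw [(zmod_two_eq_or i l).resolve_left h]) := by
        rintro l rfl
        rw [dif_pos rfl]
        simpa using h₁
      simpa using this _ (zmod_two_add_one_add_one i)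

section

variable {M N : Cpx A} (i : ZMod 2) (f₀ : M.X i ⟶ N.X i)
    (f₁ : M.X (i + 1) ⟶ N.X (i + 1)) (h₀ : f₀ ≫ N.d i (i + 1) = M.d i (i + 1) ≫ f₁)
    (h₁ : f₁ ≫ N.d (i + 1) i = M.d (i + 1) i ≫ f₀)

@[simp]
lemma cpxHomMk_f₀ : (cpxHomMk i f₀ f₁ h₀ h₁).f i = f₀ := by simp [cpxHomMk]

@[simp]
lemma cpxHomMk_f₁ : (cpxHomMk i f₀ f₁ h₀ h₁).f (i + 1) = f₁ := by
  dsimp only [cpxHomMk]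
  rw [dif_neg (zmod_two_ne_add_one i).symm]
  simp

end

lemma isSES_of_eval {M X L : Cpx A} {f : M ⟶ X} {g : X ⟶ L} (i : ZMod 2)
    (h₀ : IsSES (f.f i) (g.f i)) (h₁ : IsSES (f.f (i + 1)) (g.f (i + 1))) : IsSES f g := by
  have w : f ≫ g = 0 := cpx_hom_ext i (by simpa using h₀.zero) (by simpa using h₁.zero)
  refine ⟨w, (HomologicalComplex.shortExact_iff_degreewise_shortExact _).2 fun k => ?_⟩
  obtain rfl | rfl := zmod_two_eq_or i k
  · exact h₀.2
  · exact h₁.2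

/-- The `ℤ/2`-graded complex with given components and differentials. -/
def cpxMk {X₀ X₁ : A} (d₀ : X₀ ⟶ X₁) (d₁ : X₁ ⟶ X₀) (h₀ : d₀ ≫ d₁ = 0) (h₁ : d₁ ≫ d₀ = 0) :
    Cpx A where
  -- Matching on the numerals 0 and 1 makes the components and differentials reduce definitionally,
  -- which later definitional unfoldings of complexes rely on.
  X i := match (i : Fin 2) with
    | 0 => X₀
    | 1 => X₁
  d i j := match (i : Fin 2), (j : Fin 2) with
    | 0, 0 => 0
    | 0, 1 => d₀
    | 1, 0 => d₁
    | 1, 1 => 0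
  shape i j h := by
    match (i : Fin 2), (j : Fin 2), h with
    | 0, 0, _ => rfl
    | 0, 1, h => exact (h rfl).elim
    | 1, 0, h => exact (h rfl).elim
    | 1, 1, _ => rfl
  d_comp_d' i j k _ _ := by
    match (i : Fin 2), (j : Fin 2), (k : Fin 2) with
    | 0, 0, _ => exact zero_comp
    | 1, 1, _ => exact zero_comp
    | 1, 0, 0 => exact comp_zero
    | 0, 1, 1 => exact comp_zero
    | 0, 1, 0 => exact h₀
    | 1, 0, 1 => exact h₁

/-- The contractible complex with `X` in degrees `i` and `i + 1`. -/
noncomputable def cpxD (i : ZMod 2) (X : A) : Cpx A :=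
  HomologicalComplex.double (𝟙 X) (rel_add_one i)

/-- The component of `cpxD i X` in degree `i`. -/
noncomputable def cpxDIso₀ (i : ZMod 2) (X : A) : (cpxD i X).X i ≅ X :=
  HomologicalComplex.doubleXIso₀ _ _

/-- The component of `cpxD i X` in degree `i + 1`. -/
noncomputable def cpxDIso₁ (i : ZMod 2) (X : A) : (cpxD i X).X (i + 1) ≅ X :=
  HomologicalComplex.doubleXIso₁ _ _ (zmod_two_ne_add_one i)

lemma cpxD_d₀ (i : ZMod 2) (X : A) :
    (cpxD i X).d i (i + 1) = (cpxDIso₀ i X).hom ≫ (cpxDIso₁ i X).inv := by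
  refine (HomologicalComplex.double_d _ _ (zmod_two_ne_add_one i)).trans ?_
  rw [Category.id_comp]
  rfl

lemma cpxD_d₁ (i : ZMod 2) (X : A) : (cpxD i X).d (i + 1) i = 0 :=
  HomologicalComplex.double_d_eq_zero₀ _ _ _ _ (zmod_two_ne_add_one i).symm

/-- The morphism `cpxD i X ⟶ cpxD i Y` induced by a morphism `X ⟶ Y`. -/
noncomputable def cpxDMap (i : ZMod 2) {X Y : A} (φ : X ⟶ Y) : cpxD i X ⟶ cpxD i Y :=
  cpxHomMk i ((cpxDIso₀ i X).hom ≫ φ ≫ (cpxDIso₀ i Y).inv)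
    ((cpxDIso₁ i X).hom ≫ φ ≫ (cpxDIso₁ i Y).inv) (by simp [cpxD_d₀]) (by simp [cpxD_d₁])

lemma cpxDMap_f₀ (i : ZMod 2) {X Y : A} (φ : X ⟶ Y) : (cpxDMap i φ).f i =
    (cpxDIso₀ i X).hom ≫ φ ≫ (cpxDIso₀ i Y).inv := cpxHomMk_f₀ ..

lemma cpxDMap_f₁ (i : ZMod 2) {X Y : A} (φ : X ⟶ Y) : (cpxDMap i φ).f (i + 1) =
    (cpxDIso₁ i X).hom ≫ φ ≫ (cpxDIso₁ i Y).inv := cpxHomMk_f₁ ..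

/-- The functor `X ↦ cpxD i X`. -/
noncomputable def cpxDFunctor (i : ZMod 2) : A ⥤ Cpx A where
  obj X := cpxD i X
  map φ := cpxDMap i φ
  map_id X := cpx_hom_ext i (by simp [cpxDMap_f₀]) (by simp [cpxDMap_f₁])
  map_comp φ ψ := cpx_hom_ext i (by simp [cpxDMap_f₀]) (by simp [cpxDMap_f₁])

lemma cpxD_d₀_hom (i : ZMod 2) (X : A) :
    (cpxD i X).d i (i + 1) ≫ (cpxDIso₁ i X).hom = (cpxDIso₀ i X).hom := by
  rw [cpxD_d₀]; simp

lemma cpxD_inv_d₀_assoc (i : ZMod 2) (X : A) {Z : A} (h : (cpxD i X).X (i + 1) ⟶ Z) :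
    (cpxDIso₀ i X).inv ≫ (cpxD i X).d i (i + 1) ≫ h = (cpxDIso₁ i X).inv ≫ h := by
  rw [cpxD_d₀]; simp

/-- The morphism from `cpxD i X` determined by its component of degree `i`. -/
noncomputable def fromCpxD (i : ZMod 2) {X : A} {N : Cpx A} (φ : X ⟶ N.X i) : cpxD i X ⟶ N :=
  cpxHomMk i ((cpxDIso₀ i X).hom ≫ φ) ((cpxDIso₁ i X).hom ≫ φ ≫ N.d i (i + 1))
    (by simp [cpxD_d₀]) (by simp [cpxD_d₁])

lemma fromCpxD_f₀ (i : ZMod 2) {X : A} {N : Cpx A} (φ : X ⟶ N.X i) :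
    (fromCpxD i φ).f i = (cpxDIso₀ i X).hom ≫ φ := cpxHomMk_f₀ ..

lemma fromCpxD_f₁ (i : ZMod 2) {X : A} {N : Cpx A} (φ : X ⟶ N.X i) :
    (fromCpxD i φ).f (i + 1) = (cpxDIso₁ i X).hom ≫ φ ≫ N.d i (i + 1) := cpxHomMk_f₁ ..

lemma fromCpxD_inv (i : ZMod 2) {X : A} {N : Cpx A} (g : cpxD i X ⟶ N) :
    fromCpxD i ((cpxDIso₀ i X).inv ≫ g.f i) = g := by
  refine cpx_hom_ext i ?_ ?_
  · rw [fromCpxD_f₀, Iso.hom_inv_id_assoc]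
  · rw [fromCpxD_f₁, Category.assoc, g.comm, cpxD_inv_d₀_assoc, Iso.hom_inv_id_assoc]

/-- The morphism to `cpxD i X` determined by its component of degree `i + 1`. -/
noncomputable def toCpxD (i : ZMod 2) {X : A} {N : Cpx A} (φ : N.X (i + 1) ⟶ X) : N ⟶ cpxD i X :=
  cpxHomMk i (N.d i (i + 1) ≫ φ ≫ (cpxDIso₀ i X).inv) (φ ≫ (cpxDIso₁ i X).inv)
    (by simp [cpxD_d₀]) (by simp [cpxD_d₁])

lemma toCpxD_f₀ (i : ZMod 2) {X : A} {N : Cpx A} (φ : N.X (i + 1) ⟶ X) :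
    (toCpxD i φ).f i = N.d i (i + 1) ≫ φ ≫ (cpxDIso₀ i X).inv := cpxHomMk_f₀ ..

lemma toCpxD_f₁ (i : ZMod 2) {X : A} {N : Cpx A} (φ : N.X (i + 1) ⟶ X) :
    (toCpxD i φ).f (i + 1) = φ ≫ (cpxDIso₁ i X).inv := cpxHomMk_f₁ ..

lemma toCpxD_inv (i : ZMod 2) {X : A} {N : Cpx A} (g : N ⟶ cpxD i X) :
    toCpxD i (g.f (i + 1) ≫ (cpxDIso₁ i X).hom) = g := by
  refine cpx_hom_ext i ?_ ?_
  · rw [toCpxD_f₀, ← Category.assoc, ← Category.assoc, ← g.comm, Category.assoc (g.f i),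
      cpxD_d₀_hom, Category.assoc, Iso.hom_inv_id, Category.comp_id]
  · rw [toCpxD_f₁, Category.assoc, Iso.hom_inv_id, Category.comp_id]

/-- Morphisms from `cpxD i X`. -/
noncomputable def cpxDHomEquiv (i : ZMod 2) (X : A) (N : Cpx A) : (cpxD i X ⟶ N) ≃ (X ⟶ N.X i) where
  toFun g := (cpxDIso₀ i X).inv ≫ g.f i
  invFun φ := fromCpxD i φ
  left_inv := fromCpxD_inv i
  right_inv φ := by
    beta_reduce
    rw [fromCpxD_f₀, Iso.inv_hom_id_assoc]

/-- Morphisms to `cpxD i X`. -/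
noncomputable def homCpxDEquiv (i : ZMod 2) (N : Cpx A) (X : A) :
    (N.X (i + 1) ⟶ X) ≃ (N ⟶ cpxD i X) where
  toFun φ := toCpxD i φ
  invFun g := g.f (i + 1) ≫ (cpxDIso₁ i X).hom
  left_inv φ := by
    beta_reduce
    rw [toCpxD_f₁, Category.assoc, Iso.inv_hom_id, Category.comp_id]
  right_inv := toCpxD_inv i

lemma fromCpxD_comp (i : ZMod 2) {X Y : A} {N : Cpx A} (φ : X ⟶ Y) (ψ : Y ⟶ N.X i) :
    fromCpxD i (φ ≫ ψ) = cpxDMap i φ ≫ fromCpxD i ψ := by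
  rw [← fromCpxD_inv i (cpxDMap i φ ≫ fromCpxD i ψ), HomologicalComplex.comp_f, cpxDMap_f₀,
    fromCpxD_f₀]
  simp

lemma toCpxD_comp (i : ZMod 2) {X Y : A} {N : Cpx A} (φ : N.X (i + 1) ⟶ X) (ψ : X ⟶ Y) :
    toCpxD i (φ ≫ ψ) = toCpxD i φ ≫ cpxDMap i ψ := by
  rw [← toCpxD_inv i (toCpxD i φ ≫ cpxDMap i ψ), HomologicalComplex.comp_f, cpxDMap_f₁,
    toCpxD_f₁]
  simp

lemma cpxDMap_add (i : ZMod 2) {X Y : A} (φ ψ : X ⟶ Y) :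
    cpxDMap i (φ + ψ) = cpxDMap i φ + cpxDMap i ψ :=
  cpx_hom_ext i (by simp [cpxDMap_f₀]) (by simp [cpxDMap_f₁])

/-- `cpxD i` is left adjoint to the evaluation in degree `i`. -/
noncomputable def cpxDAdj (i : ZMod 2) :
    cpxDFunctor (A := A) i ⊣ HomologicalComplex.eval A (ComplexShape.up (ZMod 2)) i :=
  Adjunction.mkOfHomEquiv
    { homEquiv := fun X N => cpxDHomEquiv i X N
      homEquiv_naturality_left_symm := fun f g => fromCpxD_comp i f g
      homEquiv_naturality_right := fun _ _ => (Category.assoc _ _ _).symm }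

/-- `cpxD i` is right adjoint to the evaluation in degree `i + 1`. -/
noncomputable def evalCpxDAdj (i : ZMod 2) :
    HomologicalComplex.eval A (ComplexShape.up (ZMod 2)) (i + 1) ⊣ cpxDFunctor (A := A) i :=
  Adjunction.mkOfHomEquiv
    { homEquiv := fun N X => homCpxDEquiv i N X
      homEquiv_naturality_left_symm := fun _ _ => Category.assoc _ _ _
      homEquiv_naturality_right := fun f g => toCpxD_comp i f g }

instance (i : ZMod 2) : (cpxDFunctor (A := A) i).Additive where
  map_add := cpxDMap_add i _ _

/-- The functor is right adjoint to evaluation in degree i + 1 and left adjoint to evaluation in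
degree i, hence exact. This is what `extAdjEquiv` requires. -/
instance (i : ZMod 2) : PreservesFiniteLimits (cpxDFunctor (A := A) i) :=
  have := (evalCpxDAdj (A := A) i).rightAdjoint_preservesLimits
  inferInstance

instance (i : ZMod 2) : PreservesFiniteColimits (cpxDFunctor (A := A) i) :=
  have := (cpxDAdj (A := A) i).leftAdjoint_preservesColimits
  inferInstance

/-- Extensions of `cpxD i X` by a complex. -/
noncomputable def extCpxDEquiv (i : ZMod 2) (X : A) (N : Cpx A) (n : ℕ) :
    Ext (cpxD i X) N n ≃ Ext X (N.X i) n :=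
  extAdjEquiv (cpxDAdj i) X N n

/-- Extensions of a complex by `cpxD i X`. -/
noncomputable def extToCpxDEquiv (i : ZMod 2) (N : Cpx A) (X : A) (n : ℕ) :
    Ext N (cpxD i X) n ≃ Ext (N.X (i + 1)) X n :=
  (extAdjEquiv (evalCpxDAdj i) N X n).symm

lemma exactAt_iff_exact (M : Cpx A) (k : ZMod 2) : M.ExactAt k ↔
    (ShortComplex.mk (M.d (k + 1) k) (M.d k (k + 1)) (M.d_comp_d _ _ _)).Exact :=
  HomologicalComplex.exactAt_iff' _ (k + 1) k (k + 1)
    ((ComplexShape.up (ZMod 2)).prev_eq' (rel_add_one' k))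
    ((ComplexShape.up (ZMod 2)).next_eq' (rel_add_one k))

lemma cpxD_acyclic (i : ZMod 2) (X : A) : (cpxD i X).Acyclic := by
  have h1 : IsIso ((cpxD i X).d i (i + 1)) := by rw [cpxD_d₀]; infer_instance
  intro k
  obtain rfl | rfl := zmod_two_eq_or i k
  · rw [exactAt_iff_exact, ShortComplex.exact_iff_mono _ (cpxD_d₁ k X)]
    exact inferInstanceAs (Mono ((cpxD k X).d k (k + 1)))
  · rw [exactAt_iff_exact]
    have : ∀ l (hl : l = i), (ShortComplex.mk ((cpxD i X).d l (i + 1)) ((cpxD i X).d (i + 1) l)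
        (HomologicalComplex.d_comp_d _ _ _ _)).Exact := by
      rintro l rfl
      rw [ShortComplex.exact_iff_epi _ (cpxD_d₁ l X)]
      exact inferInstanceAs (Epi ((cpxD l X).d l (l + 1)))
    exact this _ (zmod_two_add_one_add_one i)

end TwoPeriodicComplexes

/-! ### Lifting and extending extensions over a hereditary category -/

section HereditaryLifting

variable {A : Type u} [Category.{v} A] [Abelian A]

lemma isSES_cpxDMap (i : ZMod 2) {K L M : A} {f : K ⟶ L} {g : L ⟶ M} (h : IsSES f g) :
    IsSES (cpxDMap i f) (cpxDMap i g) :=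
  ⟨_, h.2.map_of_exact (cpxDFunctor i)⟩

lemma card_hom_cpxD (i : ZMod 2) (X : A) (N : Cpx A) :
    Nat.card (cpxD i X ⟶ N) = Nat.card (X ⟶ N.X i) := Nat.card_congr (cpxDHomEquiv i X N)

lemma card_ext_cpxD (i : ZMod 2) (X : A) (N : Cpx A) :
    Nat.card (Ext (cpxD i X) N 1) = Nat.card (Ext X (N.X i) 1) :=
  Nat.card_congr (extCpxDEquiv i X N 1)

lemma card_hom_to_cpxD (i : ZMod 2) (N : Cpx A) (X : A) :
    Nat.card (N ⟶ cpxD i X) = Nat.card (N.X (i + 1) ⟶ X) :=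
  (Nat.card_congr (homCpxDEquiv i N X)).symm

lemma card_ext_to_cpxD (i : ZMod 2) (N : Cpx A) (X : A) :
    Nat.card (Ext N (cpxD i X) 1) = Nat.card (Ext (N.X (i + 1)) X 1) :=
  Nat.card_congr (extToCpxDEquiv i N X 1)

variable [HereditaryFinite A]

/-- In a hereditary category extensions lift along epimorphisms. -/
lemma exists_lift_isSES {R Y Z X W : A} {r : R ⟶ Y} {s : Y ⟶ Z} (hs : IsSES r s) {i : Z ⟶ X}
    {p : X ⟶ W} (hi : IsSES i p) : ∃ (E : A) (a : Y ⟶ E) (b : E ⟶ W) (e : E ⟶ X),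
      IsSES a b ∧ IsSES (r ≫ a) e ∧ a ≫ e = s ≫ i ∧ e ≫ p = b := by
  -- Since Ext²(W, R) = 0, the class of the given extension of W by Z is the image of some x in
  -- Ext¹(W, Y); E is the middle term of x.
  obtain ⟨x, hx⟩ := Ext.covariant_sequence_exact₃ W hs.2 hi.2.extClass (by norm_num : 1 + 1 = 2)
    (Subsingleton.elim _ _)
  obtain ⟨a, b, hab, hc⟩ := extMid_spec x
  have := hs.mono
  have := hab.mono
  have hc' : IsSES (r ≫ a) (cokernel.π (r ≫ a)) :=
    isSES_of_desc inferInstance inferInstance (cokernel.condition _)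
      fun t ht => ⟨cokernel.desc _ t ht, by simp⟩
  obtain ⟨f', g', hs', h1, h2⟩ := exists_right hs hab hc'
  let φ : ShortComplex.mk a b hab.1 ⟶ ShortComplex.mk f' g' hs'.1 :=
    { τ₁ := s, τ₂ := cokernel.π (r ≫ a), τ₃ := 𝟙 _
      comm₁₂ := h2
      comm₂₃ := by dsimp; rw [h1, Category.comp_id] }
  have hn := ShortComplex.ShortExact.extClass_naturality hab.2 hs'.2 φ
  dsimp only [φ] at hn
  rw [Ext.mk₀_id_comp, hc] at hn
  obtain ⟨ν, hν1, hν2⟩ := exists_of_extClass_eq hs' hi (hn.symm.trans hx)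
  refine ⟨_, a, b, cokernel.π (r ≫ a) ≫ ν.hom, hab, ?_, ?_, ?_⟩
  · simpa using hc'.congr_outer (Iso.refl _) ν
  · rw [← Category.assoc, ← h2, Category.assoc, hν1]
  · rw [Category.assoc, hν2, h1]

lemma subsingleton_ext_cpxD (i : ZMod 2) (X : A) (N : Cpx A) (n : ℕ) (hn : 2 ≤ n) :
    Subsingleton (Ext (cpxD i X) N n) :=
  have := HereditaryFinite.hereditary X (N.X i) n hn
  (extCpxDEquiv i X N n).subsingleton

lemma subsingleton_ext_to_cpxD (i : ZMod 2) (N : Cpx A) (X : A) (n : ℕ) (hn : 2 ≤ n) :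
    Subsingleton (Ext N (cpxD i X) n) :=
  have := HereditaryFinite.hereditary (N.X (i + 1)) X n hn
  (extToCpxDEquiv i N X n).subsingleton

/-- Extensions of a contractible subcomplex extend to the whole complex. -/
lemma ext_precomp_surjective_of_mono (i : ZMod 2) {X : A} {L : Cpx A} (t : cpxD i X ⟶ L) [Mono t]
    (N : Cpx A) (e : Ext (cpxD i X) N 1) : ∃ e' : Ext L N 1, (Ext.mk₀ t).comp e' (zero_add 1) = e := by
  let u : X ⟶ L.X (i + 1) := (cpxDIso₁ i X).inv ≫ t.f (i + 1)
  have hu : Mono u := by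
    have : Mono (t.f (i + 1)) :=
      inferInstanceAs (Mono ((HomologicalComplex.eval A _ (i + 1)).map t))
    exact mono_comp _ _
  have hc : IsSES u (cokernel.π u) :=
    isSES_of_desc inferInstance inferInstance (cokernel.condition _)
      fun t ht => ⟨cokernel.desc _ t ht, by simp⟩
  -- The identity of L^(i+1) defines a map from L to a contractible complex which restricts on `cpxD
  -- i X` to a monomorphism with contractible cokernel. A class extends along that monomorphism
  -- because Ext² out of the cokernel vanishes, and it is then pulled back to L.
  have hr : t ≫ toCpxD i (𝟙 (L.X (i + 1))) = cpxDMap i u := by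
    rw [← toCpxD_inv i (t ≫ toCpxD i (𝟙 (L.X (i + 1)))), ← toCpxD_inv i (cpxDMap i u)]
    congr 1
    rw [HomologicalComplex.comp_f, toCpxD_f₁, cpxDMap_f₁]
    simp [u]
  have := subsingleton_ext_cpxD i (cokernel u) N 2 le_rfl
  obtain ⟨x, hx⟩ := Ext.contravariant_sequence_exact₁ (isSES_cpxDMap i hc).2 N e
    (by norm_num : 1 + 1 = 2) (Subsingleton.elim _ _)
  refine ⟨(Ext.mk₀ (toCpxD i (𝟙 (L.X (i + 1))))).comp x (zero_add 1), ?_⟩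
  rw [Ext.mk₀_comp_mk₀_assoc, hr]
  exact hx

end HereditaryLifting

/-! ### Resolutions of acyclic complexes by contractible ones -/

section AcyclicResolution

variable {A : Type u} [Category.{v} A] [Abelian A]

lemma cpxMk_acyclic {X₀ X₁ : A} (d₀ : X₀ ⟶ X₁) (d₁ : X₁ ⟶ X₀) (h₀ : d₀ ≫ d₁ = 0) (h₁ : d₁ ≫ d₀ = 0)
    (e₀ : (ShortComplex.mk d₁ d₀ h₁).Exact) (e₁ : (ShortComplex.mk d₀ d₁ h₀).Exact) :
    (cpxMk d₀ d₁ h₀ h₁).Acyclic := by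
  intro k
  rw [exactAt_iff_exact]
  match (k : Fin 2) with
  | 0 => exact e₀
  | 1 => exact e₁

lemma isSES_congr {M X L : A} {f f' : M ⟶ X} {g g' : X ⟶ L} (hf : f = f') (hg : g = g')
    (h : IsSES f' g') : IsSES f g := by rwa [hf, hg]

lemma isSES_biprod_lift {X Y : A} (f : X ⟶ Y) :
    IsSES (biprod.lift (-𝟙 X) f) (biprod.desc f (𝟙 Y)) := by
  have : Mono (biprod.lift (-𝟙 X) f) := Preadditive.mono_of_cancel_zero _ fun t ht => by
    simpa using congrArg (fun u => u ≫ biprod.fst) ht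
  have : Epi (biprod.desc f (𝟙 Y)) := Preadditive.epi_of_cancel_zero _ fun t ht => by
    simpa using congrArg (fun u => biprod.inr ≫ u) ht
  refine isSES_of_lift inferInstance inferInstance (by simp) fun t ht => ⟨-(t ≫ biprod.fst), ?_⟩
  rw [biprod.desc_eq, Preadditive.comp_add, Category.comp_id, add_eq_zero_iff_neg_eq] at ht
  apply biprod.hom_ext
  · simp
  · simpa using ht

lemma isSES_biprod' (K M : A) : IsSES (biprod.inr : M ⟶ K ⊞ M) biprod.fst := by
  refine isSES_of_lift inferInstance inferInstance (by simp) fun t ht => ⟨t ≫ biprod.snd, ?_⟩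
  apply biprod.hom_ext <;> simp [ht]

lemma isSES_of_exact_kernel {X Y Z : A} (f : X ⟶ Y) (g : Y ⟶ Z) (w : f ≫ g = 0)
    (h : (ShortComplex.mk f g w).Exact) : IsSES (kernel.ι f) (kernel.lift g f w) := by
  have he : Epi (kernel.lift g f w) := h.epi_kernelLift
  refine isSES_of_lift inferInstance he (by rw [← cancel_mono (kernel.ι g)]; simp) fun t ht => ?_
  have ht' : t ≫ f = 0 := by simpa using congrArg (fun u => u ≫ kernel.ι g) ht
  exact ⟨kernel.lift f t ht', kernel.lift_ι ..⟩

/-- An acyclic complex is the quotient of an extension of contractible complexes by a contractible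
complex. -/
lemma acyclic_resolution [HereditaryFinite A] {K : Cpx A} (hK : K.Acyclic) :
    ∃ (L : Cpx A) (X Y Z : A) (f : cpxD 0 X ⟶ L) (g : L ⟶ K) (f' : cpxD 0 Y ⟶ L)
      (g' : L ⟶ cpxD 1 Z), IsSES f g ∧ IsSES f' g' := by
  have e0 := isSES_of_exact_kernel _ _ _ ((exactAt_iff_exact K 1).1 (hK 1))
  have e1 := isSES_of_exact_kernel _ _ _ ((exactAt_iff_exact K 0).1 (hK 0))
  change IsSES (kernel.ι (K.d 0 1)) (kernel.lift (K.d 1 0) (K.d 0 1) (K.d_comp_d 0 1 0)) at e0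
  change IsSES (kernel.ι (K.d 1 0)) (kernel.lift (K.d 0 1) (K.d 1 0) (K.d_comp_d 1 0 1)) at e1
  -- Exactness gives 0 → ker d⁰ → K⁰ → ker d¹ → 0 and 0 → ker d¹ → K¹ → ker d⁰ → 0. Heredity lifts
  -- the second sequence along K⁰ → ker d¹ to an extension E of ker d⁰ by K⁰. The complex L has ker
  -- d⁰ ⊕ K⁰ in degree 0 and E in degree 1.
  obtain ⟨E, a, b, e, hab, hae, h1, h2⟩ := exists_lift_isSES e0 e1
  have hab0 : ∀ {T : A} (t : _ ⟶ T), a ≫ b ≫ t = 0 := fun t => by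
    rw [← Category.assoc, hab.zero, zero_comp]
  have h1' : a ≫ e = K.d 0 1 := by rw [h1, kernel.lift_ι]
  have h2' : e ≫ K.d 1 0 = b ≫ kernel.ι (K.d 0 1) := by rw [← h2, Category.assoc, kernel.lift_ι]
  let L : Cpx A := cpxMk (X₀ := kernel (K.d 0 1) ⊞ K.X 0) (X₁ := E) (biprod.snd ≫ a)
    (b ≫ biprod.inl) (by simp [hab0]) (by simp)
  let g : L ⟶ K := cpxHomMk 0 (biprod.desc (kernel.ι (K.d 0 1)) (𝟙 _) :
    (kernel (K.d 0 1) ⊞ K.X 0) ⟶ K.X 0) e (by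
      change biprod.desc (kernel.ι (K.d 0 1)) (𝟙 _) ≫ K.d 0 1 = (biprod.snd ≫ a) ≫ e
      rw [Category.assoc, h1']
      apply biprod.hom_ext' <;> simp) (by
      change e ≫ K.d 1 0 = (b ≫ biprod.inl) ≫ biprod.desc (kernel.ι (K.d 0 1)) (𝟙 _)
      rw [h2']
      simp)
  have hg0 : g.f 0 = biprod.desc (kernel.ι (K.d 0 1)) (𝟙 _) := cpxHomMk_f₀ ..
  have hg1 : g.f (0 + 1) = e := cpxHomMk_f₁ ..
  -- In both degrees the kernel of g is ker d⁰: in degree 0 it is embedded by minus the identity and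
  -- the inclusion, in degree 1 through K⁰ → E.
  have hgs : IsSES (fromCpxD 0 (N := L) (biprod.lift (-𝟙 _) (kernel.ι (K.d 0 1)))) g := by
    refine isSES_of_eval 0 ?_ ?_
    · have h := (isSES_biprod_lift (kernel.ι (K.d 0 1))).congr_outer (cpxDIso₀ 0 _) (Iso.refl _)
      rw [Iso.refl_hom, Category.comp_id] at h
      exact isSES_congr (fromCpxD_f₀ 0 _) hg0 h
    · have : biprod.lift (-𝟙 _) (kernel.ι (K.d 0 1)) ≫ L.d 0 (0 + 1) = kernel.ι (K.d 0 1) ≫ a := by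
        change biprod.lift (-𝟙 _) (kernel.ι (K.d 0 1)) ≫ (biprod.snd ≫ a) = _
        simp
      have h := hae.congr_outer (cpxDIso₁ 0 _) (Iso.refl _)
      rw [Iso.refl_hom, Category.comp_id] at h
      exact isSES_congr ((fromCpxD_f₁ 0 _).trans (congrArg _ this)) hg1 h
  -- The summand K⁰ with its image in E is a contractible subcomplex, and the quotient has ker d⁰ in
  -- both degrees.
  let f' : cpxD 0 (K.X 0) ⟶ L := fromCpxD 0 (biprod.inr : K.X 0 ⟶ kernel (K.d 0 1) ⊞ K.X 0)
  let g' : L ⟶ cpxD 1 (kernel (K.d 0 1)) :=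
    toCpxD 1 (biprod.fst : kernel (K.d 0 1) ⊞ K.X 0 ⟶ kernel (K.d 0 1))
  refine ⟨L, _, _, _, _, g, f', g', hgs, isSES_of_eval 0 ?_ ?_⟩
  · have h : g'.f 0 = biprod.fst ≫ (cpxDIso₁ 1 _).inv := toCpxD_f₁ 1 _
    exact isSES_congr (fromCpxD_f₀ 0 _) h ((isSES_biprod' _ _).congr_outer (cpxDIso₀ 0 _) (cpxDIso₁ 1 _).symm)
  · have h : g'.f (0 + 1) = b ≫ (cpxDIso₀ 1 _).inv := by
      refine (toCpxD_f₀ 1 _).trans ?_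
      change (b ≫ biprod.inl) ≫ biprod.fst ≫ _ = _
      simp
    have h2 : (biprod.inr : K.X 0 ⟶ kernel (K.d 0 1) ⊞ K.X 0) ≫ L.d 0 (0 + 1) = a := by
      change biprod.inr ≫ (biprod.snd ≫ a) = a
      simp
    exact isSES_congr ((fromCpxD_f₁ 0 _).trans (congrArg _ h2)) h
      (hab.congr_outer (cpxDIso₁ 0 _) (cpxDIso₀ 1 _).symm)

end AcyclicResolution

/-! ### Boundary classes and Euler forms of acyclic complexes -/

section AcyclicInvariants

variable {A : Type u} [Category.{v} A] [Abelian A]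

lemma cpx_next (i : ZMod 2) : (ComplexShape.up (ZMod 2)).next i = i + 1 :=
  (ComplexShape.up (ZMod 2)).next_eq' (rel_add_one i)

lemma cpx_prev (i : ZMod 2) : (ComplexShape.up (ZMod 2)).prev i = i + 1 :=
  (ComplexShape.up (ZMod 2)).prev_eq' (rel_add_one' i)

lemma exists_boundary_of_acyclic {K : Cpx A} (hK : K.Acyclic) (i : ZMod 2) {T : A}
    (t : T ⟶ K.X i) (ht : t ≫ K.d i (i + 1) = 0) :
    ∃ (T' : A) (π : T' ⟶ T) (_ : Epi π) (x : T' ⟶ K.X (i + 1)), π ≫ t = x ≫ K.d (i + 1) i :=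
  ((exactAt_iff_exact K i).1 (hK i)).exact_up_to_refinements t ht

lemma exists_boundary_of_acyclic' {K : Cpx A} (hK : K.Acyclic) (i : ZMod 2) {T : A}
    (t : T ⟶ K.X (i + 1)) (ht : t ≫ K.d (i + 1) i = 0) :
    ∃ (T' : A) (π : T' ⟶ T) (_ : Epi π) (x : T' ⟶ K.X i), π ≫ t = x ≫ K.d i (i + 1) := by
  have h : ∀ l (_ : i + 1 + 1 = l),
      (ShortComplex.mk (K.d l (i + 1)) (K.d (i + 1) l) (K.d_comp_d _ _ _)).Exact := by
    rintro l rfl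
    exact (exactAt_iff_exact K (i + 1)).1 (hK (i + 1))
  exact (h i (zmod_two_add_one_add_one i)).exact_up_to_refinements t ht

/-- Cycles are only left exact in general, and acyclicity of one end supplies surjectivity. If K is
acyclic, the differential of a lift of a cycle of M is a boundary in K, and the lift can be
corrected. If M is acyclic, the cycle is a boundary, and the boundary of a lift of its primitive
maps to it. -/
lemma isSES_cyclesMap {K L M : Cpx A} {f : K ⟶ L} {g : L ⟶ M} (h : IsSES f g)
    (hKM : K.Acyclic ∨ M.Acyclic) (i : ZMod 2) :
    IsSES (HomologicalComplex.cyclesMap f i) (HomologicalComplex.cyclesMap g i) := by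
  have h₀ := h.eval i
  have h₁ := h.eval (i + 1)
  have := h₀.mono
  have := h₁.mono
  have := h₀.epi
  have := h₁.epi
  have hep : Epi (HomologicalComplex.cyclesMap g i) := by
    rw [epi_iff_surjective_up_to_refinements]
    intro T y
    obtain ⟨T', π, hπ, x, hx, hx'⟩ : ∃ (T' : A) (π : T' ⟶ T) (_ : Epi π) (x : T' ⟶ L.X i),
        x ≫ L.d i (i + 1) = 0 ∧ π ≫ y ≫ M.iCycles i = x ≫ g.f i := by
      obtain hK | hM := hKM
      · obtain ⟨T₁, π₁, hπ₁, x, hx⟩ :=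
          surjective_up_to_refinements_of_epi (g.f i) (y ≫ M.iCycles i)
        obtain ⟨w, hw⟩ := h₁.lift (x ≫ L.d i (i + 1)) (by
          rw [Category.assoc, ← g.comm, ← Category.assoc, ← hx]
          simp)
        have hw0 : w ≫ K.d (i + 1) i = 0 := by
          rw [← cancel_mono (f.f i), Category.assoc, ← f.comm, ← Category.assoc, hw]
          simp
        obtain ⟨T₂, π₂, hπ₂, v, hv⟩ := exists_boundary_of_acyclic' hK i w hw0
        refine ⟨T₂, π₂ ≫ π₁, inferInstance, π₂ ≫ x - v ≫ f.f i, ?_, ?_⟩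
        · rw [Preadditive.sub_comp, Category.assoc, ← hw, Category.assoc, f.comm,
            ← Category.assoc v, ← hv, Category.assoc, sub_self]
        · rw [Preadditive.sub_comp, Category.assoc v, h₀.zero, comp_zero, sub_zero,
            Category.assoc, hx, Category.assoc]
      · obtain ⟨T₁, π₁, hπ₁, z, hz⟩ := exists_boundary_of_acyclic hM i (y ≫ M.iCycles i) (by simp)
        obtain ⟨T₂, π₂, hπ₂, z', hz'⟩ := surjective_up_to_refinements_of_epi (g.f (i + 1)) z
        refine ⟨T₂, π₂ ≫ π₁, inferInstance, z' ≫ L.d (i + 1) i, by simp, ?_⟩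
        rw [Category.assoc, hz, ← Category.assoc, hz', Category.assoc, Category.assoc, g.comm]
    refine ⟨T', π, hπ, L.liftCycles x _ (cpx_next i) hx, ?_⟩
    rw [← cancel_mono (M.iCycles i), Category.assoc, Category.assoc,
      HomologicalComplex.cyclesMap_i, hx', HomologicalComplex.liftCycles_i_assoc]
  refine isSES_of_lift inferInstance hep ?_ fun t ht => ?_
  · rw [← HomologicalComplex.cyclesMap_comp, h.zero, HomologicalComplex.cyclesMap_zero]
  · obtain ⟨s, hs⟩ := h₀.lift (t ≫ L.iCycles i) (by
      rw [Category.assoc, ← HomologicalComplex.cyclesMap_i, ← Category.assoc, ht, zero_comp])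
    refine ⟨K.liftCycles s _ (cpx_next i) ?_, ?_⟩
    · rw [← cancel_mono (f.f (i + 1)), Category.assoc, ← f.comm, ← Category.assoc, hs]
      simp
    · rw [← cancel_mono (L.iCycles i), Category.assoc, HomologicalComplex.cyclesMap_i,
        HomologicalComplex.liftCycles_i_assoc, hs]

lemma homology_iso_of_acyclic_left {K L M : Cpx A} {f : K ⟶ L} {g : L ⟶ M} (h : IsSES f g)
    (hK : K.Acyclic) (i : ZMod 2) : Nonempty (L.homology i ≅ M.homology i) := by
  have : Mono (HomologicalComplex.homologyMap g i) :=
    (h.2.homology_exact₂ i).mono_g ((hK i).isZero_homology.eq_of_src _ _)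
  have : Epi (HomologicalComplex.homologyMap g i) :=
    (h.2.homology_exact₃ i (i + 1) rfl).epi_f ((hK (i + 1)).isZero_homology.eq_of_tgt _ _)
  exact ⟨@asIso _ _ _ _ (HomologicalComplex.homologyMap g i) (isIso_of_mono_of_epi _)⟩

lemma homology_iso_of_acyclic_right {K L M : Cpx A} {f : K ⟶ L} {g : L ⟶ M} (h : IsSES f g)
    (hM : M.Acyclic) (i : ZMod 2) : Nonempty (L.homology i ≅ K.homology i) := by
  have : Epi (HomologicalComplex.homologyMap f i) :=
    (h.2.homology_exact₂ i).epi_f ((hM i).isZero_homology.eq_of_tgt _ _)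
  have : Mono (HomologicalComplex.homologyMap f i) :=
    (h.2.homology_exact₁ (i + 1) i (rel_add_one' i)).mono_g
      ((hM (i + 1)).isZero_homology.eq_of_src _ _)
  exact ⟨(@asIso _ _ _ _ (HomologicalComplex.homologyMap f i) (isIso_of_mono_of_epi _)).symm⟩

/-- The class in `K₀(A)` of the boundaries of a complex which come from degree `i`. -/
noncomputable def cpxBd (M : Cpx A) (i : ZMod 2) : K0 A := k0Cls (M.X i) - k0Cls (M.cycles i)

lemma cpxBd_of_isSES {K L M : Cpx A} {f : K ⟶ L} {g : L ⟶ M} (h : IsSES f g)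
    (hKM : K.Acyclic ∨ M.Acyclic) (i : ZMod 2) : cpxBd L i = cpxBd K i + cpxBd M i := by
  rw [cpxBd, cpxBd, cpxBd, k0Cls_of_isSES (h.eval i), k0Cls_of_isSES (isSES_cyclesMap h hKM i)]
  abel

lemma cpxBd_congr {M N : Cpx A} (e : M ≅ N) (i : ZMod 2) : cpxBd M i = cpxBd N i := by
  have h : k0Cls (M.X i) = k0Cls (N.X i) := k0Cls_iso ((HomologicalComplex.eval A _ i).mapIso e)
  rw [cpxBd, cpxBd, h, k0Cls_iso (HomologicalComplex.cyclesMapIso e i)]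

lemma cpxBd_of_mono {M : Cpx A} {i : ZMod 2} (h : Mono (M.d i (i + 1))) :
    cpxBd M i = k0Cls (M.X i) := by
  have hz : IsZero (M.cycles i) := by
    have h0 : M.iCycles i = 0 := by
      rw [← cancel_mono (M.d i (i + 1))]
      simp
    rw [IsZero.iff_id_eq_zero, ← cancel_mono (M.iCycles i), h0, comp_zero, comp_zero]
  rw [cpxBd, k0Cls_zero hz, sub_zero]

lemma cpxBd_of_d_eq_zero {M : Cpx A} {i : ZMod 2} (h : M.d i (i + 1) = 0) : cpxBd M i = 0 := by
  have := M.isIso_iCycles i (i + 1) (cpx_next i) h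
  rw [cpxBd, k0Cls_iso (asIso (M.iCycles i)), sub_self]

/-- The classes of the boundaries of a complex. -/
noncomputable def cpxBds (M : Cpx A) : K0 A × K0 A := (cpxBd M 0, cpxBd M 1)

lemma cpxBds_of_isSES {K L M : Cpx A} {f : K ⟶ L} {g : L ⟶ M} (h : IsSES f g)
    (hKM : K.Acyclic ∨ M.Acyclic) : cpxBds L = cpxBds K + cpxBds M :=
  Prod.ext (cpxBd_of_isSES h hKM 0) (cpxBd_of_isSES h hKM 1)

lemma cpxBds_congr {M N : Cpx A} (e : M ≅ N) : cpxBds M = cpxBds N :=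
  Prod.ext (cpxBd_congr e 0) (cpxBd_congr e 1)

lemma cpxBds_cpxD_zero (X : A) : cpxBds (cpxD 0 X) = (k0Cls X, 0) := by
  have h1 : IsIso ((cpxD 0 X).d 0 (0 + 1)) := by rw [cpxD_d₀]; infer_instance
  refine Prod.ext ((cpxBd_of_mono inferInstance).trans (k0Cls_iso (cpxDIso₀ 0 X))) ?_
  exact cpxBd_of_d_eq_zero (cpxD_d₁ 0 X)

lemma cpxBds_cpxD_one (X : A) : cpxBds (cpxD 1 X) = (0, k0Cls X) := by
  have h1 : IsIso ((cpxD 1 X).d 1 (1 + 1)) := by rw [cpxD_d₀]; infer_instance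
  refine Prod.ext ?_ ((cpxBd_of_mono inferInstance).trans (k0Cls_iso (cpxDIso₀ 1 X)))
  exact cpxBd_of_d_eq_zero (cpxD_d₁ 1 X)

variable [HereditaryFinite A]

/-- In the resolution, L is an extension of contractible complexes, so Ext²(N, L) = 0. It surjects
onto Ext²(N, K) because the next term, Ext³ into a contractible complex, vanishes. -/
lemma subsingleton_ext_two_of_acyclic_right {K : Cpx A} (hK : K.Acyclic) (N : Cpx A) :
    Subsingleton (Ext N K 2) := by
  obtain ⟨L, X, Y, Z, f, g, f', g', h, h'⟩ := acyclic_resolution hK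
  have := subsingleton_ext_to_cpxD 0 N Y 2 le_rfl
  have := subsingleton_ext_to_cpxD 1 N Z 2 le_rfl
  have := subsingleton_ext_to_cpxD 0 N X 3 (by norm_num)
  have hL : ∀ x : Ext N L 2, x = 0 := fun x => by
    obtain ⟨y, rfl⟩ := Ext.covariant_sequence_exact₂ N h'.2 x (Subsingleton.elim _ _)
    rw [Subsingleton.elim y 0, Ext.zero_comp]
  refine subsingleton_of_forall_eq 0 fun x => ?_
  obtain ⟨y, rfl⟩ := Ext.covariant_sequence_exact₃ N h.2 x (by norm_num : 2 + 1 = 3)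
    (Subsingleton.elim _ _)
  rw [hL y, Ext.zero_comp]

/-- The same resolution has to be used from its other side. As Ext²(L, N) = 0, every class in
Ext²(K, N) is a connecting image from Ext¹ of the contractible subcomplex, and the connecting map is
zero because those classes extend to L by `ext_precomp_surjective_of_mono`. -/
lemma subsingleton_ext_two_of_acyclic_left {K : Cpx A} (hK : K.Acyclic) (N : Cpx A) :
    Subsingleton (Ext K N 2) := by
  obtain ⟨L, X, Y, Z, f, g, f', g', h, h'⟩ := acyclic_resolution hK
  have := subsingleton_ext_cpxD 0 Y N 2 le_rfl
  have := subsingleton_ext_cpxD 1 Z N 2 le_rfl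
  have := h.mono
  have hL : ∀ x : Ext L N 2, x = 0 := fun x => by
    obtain ⟨y, rfl⟩ := Ext.contravariant_sequence_exact₂ h'.2 N x (Subsingleton.elim _ _)
    rw [Subsingleton.elim y 0, Ext.comp_zero]
  refine subsingleton_of_forall_eq 0 fun x => ?_
  obtain ⟨y, rfl⟩ := Ext.contravariant_sequence_exact₃ h.2 N x (hL _) (by norm_num : 1 + 1 = 2)
  obtain ⟨z, rfl⟩ := ext_precomp_surjective_of_mono 0 f N y
  exact h.2.extClass_comp_assoc z (h := by norm_num)

/-- The number `|Ext¹(N, K)| / |Hom(N, K)|` for `K` acyclic, in terms of the classes of the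
components of `N` and of the boundaries of `K`. -/
noncomputable def acyclicR (α κ : K0 A × K0 A) : ℂ :=
  ((eulerForm α.2 κ.1 * eulerForm α.1 κ.2)⁻¹ : ℝ)

/-- The number `|Ext¹(K, N)| / |Hom(K, N)|` for `K` acyclic, in terms of the classes of the
boundaries of `K` and of the components of `N`. -/
noncomputable def acyclicL (κ α : K0 A × K0 A) : ℂ :=
  ((eulerForm κ.1 α.1 * eulerForm κ.2 α.2)⁻¹ : ℝ)

lemma acyclicR_ne_zero (α κ : K0 A × K0 A) : acyclicR α κ ≠ 0 :=
  Complex.ofReal_ne_zero.2 (inv_ne_zero (mul_pos (eulerForm_pos _ _) (eulerForm_pos _ _)).ne')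

lemma acyclicL_ne_zero (κ α : K0 A × K0 A) : acyclicL κ α ≠ 0 :=
  Complex.ofReal_ne_zero.2 (inv_ne_zero (mul_pos (eulerForm_pos _ _) (eulerForm_pos _ _)).ne')

lemma acyclicR_add_right (α κ κ' : K0 A × K0 A) :
    acyclicR α (κ + κ') = acyclicR α κ * acyclicR α κ' := by
  simp only [acyclicR, Prod.fst_add, Prod.snd_add, eulerForm_add_right]
  push_cast
  rw [← mul_inv]
  congr 1
  ring

lemma acyclicR_add_left (α α' κ : K0 A × K0 A) :
    acyclicR (α + α') κ = acyclicR α κ * acyclicR α' κ := by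
  simp only [acyclicR, Prod.fst_add, Prod.snd_add, eulerForm_add_left]
  push_cast
  rw [← mul_inv]
  congr 1
  ring

lemma acyclicL_add_left (κ κ' α : K0 A × K0 A) :
    acyclicL (κ + κ') α = acyclicL κ α * acyclicL κ' α := by
  simp only [acyclicL, Prod.fst_add, Prod.snd_add, eulerForm_add_left]
  push_cast
  rw [← mul_inv]
  congr 1
  ring

lemma acyclicR_zero_right (α : K0 A × K0 A) : acyclicR α 0 = 1 := by
  simp [acyclicR, eulerForm_zero_right]

lemma acyclicR_zero_left (κ : K0 A × K0 A) : acyclicR 0 κ = 1 := by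
  simp [acyclicR, eulerForm_zero_left]

/-- Morphisms and extensions from N to `cpxD i X` are those from the component of degree i + 1 of N
to X. This is why `acyclicR` pairs opposite indices, whereas `acyclicL` pairs equal ones. -/
lemma card_div_cpxD_right (N : Cpx A) (i : ZMod 2) (X : A) :
    (Nat.card (Ext N (cpxD i X) 1) : ℂ) / Nat.card (N ⟶ cpxD i X) =
      acyclicR (cpxDeg (isoCls N)) (cpxBds (cpxD i X)) := by
  rw [card_ext_to_cpxD, card_hom_to_cpxD, cpxDeg_isoCls]
  match (i : Fin 2) with
  | 0 =>
    change _ = acyclicR _ (cpxBds (cpxD 0 X))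
    rw [cpxBds_cpxD_zero, acyclicR]
    simp only [eulerForm_zero_right, eulerForm_k0Cls, mul_one, inv_div]
    push_cast
    rfl
  | 1 =>
    change _ = acyclicR _ (cpxBds (cpxD 1 X))
    rw [cpxBds_cpxD_one, acyclicR]
    simp only [eulerForm_zero_right, eulerForm_k0Cls, one_mul, inv_div]
    push_cast
    rfl

lemma card_div_cpxD_left (N : Cpx A) (i : ZMod 2) (X : A) :
    (Nat.card (Ext (cpxD i X) N 1) : ℂ) / Nat.card (cpxD i X ⟶ N) =
      acyclicL (cpxBds (cpxD i X)) (cpxDeg (isoCls N)) := by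
  rw [card_ext_cpxD, card_hom_cpxD, cpxDeg_isoCls]
  match (i : Fin 2) with
  | 0 =>
    change _ = acyclicL (cpxBds (cpxD 0 X)) _
    rw [cpxBds_cpxD_zero, acyclicL]
    simp only [eulerForm_zero_left, eulerForm_k0Cls, mul_one, inv_div]
    push_cast
    rfl
  | 1 =>
    change _ = acyclicL (cpxBds (cpxD 1 X)) _
    rw [cpxBds_cpxD_one, acyclicL]
    simp only [eulerForm_zero_left, eulerForm_k0Cls, one_mul, inv_div]
    push_cast
    rfl

lemma card_div_right_of_isSES {K L M : Cpx A} {f : K ⟶ L} {g : L ⟶ M} (h : IsSES f g) (N : Cpx A)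
    [Subsingleton (Ext N K 2)] : (Nat.card (Ext N L 1) : ℂ) / Nat.card (N ⟶ L) =
    (Nat.card (Ext N K 1) : ℂ) / Nat.card (N ⟶ K) *
      ((Nat.card (Ext N M 1) : ℂ) / Nat.card (N ⟶ M)) := by
  have hc : (Nat.card (N ⟶ L) : ℂ) * (Nat.card (Ext N K 1) * Nat.card (Ext N M 1)) =
      Nat.card (N ⟶ K) * Nat.card (N ⟶ M) * Nat.card (Ext N L 1) := by
    exact_mod_cast card_covariant_of_subsingleton h N
  have h1 := card_hom_ne_zero' N L
  have h2 := card_hom_ne_zero' N K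
  have h3 := card_hom_ne_zero' N M
  field_simp
  linear_combination -hc

lemma card_div_left_of_isSES {K L M : Cpx A} {f : K ⟶ L} {g : L ⟶ M} (h : IsSES f g) (N : Cpx A)
    [Subsingleton (Ext M N 2)] : (Nat.card (Ext L N 1) : ℂ) / Nat.card (L ⟶ N) =
    (Nat.card (Ext K N 1) : ℂ) / Nat.card (K ⟶ N) *
      ((Nat.card (Ext M N 1) : ℂ) / Nat.card (M ⟶ N)) := by
  have hc : (Nat.card (L ⟶ N) : ℂ) * (Nat.card (Ext M N 1) * Nat.card (Ext K N 1)) =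
      Nat.card (M ⟶ N) * Nat.card (K ⟶ N) * Nat.card (Ext L N 1) := by
    exact_mod_cast card_contravariant_of_subsingleton h N
  have h1 := card_hom_ne_zero' L N
  have h2 := card_hom_ne_zero' K N
  have h3 := card_hom_ne_zero' M N
  field_simp
  linear_combination -hc

/-- Both sides are multiplicative along the two exact sequences of the resolution and agree on
contractible complexes, so the value at K is found by cancelling a nonzero factor. -/
lemma card_div_of_acyclic_right {K : Cpx A} (hK : K.Acyclic) (N : Cpx A) :
    (Nat.card (Ext N K 1) : ℂ) / Nat.card (N ⟶ K) =
      acyclicR (cpxDeg (isoCls N)) (cpxBds K) := by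
  obtain ⟨L, X, Y, Z, f, g, f', g', h, h'⟩ := acyclic_resolution hK
  have := subsingleton_ext_to_cpxD 0 N Y 2 le_rfl
  have := subsingleton_ext_to_cpxD 0 N X 2 le_rfl
  have e1 := card_div_right_of_isSES h N
  have e2 := card_div_right_of_isSES h' N
  have e3 := cpxBds_of_isSES h (Or.inr hK)
  have e4 := cpxBds_of_isSES h' (Or.inl (cpxD_acyclic _ _))
  rw [card_div_cpxD_right] at e1
  rw [card_div_cpxD_right, card_div_cpxD_right, ← acyclicR_add_right, ← e4, e3,
    acyclicR_add_right, e1] at e2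
  exact mul_left_cancel₀ (acyclicR_ne_zero _ _) e2

lemma card_div_of_acyclic_left {K : Cpx A} (hK : K.Acyclic) (N : Cpx A) :
    (Nat.card (Ext K N 1) : ℂ) / Nat.card (K ⟶ N) =
      acyclicL (cpxBds K) (cpxDeg (isoCls N)) := by
  obtain ⟨L, X, Y, Z, f, g, f', g', h, h'⟩ := acyclic_resolution hK
  have := subsingleton_ext_two_of_acyclic_left hK N
  have := subsingleton_ext_cpxD 1 Z N 2 le_rfl
  have e1 := card_div_left_of_isSES h N
  have e2 := card_div_left_of_isSES h' N
  have e3 := cpxBds_of_isSES h (Or.inr hK)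
  have e4 := cpxBds_of_isSES h' (Or.inl (cpxD_acyclic _ _))
  rw [card_div_cpxD_left] at e1
  rw [card_div_cpxD_left, card_div_cpxD_left, ← acyclicL_add_left, ← e4, e3,
    acyclicL_add_left, e1] at e2
  exact mul_left_cancel₀ (acyclicL_ne_zero _ _) e2

end AcyclicInvariants

/-! ### Comparing a complex with its homology -/

section HomologyResolution

variable {A : Type u} [Category.{v} A] [Abelian A]

/-- A morphism of `ℤ/2`-graded complexes from its components of degrees `0` and `1`. -/
def cpxHom₂ {M N : Cpx A} (f₀ : M.X 0 ⟶ N.X 0) (f₁ : M.X 1 ⟶ N.X 1)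
    (h₀ : f₀ ≫ N.d 0 1 = M.d 0 1 ≫ f₁) (h₁ : f₁ ≫ N.d 1 0 = M.d 1 0 ≫ f₀) : M ⟶ N where
  f i := match (i : Fin 2) with
    | 0 => f₀
    | 1 => f₁
  comm' i j hij := by
    have hj : i + 1 = j := hij
    subst hj
    match (i : Fin 2) with
    | 0 => exact h₀
    | 1 => exact h₁

/-- The complex with given components and vanishing differentials. -/
abbrev cpxZ (X₀ X₁ : A) : Cpx A := cpxMk (0 : X₀ ⟶ X₁) (0 : X₁ ⟶ X₀) comp_zero comp_zero

lemma isSES_biprod_lift' {X Y : A} (f : Y ⟶ X) :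
    IsSES (biprod.lift (-f) (𝟙 Y)) (biprod.desc (𝟙 X) f) := by
  have : Mono (biprod.lift (-f) (𝟙 Y)) := Preadditive.mono_of_cancel_zero _ fun t ht => by
    simpa using congrArg (fun u => u ≫ biprod.snd) ht
  have : Epi (biprod.desc (𝟙 X) f) := Preadditive.epi_of_cancel_zero _ fun t ht => by
    simpa using congrArg (fun u => biprod.inl ≫ u) ht
  refine isSES_of_lift inferInstance inferInstance (by simp) fun t ht => ⟨t ≫ biprod.snd, ?_⟩
  rw [biprod.desc_eq, Preadditive.comp_add, Category.comp_id, ← eq_neg_iff_add_eq_zero] at ht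
  apply biprod.hom_ext
  · simp [ht]
  · simp

lemma isSES_biprod_map {X Y Z W : A} {f : X ⟶ Y} {g : Y ⟶ Z} (h : IsSES f g) :
    IsSES (biprod.map (𝟙 W) f) (biprod.snd ≫ g) := by
  have := h.mono
  have := h.epi
  refine isSES_of_lift inferInstance inferInstance (by simp [h.zero]) fun t ht => ?_
  obtain ⟨s, hs⟩ := h.lift (t ≫ biprod.snd) (by simpa using ht)
  exact ⟨biprod.lift (t ≫ biprod.fst) s, by apply biprod.hom_ext <;> simp [hs]⟩

lemma isSES_boundary (M : Cpx A) (i : ZMod 2) : IsSES (M.iCycles i)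
    (kernel.lift (M.homologyπ (i + 1)) (M.toCycles i (i + 1))
      (M.toCycles_comp_homologyπ i (i + 1))) := by
  have hex : (ShortComplex.mk _ _ (M.toCycles_comp_homologyπ i (i + 1))).Exact :=
    ShortComplex.exact_of_g_is_cokernel _
      (M.homologyIsCokernel i (i + 1) ((ComplexShape.up (ZMod 2)).prev_eq' (rel_add_one i)))
  have he : Epi (kernel.lift (M.homologyπ (i + 1)) (M.toCycles i (i + 1))
    (M.toCycles_comp_homologyπ i (i + 1))) := hex.epi_kernelLift
  refine isSES_of_lift inferInstance he ?_ fun t ht => ?_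
  · rw [← cancel_mono (kernel.ι _), ← cancel_mono (M.iCycles _)]
    simp
  · have ht' : t ≫ M.d i (i + 1) = 0 := by
      simpa using congrArg (fun u => u ≫ kernel.ι _ ≫ M.iCycles (i + 1)) ht
    exact ⟨M.liftCycles t _ (cpx_next i) ht', by simp⟩

lemma isSES_homologyπ (M : Cpx A) (i : ZMod 2) :
    IsSES (kernel.ι (M.homologyπ i)) (M.homologyπ i) :=
  isSES_of_lift inferInstance inferInstance (kernel.condition _)
    fun t ht => ⟨kernel.lift _ t ht, by simp⟩

/-- The extension of the homology by the boundaries in degree i + 1 is lifted along the surjection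
of Mⁱ onto those boundaries. The result E is an extension of the homology by Mⁱ and covers the
cycles of degree i + 1. -/
lemma exists_cycles_cover [HereditaryFinite A] (M : Cpx A) (i : ZMod 2) :
    ∃ (E : A) (a : M.X i ⟶ E) (b : E ⟶ M.homology (i + 1)) (e : E ⟶ M.cycles (i + 1)),
      IsSES a b ∧ IsSES (M.iCycles i ≫ a) e ∧ a ≫ e ≫ M.iCycles (i + 1) = M.d i (i + 1) := by
  obtain ⟨E, a, b, e, hab, he, h1, h2⟩ :=
    exists_lift_isSES (isSES_boundary M i) (isSES_homologyπ M (i + 1))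
  exact ⟨E, a, b, e, hab, he, by rw [← Category.assoc, h1]; simp⟩

/-- Every complex has the same resolution as its homology, up to acyclic complexes. -/
lemma homology_resolution [HereditaryFinite A] (M : Cpx A) {H₀ H₁ : A} (j₀ : M.homology 0 ≅ H₀)
    (j₁ : M.homology 1 ≅ H₁) :
    ∃ (K K' P : Cpx A) (f : K ⟶ P) (g : P ⟶ M) (f' : K' ⟶ P) (g' : P ⟶ cpxZ H₀ H₁),
      K.Acyclic ∧ K'.Acyclic ∧ IsSES f g ∧ IsSES f' g' := by
  obtain ⟨E₀, a₀, b₀, e₀, hab₀, he₀, hd₀⟩ := exists_cycles_cover M 0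
  obtain ⟨E₁, a₁, b₁, e₁, hab₁, he₁, hd₁⟩ : ∃ (E : A) (a : M.X 1 ⟶ E) (b : E ⟶ M.homology 0)
    (e : E ⟶ M.cycles 0), IsSES a b ∧ IsSES (M.iCycles 1 ≫ a) e ∧ a ≫ e ≫ M.iCycles 0 = M.d 1 0 :=
      exists_cycles_cover M 1
  change E₀ ⟶ M.homology 1 at b₀
  change E₀ ⟶ M.cycles 1 at e₀
  change a₀ ≫ e₀ ≫ M.iCycles 1 = M.d 0 1 at hd₀
  have hd₀' : ∀ {T : A} (t : _ ⟶ T), a₀ ≫ e₀ ≫ M.iCycles 1 ≫ t = M.d 0 1 ≫ t := fun t => by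
    rw [← hd₀]; simp
  have hd₁' : ∀ {T : A} (t : _ ⟶ T), a₁ ≫ e₁ ≫ M.iCycles 0 ≫ t = M.d 1 0 ≫ t := fun t => by
    rw [← hd₁]; simp
  have hab₀' : ∀ {T : A} (t : _ ⟶ T), a₀ ≫ b₀ ≫ t = 0 := fun t => by
    rw [← Category.assoc, hab₀.zero, zero_comp]
  have hab₁' : ∀ {T : A} (t : _ ⟶ T), a₁ ≫ b₁ ≫ t = 0 := fun t => by
    rw [← Category.assoc, hab₁.zero, zero_comp]
  have := hab₀.mono
  have := hab₁.mono
  have := he₀.epi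
  have := he₁.epi
  -- P pairs each component of M with the cover of its cycles, and its differential is M⁰ → E₀, M¹ →
  -- E₁. It maps onto M by the identity and the covers of the cycles, and onto the homology by E₁ →
  -- H⁰ and E₀ → H¹. The kernels K and K' are acyclic, with components E₁, E₀ and M⁰ ⊕ M¹, M¹ ⊕ M⁰.
  let P : Cpx A := cpxMk (X₀ := M.X 0 ⊞ E₁) (X₁ := M.X 1 ⊞ E₀) (biprod.fst ≫ a₀ ≫ biprod.inr)
    (biprod.fst ≫ a₁ ≫ biprod.inr) (by simp) (by simp)
  let K : Cpx A := cpxMk (X₀ := E₁) (X₁ := E₀) (-(e₁ ≫ M.iCycles 0 ≫ a₀))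
    (-(e₀ ≫ M.iCycles 1 ≫ a₁)) (by simp [hd₀']) (by simp [hd₁'])
  let K' : Cpx A := cpxMk (X₀ := M.X 0 ⊞ M.X 1) (X₁ := M.X 1 ⊞ M.X 0) (biprod.fst ≫ biprod.inr)
    (biprod.fst ≫ biprod.inr) (by simp) (by simp)
  let f : K ⟶ P := cpxHom₂ (M := K) (N := P) (biprod.lift (-(e₁ ≫ M.iCycles 0)) (𝟙 E₁))
    (biprod.lift (-(e₀ ≫ M.iCycles 1)) (𝟙 E₀))
    (show biprod.lift (-(e₁ ≫ M.iCycles 0)) (𝟙 E₁) ≫ biprod.fst ≫ a₀ ≫ biprod.inr =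
      (-(e₁ ≫ M.iCycles 0 ≫ a₀)) ≫ biprod.lift (-(e₀ ≫ M.iCycles 1)) (𝟙 E₀) by
        apply biprod.hom_ext <;> simp [hd₀])
    (show biprod.lift (-(e₀ ≫ M.iCycles 1)) (𝟙 E₀) ≫ biprod.fst ≫ a₁ ≫ biprod.inr =
      (-(e₀ ≫ M.iCycles 1 ≫ a₁)) ≫ biprod.lift (-(e₁ ≫ M.iCycles 0)) (𝟙 E₁) by
        apply biprod.hom_ext <;> simp [hd₁])
  let g : P ⟶ M := cpxHom₂ (M := P) (biprod.desc (𝟙 (M.X 0)) (e₁ ≫ M.iCycles 0))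
    (biprod.desc (𝟙 (M.X 1)) (e₀ ≫ M.iCycles 1))
    (show biprod.desc (𝟙 (M.X 0)) (e₁ ≫ M.iCycles 0) ≫ M.d 0 1 =
      (biprod.fst ≫ a₀ ≫ biprod.inr) ≫ biprod.desc (𝟙 (M.X 1)) (e₀ ≫ M.iCycles 1) by
        apply biprod.hom_ext' <;> simp [hd₀])
    (show biprod.desc (𝟙 (M.X 1)) (e₀ ≫ M.iCycles 1) ≫ M.d 1 0 =
      (biprod.fst ≫ a₁ ≫ biprod.inr) ≫ biprod.desc (𝟙 (M.X 0)) (e₁ ≫ M.iCycles 0) by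
        apply biprod.hom_ext' <;> simp [hd₁])
  let f' : K' ⟶ P := cpxHom₂ (M := K') (N := P) (biprod.map (𝟙 (M.X 0)) a₁)
    (biprod.map (𝟙 (M.X 1)) a₀)
    (show biprod.map (𝟙 (M.X 0)) a₁ ≫ biprod.fst ≫ a₀ ≫ biprod.inr =
      (biprod.fst ≫ biprod.inr) ≫ biprod.map (𝟙 (M.X 1)) a₀ by simp)
    (show biprod.map (𝟙 (M.X 1)) a₀ ≫ biprod.fst ≫ a₁ ≫ biprod.inr =
      (biprod.fst ≫ biprod.inr) ≫ biprod.map (𝟙 (M.X 0)) a₁ by simp)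
  let g' : P ⟶ cpxZ H₀ H₁ := cpxHom₂ (M := P) (N := cpxZ H₀ H₁) (biprod.snd ≫ b₁ ≫ j₀.hom)
    (biprod.snd ≫ b₀ ≫ j₁.hom)
    (show (biprod.snd ≫ b₁ ≫ j₀.hom) ≫ 0 =
      (biprod.fst ≫ a₀ ≫ biprod.inr) ≫ biprod.snd ≫ b₀ ≫ j₁.hom by simp [hab₀'])
    (show (biprod.snd ≫ b₀ ≫ j₁.hom) ≫ 0 =
      (biprod.fst ≫ a₁ ≫ biprod.inr) ≫ biprod.snd ≫ b₁ ≫ j₀.hom by simp [hab₁'])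
  refine ⟨K, K', P, f, g, f', g', ?_, ?_, ?_, ?_⟩
  · refine cpxMk_acyclic _ _ _ _ ?_ ?_
    · rw [ShortComplex.exact_iff_exact_up_to_refinements]
      intro T x hx
      have hx' : x ≫ e₁ = 0 := by
        rw [← cancel_mono (M.iCycles 0), ← cancel_mono a₀]
        simpa using hx
      obtain ⟨y, hy⟩ := he₁.lift x hx'
      obtain ⟨T', π, hπ, z, hz⟩ := surjective_up_to_refinements_of_epi e₀ y
      refine ⟨T', π, hπ, -z, ?_⟩
      change π ≫ x = (-z) ≫ (-(e₀ ≫ M.iCycles 1 ≫ a₁))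
      have h : π ≫ y ≫ M.iCycles 1 ≫ a₁ = z ≫ e₀ ≫ M.iCycles 1 ≫ a₁ := by
        rw [reassoc_of% hz]
      exact ((congrArg (π ≫ ·) hy.symm).trans h).trans (Preadditive.neg_comp_neg _ _).symm
    · rw [ShortComplex.exact_iff_exact_up_to_refinements]
      intro T x hx
      have hx' : x ≫ e₀ = 0 := by
        rw [← cancel_mono (M.iCycles 1), ← cancel_mono a₁]
        simpa using hx
      obtain ⟨y, hy⟩ := he₀.lift x hx'
      obtain ⟨T', π, hπ, z, hz⟩ := surjective_up_to_refinements_of_epi e₁ y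
      refine ⟨T', π, hπ, -z, ?_⟩
      change π ≫ x = (-z) ≫ (-(e₁ ≫ M.iCycles 0 ≫ a₀))
      have h : π ≫ y ≫ M.iCycles 0 ≫ a₀ = z ≫ e₁ ≫ M.iCycles 0 ≫ a₀ := by
        rw [reassoc_of% hz]
      exact ((congrArg (π ≫ ·) hy.symm).trans h).trans (Preadditive.neg_comp_neg _ _).symm
  · refine cpxMk_acyclic _ _ _ _ ?_ ?_ <;>
    · rw [ShortComplex.exact_iff_exact_up_to_refinements]
      intro T x hx
      have hx' : x ≫ biprod.fst = 0 := by
        simpa using congrArg (fun u => u ≫ biprod.snd) hx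
      refine ⟨T, 𝟙 _, inferInstance, x ≫ biprod.snd ≫ biprod.inl, ?_⟩
      apply biprod.hom_ext <;> simp [hx']
  · exact isSES_of_eval 0 (isSES_biprod_lift' _) (isSES_biprod_lift' _)
  · refine isSES_of_eval 0 ?_ ?_
    · have h := (isSES_biprod_map (W := M.X 0) hab₁).congr_outer (Iso.refl _) j₀
      rw [Iso.refl_hom, Category.id_comp, Category.assoc] at h
      exact h
    · have h := (isSES_biprod_map (W := M.X 1) hab₀).congr_outer (Iso.refl _) j₁
      rw [Iso.refl_hom, Category.id_comp, Category.assoc] at h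
      exact h

end HomologyResolution

/-! ### Twisting a graded algebra by a character -/

section GradingTwist

variable {R : Type*} [Ring R] [Algebra ℂ R] {G : Type*} [AddCommGroup G]

/-- The endomorphism of a graded algebra given by a character of the grading group. -/
noncomputable def Grading.twist (D : Grading R G) (χ : Multiplicative G →* ℂ) : R →ₐ[ℂ] R :=
  (AddMonoidAlgebra.liftNCAlgHom (AlgHom.id ℂ R) ((algebraMap ℂ R : ℂ →* R).comp χ)
    fun x y => (Algebra.commutes (χ y) x).symm).comp D.coact

lemma Grading.twist_homog {D : Grading R G} (χ : Multiplicative G →* ℂ) {g : G} {x : R}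
    (hx : D.Homog g x) : D.twist χ x = χ (Multiplicative.ofAdd g) • x := by
  rw [Grading.Homog] at hx
  rw [Grading.twist, AlgHom.comp_apply, hx]
  refine (AddMonoidAlgebra.liftNC_single _ _ _ _).trans ?_
  change x * algebraMap ℂ R _ = _
  rw [← Algebra.commutes, ← Algebra.smul_def]

end GradingTwist

/-! ### The action on the space of invariants of complexes -/

section InvariantSpace

variable {A : Type u} [Category.{v} A] [Abelian A]

variable (A) in
/-- The set indexing the invariants of complexes: the isomorphism classes of the homology objects
and the classes of the boundaries. -/
abbrev CpxInv : Type u := (IsoClass A × IsoClass A) × (K0 A × K0 A)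

/-- The invariants of a complex. -/
noncomputable def cpxInv (M : Cpx A) : CpxInv A :=
  ((isoCls (M.homology 0), isoCls (M.homology 1)), cpxBds M)

lemma cpxInv_congr {M N : Cpx A} (e : M ≅ N) : cpxInv M = cpxInv N := by
  have h : ∀ i, isoCls (M.homology i) = isoCls (N.homology i) := fun i =>
    isoCls_eq_iff.2 ⟨HomologicalComplex.homologyMapIso e i⟩
  rw [cpxInv, cpxInv, h, h, cpxBds_congr e]

lemma cpxInv_of_acyclic_left {K L M : Cpx A} {f : K ⟶ L} {g : L ⟶ M} (h : IsSES f g)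
    (hK : K.Acyclic) : cpxInv L = ((cpxInv M).1, (cpxInv M).2 + cpxBds K) := by
  have h1 : ∀ i, isoCls (L.homology i) = isoCls (M.homology i) := fun i =>
    isoCls_eq_iff.2 (homology_iso_of_acyclic_left h hK i)
  rw [cpxInv, cpxInv, h1, h1, cpxBds_of_isSES h (Or.inl hK), add_comm]

lemma cpxInv_of_acyclic_right {K L M : Cpx A} {f : M ⟶ L} {g : L ⟶ K} (h : IsSES f g)
    (hK : K.Acyclic) : cpxInv L = ((cpxInv M).1, (cpxInv M).2 + cpxBds K) := by
  have h1 : ∀ i, isoCls (L.homology i) = isoCls (M.homology i) := fun i =>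
    isoCls_eq_iff.2 (homology_iso_of_acyclic_right h hK i)
  rw [cpxInv, cpxInv, h1, h1, cpxBds_of_isSES h (Or.inr hK)]

lemma acyclic_iff (M : Cpx A) : M.Acyclic ↔ ∀ i, IsZero (M.homology i) :=
  forall_congr' fun i => M.exactAt_iff_isZero_homology i

lemma acyclic_of_isSES_left {K L M : Cpx A} {f : K ⟶ L} {g : L ⟶ M} (h : IsSES f g)
    (hK : K.Acyclic) : L.Acyclic ↔ M.Acyclic := by
  rw [acyclic_iff, acyclic_iff]
  refine forall_congr' fun i => ?_
  obtain ⟨e⟩ := homology_iso_of_acyclic_left h hK i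
  exact e.isZero_iff

lemma acyclic_of_isSES_right {K L M : Cpx A} {f : M ⟶ L} {g : L ⟶ K} (h : IsSES f g)
    (hK : K.Acyclic) : L.Acyclic ↔ M.Acyclic := by
  rw [acyclic_iff, acyclic_iff]
  refine forall_congr' fun i => ?_
  obtain ⟨e⟩ := homology_iso_of_acyclic_right h hK i
  exact e.isZero_iff

lemma acyclic_biprod {K L : Cpx A} (hK : K.Acyclic) (hL : L.Acyclic) : (K ⊞ L).Acyclic :=
  (acyclic_of_isSES_left (isSES_biprod K L) hK).2 hL

lemma acyclic_zero {Z : Cpx A} (hZ : IsZero Z) : Z.Acyclic := by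
  rw [acyclic_iff]
  exact fun i => (HomologicalComplex.homologyFunctor A _ i).map_isZero hZ

lemma homology_iso_of_d_eq_zero (M : Cpx A) (i : ZMod 2) (h₀ : M.d i (i + 1) = 0)
    (h₁ : M.d (i + 1) i = 0) : Nonempty (M.homology i ≅ M.X i) := by
  have := M.isIso_iCycles i (i + 1) (cpx_next i) h₀
  exact ⟨(M.isoHomologyπ (i + 1) i (cpx_prev i) h₁).symm ≪≫ asIso (M.iCycles i)⟩

lemma cpxInv_cpxZ (X₀ X₁ : A) : cpxInv (cpxZ X₀ X₁) = ((isoCls X₀, isoCls X₁), 0) := by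
  refine Prod.ext (Prod.ext ?_ ?_) (Prod.ext ?_ ?_)
  · exact isoCls_eq_iff.2 (homology_iso_of_d_eq_zero (cpxZ X₀ X₁) 0 rfl rfl)
  · exact isoCls_eq_iff.2 (homology_iso_of_d_eq_zero (cpxZ X₀ X₁) 1 rfl rfl)
  · exact cpxBd_of_d_eq_zero (M := cpxZ X₀ X₁) (i := 0) rfl
  · exact cpxBd_of_d_eq_zero (M := cpxZ X₀ X₁) (i := 1) rfl

variable (A) in
/-- The vector space with basis the invariants of complexes. -/
abbrev InvSpace : Type u := CpxInv A →₀ ℂ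

/-- The translation of the boundary classes. -/
noncomputable def invShift (κ : K0 A × K0 A) : InvSpace A →ₗ[ℂ] InvSpace A :=
  Finsupp.lmapDomain ℂ ℂ fun p => (p.1, p.2 + κ)

lemma invShift_single (κ : K0 A × K0 A) (p : CpxInv A) (c : ℂ) :
    invShift κ (Finsupp.single p c) = Finsupp.single (p.1, p.2 + κ) c :=
  Finsupp.mapDomain_single

lemma invShift_add (κ κ' : K0 A × K0 A) (x : InvSpace A) :
    invShift (κ + κ') x = invShift κ (invShift κ' x) := by
  induction x using Finsupp.induction_linear with
  | zero => simp
  | add x y hx hy => rw [map_add, map_add, map_add, hx, hy]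
  | single p c => rw [invShift_single, invShift_single, invShift_single, add_comm κ, add_assoc]

lemma invShift_zero (x : InvSpace A) : invShift 0 x = x := by
  induction x using Finsupp.induction_linear with
  | zero => simp
  | add x y hx hy => rw [map_add, hx, hy]
  | single p c => rw [invShift_single, add_zero]

lemma invShift_injective (κ : K0 A × K0 A) : Function.Injective (invShift κ) :=
  Function.LeftInverse.injective (g := invShift (-κ)) fun x => by
    rw [← invShift_add, neg_add_cancel, invShift_zero]

lemma exists_mono_to_contractible (L : Cpx A) : ∃ (K : Cpx A) (j : L ⟶ K), K.Acyclic ∧ Mono j := by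
  refine ⟨cpxD 0 (L.X 1) ⊞ cpxD 1 (L.X 0), biprod.lift (toCpxD 0 (𝟙 (L.X (0 + 1))))
    (toCpxD 1 (𝟙 (L.X (1 + 1)))), acyclic_biprod (cpxD_acyclic _ _) (cpxD_acyclic _ _), ?_⟩
  refine Preadditive.mono_of_cancel_zero _ fun t ht => cpx_hom_ext 1 ?_ ?_
  · have h := congrArg (fun u => HomologicalComplex.Hom.f (u ≫ biprod.fst) (0 + 1)) ht
    simp only [Category.assoc, biprod.lift_fst, HomologicalComplex.comp_f, toCpxD_f₁] at h
    rw [Category.id_comp, HomologicalComplex.zero_f, zero_comp] at h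
    exact zero_of_comp_mono _ h
  · have h := congrArg (fun u => HomologicalComplex.Hom.f (u ≫ biprod.snd) (1 + 1)) ht
    simp only [Category.assoc, biprod.lift_snd, HomologicalComplex.comp_f, toCpxD_f₁] at h
    rw [Category.id_comp, HomologicalComplex.zero_f, zero_comp] at h
    exact zero_of_comp_mono _ h

variable [HereditaryFinite A]

/-- The linear map which records the invariants of complexes. -/
noncomputable def invMap : HallAlg (Cpx A) →ₗ[ℂ] InvSpace A :=
  (hallConst (Cpx A)).basis.constr ℂ fun x => Finsupp.single (cpxInv x.rep) 1

lemma invMap_hallCls (M : Cpx A) : invMap (hallCls M) = Finsupp.single (cpxInv M) 1 := by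
  rw [invMap, hallCls, Module.Basis.constr_basis, cpxInv_congr (rep_isoCls M).some]

lemma invMap_hallCls_of_isSES_left {K L M : Cpx A} {f : K ⟶ L} {g : L ⟶ M} (h : IsSES f g)
    (hK : K.Acyclic) : invMap (hallCls L) = invShift (cpxBds K) (invMap (hallCls M)) := by
  rw [invMap_hallCls, invMap_hallCls, invShift_single, cpxInv_of_acyclic_left h hK]

lemma invMap_hallCls_of_isSES_right {K L M : Cpx A} {f : M ⟶ L} {g : L ⟶ K} (h : IsSES f g)
    (hK : K.Acyclic) : invMap (hallCls L) = invShift (cpxBds K) (invMap (hallCls M)) := by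
  rw [invMap_hallCls, invMap_hallCls, invShift_single, cpxInv_of_acyclic_right h hK]

/-- An acyclic subcomplex of L is also one of every extension of N by L, and removing it shifts the
boundary classes and keeps the homology. Only the invariants are compared, so no relation in the
Hall algebra is used. -/
lemma invMap_mul_of_isSES_left {K L M : Cpx A} {f : K ⟶ L} {g : L ⟶ M} (h : IsSES f g)
    (hK : K.Acyclic) (N : Cpx A) : invMap (hallCls N * hallCls L) =
      acyclicR (cpxDeg (isoCls N)) (cpxBds K) •
        invShift (cpxBds K) (invMap (hallCls N * hallCls M)) := by
  have := subsingleton_ext_two_of_acyclic_right hK N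
  rw [← card_div_of_acyclic_right hK]
  exact map_hallCls_mul_of_isSES h invMap (invShift (cpxBds K) ∘ₗ invMap)
    fun _ _ h => invMap_hallCls_of_isSES_left h hK

lemma invMap_mul_of_isSES_right {K L M : Cpx A} {f : M ⟶ L} {g : L ⟶ K} (h : IsSES f g)
    (hK : K.Acyclic) (N : Cpx A) : invMap (hallCls L * hallCls N) =
      acyclicL (cpxBds K) (cpxDeg (isoCls N)) •
        invShift (cpxBds K) (invMap (hallCls M * hallCls N)) := by
  have := subsingleton_ext_two_of_acyclic_left hK N
  rw [← card_div_of_acyclic_left hK]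
  exact map_mul_hallCls_of_isSES h invMap (invShift (cpxBds K) ∘ₗ invMap)
    fun _ _ h => invMap_hallCls_of_isSES_right h hK

variable (A) in
/-- The Hall algebra of complexes acts on the space of invariants. -/
noncomputable def hallActLin : HallAlg (Cpx A) →ₗ[ℂ] Module.End ℂ (InvSpace A) :=
  -- A basis vector is represented by the complex with zero differential and the given homology. The
  -- scalar and the shift imitate an acyclic subcomplex with boundary classes `p.2`, which makes
  -- sense even when no such complex exists.
  (hallConst (Cpx A)).basis.constr ℂ fun x => Finsupp.linearCombination ℂ fun p : CpxInv A =>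
    acyclicR (cpxDeg x) p.2 • invShift p.2
      (invMap ((hallConst (Cpx A)).basis x * hallCls (cpxZ p.1.1.rep p.1.2.rep)))

lemma hallActLin_hallCls (N : Cpx A) (p : CpxInv A) :
    hallActLin A (hallCls N) (Finsupp.single p 1) =
    acyclicR (cpxDeg (isoCls N)) p.2 • invShift p.2
      (invMap (hallCls N * hallCls (cpxZ p.1.1.rep p.1.2.rep))) := by
  rw [hallActLin, hallCls, Module.Basis.constr_basis, Finsupp.linearCombination_single, one_smul]

lemma hallAlg_induction {C : Type*} [Category* C] [Abelian C] [HallFinite C] {P : HallAlg C → Prop}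
    (hadd : ∀ x y, P x → P y → P (x + y)) (hsmul : ∀ (r : ℂ) x, P x → P (r • x))
    (hb : ∀ X, P (hallCls X)) (x : HallAlg C) : P x :=
  AlgConst.induction _ hadd hsmul (fun a => by
    have := hb a.rep
    rwa [hallCls, isoCls_rep] at this) x

/-- The invariants of [N][M] depend on M only through the invariants of M. To see this, [N][P] is
computed twice, where P is the common cover of M and of its homology; both kernels are acyclic, so
the two answers differ from the two sides by the same scalar and the same shift. -/
lemma hallActLin_invMap (x y : HallAlg (Cpx A)) : hallActLin A x (invMap y) = invMap (x * y) := by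
  induction x using hallAlg_induction with
  | hadd x x' h h' => rw [map_add, LinearMap.add_apply, h, h', add_mul, map_add]
  | hsmul r x h => rw [map_smul, LinearMap.smul_apply, h, smul_mul_assoc, map_smul]
  | hb N =>
  induction y using hallAlg_induction with
  | hadd x x' h h' => rw [map_add, map_add, h, h', mul_add, map_add]
  | hsmul r x h => rw [map_smul, map_smul, h, mul_smul_comm, map_smul]
  | hb M =>
  rw [invMap_hallCls, hallActLin_hallCls]
  obtain ⟨K, K', P, f, g, f', g', hK, hK', h, h'⟩ := homology_resolution M
    (rep_isoCls (M.homology 0)).some.symm (rep_isoCls (M.homology 1)).some.symm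
  have e1 := invMap_mul_of_isSES_left h hK N
  have e2 := invMap_mul_of_isSES_left h' hK' N
  have e3 := cpxBds_of_isSES h (Or.inl hK)
  have e4 := cpxBds_of_isSES h' (Or.inl hK')
  have e5 : cpxBds (cpxZ (isoCls (M.homology 0)).rep (isoCls (M.homology 1)).rep) = 0 :=
    congrArg Prod.snd (cpxInv_cpxZ _ _)
  rw [e5, add_zero, e3] at e4
  rw [e1, ← e4, acyclicR_add_right, mul_smul, invShift_add] at e2
  have e6 := smul_right_injective _ (acyclicR_ne_zero _ _) e2
  refine (invShift_injective (cpxBds K) (e6.trans ?_)).symm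
  rw [map_smul]
  rfl

/-- The character `α ↦ acyclicR α κ`. -/
noncomputable def acyclicChar (κ : K0 A × K0 A) : Multiplicative (K0 A × K0 A) →* ℂ where
  toFun α := acyclicR α.toAdd κ
  map_one' := acyclicR_zero_left κ
  map_mul' _ _ := acyclicR_add_left _ _ _

/-- Shifting by κ multiplies the action of x by a scalar which is a character of the degree of x, so
the defect is absorbed by an automorphism of the graded algebra rather than by a number. -/
lemma hallActLin_invShift (x : HallAlg (Cpx A)) (κ : K0 A × K0 A) (w : InvSpace A) :
    hallActLin A x (invShift κ w) =
      invShift κ (hallActLin A ((cpxHallGrading A).twist (acyclicChar κ) x) w) := by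
  induction x using hallAlg_induction with
  | hadd x x' h h' => simp only [map_add, LinearMap.add_apply, h, h']
  | hsmul r x h => simp only [map_smul, LinearMap.smul_apply, h]
  | hb N =>
  rw [Grading.twist_homog _ (cpxHallGrading_homog A N), map_smul, LinearMap.smul_apply]
  induction w using Finsupp.induction_linear with
  | zero => simp
  | add x y hx hy => simp only [map_add, smul_add, hx, hy]
  | single p c =>
    rw [← mul_one c, ← smul_eq_mul, ← Finsupp.smul_single]
    simp only [map_smul]
    rw [invShift_single, hallActLin_hallCls, hallActLin_hallCls, smul_comm _ c]
    congr 1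
    simp only [map_smul]
    rw [add_comm, acyclicR_add_right, mul_smul, invShift_add]
    rfl

/-- The invariants of actual complexes do not span, since their boundary classes are effective;
their translates do. Endomorphisms are therefore compared on translates. -/
lemma invShift_invMap_span (w : InvSpace A) : w ∈ Submodule.span ℂ
    {w | ∃ (κ : K0 A × K0 A) (y : HallAlg (Cpx A)), w = invShift κ (invMap y)} := by
  induction w using Finsupp.induction_linear with
  | zero => exact Submodule.zero_mem _
  | add x y hx hy => exact Submodule.add_mem _ hx hy
  | single p c =>
    rw [← mul_one c, ← smul_eq_mul, ← Finsupp.smul_single]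
    refine Submodule.smul_mem _ _ (Submodule.subset_span
      ⟨p.2, hallCls (cpxZ p.1.1.rep p.1.2.rep), ?_⟩)
    rw [invMap_hallCls, cpxInv_cpxZ, invShift_single, isoCls_rep, isoCls_rep, zero_add]

variable (A) in
/-- The action of the Hall algebra of complexes on the space of invariants. -/
noncomputable def hallAct : HallAlg (Cpx A) →ₐ[ℂ] Module.End ℂ (InvSpace A) :=
  have key : ∀ f g : Module.End ℂ (InvSpace A), (∀ κ y, f (invShift κ (invMap y)) =
      g (invShift κ (invMap y))) → f = g := fun f g h => LinearMap.ext fun w => by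
    induction invShift_invMap_span w using Submodule.span_induction with
    | mem w hw =>
      obtain ⟨κ, y, rfl⟩ := hw
      exact h κ y
    | zero => simp
    | add x y _ _ hx hy => rw [map_add, map_add, hx, hy]
    | smul c x _ hx => rw [map_smul, map_smul, hx]
  AlgHom.ofLinearMap (hallActLin A)
    (key _ _ fun κ y => by
      rw [hallActLin_invShift, map_one, hallActLin_invMap, one_mul, Module.End.one_apply])
    (fun x y => key _ _ fun κ z => by
      rw [Module.End.mul_apply, hallActLin_invShift, hallActLin_invShift, hallActLin_invShift,
        map_mul, hallActLin_invMap, hallActLin_invMap, hallActLin_invMap, mul_assoc])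

/-- In a left factor it is acyclic quotients, not acyclic subcomplexes, that can be split off. Embed
L in an acyclic K'. Then L and K ⊕ M both embed in K' ⊕ M with the same acyclic quotient K'/K, so
their products with [N] have equal shifted multiples. -/
lemma invMap_mul_of_acyclicRel {K L M : Cpx A} {f : K ⟶ L} {g : L ⟶ M} (h : IsSES f g)
    (hK : K.Acyclic) (N : Cpx A) :
    invMap (hallCls L * hallCls N) = invMap (hallCls (K ⊞ M) * hallCls N) := by
  obtain ⟨K', j, hK', hj⟩ := exists_mono_to_contractible L
  have := h.mono
  have := h.epi
  have hc : IsSES (f ≫ j) (cokernel.π (f ≫ j)) :=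
    isSES_of_desc inferInstance inferInstance (cokernel.condition _)
      fun t ht => ⟨cokernel.desc _ t ht, by simp⟩
  have hQ : (cokernel (f ≫ j)).Acyclic := (acyclic_of_isSES_left hc hK).1 hK'
  obtain ⟨s, hs⟩ := h.desc (j ≫ cokernel.π (f ≫ j)) (by rw [← Category.assoc, hc.zero])
  have h1 : IsSES (biprod.lift j g) (biprod.desc (cokernel.π (f ≫ j)) (-s)) := by
    have : Mono (biprod.lift j g) := Preadditive.mono_of_cancel_zero _ fun t ht => by
      rw [← cancel_mono j]
      simpa using congrArg (fun u => u ≫ biprod.fst) ht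
    have : Epi (biprod.desc (cokernel.π (f ≫ j)) (-s)) :=
      Preadditive.epi_of_cancel_zero _ fun t ht => by
        rw [← cancel_epi (cokernel.π (f ≫ j))]
        simpa using congrArg (fun u => biprod.inl ≫ u) ht
    refine isSES_of_desc inferInstance inferInstance (by simp [hs]) fun t ht => ?_
    rw [biprod.lift_eq, Preadditive.add_comp, Category.assoc, Category.assoc] at ht
    obtain ⟨w, hw⟩ := hc.desc (biprod.inl ≫ t) (by
      rw [Category.assoc, eq_neg_of_add_eq_zero_left ht, Preadditive.comp_neg, ← Category.assoc,
        h.zero, zero_comp, neg_zero])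
    refine ⟨w, biprod.hom_ext' _ _ (by simpa using hw) ?_⟩
    rw [← cancel_epi g, biprod.inr_desc_assoc, Preadditive.neg_comp, Preadditive.comp_neg,
      ← Category.assoc, hs, Category.assoc, hw]
    exact (eq_neg_of_add_eq_zero_right ht).symm
  have h2 : IsSES (biprod.map (f ≫ j) (𝟙 M)) (biprod.fst ≫ cokernel.π (f ≫ j)) := by
    refine isSES_of_desc inferInstance inferInstance (by simp) fun t ht => ?_
    obtain ⟨w, hw⟩ := hc.desc (biprod.inl ≫ t) (by
      simpa using congrArg (fun u => biprod.inl ≫ u) ht)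
    have h0 : biprod.inr ≫ t = 0 := by simpa using congrArg (fun u => biprod.inr ≫ u) ht
    refine ⟨w, biprod.hom_ext' _ _ (by simpa using hw) (by simp [h0])⟩
  have e1 := invMap_mul_of_isSES_right h1 hQ N
  rw [invMap_mul_of_isSES_right h2 hQ N] at e1
  exact (invShift_injective _ (smul_right_injective _ (acyclicL_ne_zero _ _) e1)).symm

lemma hallAct_eq_of_acyclicRel (x y : HallAlg (Cpx A)) (hxy : AcyclicRel A x y) :
    hallAct A x = hallAct A y := by
  obtain ⟨f, g, h, hK⟩ := hxy
  rename_i K L M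
  refine Finsupp.lhom_ext' fun p => LinearMap.ext_ring ?_
  change hallActLin A _ (Finsupp.single p 1) = hallActLin A _ (Finsupp.single p 1)
  rw [hallActLin_hallCls, hallActLin_hallCls, invMap_mul_of_acyclicRel h hK,
    cpxDeg_of_isSES h, ← cpxDeg_of_isSES (isSES_biprod _ _)]

open ZeroObject in
lemma hallCls_zero : hallCls (0 : Cpx A) = 1 := rfl

open ZeroObject in
lemma invMap_mul_of_acyclic {K : Cpx A} (hK : K.Acyclic) (N : Cpx A) :
    invMap (hallCls K * hallCls N) = acyclicL (cpxBds K) (cpxDeg (isoCls N)) •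
      invShift (cpxBds K) (invMap (hallCls N)) := by
  have h : IsSES (0 : (0 : Cpx A) ⟶ K) (𝟙 K) := isSES_id_zero (Iso.refl K) (isZero_zero _)
  rw [invMap_mul_of_isSES_right h hK, hallCls_zero, one_mul]

/-- An acyclic class translates each basis vector by its boundary classes and multiplies it by a
nonzero scalar c, so the inverse can be written down. -/
lemma isUnit_hallAct {K : Cpx A} (hK : K.Acyclic) : IsUnit (hallAct A (hallCls K)) := by
  let c : CpxInv A → ℂ := fun p => acyclicR (cpxDeg (isoCls K)) p.2 *
    acyclicL (cpxBds K) (cpxDeg (isoCls (cpxZ p.1.1.rep p.1.2.rep)))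
  have hc : ∀ p, c p ≠ 0 := fun p => mul_ne_zero (acyclicR_ne_zero _ _) (acyclicL_ne_zero _ _)
  have h : ∀ p, hallAct A (hallCls K) (Finsupp.single p 1) =
      Finsupp.single (p.1, p.2 + cpxBds K) (c p) := fun p => by
    change hallActLin A _ _ = _
    rw [hallActLin_hallCls, invMap_mul_of_acyclic hK, invMap_hallCls, cpxInv_cpxZ, map_smul,
      invShift_single, invShift_single, smul_smul, Finsupp.smul_single, smul_eq_mul, mul_one,
      isoCls_rep, isoCls_rep, zero_add, add_comm]
  let F : Module.End ℂ (InvSpace A) := Finsupp.linearCombination ℂ fun p : CpxInv A =>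
    Finsupp.single (p.1, p.2 - cpxBds K) (c (p.1, p.2 - cpxBds K))⁻¹
  have hF : ∀ p, F (Finsupp.single p 1) =
      Finsupp.single (p.1, p.2 - cpxBds K) (c (p.1, p.2 - cpxBds K))⁻¹ := fun p => by
    rw [Finsupp.linearCombination_single, one_smul]
  have hs : ∀ (G : Module.End ℂ (InvSpace A)) (p : CpxInv A) (r : ℂ),
      G (Finsupp.single p r) = r • G (Finsupp.single p 1) := fun G p r => by
    rw [← map_smul, Finsupp.smul_single, smul_eq_mul, mul_one]
  refine ⟨⟨hallAct A (hallCls K), F, ?_, ?_⟩, rfl⟩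
  · refine Finsupp.lhom_ext' fun p => LinearMap.ext_ring ?_
    change hallAct A (hallCls K) (F (Finsupp.single p 1)) = Finsupp.single p 1
    rw [hF, hs, h, Finsupp.smul_single, smul_eq_mul, inv_mul_cancel₀ (hc _), sub_add_cancel]
  · refine Finsupp.lhom_ext' fun p => LinearMap.ext_ring ?_
    change F (hallAct A (hallCls K) (Finsupp.single p 1)) = Finsupp.single p 1
    rw [h, hs, hF, Finsupp.smul_single, smul_eq_mul, add_sub_cancel_right, mul_inv_cancel₀ (hc _)]

variable (A) in
/-- The action of the quotient algebra on the space of invariants. -/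
noncomputable def quotAct : QuotHall A →ₐ[ℂ] Module.End ℂ (InvSpace A) :=
  RingQuot.liftAlgHom ℂ ⟨hallAct A, fun _ _ h => hallAct_eq_of_acyclicRel _ _ h⟩

lemma quotAct_mk (x : HallAlg (Cpx A)) :
    quotAct A (RingQuot.mkAlgHom ℂ (AcyclicRel A) x) = hallAct A x :=
  RingQuot.liftAlgHom_mkAlgHom_apply ..

lemma isUnit_quotAct (s : QuotHall A) (hs : s ∈ acyclicSet A) : IsUnit (quotAct A s) := by
  obtain ⟨c, K, hc, hK, rfl⟩ := hs
  rw [map_smul, quotCls, quotAct_mk]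
  exact (isUnit_hallAct hK).smul (Units.mk0 c hc)

variable (A) in
/-- The action of the modified Hall algebra on the space of invariants. -/
noncomputable def modAct : ModHall A →ₐ[ℂ] Module.End ℂ (InvSpace A) :=
  UnivLoc.lift (acyclicSet A) (quotAct A) isUnit_quotAct

variable (A) in
/-- The linear map which records the invariants of the classes of complexes in the modified Hall
algebra. -/
noncomputable def modInvMap : ModHall A →ₗ[ℂ] InvSpace A where
  toFun x := modAct A x (invMap 1)
  map_add' x y := by rw [map_add, LinearMap.add_apply]
  map_smul' c x := by rw [map_smul, LinearMap.smul_apply, RingHom.id_apply]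

lemma modInvMap_of (M : Cpx A) :
    modInvMap A (UnivLoc.of (acyclicSet A) (quotCls M)) = Finsupp.single (cpxInv M) 1 := by
  change modAct A _ _ = _
  rw [modAct, UnivLoc.lift_of, quotCls, quotAct_mk]
  change hallActLin A _ _ = _
  rw [hallActLin_invMap, mul_one, invMap_hallCls]

end InvariantSpace

/-! ### The universal localization as a right Ore localization -/

section OreLocalization

variable {R : Type*} [Ring R] [Algebra ℂ R] {S : Set R}

/-- `OreLocalization` consists of left fractions, so it is formed over the opposite ring and its
opposite is taken. The universal localization maps to it, hence an element that dies in the former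
dies in the latter, where vanishing is explicit. -/
lemma univLoc_eq_zero_iff (h1 : (1 : R) ∈ S) (hm : ∀ s ∈ S, ∀ t ∈ S, s * t ∈ S)
    (hore : ∀ r, ∀ s ∈ S, ∃ r', ∃ s' ∈ S, r * s' = s * r')
    (hrev : ∀ a, ∀ s ∈ S, s * a = 0 → ∃ s' ∈ S, a * s' = 0) (a : R)
    (ha : UnivLoc.of S a = 0) : ∃ s ∈ S, a * s = 0 := by
  let S' : Submonoid Rᵐᵒᵖ :=
    { carrier := {x | x.unop ∈ S}
      one_mem' := h1
      mul_mem' := fun hx hy => hm _ hy _ hx }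
  choose! num den hden hnd using hore
  let _ : OreLocalization.OreSet S' :=
    { ore_right_cancel := fun r₁ r₂ s h => by
        have h' : (s : Rᵐᵒᵖ).unop * (r₁.unop - r₂.unop) = 0 := by
          rw [mul_sub, sub_eq_zero]
          exact congrArg MulOpposite.unop h
        obtain ⟨s', hs', e⟩ := hrev _ _ s.2 h'
        refine ⟨⟨MulOpposite.op s', hs'⟩, MulOpposite.unop_injective ?_⟩
        rw [sub_mul, sub_eq_zero] at e
        exact e
      oreNum := fun r s => MulOpposite.op (num r.unop (s : Rᵐᵒᵖ).unop)
      oreDenom := fun r s => ⟨MulOpposite.op (den r.unop (s : Rᵐᵒᵖ).unop), hden _ _ s.2⟩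
      ore_eq := fun r s => MulOpposite.unop_injective (hnd r.unop (s : Rᵐᵒᵖ).unop s.2) }
  let n : Rᵐᵒᵖ →+* OreLocalization S' Rᵐᵒᵖ := OreLocalization.numeratorRingHom
  let f : R →ₐ[ℂ] (OreLocalization S' Rᵐᵒᵖ)ᵐᵒᵖ :=
    { toFun := fun x => MulOpposite.op (n (MulOpposite.op x))
      map_one' := MulOpposite.unop_injective (map_one n)
      map_mul' := fun x y => MulOpposite.unop_injective
        (map_mul n (MulOpposite.op y) (MulOpposite.op x))
      map_zero' := MulOpposite.unop_injective (map_zero n)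
      map_add' := fun x y => MulOpposite.unop_injective
        (map_add n (MulOpposite.op x) (MulOpposite.op y))
      commutes' := fun c => rfl }
  have hf : ∀ s ∈ S, IsUnit (f s) := fun s hs =>
    (OreLocalization.numerator_isUnit (⟨MulOpposite.op s, hs⟩ : S')).op
  have h0 := UnivLoc.lift_of S f hf a
  rw [ha, map_zero] at h0
  have h2 : n (MulOpposite.op a) = n 0 := by
    rw [map_zero]
    exact congrArg MulOpposite.unop h0.symm
  obtain ⟨x, y, h3, h4⟩ := OreLocalization.oreDiv_eq_iff.1 h2
  refine ⟨y.unop, ?_, ?_⟩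
  · have : y = x := by simpa using h4.symm
    rw [this]
    exact x.2
  · have h5 : (0 : Rᵐᵒᵖ) = y * MulOpposite.op a := by simpa using h3
    exact congrArg MulOpposite.unop h5.symm

/-- The elements which some s in S multiplies from the right into the image of R contain the
generators, and the Ore condition makes them closed under sums and products. The criterion for
equality comes from `univLoc_eq_zero_iff`. -/
lemma isRightLocalization_univLoc (h1 : (1 : R) ∈ S) (hm : ∀ s ∈ S, ∀ t ∈ S, s * t ∈ S)
    (hore : ∀ r, ∀ s ∈ S, ∃ r', ∃ s' ∈ S, r * s' = s * r')
    (hrev : ∀ a, ∀ s ∈ S, s * a = 0 → ∃ s' ∈ S, a * s' = 0) :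
    IsRightLocalization S (UnivLoc.of S : R →+* UnivLoc R S) where
  isUnit s hs := UnivLoc.isUnit_of S ⟨s, hs⟩
  surj t := by
    have hu : ∀ s ∈ S, IsUnit (UnivLoc.of S s) := fun s hs => UnivLoc.isUnit_of S ⟨s, hs⟩
    have key : ∀ (x : UnivLoc R S) (a s : R), s ∈ S → x * UnivLoc.of S s = UnivLoc.of S a →
        ∃ a : R, ∃ s ∈ S, x = UnivLoc.of S a * Ring.inverse (UnivLoc.of S s) :=
      fun x a s hs h => ⟨a, s, hs, by rw [← h, Ring.mul_inverse_cancel_right _ _ (hu s hs)]⟩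
    suffices h : ∃ a : R, ∃ s ∈ S, t * UnivLoc.of S s = UnivLoc.of S a by
      obtain ⟨a, s, hs, h⟩ := h
      exact key t a s hs h
    obtain ⟨t, rfl⟩ := RingQuot.mkAlgHom_surjective ℂ (UnivLocRel R S) t
    induction t using FreeAlgebra.induction with
    | grade0 r =>
      refine ⟨algebraMap ℂ R r, 1, h1, ?_⟩
      rw [map_one, mul_one, AlgHom.commutes, AlgHom.commutes]
    | grade1 x =>
      obtain x | s := x
      · exact ⟨x, 1, h1, by rw [map_one, mul_one]; rfl⟩
      · exact ⟨1, s, s.2, by rw [map_one]; exact UnivLoc.inv_mul_of S s⟩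
    | mul x y hx hy =>
      obtain ⟨a, s, hs, h⟩ := hx
      obtain ⟨b, t, ht, h'⟩ := hy
      obtain ⟨b', s', hs', e⟩ := hore b s hs
      refine ⟨a * b', t * s', hm _ ht _ hs', ?_⟩
      rw [map_mul, map_mul, map_mul, mul_assoc, ← mul_assoc _ (UnivLoc.of S t), h', ← map_mul, e,
        map_mul, ← mul_assoc, h]
    | add x y hx hy =>
      obtain ⟨a, s, hs, h⟩ := hx
      obtain ⟨b, t, ht, h'⟩ := hy
      obtain ⟨r', s', hs', e⟩ := hore s t ht
      refine ⟨a * s' + b * r', s * s', hm _ hs _ hs', ?_⟩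
      rw [map_add, add_mul, map_add, map_mul _ a, map_mul _ b, ← h, ← h', mul_assoc, mul_assoc,
        ← map_mul, ← map_mul, e]
  eq_iff a b := by
    refine ⟨fun h => ?_, fun ⟨s, hs, h⟩ => ?_⟩
    · obtain ⟨s, hs, e⟩ := univLoc_eq_zero_iff h1 hm hore hrev (a - b)
        (by rw [map_sub, sub_eq_zero]; exact h)
      exact ⟨s, hs, by rwa [sub_mul, sub_eq_zero] at e⟩
    · have h' := congrArg (UnivLoc.of S) h
      rw [map_mul, map_mul] at h'
      exact (UnivLoc.isUnit_of S ⟨s, hs⟩).mul_left_injective h'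

end OreLocalization

/-! ### The Ore condition for acyclic classes in the quotient algebra -/

section QuotientAlgebra

variable {A : Type u} [Category.{v} A] [Abelian A]

lemma Grading.twist_twist {R : Type*} [Ring R] [Algebra ℂ R] {G : Type*} [AddCommGroup G]
    (D : Grading R G) (χ χ' : Multiplicative G →* ℂ) (h : ∀ g, χ g * χ' g = 1) (x : R) :
    D.twist χ (D.twist χ' x) = x := by
  induction x using D.induction with
  | h0 => simp
  | hadd x y hx hy => simp [hx, hy]
  | hom g x hx =>
    rw [Grading.twist_homog _ hx, map_smul, Grading.twist_homog _ hx, smul_smul, mul_comm, h,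
      one_smul]

lemma exists_epi_from_contractible (L : Cpx A) :
    ∃ (K : Cpx A) (q : K ⟶ L), K.Acyclic ∧ Epi q := by
  refine ⟨cpxD 0 (L.X 0) ⊞ cpxD 1 (L.X 1), biprod.desc (fromCpxD 0 (𝟙 (L.X 0)))
    (fromCpxD 1 (𝟙 (L.X 1))), acyclic_biprod (cpxD_acyclic _ _) (cpxD_acyclic _ _), ?_⟩
  refine Preadditive.epi_of_cancel_zero _ fun t ht => cpx_hom_ext 0 ?_ ?_
  · have h := congrArg (fun u => HomologicalComplex.Hom.f (biprod.inl ≫ u) 0) ht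
    simp only [biprod.inl_desc_assoc, HomologicalComplex.comp_f, fromCpxD_f₀] at h
    rw [Category.comp_id, HomologicalComplex.zero_f, comp_zero] at h
    exact zero_of_epi_comp _ h
  · have h := congrArg (fun u => HomologicalComplex.Hom.f (biprod.inr ≫ u) 1) ht
    simp only [biprod.inr_desc_assoc, HomologicalComplex.comp_f, fromCpxD_f₀] at h
    rw [Category.comp_id, HomologicalComplex.zero_f, comp_zero] at h
    exact zero_of_epi_comp _ h

/-- An extension with acyclic quotient and the direct sum become isomorphic up to acyclic
complexes. -/
lemma exists_common_cover {K X M : Cpx A} {f : M ⟶ X} {g : X ⟶ K} (h : IsSES f g)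
    (hK : K.Acyclic) : ∃ (K₂ P : Cpx A) (a : K₂ ⟶ P) (b : P ⟶ X) (a' : K₂ ⟶ P) (b' : P ⟶ K ⊞ M),
      K₂.Acyclic ∧ IsSES a b ∧ IsSES a' b' := by
  obtain ⟨K₁, q, hK₁, hq⟩ := exists_epi_from_contractible X
  have := h.epi
  have := h.mono
  have hk : IsSES (kernel.ι (q ≫ g)) (q ≫ g) :=
    isSES_of_lift inferInstance inferInstance (kernel.condition _)
      fun t ht => ⟨kernel.lift _ t ht, by simp⟩
  obtain ⟨s, hs⟩ := h.lift (kernel.ι (q ≫ g) ≫ q) (by rw [Category.assoc, hk.zero])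
  -- Both X and K ⊕ M are quotients of K₁ ⊕ M by the kernel of K₁ → X → K, which is acyclic because
  -- K₁ and K are.
  refine ⟨kernel (q ≫ g), K₁ ⊞ M, biprod.lift (kernel.ι (q ≫ g)) (-s), biprod.desc q f,
    kernel.ι (q ≫ g) ≫ biprod.inl, biprod.map (q ≫ g) (𝟙 M),
    (acyclic_of_isSES_right hk hK).1 hK₁, ?_, ?_⟩
  · have : Mono (biprod.lift (kernel.ι (q ≫ g)) (-s)) :=
      Preadditive.mono_of_cancel_zero _ fun t ht => by
        rw [← cancel_mono (kernel.ι (q ≫ g)), zero_comp]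
        simpa using congrArg (fun u => u ≫ biprod.fst) ht
    have : Epi (biprod.desc q f) := Preadditive.epi_of_cancel_zero _ fun t ht => by
      rw [← cancel_epi q]
      simpa using congrArg (fun u => biprod.inl ≫ u) ht
    refine isSES_of_lift inferInstance inferInstance (by simp [hs]) fun t ht => ?_
    rw [biprod.desc_eq, Preadditive.comp_add] at ht
    have h0 : (t ≫ biprod.fst) ≫ q = -((t ≫ biprod.snd) ≫ f) := by
      rw [eq_neg_iff_add_eq_zero, Category.assoc, Category.assoc, ht]
    obtain ⟨w, hw⟩ := hk.lift (t ≫ biprod.fst) (by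
      rw [← Category.assoc, h0, Preadditive.neg_comp, Category.assoc, h.zero, comp_zero, neg_zero])
    refine ⟨w, biprod.hom_ext _ _ (by simp [hw]) ?_⟩
    rw [← cancel_mono f, Category.assoc, Category.assoc, biprod.lift_snd_assoc,
      Preadditive.neg_comp, Preadditive.comp_neg, hs, ← Category.assoc, hw, h0, neg_neg]
  · refine isSES_of_lift inferInstance inferInstance (by
      rw [Category.assoc, biprod.inl_map, ← Category.assoc, hk.zero, zero_comp]) fun t ht => ?_
    obtain ⟨w, hw⟩ := hk.lift (t ≫ biprod.fst) (by
      simpa using congrArg (fun u => u ≫ biprod.fst) ht)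
    have h0 : t ≫ biprod.snd = 0 := by simpa using congrArg (fun u => u ≫ biprod.snd) ht
    refine ⟨w, biprod.hom_ext _ _ (by simpa using hw) (by simp [h0])⟩

variable [HereditaryFinite A]

lemma quotCls_congr {M N : Cpx A} (e : M ≅ N) : quotCls M = quotCls N := by
  rw [quotCls, hallCls_congr e, quotCls]

lemma quotCls_of_isSES {K L M : Cpx A} {f : K ⟶ L} {g : L ⟶ M} (h : IsSES f g) (hK : K.Acyclic) :
    quotCls L = quotCls (K ⊞ M) :=
  RingQuot.mkAlgHom_rel ℂ (AcyclicRel.mk f g h hK)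

lemma quotHall_induction {P : QuotHall A → Prop} (hadd : ∀ x y, P x → P y → P (x + y))
    (hsmul : ∀ (r : ℂ) x, P x → P (r • x)) (hb : ∀ M, P (quotCls M)) (x : QuotHall A) : P x := by
  obtain ⟨x, rfl⟩ := RingQuot.mkAlgHom_surjective ℂ (AcyclicRel A) x
  induction x using hallAlg_induction with
  | hadd x y hx hy => rw [map_add]; exact hadd _ _ hx hy
  | hsmul r x hx => rw [map_smul]; exact hsmul _ _ hx
  | hb M => exact hb M

lemma quotGrading_homog (M : Cpx A) :
    (quotGrading A).Homog (cpxDeg (isoCls M)) (quotCls M) :=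
  Grading.ringQuot_homog _ (cpxHallGrading_homog A M)

/-- The linear map `[M] ↦ [K ⊕ M]`. -/
noncomputable def quotAddCls (K : Cpx A) : HallAlg (Cpx A) →ₗ[ℂ] QuotHall A :=
  (hallConst (Cpx A)).basis.constr ℂ fun x => quotCls (K ⊞ x.rep)

lemma quotAddCls_hallCls (K M : Cpx A) : quotAddCls K (hallCls M) = quotCls (K ⊞ M) := by
  rw [quotAddCls, hallCls, Module.Basis.constr_basis]
  exact quotCls_congr (biprod.mapIso (Iso.refl K) (rep_isoCls M).some)

open ZeroObject in
lemma quotCls_zero : quotCls (0 : Cpx A) = 1 := by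
  rw [quotCls, hallCls_zero, map_one]

-- Every extension of M by K has K as an acyclic subcomplex, so the defining relation identifies all
-- the middle terms with K ⊕ M and the product collapses to one class.
open ZeroObject in
lemma quotCls_mul_acyclic (M : Cpx A) {K : Cpx A} (hK : K.Acyclic) :
    quotCls M * quotCls K = acyclicR (cpxDeg (isoCls M)) (cpxBds K) • quotCls (K ⊞ M) := by
  have := subsingleton_ext_two_of_acyclic_right hK M
  have h : IsSES (𝟙 K) (0 : K ⟶ (0 : Cpx A)) := by
    have : Epi (0 : K ⟶ (0 : Cpx A)) := ⟨fun _ _ _ => (isZero_zero _).eq_of_src _ _⟩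
    exact isSES_of_lift inferInstance this comp_zero fun t _ => ⟨t, Category.comp_id t⟩
  have key := map_hallCls_mul_of_isSES (N := M) h (RingQuot.mkAlgHom ℂ (AcyclicRel A)).toLinearMap
    (quotAddCls K) fun f g h => by rw [quotAddCls_hallCls]; exact quotCls_of_isSES h hK
  rw [hallCls_zero, mul_one, quotAddCls_hallCls, card_div_of_acyclic_right hK] at key
  rw [← key]
  exact (map_mul (RingQuot.mkAlgHom ℂ (AcyclicRel A)) _ _).symm

open ZeroObject in
lemma one_mem_acyclicSet : (1 : QuotHall A) ∈ acyclicSet A :=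
  ⟨1, 0, one_ne_zero, acyclic_zero (isZero_zero _), by rw [quotCls_zero, one_smul]⟩

lemma quotCls_mem_acyclicSet {K : Cpx A} (hK : K.Acyclic) : quotCls K ∈ acyclicSet A :=
  ⟨1, K, one_ne_zero, hK, (one_smul _ _).symm⟩

lemma smul_mem_acyclicSet {s : QuotHall A} (hs : s ∈ acyclicSet A) {c : ℂ} (hc : c ≠ 0) :
    c • s ∈ acyclicSet A := by
  obtain ⟨c', K, hc', hK, rfl⟩ := hs
  exact ⟨c * c', K, mul_ne_zero hc hc', hK, by rw [smul_smul]⟩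

lemma mul_mem_acyclicSet {s t : QuotHall A} (hs : s ∈ acyclicSet A) (ht : t ∈ acyclicSet A) :
    s * t ∈ acyclicSet A := by
  obtain ⟨c, K, hc, hK, rfl⟩ := hs
  obtain ⟨c', K', hc', hK', rfl⟩ := ht
  rw [smul_mul_smul_comm, quotCls_mul_acyclic K hK', smul_smul]
  exact ⟨_, K' ⊞ K, mul_ne_zero (mul_ne_zero hc hc') (acyclicR_ne_zero _ _),
    acyclic_biprod hK' hK, rfl⟩

lemma acyclicSet_comm {s t : QuotHall A} (hs : s ∈ acyclicSet A) (ht : t ∈ acyclicSet A) :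
    ∃ c : ℂ, s * t = c • (t * s) := by
  obtain ⟨c, K, hc, hK, rfl⟩ := hs
  obtain ⟨c', K', hc', hK', rfl⟩ := ht
  refine ⟨acyclicR (cpxDeg (isoCls K)) (cpxBds K') / acyclicR (cpxDeg (isoCls K')) (cpxBds K), ?_⟩
  rw [smul_mul_smul_comm, smul_mul_smul_comm, quotCls_mul_acyclic K hK', quotCls_mul_acyclic K' hK,
    quotCls_congr (biprod.braiding K' K), smul_smul, smul_smul, smul_smul]
  congr 1
  have := acyclicR_ne_zero (cpxDeg (isoCls K')) (cpxBds K)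
  field_simp

variable (A) in
/-- The elements of the quotient algebra annihilated by the class of an acyclic complex. -/
noncomputable def quotTorsion : Submodule ℂ (QuotHall A) where
  carrier := {a | ∃ s ∈ acyclicSet A, a * s = 0}
  zero_mem' := ⟨1, one_mem_acyclicSet, zero_mul 1⟩
  add_mem' := by
    rintro a b ⟨s, hs, h⟩ ⟨t, ht, h'⟩
    obtain ⟨c, hc⟩ := acyclicSet_comm hs ht
    refine ⟨s * t, mul_mem_acyclicSet hs ht, ?_⟩
    rw [add_mul, ← mul_assoc, h, zero_mul, hc, mul_smul_comm, ← mul_assoc, h', zero_mul, smul_zero,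
      add_zero]
  smul_mem' := by
    rintro c a ⟨s, hs, h⟩
    exact ⟨s, hs, by rw [smul_mul_assoc, h, smul_zero]⟩

/-- The ideal imposes relations for acyclic subcomplexes only. For an acyclic quotient, right
multiplication by [K₂] turns both classes into the same multiple of the class of their common cover.
-/
lemma quotCls_sub_mem_torsion {K X M : Cpx A} {f : M ⟶ X} {g : X ⟶ K} (h : IsSES f g)
    (hK : K.Acyclic) : quotCls X - quotCls (K ⊞ M) ∈ quotTorsion A := by
  obtain ⟨K₂, P, a, b, a', b', hK₂, h1, h2⟩ := exists_common_cover h hK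
  refine ⟨quotCls K₂, quotCls_mem_acyclicSet hK₂, ?_⟩
  have hd : cpxDeg (isoCls X) = cpxDeg (isoCls (K ⊞ M)) := by
    rw [cpxDeg_of_isSES h, cpxDeg_of_isSES (isSES_biprod K M), add_comm]
  rw [sub_mul, quotCls_mul_acyclic _ hK₂, quotCls_mul_acyclic _ hK₂, ← quotCls_of_isSES h1 hK₂,
    ← quotCls_of_isSES h2 hK₂, hd, sub_self]

-- Each extension of K by M has acyclic quotient K, hence equals K ⊕ M modulo torsion. Left
-- multiplication by an acyclic class is thus known only modulo torsion, unlike right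
-- multiplication.
open ZeroObject in
lemma acyclic_mul_sub_mem_torsion {K : Cpx A} (hK : K.Acyclic) (M : Cpx A) :
    quotCls K * quotCls M - acyclicL (cpxBds K) (cpxDeg (isoCls M)) • quotCls (K ⊞ M) ∈
      quotTorsion A := by
  have := subsingleton_ext_two_of_acyclic_left hK M
  have h : IsSES (0 : (0 : Cpx A) ⟶ K) (𝟙 K) := isSES_id_zero (Iso.refl K) (isZero_zero _)
  have key := map_mul_hallCls_of_isSES (N := M) h
    ((quotTorsion A).mkQ ∘ₗ (RingQuot.mkAlgHom ℂ (AcyclicRel A)).toLinearMap)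
    ((quotTorsion A).mkQ ∘ₗ quotAddCls K) fun f g h => by
      rw [LinearMap.comp_apply, LinearMap.comp_apply, quotAddCls_hallCls, ← sub_eq_zero, ← map_sub]
      exact (Submodule.Quotient.mk_eq_zero _).2 (quotCls_sub_mem_torsion h hK)
  rw [hallCls_zero, one_mul, LinearMap.comp_apply, LinearMap.comp_apply, quotAddCls_hallCls,
    card_div_of_acyclic_left hK, ← map_smul, ← sub_eq_zero, ← map_sub] at key
  have := (Submodule.Quotient.mk_eq_zero _).1 key
  rw [AlgHom.toLinearMap_apply, map_mul] at this
  exact this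

lemma acyclicL_add_right (κ α α' : K0 A × K0 A) :
    acyclicL κ (α + α') = acyclicL κ α * acyclicL κ α' := by
  simp only [acyclicL, Prod.fst_add, Prod.snd_add, eulerForm_add_right]
  push_cast
  rw [← mul_inv]
  congr 1
  ring

lemma acyclicL_zero_right (κ : K0 A × K0 A) : acyclicL κ 0 = 1 := by
  simp [acyclicL, eulerForm_zero_right]

lemma acyclicL_zero_left (κ : K0 A × K0 A) : acyclicL 0 κ = 1 := by
  simp [acyclicL, eulerForm_zero_left]

/-- The character by which the class of an acyclic complex commutes with the other classes. -/
noncomputable def acyclicConjChar (κ : K0 A × K0 A) : Multiplicative (K0 A × K0 A) →* ℂ where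
  toFun α := acyclicL κ α.toAdd / acyclicR α.toAdd κ
  map_one' := by
    change acyclicL κ 0 / acyclicR 0 κ = 1
    rw [acyclicR_zero_left, acyclicL_zero_right, div_one]
  map_mul' α β := by
    change acyclicL κ (α.toAdd + β.toAdd) / acyclicR (α.toAdd + β.toAdd) κ = _
    rw [acyclicR_add_left, acyclicL_add_right, mul_div_mul_comm]

lemma acyclicConjChar_mul_neg (κ : K0 A × K0 A) (α : Multiplicative (K0 A × K0 A)) :
    acyclicConjChar κ α * acyclicConjChar (-κ) α = 1 := by
  change acyclicL κ α.toAdd / acyclicR α.toAdd κ * (acyclicL (-κ) α.toAdd / acyclicR α.toAdd (-κ)) = 1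
  rw [div_mul_div_comm, ← acyclicL_add_left, ← acyclicR_add_right, add_neg_cancel,
    acyclicR_zero_right, acyclicL_zero_left, div_one]

lemma acyclicConjChar_neg_mul (κ : K0 A × K0 A) (α : Multiplicative (K0 A × K0 A)) :
    acyclicConjChar (-κ) α * acyclicConjChar κ α = 1 := by
  rw [mul_comm, acyclicConjChar_mul_neg]

/-- Left and right multiplication by [K] both give multiples of [K ⊕ M], with scalars whose ratio is
a character of the degree of M. So [K] can be moved past a, at the cost of a twist of a and of
torsion; the Ore condition and reversibility both follow. -/
lemma acyclic_mul_sub_twist_mem_torsion {K : Cpx A} (hK : K.Acyclic) (a : QuotHall A) :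
    quotCls K * a - (quotGrading A).twist (acyclicConjChar (cpxBds K)) a * quotCls K ∈
      quotTorsion A := by
  induction a using quotHall_induction with
  | hadd x y hx hy =>
    rw [mul_add, map_add, add_mul, add_sub_add_comm]
    exact Submodule.add_mem _ hx hy
  | hsmul r x hx =>
    rw [mul_smul_comm, map_smul, smul_mul_assoc, ← smul_sub]
    exact Submodule.smul_mem _ _ hx
  | hb M =>
    rw [Grading.twist_homog _ (quotGrading_homog M), smul_mul_assoc, quotCls_mul_acyclic M hK,
      smul_smul]
    convert acyclic_mul_sub_mem_torsion hK M using 3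
    exact div_mul_cancel₀ _ (acyclicR_ne_zero _ _)

/-- The classes of the acyclic complexes satisfy the right Ore condition. -/
lemma acyclicSet_ore (r s : QuotHall A) (hs : s ∈ acyclicSet A) :
    ∃ r', ∃ s' ∈ acyclicSet A, r * s' = s * r' := by
  obtain ⟨c, K, hc, hK, rfl⟩ := hs
  obtain ⟨t, ht, h⟩ := acyclic_mul_sub_twist_mem_torsion hK
    ((quotGrading A).twist (acyclicConjChar (-cpxBds K)) r)
  rw [Grading.twist_twist _ _ _ (acyclicConjChar_mul_neg _), sub_mul, sub_eq_zero, mul_assoc,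
    mul_assoc] at h
  refine ⟨c⁻¹ • ((quotGrading A).twist (acyclicConjChar (-cpxBds K)) r * t), quotCls K * t,
    mul_mem_acyclicSet (quotCls_mem_acyclicSet hK) ht, ?_⟩
  rw [← h, smul_mul_smul_comm, mul_inv_cancel₀ hc, one_smul]

/-- Moving s past a shows that the twist of a is annihilated from the right by an acyclic class.
Undoing the twist rescales that class by a nonzero number and restores a. -/
lemma acyclicSet_reversible (a s : QuotHall A) (hs : s ∈ acyclicSet A) (h : s * a = 0) :
    ∃ s' ∈ acyclicSet A, a * s' = 0 := by
  obtain ⟨c, K, hc, hK, rfl⟩ := hs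
  obtain ⟨t, ht, h'⟩ := acyclic_mul_sub_twist_mem_torsion hK a
  rw [smul_mul_assoc, smul_eq_zero_iff_right hc] at h
  rw [h, zero_sub, neg_mul, neg_eq_zero, mul_assoc] at h'
  obtain ⟨c', K', hc', hK', e⟩ := mul_mem_acyclicSet (quotCls_mem_acyclicSet hK) ht
  rw [e, mul_smul_comm, smul_eq_zero_iff_right hc'] at h'
  have h2 := congrArg ((quotGrading A).twist (acyclicConjChar (-cpxBds K))) h'
  rw [map_mul, Grading.twist_twist _ _ _ (acyclicConjChar_neg_mul _), map_zero,
    Grading.twist_homog _ (quotGrading_homog K')] at h2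
  refine ⟨_, smul_mem_acyclicSet (quotCls_mem_acyclicSet hK') ?_, h2⟩
  intro h0
  have := acyclicConjChar_mul_neg (cpxBds K) (Multiplicative.ofAdd (cpxDeg (isoCls K')))
  rw [h0, mul_zero] at this
  exact zero_ne_one this

variable (A) in
/-- The modified Hall algebra is a right localization. -/
lemma modHall_isRightLocalization :
    IsRightLocalization (acyclicSet A) (UnivLoc.of (acyclicSet A) : QuotHall A →+* ModHall A) :=
  isRightLocalization_univLoc one_mem_acyclicSet (fun _ hs _ ht => mul_mem_acyclicSet hs ht)
    (fun r s hs => acyclicSet_ore r s hs) fun a s hs h => acyclicSet_reversible a s hs h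

end QuotientAlgebra

/-! ### Units in a twisted graded algebra -/

section TwistedUnits

variable {R : Type*} [Ring R] [Algebra ℂ R] {G : Type*} [AddCommGroup G]

lemma Bichar.ne_zero (σ : Bichar G) (g h : G) : σ.toFun g h ≠ 0 := fun h0 => by
  have := σ.add_left g (-g) h
  rw [h0, zero_mul, add_neg_cancel, σ.zero_left] at this
  exact one_ne_zero this

lemma Twisted.mk_mul_mk {D : Grading R G} (σ : Bichar G) {g h : G} {x y : R} (hx : D.Homog g x)
    (hy : D.Homog h y) :
    Twisted.mk D σ x * Twisted.mk D σ y = σ.toFun g h • Twisted.mk D σ (x * y) :=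
  (congrArg (Twisted.mk D σ) (Twisted.tmul_homog σ hx hy)).trans (map_smul _ _ _)

lemma Twisted.mk_one (D : Grading R G) (σ : Bichar G) : Twisted.mk D σ 1 = 1 := rfl

lemma Twisted.isUnit_mk {D : Grading R G} (σ : Bichar G) {g h : G} {x y : R} (hx : D.Homog g x)
    (hy : D.Homog h y) (hxy : x * y = 1) (hyx : y * x = 1) : IsUnit (Twisted.mk D σ x) := by
  refine isUnit_iff_exists_and_exists.2 ⟨⟨(σ.toFun g h)⁻¹ • Twisted.mk D σ y, ?_⟩,
    ⟨(σ.toFun h g)⁻¹ • Twisted.mk D σ y, ?_⟩⟩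
  · rw [mul_smul_comm, Twisted.mk_mul_mk σ hx hy, hxy, smul_smul, inv_mul_cancel₀ (σ.ne_zero _ _),
      one_smul, Twisted.mk_one]
  · rw [smul_mul_assoc, Twisted.mk_mul_mk σ hy hx, hyx, smul_smul, inv_mul_cancel₀ (σ.ne_zero _ _),
      one_smul, Twisted.mk_one]

end TwistedUnits

/-! ### Acyclic classes and normal forms in the twisted algebra -/

section TwistedModifiedHallAlgebra

variable {A : Type u} [Category.{v} A] [Abelian A]

lemma cpxDeg_cpxD (i : ZMod 2) (X : A) : cpxDeg (isoCls (cpxD i X)) = (k0Cls X, k0Cls X) := by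
  rw [cpxDeg_isoCls]
  match (i : Fin 2) with
  | 0 => exact Prod.ext (k0Cls_iso (cpxDIso₀ 0 X)) (k0Cls_iso (cpxDIso₁ 0 X))
  | 1 => exact Prod.ext (k0Cls_iso (cpxDIso₁ 1 X)) (k0Cls_iso (cpxDIso₀ 1 X))

lemma cpxDeg_cpxMk {X₀ X₁ : A} (d₀ : X₀ ⟶ X₁) (d₁ : X₁ ⟶ X₀) (h₀ : d₀ ≫ d₁ = 0)
    (h₁ : d₁ ≫ d₀ = 0) : cpxDeg (isoCls (cpxMk d₀ d₁ h₀ h₁)) = (k0Cls X₀, k0Cls X₁) :=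
  cpxDeg_isoCls _

lemma cpxBds_cpxZ (X₀ X₁ : A) : cpxBds (cpxZ X₀ X₁) = 0 := congrArg Prod.snd (cpxInv_cpxZ X₀ X₁)

variable [HereditaryFinite A]

lemma sqrtEuler_ne_zero (α β : K0 A) : sqrtEuler α β ≠ 0 :=
  Complex.ofReal_ne_zero.2 (Real.sqrt_pos.2 (eulerForm_pos α β)).ne'

lemma sqrtEuler_neg_left (α β : K0 A) : sqrtEuler (-α) β = (sqrtEuler α β)⁻¹ := by
  exact eq_inv_of_mul_eq_one_left (by
    rw [← sqrtEuler_add_left, neg_add_cancel, sqrtEuler_zero_left])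

lemma sqrtEuler_neg_right (α β : K0 A) : sqrtEuler α (-β) = (sqrtEuler α β)⁻¹ := by
  exact eq_inv_of_mul_eq_one_left (by
    rw [← sqrtEuler_add_right, neg_add_cancel, sqrtEuler_zero_right])

lemma sqrtEuler_sub_left (α α' β : K0 A) :
    sqrtEuler (α - α') β = sqrtEuler α β / sqrtEuler α' β := by
  rw [sub_eq_add_neg, sqrtEuler_add_left, sqrtEuler_neg_left, div_eq_mul_inv]

lemma sqrtEuler_sub_right (α β β' : K0 A) :
    sqrtEuler α (β - β') = sqrtEuler α β / sqrtEuler α β' := by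
  rw [sub_eq_add_neg, sqrtEuler_add_right, sqrtEuler_neg_right, div_eq_mul_inv]

lemma sqrtEuler_mul_self (α β : K0 A) : sqrtEuler α β * sqrtEuler α β = (eulerForm α β : ℂ) := by
  rw [sqrtEuler, ← Complex.ofReal_mul, Real.mul_self_sqrt (eulerForm_pos _ _).le]

lemma cwForm_toFun (α β : K0 A × K0 A) :
    (cwForm A).toFun α β = sqrtEuler α.1 β.1 * sqrtEuler α.2 β.2 := by
  change ((√(eulerForm α.1 β.1 * eulerForm α.2 β.2) : ℝ) : ℂ) = _
  rw [Real.sqrt_mul (eulerForm_pos _ _).le, Complex.ofReal_mul]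
  rfl

lemma acyclicR_eq (α κ : K0 A × K0 A) : acyclicR α κ =
    (sqrtEuler α.2 κ.1 * sqrtEuler α.2 κ.1 * (sqrtEuler α.1 κ.2 * sqrtEuler α.1 κ.2))⁻¹ := by
  rw [sqrtEuler_mul_self, sqrtEuler_mul_self, acyclicR]
  push_cast
  rfl

lemma acyclicL_eq (κ α : K0 A × K0 A) : acyclicL κ α =
    (sqrtEuler κ.1 α.1 * sqrtEuler κ.1 α.1 * (sqrtEuler κ.2 α.2 * sqrtEuler κ.2 α.2))⁻¹ := by
  rw [sqrtEuler_mul_self, sqrtEuler_mul_self, acyclicL]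
  push_cast
  rfl

/-- An acyclic complex with boundary classes κ has degree (κ.1 + κ.2, κ.1 + κ.2). The twist
contributes square roots of four Euler pairings, two of which are inverted by `acyclicR`; what is
left pairs the differences of the two components. -/
lemma cwForm_mul_acyclicR (α κ : K0 A × K0 A) :
    (cwForm A).toFun α (κ.1 + κ.2, κ.1 + κ.2) * acyclicR α κ =
      sqrtEuler (α.1 - α.2) (κ.1 - κ.2) := by
  have h := sqrtEuler_ne_zero (A := A)
  simp only [cwForm_toFun, acyclicR_eq, sqrtEuler_add_right, sqrtEuler_sub_left,
    sqrtEuler_sub_right]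
  field_simp [h]

lemma cwForm_mul_acyclicL (κ α : K0 A × K0 A) :
    (cwForm A).toFun (κ.1 + κ.2, κ.1 + κ.2) α * acyclicL κ α =
      sqrtEuler (κ.1 - κ.2) (α.2 - α.1) := by
  have h := sqrtEuler_ne_zero (A := A)
  simp only [cwForm_toFun, acyclicL_eq, sqrtEuler_add_left, sqrtEuler_sub_left,
    sqrtEuler_sub_right]
  field_simp [h]

lemma cpxDeg_of_acyclic {K : Cpx A} (hK : K.Acyclic) :
    cpxDeg (isoCls K) = ((cpxBds K).1 + (cpxBds K).2, (cpxBds K).1 + (cpxBds K).2) := by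
  obtain ⟨L, X, Y, Z, f, g, f', g', h, h'⟩ := acyclic_resolution hK
  have d1 := cpxDeg_of_isSES h
  have d2 := cpxDeg_of_isSES h'
  have b1 := cpxBds_of_isSES h (Or.inr hK)
  have b2 := cpxBds_of_isSES h' (Or.inl (cpxD_acyclic 0 Y))
  rw [d2, cpxDeg_cpxD, cpxDeg_cpxD, cpxDeg_cpxD] at d1
  rw [b2, cpxBds_cpxD_zero, cpxBds_cpxD_one, cpxBds_cpxD_zero] at b1
  rw [← sub_eq_iff_eq_add'] at d1 b1
  rw [← d1, ← b1]
  refine Prod.ext ?_ ?_ <;> simp <;> abel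

lemma modHallGrading_homog (M : Cpx A) : (modHallGrading A).Homog (cpxDeg (isoCls M))
    (UnivLoc.of (acyclicSet A) (quotCls M)) :=
  univLocCoact_of _ _ (acyclicSet_homog A) (quotGrading_homog M)

variable (A) in
/-- The linear map sending the class of a complex to its class in the twisted algebra. -/
noncomputable def mhLin : HallAlg (Cpx A) →ₗ[ℂ] ModHallTw A :=
  (Twisted.mk (modHallGrading A) (cwForm A)).toLinearMap ∘ₗ
    (UnivLoc.of (acyclicSet A)).toLinearMap ∘ₗ (RingQuot.mkAlgHom ℂ (AcyclicRel A)).toLinearMap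

lemma mhCls_mul (L M : Cpx A) : mhCls L * mhCls M =
    (cwForm A).toFun (cpxDeg (isoCls L)) (cpxDeg (isoCls M)) •
      mhLin A (hallCls L * hallCls M) := by
  rw [mhCls, mhCls, Twisted.mk_mul_mk _ (modHallGrading_homog L) (modHallGrading_homog M),
    ← map_mul, quotCls, quotCls, ← map_mul]
  rfl

lemma mhCls_congr {M N : Cpx A} (e : M ≅ N) : mhCls M = mhCls N := by
  rw [mhCls, quotCls_congr e, mhCls]

open ZeroObject in
lemma mhCls_zero : mhCls (0 : Cpx A) = 1 := by
  rw [mhCls, quotCls_zero, map_one, Twisted.mk_one]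

lemma of_eq_zero_of_mem_torsion {a : QuotHall A} (h : a ∈ quotTorsion A) :
    UnivLoc.of (acyclicSet A) a = 0 := by
  obtain ⟨s, hs, h⟩ := h
  have h1 := congrArg (UnivLoc.of (acyclicSet A)) h
  rw [map_mul, map_zero] at h1
  exact (UnivLoc.isUnit_of (acyclicSet A) ⟨s, hs⟩).mul_left_eq_zero.1 h1

lemma mhCls_mul_acyclic (M : Cpx A) {K : Cpx A} (hK : K.Acyclic) :
    mhCls M * mhCls K = sqrtEuler ((cpxDeg (isoCls M)).1 - (cpxDeg (isoCls M)).2)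
      ((cpxBds K).1 - (cpxBds K).2) • mhCls (K ⊞ M) := by
  rw [mhCls, mhCls, Twisted.mk_mul_mk _ (modHallGrading_homog M) (modHallGrading_homog K),
    ← map_mul, quotCls_mul_acyclic M hK, map_smul, map_smul, smul_smul, cpxDeg_of_acyclic hK,
    cwForm_mul_acyclicR]
  rfl

lemma mhCls_acyclic_mul {K : Cpx A} (hK : K.Acyclic) (M : Cpx A) :
    mhCls K * mhCls M = sqrtEuler ((cpxBds K).1 - (cpxBds K).2)
      ((cpxDeg (isoCls M)).2 - (cpxDeg (isoCls M)).1) • mhCls (K ⊞ M) := by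
  have h := of_eq_zero_of_mem_torsion (acyclic_mul_sub_mem_torsion hK M)
  rw [map_sub, sub_eq_zero] at h
  rw [mhCls, mhCls, Twisted.mk_mul_mk _ (modHallGrading_homog K) (modHallGrading_homog M),
    ← map_mul, h, map_smul, map_smul, smul_smul, cpxDeg_of_acyclic hK,
    cwForm_mul_acyclicL]
  rfl

lemma mhCls_of_isSES_left {K L M : Cpx A} {f : K ⟶ L} {g : L ⟶ M} (h : IsSES f g)
    (hK : K.Acyclic) : mhCls L = mhCls (K ⊞ M) := by
  rw [mhCls, quotCls_of_isSES h hK, mhCls]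

/-- The two components of an acyclic complex have equal class, so the scalar is 1. Acyclic classes
therefore commute, and they generate a commutative group of units. -/
lemma mhCls_mul_mhCls_of_acyclic {K K' : Cpx A} (hK : K.Acyclic) (hK' : K'.Acyclic) :
    mhCls K * mhCls K' = mhCls (K ⊞ K') := by
  rw [mhCls_acyclic_mul hK, cpxDeg_of_acyclic hK', sub_self, sqrtEuler_zero_right, one_smul]

lemma isUnit_mhCls {K : Cpx A} (hK : K.Acyclic) : IsUnit (mhCls K) := by
  let s : acyclicSet A := ⟨quotCls K, quotCls_mem_acyclicSet hK⟩
  obtain ⟨g, hg⟩ := univLocCoact_inv (quotGrading A) (acyclicSet A) (acyclicSet_homog A) s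
  exact Twisted.isUnit_mk (D := modHallGrading A) _ (modHallGrading_homog K) hg
    (UnivLoc.of_mul_inv _ s) (UnivLoc.inv_mul_of _ s)

variable (A) in
/-- The group generated by the classes of the acyclic complexes. -/
noncomputable def acyclicUnits : Subgroup (ModHallTw A)ˣ :=
  Subgroup.closure {x | ∃ K : Cpx A, K.Acyclic ∧ (x : ModHallTw A) = mhCls K}

instance : IsMulCommutative (acyclicUnits A) :=
  Subgroup.isMulCommutative_closure (by
    rintro x ⟨K, hK, hx⟩ y ⟨K', hK', hy⟩
    refine Units.ext ?_
    rw [Units.val_mul, Units.val_mul, hx, hy, mhCls_mul_mhCls_of_acyclic hK hK',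
      mhCls_mul_mhCls_of_acyclic hK' hK]
    exact mhCls_congr (biprod.braiding _ _))

noncomputable instance : CommGroup (acyclicUnits A) where
  mul_comm := mul_comm'

/-- The class of an acyclic complex in the group of units. -/
noncomputable def acyclicUnit {K : Cpx A} (hK : K.Acyclic) : acyclicUnits A :=
  ⟨(isUnit_mhCls hK).unit, Subgroup.subset_closure ⟨K, hK, rfl⟩⟩

/-- The relation for the contractible subcomplex turns exact sequences into products of units, which
is what lets [K_X] and [K_X^*] be defined on the Grothendieck group. -/
lemma acyclicUnit_cpxD_of_isSES (i : ZMod 2) {M X L : A} (f : M ⟶ X) (g : X ⟶ L)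
    (h : IsSES f g) : Additive.ofMul (acyclicUnit (cpxD_acyclic i X)) =
      Additive.ofMul (acyclicUnit (cpxD_acyclic i M)) +
        Additive.ofMul (acyclicUnit (cpxD_acyclic i L)) := by
  refine Additive.toMul.injective (Subtype.ext (Units.ext ?_))
  change mhCls (cpxD i X) = mhCls (cpxD i M) * mhCls (cpxD i L)
  rw [mhCls_mul_mhCls_of_acyclic (cpxD_acyclic i M) (cpxD_acyclic i L)]
  exact mhCls_of_isSES_left (isSES_cpxDMap i h) (cpxD_acyclic i M)

variable (A) in
/-- The additive map `[X] ↦ [K_X]` or `[K_X^*]` with values in the units. -/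
noncomputable def mhKHom (i : ZMod 2) : K0 A →+ Additive (acyclicUnits A) :=
  k0Lift (fun X => Additive.ofMul (acyclicUnit (cpxD_acyclic i X))) (acyclicUnit_cpxD_of_isSES i)

lemma mhKHom_k0Cls (i : ZMod 2) (X : A) :
    mhKHom A i (k0Cls X) = Additive.ofMul (acyclicUnit (cpxD_acyclic i X)) :=
  k0Lift_k0Cls _ (acyclicUnit_cpxD_of_isSES i) X

/-- The unit of the twisted algebra which is the class of the acyclic complexes with the given
classes of boundaries. -/
noncomputable def mhK (κ : K0 A × K0 A) : ModHallTw A :=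
  ((Additive.toMul (α := acyclicUnits A) (mhKHom A 0 κ.1 + mhKHom A 1 κ.2)) : (ModHallTw A)ˣ)

lemma isUnit_mhK (κ : K0 A × K0 A) : IsUnit (mhK κ) := Units.isUnit _

lemma mhK_zero : mhK (0 : K0 A × K0 A) = 1 := by
  rw [mhK, Prod.fst_zero, Prod.snd_zero, map_zero, map_zero, add_zero]
  rfl

lemma mhK_add (κ κ' : K0 A × K0 A) : mhK (κ + κ') = mhK κ * mhK κ' := by
  rw [mhK, Prod.fst_add, Prod.snd_add, map_add (mhKHom A 0), map_add (mhKHom A 1),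
    add_add_add_comm]
  rfl

lemma mhK_cpxD_zero (X : A) : mhK (k0Cls X, 0) = mhCls (cpxD 0 X) := by
  rw [mhK, map_zero, add_zero, mhKHom_k0Cls]
  rfl

lemma mhK_cpxD_one (X : A) : mhK (0, k0Cls X) = mhCls (cpxD 1 X) := by
  rw [mhK, map_zero, zero_add, mhKHom_k0Cls]
  rfl

/-- In the resolution the class of L is a product in two ways, once with [K] and once with
contractible classes only. The contractible factor next to [K] is a unit and can be cancelled. -/
lemma mhCls_of_acyclic {K : Cpx A} (hK : K.Acyclic) : mhCls K = mhK (cpxBds K) := by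
  obtain ⟨L, X, Y, Z, f, g, f', g', h, h'⟩ := acyclic_resolution hK
  have b1 := cpxBds_of_isSES h (Or.inr hK)
  have b2 := cpxBds_of_isSES h' (Or.inl (cpxD_acyclic 0 Y))
  have t1 := mhCls_of_isSES_left h (cpxD_acyclic 0 X)
  have t2 := mhCls_of_isSES_left h' (cpxD_acyclic 0 Y)
  rw [← mhCls_mul_mhCls_of_acyclic (cpxD_acyclic _ _) hK] at t1
  rw [← mhCls_mul_mhCls_of_acyclic (cpxD_acyclic _ _) (cpxD_acyclic _ _), t1, ← mhK_cpxD_zero,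
    ← mhK_cpxD_zero, ← mhK_cpxD_one, ← mhK_add] at t2
  rw [b1, cpxBds_cpxD_zero, cpxBds_cpxD_zero, cpxBds_cpxD_one] at b2
  rw [← b2, mhK_add] at t2
  exact (isUnit_mhK _).mul_left_cancel t2

lemma sqrtSym_ne_zero (α β : K0 A) : sqrtSym α β ≠ 0 := by
  rw [sqrtSym_eq]
  exact mul_ne_zero (sqrtEuler_ne_zero _ _) (sqrtEuler_ne_zero _ _)

lemma sqrtSym_add_left (α α' β : K0 A) : sqrtSym (α + α') β = sqrtSym α β * sqrtSym α' β := by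
  simp only [sqrtSym_eq, sqrtEuler_add_left, sqrtEuler_add_right]
  ring

lemma sqrtSym_zero_left (β : K0 A) : sqrtSym 0 β = 1 := by
  rw [sqrtSym_eq, sqrtEuler_zero_left, sqrtEuler_zero_right, one_mul]

lemma sqrtSym_comm (α β : K0 A) : sqrtSym α β = sqrtSym β α := by
  rw [sqrtSym_eq, sqrtSym_eq, mul_comm]

lemma sqrtSym_neg_left (α β : K0 A) : sqrtSym (-α) β = (sqrtSym α β)⁻¹ := by
  exact eq_inv_of_mul_eq_one_left (by
    rw [← sqrtSym_add_left, neg_add_cancel, sqrtSym_zero_left])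

lemma sqrtSym_neg_right (α β : K0 A) : sqrtSym α (-β) = (sqrtSym α β)⁻¹ := by
  rw [sqrtSym_comm, sqrtSym_neg_left, sqrtSym_comm]

/-- For the class of an acyclic complex both orders of multiplication give multiples of [K ⊕ M], and
the ratio of the scalars is a symmetric form. The formula is stable under sums and negation of κ, so
it extends from contractible complexes to K₀ × K₀. -/
lemma mhK_mul_mhCls (κ : K0 A × K0 A) (M : Cpx A) : mhK κ * mhCls M =
    sqrtSym (κ.1 - κ.2) ((cpxDeg (isoCls M)).2 - (cpxDeg (isoCls M)).1) • (mhCls M * mhK κ) := by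
  set m := (cpxDeg (isoCls M)).2 - (cpxDeg (isoCls M)).1 with hm
  have hac : ∀ K : Cpx A, K.Acyclic → mhK (cpxBds K) * mhCls M =
      sqrtSym ((cpxBds K).1 - (cpxBds K).2) m • (mhCls M * mhK (cpxBds K)) := fun K hK => by
    rw [← mhCls_of_acyclic hK, mhCls_mul_acyclic M hK, mhCls_acyclic_mul hK M, ← hm,
      ← neg_sub (cpxDeg _).2, ← hm, smul_smul, sqrtSym_eq, sqrtEuler_neg_left, mul_assoc,
      mul_inv_cancel₀ (sqrtEuler_ne_zero _ _), mul_one]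
  have hadd : ∀ κ κ' : K0 A × K0 A,
      mhK κ * mhCls M = sqrtSym (κ.1 - κ.2) m • (mhCls M * mhK κ) →
      mhK κ' * mhCls M = sqrtSym (κ'.1 - κ'.2) m • (mhCls M * mhK κ') →
      mhK (κ + κ') * mhCls M = sqrtSym ((κ + κ').1 - (κ + κ').2) m • (mhCls M * mhK (κ + κ')) := by
    intro κ κ' h h'
    rw [mhK_add, mul_assoc, h', mul_smul_comm, ← mul_assoc, h, smul_mul_assoc, smul_smul,
      Prod.fst_add, Prod.snd_add, add_sub_add_comm, sqrtSym_add_left, mul_comm (sqrtSym _ _),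
      mul_assoc]
  have hneg : ∀ κ : K0 A × K0 A,
      mhK κ * mhCls M = sqrtSym (κ.1 - κ.2) m • (mhCls M * mhK κ) →
      mhK (-κ) * mhCls M = sqrtSym ((-κ).1 - (-κ).2) m • (mhCls M * mhK (-κ)) := by
    intro κ h
    have h1 : mhK (-κ) * mhK κ = 1 := by rw [← mhK_add, neg_add_cancel, mhK_zero]
    have h2 : mhK κ * mhK (-κ) = 1 := by rw [← mhK_add, add_neg_cancel, mhK_zero]
    have h3 : mhCls M * mhK κ = (sqrtSym (κ.1 - κ.2) m)⁻¹ • (mhK κ * mhCls M) := by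
      rw [h, smul_smul, inv_mul_cancel₀ (sqrtSym_ne_zero _ _), one_smul]
    have h4 : mhK (-κ) * (mhCls M * mhK κ) * mhK (-κ) = mhK (-κ) * mhCls M := by
      rw [mul_assoc, mul_assoc (mhCls M), h2, mul_one]
    rw [← h4, h3, mul_smul_comm, smul_mul_assoc, ← mul_assoc (mhK (-κ)), h1, one_mul,
      Prod.fst_neg, Prod.snd_neg, ← neg_sub', sqrtSym_neg_left]
  have hsum : κ = (κ.1, 0) + (0, κ.2) := by simp
  rw [hsum]
  refine hadd _ _ ?_ ?_
  · generalize κ.1 = x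
    induction x using k0_induction with
    | h0 => rw [← Prod.zero_eq_mk, mhK_zero]; simp [sqrtSym_zero_left]
    | hof X => simpa only [cpxBds_cpxD_zero] using hac _ (cpxD_acyclic 0 X)
    | hneg x hx => simpa only [Prod.neg_mk, neg_zero] using hneg _ hx
    | hadd x y hx hy => simpa only [Prod.mk_add_mk, add_zero] using hadd _ _ hx hy
  · generalize κ.2 = x
    induction x using k0_induction with
    | h0 => rw [← Prod.zero_eq_mk, mhK_zero]; simp [sqrtSym_zero_left]
    | hof X => simpa only [cpxBds_cpxD_one] using hac _ (cpxD_acyclic 1 X)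
    | hneg x hx => simpa only [Prod.neg_mk, neg_zero] using hneg _ hx
    | hadd x y hx hy => simpa only [Prod.mk_add_mk, add_zero] using hadd _ _ hx hy

/-- The class of a complex is determined by its homology and the classes of its boundaries. -/
lemma mhCls_eq (M : Cpx A) {H₀ H₁ : A} (j₀ : M.homology 0 ≅ H₀) (j₁ : M.homology 1 ≅ H₁) :
    mhCls M = sqrtEuler (k0Cls H₁ - k0Cls H₀) ((cpxBds M).1 - (cpxBds M).2) •
      (mhCls (cpxZ H₀ H₁) * mhK (cpxBds M)) := by
  obtain ⟨K, K', P, f, g, f', g', hK, hK', h, h'⟩ := homology_resolution M j₀ j₁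
  have d1 := cpxDeg_of_isSES h
  have d2 := cpxDeg_of_isSES h'
  have b1 := cpxBds_of_isSES h (Or.inl hK)
  have b2 := cpxBds_of_isSES h' (Or.inl hK')
  -- The class of the common cover P is a multiple both of [M] times a unit and of the class of the
  -- homology times a unit. Comparing the two expresses [M].
  have t1 := mhCls_mul_acyclic M hK
  have t2 := mhCls_mul_acyclic (cpxZ H₀ H₁) hK'
  rw [← mhCls_of_isSES_left h hK, mhCls_of_acyclic hK] at t1
  rw [← mhCls_of_isSES_left h' hK', mhCls_of_acyclic hK'] at t2
  rw [cpxBds_cpxZ, add_zero, b1] at b2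
  rw [d1, cpxDeg_of_acyclic hK, cpxDeg_of_acyclic hK', cpxDeg_cpxMk] at d2
  have hM : (cpxDeg (isoCls M)).1 - (cpxDeg (isoCls M)).2 = k0Cls H₀ - k0Cls H₁ := by
    have e1 := congrArg Prod.fst d2
    have e2 := congrArg Prod.snd d2
    simp only [Prod.fst_add, Prod.snd_add] at e1 e2
    have e3 := congrArg₂ (· - ·) e1 e2
    simpa using e3
  rw [hM] at t1
  rw [cpxDeg_cpxMk, ← b2, mhK_add, (show mhK (cpxBds K) * mhK (cpxBds M) =
    mhK (cpxBds M) * mhK (cpxBds K) by rw [← mhK_add, add_comm, mhK_add]), ← mul_assoc] at t2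
  have h0 := sqrtEuler_ne_zero (k0Cls H₀ - k0Cls H₁) ((cpxBds K).1 - (cpxBds K).2)
  have t3 : mhCls P = (sqrtEuler (k0Cls H₀ - k0Cls H₁) ((cpxBds K).1 - (cpxBds K).2))⁻¹ •
      (mhCls M * mhK (cpxBds K)) := by
    rw [t1, smul_smul, inv_mul_cancel₀ h0, one_smul]
  rw [t3, smul_smul, Prod.fst_add, Prod.snd_add, add_sub_add_comm, sqrtEuler_add_right,
    mul_right_comm, mul_inv_cancel₀ h0, one_mul, ← smul_mul_assoc] at t2
  have t4 := (isUnit_mhK _).mul_right_cancel t2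
  rw [t4, ← neg_sub, sqrtEuler_neg_left, smul_smul, inv_mul_cancel₀ (sqrtEuler_ne_zero _ _),
    one_smul]

end TwistedModifiedHallAlgebra

/-! ### Hall numbers under fully faithful exact functors -/

section HallFunctor

variable {C : Type u} [Category.{v} C] {D : Type u'} [Category.{v'} D]

lemma isoCls_map_injective (F : C ⥤ D) [F.Full] [F.Faithful] :
    Function.Injective fun x : IsoClass C => isoCls (F.obj x.rep) := fun x y h => by
  rw [← isoCls_rep x, ← isoCls_rep y]
  obtain ⟨e⟩ := isoCls_eq_iff.1 h
  exact isoCls_eq_iff.2 ⟨F.preimageIso e⟩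

lemma card_aut_map (F : C ⥤ D) [F.Full] [F.Faithful] (X : C) :
    Nat.card (Aut (F.obj X)) = Nat.card (Aut X) :=
  (Nat.card_congr (Functor.FullyFaithful.ofFullyFaithful F).isoEquiv).symm

variable [Abelian C] [Abelian D]

lemma card_SESPairs_map (F : C ⥤ D) [F.Full] [F.Faithful]
    (hF : ∀ {M X L : C} (f : M ⟶ X) (g : X ⟶ L), IsSES (F.map f) (F.map g) ↔ IsSES f g)
    (L M X : C) : Nat.card (SESPairs (F.obj L) (F.obj M) (F.obj X)) = Nat.card (SESPairs L M X) :=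
  (Nat.card_congr (((Functor.FullyFaithful.ofFullyFaithful F).homEquiv.prodCongr
    (Functor.FullyFaithful.ofFullyFaithful F).homEquiv).subtypeEquiv
      fun p => (hF p.1 p.2).symm)).symm

variable [HallFinite C] [HallFinite D]

/-- A fully faithful exact functor with extension closed image is compatible with the structure
constants of the Hall algebras. -/
lemma hallConst_mul_map (F : C ⥤ D) [F.Full] [F.Faithful]
    (hF : ∀ {M X L : C} (f : M ⟶ X) (g : X ⟶ L), IsSES (F.map f) (F.map g) ↔ IsSES f g)
    (hext : ∀ {L M : C} {Y : D} (f : F.obj M ⟶ Y) (g : Y ⟶ F.obj L), IsSES f g →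
      ∃ X, Nonempty (Y ≅ F.obj X)) (a b : IsoClass C) :
    (hallConst D).mul (isoCls (F.obj a.rep)) (isoCls (F.obj b.rep)) =
      ((hallConst C).mul a b).mapDomain fun x => isoCls (F.obj x.rep) := by
  ext y
  by_cases hy : y ∈ Set.range fun x : IsoClass C => isoCls (F.obj x.rep)
  · obtain ⟨x, rfl⟩ := hy
    rw [Finsupp.mapDomain_apply (isoCls_map_injective F)]
    change hallNum _ _ _ = hallNum _ _ _
    rw [hallNum_isoCls, card_SESPairs_map F hF, card_aut_map, hallNum_eq, autNum]
  · rw [Finsupp.mapDomain_of_notMem_range _ _ hy]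
    change hallNum _ _ _ = 0
    by_contra h
    rw [← isoCls_rep y, hallNum_isoCls, ← ne_eq, div_ne_zero_iff, Nat.cast_ne_zero, Nat.card_ne_zero] at h
    obtain ⟨p⟩ := h.1.1
    obtain ⟨X, ⟨e⟩⟩ := hext p.1.1 p.1.2 p.2
    refine hy ⟨isoCls X, ?_⟩
    dsimp only
    rw [← isoCls_rep y]
    exact isoCls_eq_iff.2 ⟨F.mapIso (rep_isoCls X).some ≪≫ e.symm⟩

end HallFunctor

/-! ### Stalk complexes -/

section StalkComplexes

variable {A : Type u} [Category.{v} A] [Abelian A]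

/-- The functor sending an object to the complex concentrated in a given degree. -/
noncomputable abbrev stalk (A : Type u) [Category.{v} A] [Abelian A] (i : ZMod 2) : A ⥤ Cpx A :=
  HomologicalComplex.single A (ComplexShape.up (ZMod 2)) i

lemma isSES_of_isZero {M X L : A} (hM : IsZero M) (hX : IsZero X) (hL : IsZero L) (f : M ⟶ X)
    (g : X ⟶ L) : IsSES f g := by
  have : Mono f := ⟨fun _ _ _ => hM.eq_of_tgt _ _⟩
  have : Epi g := ⟨fun _ _ _ => hL.eq_of_src _ _⟩
  exact isSES_of_lift inferInstance inferInstance (hM.eq_of_src _ _)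
    fun t _ => ⟨0, hX.eq_of_tgt _ _⟩

lemma isSES_stalk_iff (i : ZMod 2) {M X L : A} (f : M ⟶ X) (g : X ⟶ L) :
    IsSES ((stalk A i).map f) ((stalk A i).map g) ↔ IsSES f g := by
  let e := fun Y : A => HomologicalComplex.singleObjXSelf (ComplexShape.up (ZMod 2)) i Y
  have hz := fun Y : A => HomologicalComplex.isZero_single_obj_X (ComplexShape.up (ZMod 2)) i Y
    (i + 1) (zmod_two_ne_add_one i).symm
  constructor
  · intro h
    have h1 := isSES_congr (HomologicalComplex.single_map_f_self _ i f).symm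
      (HomologicalComplex.single_map_f_self _ i g).symm (h.eval i)
    have h2 := (h1.comp_iso (e X)).congr_outer (e M).symm (e L)
    exact isSES_congr (by simp [e]) (by simp [e]) h2
  · intro h
    refine isSES_of_eval i (isSES_congr (HomologicalComplex.single_map_f_self _ i f)
      (HomologicalComplex.single_map_f_self _ i g) ?_)
      (isSES_of_isZero (hz _) (hz _) (hz _) _ _)
    have h2 := (h.comp_iso (e X).symm).congr_outer (e M) (e L).symm
    exact isSES_congr (by simp [e]) (by simp [e]) h2

/-- A complex concentrated in one degree is a stalk complex. -/
noncomputable def isoStalk (i : ZMod 2) (Y : Cpx A) (hY : IsZero (Y.X (i + 1))) :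
    Y ≅ (stalk A i).obj (Y.X i) where
  hom := cpxHomMk i (HomologicalComplex.singleObjXSelf _ i (Y.X i)).inv 0 (by
    rw [HomologicalComplex.single_obj_d, comp_zero, comp_zero]) (hY.eq_of_src _ _)
  inv := cpxHomMk i (HomologicalComplex.singleObjXSelf _ i (Y.X i)).hom 0 (hY.eq_of_tgt _ _)
    (by rw [HomologicalComplex.single_obj_d, zero_comp, zero_comp])
  hom_inv_id := cpx_hom_ext i (by simp) (hY.eq_of_src _ _)
  inv_hom_id := cpx_hom_ext i (by simp)
    ((HomologicalComplex.isZero_single_obj_X _ i _ _ (zmod_two_ne_add_one i).symm).eq_of_src _ _)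

lemma exists_iso_stalk_of_isSES (i : ZMod 2) {L M : A} {Y : Cpx A} (f : (stalk A i).obj M ⟶ Y)
    (g : Y ⟶ (stalk A i).obj L) (h : IsSES f g) : ∃ X, Nonempty (Y ≅ (stalk A i).obj X) := by
  have hz := fun Y : A => HomologicalComplex.isZero_single_obj_X (ComplexShape.up (ZMod 2)) i Y
    (i + 1) (zmod_two_ne_add_one i).symm
  refine ⟨Y.X i, ⟨isoStalk i Y ?_⟩⟩
  obtain ⟨s, hs⟩ := (h.eval (i + 1)).lift (𝟙 _) ((hz L).eq_of_tgt _ _)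
  rw [IsZero.iff_id_eq_zero, ← hs, (hz M).eq_of_src (f.f (i + 1)) 0, comp_zero]

lemma isoStalk_zero_obj (i : ZMod 2) {Z : A} (hZ : IsZero Z) : IsZero ((stalk A i).obj Z) :=
  (stalk A i).map_isZero hZ

/-- The stalk complexes as complexes with vanishing differentials. -/
noncomputable def cpxZIsoC {Z : A} (hZ : IsZero Z) (X : A) : cpxZ Z X ≅ cpxC X :=
  isoStalk 1 (cpxZ Z X) hZ

noncomputable def cpxZIsoCs {Z : A} (hZ : IsZero Z) (X : A) : cpxZ X Z ≅ cpxCs X :=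
  isoStalk 0 (cpxZ X Z) hZ

lemma cpxDeg_stalk_self (i : ZMod 2) (X : A) :
    cpxDeg (isoCls ((stalk A i).obj X)) = if i = 0 then (k0Cls X, 0) else (0, k0Cls X) := by
  rw [cpxDeg_isoCls]
  match (i : Fin 2) with
  | 0 => exact Prod.ext (k0Cls_iso (HomologicalComplex.singleObjXSelf _ (0 : ZMod 2) X))
          (k0Cls_zero (HomologicalComplex.isZero_single_obj_X _ (0 : ZMod 2) X 1 (by decide)))
  | 1 => exact Prod.ext
          (k0Cls_zero (HomologicalComplex.isZero_single_obj_X _ (1 : ZMod 2) X 0 (by decide)))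
          (k0Cls_iso (HomologicalComplex.singleObjXSelf _ (1 : ZMod 2) X))

end StalkComplexes

/-! ### The homomorphisms I₊ and I₋ -/

section StalkHomomorphisms

variable {A : Type u} [Category.{v} A] [Abelian A]

variable (A) in
/-- The embeddings of the Grothendieck group in its square. -/
noncomputable def stalkShift (i : ZMod 2) : K0 A →+ K0 A × K0 A :=
  -- Stalks in degree 0 belong to I₋, whose elements k_α come from K_X^*, and the boundaries of
  -- K_X^* come from degree 1; hence the second factor for i = 0.
  if i = 0 then AddMonoidHom.inr _ _ else AddMonoidHom.inl _ _

variable [HereditaryFinite A]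

/-- For i = 0 both arguments change sign and the signs cancel, so I₊ and I₋ satisfy the same
commutation rule between k_α and [X]. -/
lemma sqrtSym_stalkShift (i : ZMod 2) (α : K0 A) (X : A) :
    sqrtSym ((stalkShift A i α).1 - (stalkShift A i α).2)
      ((cpxDeg (isoCls ((stalk A i).obj X))).2 - (cpxDeg (isoCls ((stalk A i).obj X))).1) =
      sqrtSym α (k0Cls X) := by
  rw [cpxDeg_stalk_self, stalkShift]
  split_ifs
  · change sqrtSym (0 - α) (0 - k0Cls X) = _
    rw [zero_sub, zero_sub, sqrtSym_neg_left, sqrtSym_neg_right, inv_inv]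
  · change sqrtSym (α - 0) (k0Cls X - 0) = _
    rw [sub_zero, sub_zero]

lemma cwForm_stalk (i : ZMod 2) (X Y : A) :
    (cwForm A).toFun (cpxDeg (isoCls ((stalk A i).obj X))) (cpxDeg (isoCls ((stalk A i).obj Y))) =
      sqrtEuler (k0Cls X) (k0Cls Y) := by
  rw [cpxDeg_stalk_self, cpxDeg_stalk_self, cwForm_toFun]
  split_ifs <;> simp [sqrtEuler_zero_left]

variable (A) in
/-- The image of a basis element under the embedding of the extended Hall algebra. -/
noncomputable def stalkVal (i : ZMod 2) (p : ExtIdx A) : ModHallTw A :=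
  mhCls ((stalk A i).obj p.1.rep) * mhK (stalkShift A i p.2)

lemma stalkVal_eq (i : ZMod 2) (X : A) (α : K0 A) :
    stalkVal A i (isoCls X, α) = mhCls ((stalk A i).obj X) * mhK (stalkShift A i α) := by
  rw [stalkVal, mhCls_congr ((stalk A i).mapIso (rep_isoCls X).some)]

/-- The stalk functor is fully faithful, preserves and reflects short exact sequences and has
extension closed image. The Hall numbers therefore agree, and the twist on stalks in one degree is
the Euler form of the base category. -/
lemma mhCls_stalk_mul (i : ZMod 2) (a b : IsoClass A) :
    mhCls ((stalk A i).obj a.rep) * mhCls ((stalk A i).obj b.rep) =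
      sqrtEuler (isoK0 a) (isoK0 b) • ((hallConst A).mul a b).sum fun x r =>
        r • mhCls ((stalk A i).obj x.rep) := by
  rw [mhCls_mul, cwForm_stalk, isoK0, isoK0]
  congr 1
  rw [hallCls, hallCls, AlgConst.basis_mul_basis, hallConst_mul_map (stalk A i) (isSES_stalk_iff i)
    (exists_iso_stalk_of_isSES i), AlgConst.ofCoords_eq_sum, Finsupp.sum_mapDomain_index (by simp)
    (by simp [add_smul]), map_finsuppSum]
  simp_rw [map_smul]
  rfl

lemma stalkVal_mul (i : ZMod 2) (p q : ExtIdx A) : stalkVal A i p * stalkVal A i q =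
    ((extHallConst A).mul p q).sum fun x r => r • stalkVal A i x := by
  change _ = ((extTwist p q • (hallConst A).mul p.1 q.1).mapDomain
    fun x => (x, p.2 + q.2)).sum fun x r => r • stalkVal A i x
  rw [Finsupp.sum_mapDomain_index (by simp) (by simp [add_smul]), Finsupp.sum_smul_index (by simp)]
  have h1 := mhK_mul_mhCls (stalkShift A i p.2) ((stalk A i).obj q.1.rep)
  rw [sqrtSym_stalkShift] at h1
  rw [stalkVal, stalkVal, mul_assoc, ← mul_assoc (mhK _), h1, smul_mul_assoc, mul_smul_comm,
    mul_assoc (mhCls _) (mhK _), ← mhK_add, ← map_add, ← mul_assoc, mhCls_stalk_mul,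
    smul_mul_assoc, smul_smul, Finsupp.sum, Finset.sum_mul, Finset.smul_sum, Finsupp.sum]
  refine Finset.sum_congr rfl fun x _ => ?_
  rw [smul_mul_assoc, smul_smul, stalkVal, extTwist]
  rfl

open ZeroObject in
lemma mhCls_stalk_zero (i : ZMod 2) : mhCls ((stalk A i).obj 0) = 1 := by
  rw [mhCls_congr ((isoStalk_zero_obj i (isZero_zero A)).iso (isZero_zero (Cpx A))), mhCls_zero]

variable (A) in
/-- The homomorphisms from the twisted extended Hall algebra given by the stalk complexes. -/
noncomputable def stalkHom (i : ZMod 2) : ExtHall A →ₐ[ℂ] ModHallTw A :=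
  AlgHom.ofLinearMap ((extHallConst A).basis.constr ℂ (stalkVal A i))
    (by
      rw [AlgConst.one_def, Module.Basis.constr_basis]
      change stalkVal A i (isoCls _, 0) = 1
      rw [stalkVal_eq, mhCls_stalk_zero, map_zero, mhK_zero, one_mul])
    (fun x y => by
      induction x using (extHallConst A).induction with
      | hadd x x' h1 h2 => rw [add_mul, map_add, map_add, add_mul, h1, h2]
      | hsmul r x h1 => rw [smul_mul_assoc, map_smul, map_smul, smul_mul_assoc, h1]
      | hb a =>
      induction y using (extHallConst A).induction with
      | hadd x x' h1 h2 => rw [mul_add, map_add, map_add, mul_add, h1, h2]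
      | hsmul r x h1 => rw [mul_smul_comm, map_smul, map_smul, mul_smul_comm, h1]
      | hb b =>
      rw [AlgConst.basis_mul_basis, AlgConst.ofCoords_eq_sum, map_finsuppSum,
        Module.Basis.constr_basis, Module.Basis.constr_basis, stalkVal_mul]
      refine Finsupp.sum_congr fun x _ => ?_
      rw [map_smul, Module.Basis.constr_basis])

lemma stalkHom_basis (i : ZMod 2) (p : ExtIdx A) : stalkHom A i (extB p) = stalkVal A i p :=
  Module.Basis.constr_basis (extHallConst A).basis ℂ (stalkVal A i) p

lemma stalkHom_extCls (i : ZMod 2) (X : A) :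
    stalkHom A i (extCls X) = mhCls ((stalk A i).obj X) := by
  change stalkHom A i (extB (isoCls X, 0)) = _
  rw [stalkHom_basis, stalkVal_eq, map_zero, mhK_zero, mul_one]

lemma stalkHom_extK (i : ZMod 2) (α : K0 A) : stalkHom A i (extK α) = mhK (stalkShift A i α) := by
  change stalkHom A i (extB (isoCls _, α)) = _
  rw [stalkHom_basis, stalkVal_eq, mhCls_stalk_zero, one_mul]

lemma mhK_sub (κ κ' : K0 A × K0 A) : mhK (κ - κ') = mhK κ * Ring.inverse (mhK κ') := by
  refine (isUnit_mhK κ').mul_right_cancel ?_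
  rw [← mhK_add, sub_add_cancel, mul_assoc, Ring.inverse_mul_cancel _ (isUnit_mhK κ'), mul_one]

lemma stalkHom_one_extK_sub (X Y : A) : stalkHom A 1 (extK (k0Cls X - k0Cls Y)) =
    mhCls (cpxK X) * Ring.inverse (mhCls (cpxK Y)) := by
  rw [stalkHom_extK, map_sub, mhK_sub]
  change mhK (k0Cls X, 0) * Ring.inverse (mhK (k0Cls Y, 0)) = _
  rw [mhK_cpxD_zero, mhK_cpxD_zero]
  rfl

lemma stalkHom_zero_extK_sub (X Y : A) : stalkHom A 0 (extK (k0Cls X - k0Cls Y)) =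
    mhCls (cpxKs X) * Ring.inverse (mhCls (cpxKs Y)) := by
  rw [stalkHom_extK, map_sub, mhK_sub]
  change mhK (0, k0Cls X) * Ring.inverse (mhK (0, k0Cls Y)) = _
  rw [mhK_cpxD_one, mhK_cpxD_one]
  rfl

end StalkHomomorphisms

/-! ### Hall products from explicit families of extensions -/

section ExtensionFamilies

variable {C : Type u} [Category.{v} C] [Abelian C]

lemma extClass_eq_of_iso {M X X' L : C} {f : M ⟶ X} {g : X ⟶ L} {f' : M ⟶ X'} {g' : X' ⟶ L}
    (h : IsSES f g) (h' : IsSES f' g') (ν : X ≅ X') (h₁ : f ≫ ν.hom = f') (h₂ : ν.hom ≫ g' = g) :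
    h.2.extClass = h'.2.extClass := by
  have h₃ : ν.inv ≫ g = g' := by rw [← h₂, Iso.inv_hom_id_assoc]
  subst h₁ h₃
  exact (extClass_comp_iso h ν).symm

/-- The Hall product of two objects without morphisms between them, given a family representing
the extensions. -/
lemma hallCls_mul_of_family [HallFinite C] {P Q : C} [Subsingleton (P ⟶ Q)] {T : Type*} [Fintype T]
    {E : T → C} {i : ∀ t, Q ⟶ E t} {p : ∀ t, E t ⟶ P} (h : ∀ t, IsSES (i t) (p t))
    (inj : ∀ (t t' : T) (ν : E t ≅ E t'), i t ≫ ν.hom = i t' → ν.hom ≫ p t' = p t → t = t')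
    (surj : ∀ (X : C) (f : Q ⟶ X) (g : X ⟶ P), IsSES f g →
      ∃ (t : T) (ν : E t ≅ X), i t ≫ ν.hom = f ∧ ν.hom ≫ g = p t) :
    hallCls P * hallCls Q = ∑ t, hallCls (E t) := by
  have : Fintype (Ext P Q 1) := Fintype.ofFinite _
  rw [hallCls_mul, Nat.card_eq_one_iff_unique.2 ⟨inferInstance, ⟨0⟩⟩, Nat.cast_one, inv_one, one_smul]
  symm
  refine Fintype.sum_bijective (fun t => (h t).2.extClass) ⟨fun t t' ht => ?_, fun e => ?_⟩ _ _
    fun t => hallCls_congr (extMid_iso (h t) rfl).some.symm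
  · obtain ⟨ν, h1, h2⟩ := exists_of_extClass_eq (h t) (h t') ht
    exact inj t t' ν h1 h2
  · obtain ⟨f, g, hs, he⟩ := extMid_spec e
    obtain ⟨t, ν, h1, h2⟩ := surj _ f g hs
    exact ⟨t, (extClass_eq_of_iso (h t) hs ν h1 h2).trans he⟩

lemma isIso_left_of_isSES {M X L : C} {f : M ⟶ X} {g : X ⟶ L} (h : IsSES f g) (hL : IsZero L) :
    IsIso f := by
  have := h.mono
  obtain ⟨s, hs⟩ := h.lift (𝟙 X) (hL.eq_of_tgt _ _)
  exact ⟨s, by rw [← cancel_mono f, Category.assoc, hs]; simp, hs⟩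

lemma isIso_right_of_isSES {M X L : C} {f : M ⟶ X} {g : X ⟶ L} (h : IsSES f g) (hM : IsZero M) :
    IsIso g := by
  have := h.epi
  obtain ⟨s, hs⟩ := h.desc (𝟙 X) (hM.eq_of_src _ _)
  exact ⟨s, hs, by rw [← cancel_epi g, ← Category.assoc, hs]; simp⟩

lemma isSES_id_left (X : C) {Z : C} (hZ : IsZero Z) (g : X ⟶ Z) : IsSES (𝟙 X) g := by
  have : Epi g := ⟨fun _ _ _ => hZ.eq_of_src _ _⟩
  exact isSES_of_lift inferInstance this (hZ.eq_of_tgt _ _) fun t _ => ⟨t, Category.comp_id t⟩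

lemma isSES_id_right (X : C) {Z : C} (hZ : IsZero Z) (f : Z ⟶ X) : IsSES f (𝟙 X) := by
  have : Mono f := ⟨fun _ _ _ => hZ.eq_of_tgt _ _⟩
  exact isSES_of_desc this inferInstance (hZ.eq_of_src _ _) fun t _ => ⟨t, Category.id_comp t⟩

end ExtensionFamilies

/-! ### Products of stalks in different degrees -/

section StalkProducts

variable {A : Type u} [Category.{v} A] [Abelian A]

lemma cpxDeg_stalk_zero (X : A) : cpxDeg (isoCls ((stalk A 0).obj X)) = (k0Cls X, 0) :=
  cpxDeg_stalk_self 0 X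

lemma cpxDeg_stalk_one (X : A) : cpxDeg (isoCls ((stalk A 1).obj X)) = (0, k0Cls X) :=
  cpxDeg_stalk_self 1 X

variable [HereditaryFinite A]

/-- In each degree an extension of X in degree 1 by Y in degree 0 is trivial, so its only datum is
the differential X ⟶ Y. Equivalent extensions have the same differential, and there are no morphisms
between the two stalks, so no denominator appears. -/
lemma hallCls_stalk_one_mul_stalk_zero {Z : A} (hZ : IsZero Z) (X Y : A) [Fintype (X ⟶ Y)] :
    hallCls (cpxZ Z X) * hallCls (cpxZ Y Z) =
      ∑ f : X ⟶ Y, hallCls (cpxMk (0 : Y ⟶ X) f zero_comp comp_zero) := by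
  let E : (X ⟶ Y) → Cpx A := fun f => cpxMk (0 : Y ⟶ X) f zero_comp comp_zero
  let i : ∀ f, cpxZ Y Z ⟶ E f := fun f => cpxHom₂ (M := cpxZ Y Z) (N := E f) (𝟙 Y) (0 : Z ⟶ X)
    (show 𝟙 Y ≫ (0 : Y ⟶ X) = (0 : Y ⟶ Z) ≫ (0 : Z ⟶ X) by simp)
    (show (0 : Z ⟶ X) ≫ f = (0 : Z ⟶ Y) ≫ 𝟙 Y by simp)
  let p : ∀ f, E f ⟶ cpxZ Z X := fun f => cpxHom₂ (M := E f) (N := cpxZ Z X) (0 : Y ⟶ Z) (𝟙 X)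
    (show (0 : Y ⟶ Z) ≫ (0 : Z ⟶ X) = (0 : Y ⟶ X) ≫ 𝟙 X by simp)
    (show 𝟙 X ≫ (0 : X ⟶ Z) = f ≫ (0 : Y ⟶ Z) by simp)
  have h : ∀ f, IsSES (i f) (p f) := fun f =>
    isSES_of_eval 0 (isSES_id_left Y hZ (0 : Y ⟶ Z)) (isSES_id_right X hZ (0 : Z ⟶ X))
  have : Subsingleton (cpxZ Z X ⟶ cpxZ Y Z) :=
    ⟨fun a b => cpx_hom_ext 0 (hZ.eq_of_src _ _) (hZ.eq_of_tgt _ _)⟩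
  refine hallCls_mul_of_family h (fun f f' ν h1 h2 => ?_) fun W a b hab => ?_
  · have e0 : 𝟙 Y ≫ ν.hom.f 0 = 𝟙 Y := (HomologicalComplex.comp_f (i f) ν.hom 0).symm.trans
      (congrArg (fun φ => HomologicalComplex.Hom.f φ 0) h1)
    have e1 : ν.hom.f 1 ≫ 𝟙 X = 𝟙 X := (HomologicalComplex.comp_f ν.hom (p f') 1).symm.trans
      (congrArg (fun φ => HomologicalComplex.Hom.f φ 1) h2)
    have e2 : ν.hom.f 1 ≫ f' = f ≫ ν.hom.f 0 := ν.hom.comm 1 0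
    have e0' : ν.hom.f 0 = 𝟙 Y := (Category.id_comp _).symm.trans e0
    have e1' : ν.hom.f 1 = 𝟙 X := (Category.comp_id _).symm.trans e1
    have e3 : 𝟙 X ≫ f' = f ≫ 𝟙 Y :=
      (congrArg (· ≫ f') e1').symm.trans (e2.trans (congrArg (f ≫ ·) e0'))
    simpa using e3.symm
  · let a0 : Y ⟶ W.X 0 := a.f 0
    let b1 : W.X 1 ⟶ X := b.f 1
    have i0 : IsIso a0 := isIso_left_of_isSES (hab.eval 0) hZ
    have i1 : IsIso b1 := isIso_right_of_isSES (hab.eval 1) hZ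
    let c1 : X ⟶ W.X 1 := inv b1
    have ha : a0 ≫ W.d 0 1 = 0 := (a.comm 0 1).trans
      (show (0 : (cpxZ Y Z).X 0 ⟶ (cpxZ Y Z).X 1) ≫ a.f 1 = 0 from zero_comp)
    let t : X ⟶ Y := c1 ≫ W.d 1 0 ≫ inv a0
    let ν : E t ⟶ W := cpxHom₂ (M := E t) (N := W) a0 c1
      (show a0 ≫ W.d 0 1 = (0 : Y ⟶ X) ≫ c1 by rw [ha, zero_comp])
      (show c1 ≫ W.d 1 0 = t ≫ a0 by simp [t])
    have h1 : i t ≫ ν = a := cpx_hom_ext 0 ((HomologicalComplex.comp_f (i t) ν 0).trans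
      (show 𝟙 Y ≫ a0 = a0 from Category.id_comp _)) (hZ.eq_of_src _ _)
    have h2 : ν ≫ b = p t := cpx_hom_ext 0 (hZ.eq_of_tgt _ _)
      ((HomologicalComplex.comp_f ν b 1).trans (show c1 ≫ b1 = 𝟙 X from IsIso.inv_hom_id b1))
    have := isIso_of_isSES (h t) hab ν h1 h2
    exact ⟨t, asIso ν, h1, h2⟩

lemma hallCls_stalk_zero_mul_stalk_one {Z : A} (hZ : IsZero Z) (X Y : A) [Fintype (Y ⟶ X)] :
    hallCls (cpxZ Y Z) * hallCls (cpxZ Z X) =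
      ∑ g : Y ⟶ X, hallCls (cpxMk g (0 : X ⟶ Y) comp_zero zero_comp) := by
  let E : (Y ⟶ X) → Cpx A := fun g => cpxMk g (0 : X ⟶ Y) comp_zero zero_comp
  let i : ∀ g, cpxZ Z X ⟶ E g := fun g => cpxHom₂ (M := cpxZ Z X) (N := E g) (0 : Z ⟶ Y) (𝟙 X)
    (show (0 : Z ⟶ Y) ≫ g = (0 : Z ⟶ X) ≫ 𝟙 X by simp)
    (show 𝟙 X ≫ (0 : X ⟶ Y) = (0 : X ⟶ Z) ≫ (0 : Z ⟶ Y) by simp)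
  let p : ∀ g, E g ⟶ cpxZ Y Z := fun g => cpxHom₂ (M := E g) (N := cpxZ Y Z) (𝟙 Y) (0 : X ⟶ Z)
    (show 𝟙 Y ≫ (0 : Y ⟶ Z) = g ≫ (0 : X ⟶ Z) by simp)
    (show (0 : X ⟶ Z) ≫ (0 : Z ⟶ Y) = (0 : X ⟶ Y) ≫ 𝟙 Y by simp)
  have h : ∀ f, IsSES (i f) (p f) := fun f =>
    isSES_of_eval 0 (isSES_id_right Y hZ (0 : Z ⟶ Y)) (isSES_id_left X hZ (0 : X ⟶ Z))
  have : Subsingleton (cpxZ Y Z ⟶ cpxZ Z X) :=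
    ⟨fun a b => cpx_hom_ext 0 (hZ.eq_of_tgt _ _) (hZ.eq_of_src _ _)⟩
  refine hallCls_mul_of_family h (fun g g' ν h1 h2 => ?_) fun W a b hab => ?_
  · have e0 : 𝟙 X ≫ ν.hom.f 1 = 𝟙 X := (HomologicalComplex.comp_f (i g) ν.hom 1).symm.trans
      (congrArg (fun φ => HomologicalComplex.Hom.f φ 1) h1)
    have e1 : ν.hom.f 0 ≫ 𝟙 Y = 𝟙 Y := (HomologicalComplex.comp_f ν.hom (p g') 0).symm.trans
      (congrArg (fun φ => HomologicalComplex.Hom.f φ 0) h2)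
    have e2 : ν.hom.f 0 ≫ g' = g ≫ ν.hom.f 1 := ν.hom.comm 0 1
    have e0' : ν.hom.f 1 = 𝟙 X := (Category.id_comp _).symm.trans e0
    have e1' : ν.hom.f 0 = 𝟙 Y := (Category.comp_id _).symm.trans e1
    have e3 : 𝟙 Y ≫ g' = g ≫ 𝟙 X :=
      (congrArg (· ≫ g') e1').symm.trans (e2.trans (congrArg (g ≫ ·) e0'))
    simpa using e3.symm
  · let b0 : W.X 0 ⟶ Y := b.f 0
    let a1 : X ⟶ W.X 1 := a.f 1
    have i0 : IsIso b0 := isIso_right_of_isSES (hab.eval 0) hZ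
    have i1 : IsIso a1 := isIso_left_of_isSES (hab.eval 1) hZ
    let c0 : Y ⟶ W.X 0 := inv b0
    have ha : a1 ≫ W.d 1 0 = 0 := (a.comm 1 0).trans
      (show (0 : (cpxZ Z X).X 1 ⟶ (cpxZ Z X).X 0) ≫ a.f 0 = 0 from zero_comp)
    let t : Y ⟶ X := c0 ≫ W.d 0 1 ≫ inv a1
    let ν : E t ⟶ W := cpxHom₂ (M := E t) (N := W) c0 a1
      (show c0 ≫ W.d 0 1 = t ≫ a1 by simp [t])
      (show a1 ≫ W.d 1 0 = (0 : X ⟶ Y) ≫ c0 by rw [ha, zero_comp])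
    have h1 : i t ≫ ν = a := cpx_hom_ext 0 (hZ.eq_of_src _ _)
      ((HomologicalComplex.comp_f (i t) ν 1).trans (show 𝟙 X ≫ a1 = a1 from Category.id_comp _))
    have h2 : ν ≫ b = p t := cpx_hom_ext 0 ((HomologicalComplex.comp_f ν b 0).trans
      (show c0 ≫ b0 = 𝟙 Y from IsIso.inv_hom_id b0)) (hZ.eq_of_tgt _ _)
    have := isIso_of_isSES (h t) hab ν h1 h2
    exact ⟨t, asIso ν, h1, h2⟩

lemma hallCls_stalk_one {Z : A} (hZ : IsZero Z) (X : A) :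
    hallCls ((stalk A 1).obj X) = hallCls (cpxZ Z X) := (hallCls_congr (cpxZIsoC hZ X)).symm

lemma hallCls_stalk_zero {Z : A} (hZ : IsZero Z) (X : A) :
    hallCls ((stalk A 0).obj X) = hallCls (cpxZ X Z) := (hallCls_congr (cpxZIsoCs hZ X)).symm

-- The degrees of the two stalks lie in different factors of K₀ × K₀, so the twist is 1 and the
-- untwisted formula carries over.
open ZeroObject in
lemma mhCls_stalk_one_mul_stalk_zero (X Y : A) [Fintype (X ⟶ Y)] :
    mhCls ((stalk A 1).obj X) * mhCls ((stalk A 0).obj Y) =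
      ∑ f : X ⟶ Y, mhCls (cpxMk (0 : Y ⟶ X) f zero_comp comp_zero) := by
  rw [mhCls_mul, cpxDeg_stalk_zero, cpxDeg_stalk_one, cwForm_toFun,
    sqrtEuler_zero_left, sqrtEuler_zero_right, one_mul, one_smul,
    hallCls_stalk_one (isZero_zero A), hallCls_stalk_zero (isZero_zero A),
    hallCls_stalk_one_mul_stalk_zero (isZero_zero A), map_sum]
  rfl

open ZeroObject in
lemma mhCls_stalk_zero_mul_stalk_one (X Y : A) [Fintype (Y ⟶ X)] :
    mhCls ((stalk A 0).obj Y) * mhCls ((stalk A 1).obj X) =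
      ∑ g : Y ⟶ X, mhCls (cpxMk g (0 : X ⟶ Y) comp_zero zero_comp) := by
  rw [mhCls_mul, cpxDeg_stalk_zero, cpxDeg_stalk_one, cwForm_toFun,
    sqrtEuler_zero_left, sqrtEuler_zero_right, one_mul, one_smul,
    hallCls_stalk_one (isZero_zero A), hallCls_stalk_zero (isZero_zero A),
    hallCls_stalk_zero_mul_stalk_one (isZero_zero A), map_sum]
  rfl

end StalkProducts

/-! ### Homology of complexes with one differential prescribed -/

section HomologyComputation

variable {A : Type u} [Category.{v} A] [Abelian A]

lemma homology_cpxMk_zero {X₀ X₁ : A} (d₀ : X₀ ⟶ X₁) (d₁ : X₁ ⟶ X₀) (h₀ : d₀ ≫ d₁ = 0)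
    (h₁ : d₁ ≫ d₀ = 0) : Nonempty ((cpxMk d₀ d₁ h₀ h₁).homology 0 ≅
      (ShortComplex.mk d₁ d₀ h₁).homology) :=
  ⟨(cpxMk d₀ d₁ h₀ h₁).homologyIsoSc' 1 0 1 (cpx_prev 0) (cpx_next 0)⟩

lemma homology_cpxMk_one {X₀ X₁ : A} (d₀ : X₀ ⟶ X₁) (d₁ : X₁ ⟶ X₀) (h₀ : d₀ ≫ d₁ = 0)
    (h₁ : d₁ ≫ d₀ = 0) : Nonempty ((cpxMk d₀ d₁ h₀ h₁).homology 1 ≅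
      (ShortComplex.mk d₀ d₁ h₀).homology) :=
  ⟨(cpxMk d₀ d₁ h₀ h₁).homologyIsoSc' 0 1 0 (cpx_prev 1) (cpx_next 1)⟩

/-- The class of the image of a morphism. -/
noncomputable def k0Im {X Y : A} (φ : X ⟶ Y) : K0 A := k0Cls X - k0Cls (kernel φ)

lemma cpxBds_cpxMk {X₀ X₁ : A} (d₀ : X₀ ⟶ X₁) (d₁ : X₁ ⟶ X₀) (h₀ : d₀ ≫ d₁ = 0)
    (h₁ : d₁ ≫ d₀ = 0) : cpxBds (cpxMk d₀ d₁ h₀ h₁) = (k0Im d₀, k0Im d₁) := by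
  refine Prod.ext (congrArg (k0Cls X₀ - ·) (k0Cls_iso ?_))
    (congrArg (k0Cls X₁ - ·) (k0Cls_iso ?_))
  · exact (cpxMk d₀ d₁ h₀ h₁).cyclesIsoSc' 1 0 1 (cpx_prev 0) (cpx_next 0) ≪≫
      (ShortComplex.mk d₁ d₀ h₁).cyclesIsoKernel
  · exact (cpxMk d₀ d₁ h₀ h₁).cyclesIsoSc' 0 1 0 (cpx_prev 1) (cpx_next 1) ≪≫
      (ShortComplex.mk d₀ d₁ h₀).cyclesIsoKernel

lemma k0Im_zero (X Y : A) : k0Im (0 : X ⟶ Y) = 0 := by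
  rw [k0Im, k0Cls_iso (kernelZeroIsoSource (X := X) (Y := Y)), sub_self]

variable {X Y : A} (u : X ⟶ Y) (w : cokernel u ⟶ kernel u)

lemma comp_cokernel_kernel : u ≫ cokernel.π u ≫ w ≫ kernel.ι u = 0 := by simp

lemma cokernel_kernel_comp : (cokernel.π u ≫ w ≫ kernel.ι u) ≫ u = 0 := by simp

/-- The map from Y into the kernel of u is the epimorphism onto the cokernel of u followed by w, so
the homology here is the cokernel of w. Dually, the other homology is the kernel of w: the complex
with differentials u and the one induced by w has the homology of w alone. -/
lemma homology_cokernel : Nonempty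
    ((ShortComplex.mk (cokernel.π u ≫ w ≫ kernel.ι u) u (cokernel_kernel_comp u w)).homology ≅
      (ShortComplex.mk w (0 : kernel u ⟶ cokernel u) comp_zero).homology) := by
  have e : kernel.lift u (cokernel.π u ≫ w ≫ kernel.ι u) (cokernel_kernel_comp u w) =
      cokernel.π u ≫ w := by rw [← cancel_mono (kernel.ι u)]; simp
  exact ⟨(ShortComplex.LeftHomologyData.ofHasKernelOfHasCokernel _).homologyIso ≪≫
    cokernelIsoOfEq e ≪≫ cokernelEpiComp _ _ ≪≫
      (ShortComplex.LeftHomologyData.ofHasCokernel (ShortComplex.mk w (0 : kernel u ⟶ cokernel u)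
        comp_zero) rfl).homologyIso.symm⟩

lemma homology_kernel : Nonempty
    ((ShortComplex.mk u (cokernel.π u ≫ w ≫ kernel.ι u) (comp_cokernel_kernel u w)).homology ≅
      (ShortComplex.mk (0 : kernel u ⟶ cokernel u) w zero_comp).homology) := by
  have e : cokernel.desc u (cokernel.π u ≫ w ≫ kernel.ι u) (comp_cokernel_kernel u w) =
      w ≫ kernel.ι u := by rw [← cancel_epi (cokernel.π u)]; simp
  exact ⟨(ShortComplex.RightHomologyData.ofHasCokernelOfHasKernel _).homologyIso ≪≫
    kernelIsoOfEq e ≪≫ kernelCompMono _ _ ≪≫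
      (ShortComplex.RightHomologyData.ofHasKernel (ShortComplex.mk (0 : kernel u ⟶ cokernel u) w
        zero_comp) rfl).homologyIso.symm⟩

lemma k0Im_eq_image {X Y : A} (φ : X ⟶ Y) : k0Im φ = k0Cls (Abelian.image φ) := by
  have h : IsSES (kernel.ι φ) (Abelian.factorThruImage φ) := by
    refine isSES_of_lift inferInstance inferInstance ?_ fun t ht =>
      ⟨kernel.lift φ t ?_, kernel.lift_ι _ _ _⟩
    · rw [← cancel_mono (Abelian.image.ι φ)]; simp
    · rw [← Abelian.image.fac φ, ← Category.assoc, ht, zero_comp]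
  rw [k0Im, k0Cls_of_isSES h, add_sub_cancel_left]

lemma k0Im_eq {X Y : A} (φ : X ⟶ Y) : k0Im φ = k0Cls Y - k0Cls (cokernel φ) := by
  have h : IsSES (Abelian.image.ι φ) (cokernel.π φ) :=
    isSES_of_lift inferInstance inferInstance (kernel.condition _)
      fun t ht => ⟨kernel.lift _ t ht, kernel.lift_ι _ _ _⟩
  rw [k0Im_eq_image, k0Cls_of_isSES h, add_sub_cancel_right]

/-- Composing with an epimorphism before and a monomorphism after does not change the image. -/
lemma k0Im_cokernel_kernel : k0Im (cokernel.π u ≫ w ≫ kernel.ι u) = k0Im w := by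
  rw [k0Im_eq, k0Cls_iso (cokernelEpiComp (cokernel.π u) (w ≫ kernel.ι u)), ← k0Im_eq, k0Im,
    k0Cls_iso (kernelCompMono w (kernel.ι u)), ← k0Im]

/-- With `mem_range_cokernel_kernel` this parametrizes the second differentials compatible with a
given u by the morphisms from its cokernel to its kernel. -/
lemma cokernel_kernel_injective : Function.Injective
    fun w : cokernel u ⟶ kernel u => cokernel.π u ≫ w ≫ kernel.ι u := fun w w' h => by
  rwa [cancel_epi, cancel_mono] at h

lemma mem_range_cokernel_kernel (f : Y ⟶ X) (h₀ : u ≫ f = 0) (h₁ : f ≫ u = 0) :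
    f ∈ Set.range fun w : cokernel u ⟶ kernel u => cokernel.π u ≫ w ≫ kernel.ι u := by
  have h : cokernel.desc u f h₀ ≫ u = 0 := by
    rw [← cancel_epi (cokernel.π u)]
    simp [h₁]
  exact ⟨kernel.lift u (cokernel.desc u f h₀) h, by simp⟩

end HomologyComputation

/-! ### The cross relation as a sum over all complexes -/

section CrossRelation

variable {A : Type u} [Category.{v} A] [Abelian A]

lemma stalkShift_one (α : K0 A) : stalkShift A 1 α = (α, 0) := rfl

lemma stalkShift_zero (α : K0 A) : stalkShift A 0 α = (0, α) := rfl

variable [HereditaryFinite A]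

noncomputable abbrev homFintype (X Y : A) : Fintype (X ⟶ Y) := Fintype.ofFinite _

attribute [local instance] homFintype

/-- The Euler characteristic of a complex is that of its homology. -/
lemma cpxDeg_sub (M : Cpx A) : (cpxDeg (isoCls M)).2 - (cpxDeg (isoCls M)).1 =
    k0Cls (M.homology 1) - k0Cls (M.homology 0) := by
  obtain ⟨K, K', P, f, g, f', g', hK, hK', h, h'⟩ :=
    homology_resolution M (Iso.refl (M.homology 0)) (Iso.refl (M.homology 1))
  have d2 := cpxDeg_of_isSES h'
  rw [cpxDeg_of_isSES h, cpxDeg_of_acyclic hK, cpxDeg_of_acyclic hK', cpxDeg_cpxMk] at d2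
  have e1 := congrArg Prod.fst d2
  have e2 := congrArg Prod.snd d2
  simp only [Prod.fst_add, Prod.snd_add] at e1 e2
  simpa using congrArg₂ (· - ·) e2 e1

/-- Two complexes with the same homology have normal forms that differ only in the unit, so their
classes are proportional after multiplication by the unit of the difference of boundaries. -/
lemma mhCls_of_homology_iso {M N : Cpx A} (h₀ : Nonempty (N.homology 0 ≅ M.homology 0))
    (h₁ : Nonempty (N.homology 1 ≅ M.homology 1)) {κ : K0 A × K0 A}
    (hκ : cpxBds N = cpxBds M + κ) :
    mhCls N = sqrtEuler ((cpxDeg (isoCls M)).2 - (cpxDeg (isoCls M)).1) (κ.1 - κ.2) •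
      (mhCls M * mhK κ) := by
  rw [mhCls_eq N h₀.some h₁.some, mhCls_eq M (Iso.refl _) (Iso.refl _), cpxDeg_sub, hκ, mhK_add,
    smul_mul_assoc, smul_smul, mul_assoc, Prod.fst_add, Prod.snd_add, add_sub_add_comm,
    sqrtEuler_add_right, mul_comm (sqrtEuler _ _)]

variable {X Y : A}

/-- Splitting off the image of g leaves the homology unchanged and removes exactly the boundary
class of g. -/
lemma mhCls_cokernel_kernel (g : Y ⟶ X) (f : cokernel g ⟶ kernel g) :
    mhCls (cpxMk g (cokernel.π g ≫ f ≫ kernel.ι g) (comp_cokernel_kernel g f)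
      (cokernel_kernel_comp g f)) =
    sqrtEuler (k0Cls (cokernel g) - k0Cls (kernel g)) (k0Im g) •
      (mhCls (cpxMk (0 : kernel g ⟶ cokernel g) f zero_comp comp_zero) * mhK (k0Im g, 0)) := by
  have h := mhCls_of_homology_iso (κ := (k0Im g, 0))
    (N := cpxMk g (cokernel.π g ≫ f ≫ kernel.ι g) (comp_cokernel_kernel g f)
      (cokernel_kernel_comp g f))
    (M := cpxMk (0 : kernel g ⟶ cokernel g) f zero_comp comp_zero)
    ⟨(homology_cpxMk_zero _ _ _ _).some ≪≫ (homology_cokernel g f).some ≪≫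
      (homology_cpxMk_zero _ _ _ _).some.symm⟩
    ⟨(homology_cpxMk_one _ _ _ _).some ≪≫ (homology_kernel g f).some ≪≫
      (homology_cpxMk_one _ _ _ _).some.symm⟩
    (by rw [cpxBds_cpxMk, cpxBds_cpxMk, k0Im_cokernel_kernel, k0Im_zero, Prod.mk_add_mk, zero_add,
      add_zero])
  rwa [cpxDeg_cpxMk, sub_zero] at h

lemma mhCls_cokernel_kernel' (f : X ⟶ Y) (g : cokernel f ⟶ kernel f) :
    mhCls (cpxMk (cokernel.π f ≫ g ≫ kernel.ι f) f (cokernel_kernel_comp f g)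
      (comp_cokernel_kernel f g)) =
    sqrtEuler (k0Cls (kernel f) - k0Cls (cokernel f)) (-k0Im f) •
      (mhCls (cpxMk g (0 : kernel f ⟶ cokernel f) comp_zero zero_comp) * mhK (0, k0Im f)) := by
  have h := mhCls_of_homology_iso (κ := (0, k0Im f))
    (N := cpxMk (cokernel.π f ≫ g ≫ kernel.ι f) f (cokernel_kernel_comp f g)
      (comp_cokernel_kernel f g))
    (M := cpxMk g (0 : kernel f ⟶ cokernel f) comp_zero zero_comp)
    ⟨(homology_cpxMk_zero _ _ _ _).some ≪≫ (homology_kernel f g).some ≪≫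
      (homology_cpxMk_zero _ _ _ _).some.symm⟩
    ⟨(homology_cpxMk_one _ _ _ _).some ≪≫ (homology_cokernel f g).some ≪≫
      (homology_cpxMk_one _ _ _ _).some.symm⟩
    (by rw [cpxBds_cpxMk, cpxBds_cpxMk, k0Im_cokernel_kernel, k0Im_zero, Prod.mk_add_mk, zero_add,
      add_zero])
  rwa [cpxDeg_cpxMk, zero_sub] at h

/-- The weight of a morphism in the left side of the cross relation. -/
noncomputable def crossWeightL (α β : K0 A) (g : Y ⟶ X) : ℂ :=
  sqrtEuler (k0Cls (cokernel g)) (k0Im g) * sqrtEuler (k0Im g) (k0Cls (kernel g)) *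
    sqrtSym α (k0Cls (kernel g) + β)

/-- The weight of a morphism in the right side of the cross relation. -/
noncomputable def crossWeightR (α β : K0 A) (f : X ⟶ Y) : ℂ :=
  sqrtEuler (k0Im f) (k0Cls (kernel f)) * sqrtEuler (k0Cls (cokernel f)) (k0Im f) *
    sqrtSym (k0Cls (kernel f) + α) β

/-- Once the k elements are moved to the right, the product of stalks is a sum over f : coker g ⟶
ker g, and each summand is, up to a unit and a scalar, the complex with first differential g. The
weights of (D3) are exactly what cancels the scalar down to √(α, β), which does not depend on g. -/
lemma crossWeightL_smul (α β : K0 A) (g : Y ⟶ X) :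
    crossWeightL α β g • (stalkVal A 1 (isoCls (cokernel g), k0Im g + α) *
      stalkVal A 0 (isoCls (kernel g), β)) = sqrtSym α β • ((∑ f : cokernel g ⟶ kernel g,
        mhCls (cpxMk g (cokernel.π g ≫ f ≫ kernel.ι g) (comp_cokernel_kernel g f)
          (cokernel_kernel_comp g f))) * mhK (α, β)) := by
  have h1 := mhK_mul_mhCls (k0Im g + α, 0) ((stalk A 0).obj (kernel g))
  rw [cpxDeg_stalk_zero, sub_zero, zero_sub] at h1
  have h2 : mhK (k0Im g + α, 0) * mhK (0, β) = mhK (k0Im g, 0) * mhK (α, β) := by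
    rw [← mhK_add, ← mhK_add]; simp
  rw [stalkVal_eq, stalkVal_eq, stalkShift_one, stalkShift_zero, mul_assoc, ← mul_assoc (mhK _), h1,
    smul_mul_assoc, mul_smul_comm, mul_assoc (mhCls _) (mhK _), h2, ← mul_assoc, ← mul_assoc,
    mhCls_stalk_one_mul_stalk_zero, smul_smul]
  simp_rw [mhCls_cokernel_kernel, ← Finset.smul_sum, ← Finset.sum_mul, smul_mul_assoc, smul_smul]
  congr 1
  rw [crossWeightL]
  have h := sqrtEuler_ne_zero (A := A)
  simp only [sqrtSym_eq, sqrtEuler_add_left, sqrtEuler_add_right, sqrtEuler_sub_left,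
    sqrtEuler_neg_left, sqrtEuler_neg_right]
  field_simp [h]

lemma crossWeightR_smul (α β : K0 A) (f : X ⟶ Y) :
    crossWeightR α β f • (stalkVal A 0 (isoCls (cokernel f), k0Im f + β) *
      stalkVal A 1 (isoCls (kernel f), α)) = sqrtSym α β • ((∑ g : cokernel f ⟶ kernel f,
        mhCls (cpxMk (cokernel.π f ≫ g ≫ kernel.ι f) f (cokernel_kernel_comp f g)
          (comp_cokernel_kernel f g))) * mhK (α, β)) := by
  have h1 := mhK_mul_mhCls (0, k0Im f + β) ((stalk A 1).obj (kernel f))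
  rw [cpxDeg_stalk_one, sub_zero, zero_sub] at h1
  have h2 : mhK (0, k0Im f + β) * mhK (α, 0) = mhK (0, k0Im f) * mhK (α, β) := by
    rw [← mhK_add, ← mhK_add]; simp
  rw [stalkVal_eq, stalkVal_eq, stalkShift_one, stalkShift_zero, mul_assoc, ← mul_assoc (mhK _), h1,
    smul_mul_assoc, mul_smul_comm, mul_assoc (mhCls _) (mhK _), h2, ← mul_assoc, ← mul_assoc,
    mhCls_stalk_zero_mul_stalk_one, smul_smul]
  simp_rw [mhCls_cokernel_kernel', ← Finset.smul_sum, ← Finset.sum_mul, smul_mul_assoc, smul_smul]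
  congr 1
  rw [crossWeightR]
  have h := sqrtEuler_ne_zero (A := A)
  simp only [sqrtSym_eq, sqrtEuler_add_left, sqrtEuler_add_right, sqrtEuler_sub_left,
    sqrtEuler_neg_left, sqrtEuler_neg_right]
  field_simp [h]

open Classical in
/-- The sum of the classes of all complexes with given components. -/
lemma sum_cpxMk_eq : ∑ g : Y ⟶ X, ∑ f : cokernel g ⟶ kernel g,
      mhCls (cpxMk g (cokernel.π g ≫ f ≫ kernel.ι g) (comp_cokernel_kernel g f)
        (cokernel_kernel_comp g f)) =
    ∑ f : X ⟶ Y, ∑ g : cokernel f ⟶ kernel f,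
      mhCls (cpxMk (cokernel.π f ≫ g ≫ kernel.ι f) f (cokernel_kernel_comp f g)
        (comp_cokernel_kernel f g)) := by
  -- T extends the class by zero to all pairs of morphisms. Both double sums then run over all pairs
  -- and differ only in the order of summation.
  let T : (Y ⟶ X) → (X ⟶ Y) → ModHallTw A := fun g f =>
    if h : g ≫ f = 0 ∧ f ≫ g = 0 then mhCls (cpxMk g f h.1 h.2) else 0
  have hT : ∀ g f h₀ h₁, T g f = mhCls (cpxMk g f h₀ h₁) := fun g f h₀ h₁ => dif_pos ⟨h₀, h₁⟩
  have e1 : ∀ g : Y ⟶ X, ∑ f : cokernel g ⟶ kernel g,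
      mhCls (cpxMk g (cokernel.π g ≫ f ≫ kernel.ι g) (comp_cokernel_kernel g f)
        (cokernel_kernel_comp g f)) = ∑ f : X ⟶ Y, T g f := fun g =>
    Fintype.sum_of_injective _ (cokernel_kernel_injective g) _ _
      (fun f hf => dif_neg fun h => hf (mem_range_cokernel_kernel g f h.1 h.2))
      fun f => (hT _ _ _ _).symm
  have e2 : ∀ f : X ⟶ Y, ∑ g : cokernel f ⟶ kernel f,
      mhCls (cpxMk (cokernel.π f ≫ g ≫ kernel.ι f) f (cokernel_kernel_comp f g)
        (comp_cokernel_kernel f g)) = ∑ g : Y ⟶ X, T g f := fun f =>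
    Fintype.sum_of_injective _ (cokernel_kernel_injective f) _ _
      (fun g hg => dif_neg fun h => hg (mem_range_cokernel_kernel f g h.2 h.1))
      fun g => (hT _ _ _ _).symm
  simp_rw [e1, e2]
  exact Finset.sum_comm

/-- The cross relation between the two embeddings of the extended Hall algebra. -/
lemma stalkVal_cross (X Y : A) (α β : K0 A) :
    ∑ g : Y ⟶ X, crossWeightL α β g • (stalkVal A 1 (isoCls (cokernel g), k0Im g + α) *
      stalkVal A 0 (isoCls (kernel g), β)) =
    ∑ f : X ⟶ Y, crossWeightR α β f • (stalkVal A 0 (isoCls (cokernel f), k0Im f + β) *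
      stalkVal A 1 (isoCls (kernel f), α)) := by
  simp_rw [crossWeightL_smul, crossWeightR_smul, ← Finset.smul_sum, ← Finset.sum_mul, sum_cpxMk_eq]

end CrossRelation

/-! ### Counting morphisms by kernel, image and cokernel -/

section CountingFactorizations

variable {C : Type u} [Category.{v} C] [Abelian C]

lemma card_factorizations (I : C) {X Y : C} (g : Y ⟶ X) :
    Nat.card {t : {i : I ⟶ X // Mono i} × {q : Y ⟶ I // Epi q} // t.2.1 ≫ t.1.1 = g} =
      Nat.card (I ≅ Abelian.image g) := by
  symm
  refine Nat.card_congr (Equiv.ofBijective (fun e : I ≅ Abelian.image g =>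
    ⟨(⟨e.hom ≫ Abelian.image.ι g, mono_comp _ _⟩,
      ⟨Abelian.factorThruImage g ≫ e.inv, epi_comp _ _⟩), by simp⟩) ⟨?_, ?_⟩)
  · intro e e' h
    have h1 : e.hom ≫ Abelian.image.ι g = e'.hom ≫ Abelian.image.ι g :=
      congrArg (fun t => t.1.1.1) h
    exact Iso.ext (by rwa [cancel_mono] at h1)
  · rintro ⟨⟨⟨i, hi⟩, ⟨q, hq⟩⟩, rfl⟩
    dsimp only
    have hs : i ≫ cokernel.π (q ≫ i) = 0 := by
      rw [← cancel_epi q, ← Category.assoc, cokernel.condition, comp_zero]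
    let s : I ⟶ Abelian.image (q ≫ i) := kernel.lift _ i hs
    have h1 : s ≫ Abelian.image.ι (q ≫ i) = i := kernel.lift_ι _ _ _
    have h2 : q ≫ s = Abelian.factorThruImage (q ≫ i) := by
      rw [← cancel_mono (Abelian.image.ι (q ≫ i)), Category.assoc, h1, Abelian.image.fac]
    have : Mono s := by
      have : Mono (s ≫ Abelian.image.ι (q ≫ i)) := by rw [h1]; exact hi
      exact mono_of_mono s (Abelian.image.ι (q ≫ i))
    have : Epi s := by
      have : Epi (q ≫ s) := by rw [h2]; infer_instance
      exact epi_of_epi q s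
    have : IsIso s := isIso_of_mono_of_epi s
    refine ⟨asIso s, Subtype.ext (Prod.ext (Subtype.ext h1) (Subtype.ext ?_))⟩
    change Abelian.factorThruImage (q ≫ i) ≫ inv s = q
    rw [← h2]
    simp

variable [HallFinite C]

lemma card_SESPairs_eq_sum_mono (L I X : C) [Fintype {i : I ⟶ X // Mono i}] :
    Nat.card (SESPairs L I X) = ∑ i : {i : I ⟶ X // Mono i}, Nat.card (L ≅ cokernel i.1) := by
  have h : ∀ i : {i : I ⟶ X // Mono i},
      Nat.card {g : X ⟶ L // IsSES i.1 g} = Nat.card (L ≅ cokernel i.1) := fun i => by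
    have := i.2
    exact card_cokernels L i.1
  simp_rw [← h]
  rw [← Nat.card_sigma]
  exact Nat.card_congr
    { toFun := fun p => ⟨⟨p.1.1, p.2.mono⟩, ⟨p.1.2, p.2⟩⟩
      invFun := fun t => ⟨(t.1.1, t.2.1), t.2.2⟩
      left_inv := fun p => rfl
      right_inv := fun t => rfl }

lemma card_SESPairs_eq_sum_epi (I K Y : C) [Fintype {q : Y ⟶ I // Epi q}] :
    Nat.card (SESPairs I K Y) = ∑ q : {q : Y ⟶ I // Epi q}, Nat.card (K ≅ kernel q.1) := by
  have h : ∀ q : {q : Y ⟶ I // Epi q},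
      Nat.card {f : K ⟶ Y // IsSES f q.1} = Nat.card (K ≅ kernel q.1) := fun q => by
    have := q.2
    exact card_kernels K q.1
  simp_rw [← h]
  rw [← Nat.card_sigma]
  exact Nat.card_congr
    { toFun := fun p => ⟨⟨p.1.2, p.2.epi⟩, ⟨p.1.1, p.2⟩⟩
      invFun := fun t => ⟨(t.2.1, t.1.1), t.2.2⟩
      left_inv := fun p => rfl
      right_inv := fun t => rfl }

open Classical in
/-- The number of morphisms with given kernel, image and cokernel. -/
lemma card_SESPairs_mul_card_SESPairs (a i k x y : IsoClass C) [Fintype (y.rep ⟶ x.rep)] :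
    (Nat.card (SESPairs a.rep i.rep x.rep) : ℂ) * Nat.card (SESPairs i.rep k.rep y.rep) /
      (autNum a * autNum i * autNum k) = ∑ g : y.rep ⟶ x.rep,
        if a = isoCls (cokernel g) ∧ i = isoCls (Abelian.image g) ∧ k = isoCls (kernel g)
          then 1 else 0 := by
  let _ : Fintype {f : i.rep ⟶ x.rep // Mono f} := Fintype.ofFinite _
  let _ : Fintype {q : y.rep ⟶ i.rep // Epi q} := Fintype.ofFinite _
  let c : (y.rep ⟶ x.rep) → ℂ := fun g =>
    (if a = isoCls (cokernel g) then 1 else 0) * (if k = isoCls (kernel g) then 1 else 0)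
  have h1 : (Nat.card (SESPairs a.rep i.rep x.rep) : ℂ) / autNum a *
      ((Nat.card (SESPairs i.rep k.rep y.rep) : ℂ) / autNum k) =
      ∑ t : {f : i.rep ⟶ x.rep // Mono f} × {q : y.rep ⟶ i.rep // Epi q}, c (t.2.1 ≫ t.1.1) := by
    rw [card_SESPairs_eq_sum_mono, card_SESPairs_eq_sum_epi, Nat.cast_sum, Nat.cast_sum,
      Finset.sum_div, Finset.sum_div, Finset.sum_mul_sum, ← Finset.univ_product_univ,
      Finset.sum_product]
    refine Finset.sum_congr rfl fun f _ => Finset.sum_congr rfl fun q _ => ?_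
    have := f.2
    have := q.2
    rw [card_iso, card_iso]
    dsimp only [c]
    rw [isoCls_eq_iff.2 ⟨cokernelEpiComp q.1 f.1⟩, isoCls_eq_iff.2 ⟨kernelCompMono q.1 f.1⟩]
  rw [← Finset.sum_fiberwise' _ (fun t : {f : i.rep ⟶ x.rep // Mono f} × {q : y.rep ⟶ i.rep // Epi q}
    => t.2.1 ≫ t.1.1)] at h1
  -- Dividing by |Aut I| forgets the identification of I with the image: a morphism with image I has
  -- |Aut I| factorizations through it.
  have h2 : (Nat.card (SESPairs a.rep i.rep x.rep) : ℂ) * Nat.card (SESPairs i.rep k.rep y.rep) /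
      (autNum a * autNum i * autNum k) = (Nat.card (SESPairs a.rep i.rep x.rep) : ℂ) / autNum a *
      ((Nat.card (SESPairs i.rep k.rep y.rep) : ℂ) / autNum k) / autNum i := by
    rw [div_mul_div_comm, div_div]
    ring_nf
  rw [h2, h1, Finset.sum_div]
  refine Finset.sum_congr rfl fun g _ => ?_
  rw [Finset.sum_const, nsmul_eq_mul, mul_comm, mul_div_assoc]
  have h3 : (Finset.univ.filter fun t : {f : i.rep ⟶ x.rep // Mono f} × {q : y.rep ⟶ i.rep // Epi q}
    => t.2.1 ≫ t.1.1 = g).card = Nat.card (i.rep ≅ Abelian.image g) := by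
    rw [← card_factorizations, Nat.card_eq_fintype_card, Fintype.card_subtype]
  rw [h3, card_iso]
  dsimp only [c]
  by_cases ha : a = isoCls (cokernel g) <;> by_cases hi : i = isoCls (Abelian.image g) <;>
    by_cases hk : k = isoCls (kernel g) <;> simp [ha, hi, hk]

end CountingFactorizations

/-! ### Finite sums of indicator functions -/

section IndicatorSums

variable {V ι κ : Type*} [AddCommGroup V] [Fintype ι] [DecidableEq κ]

lemma support_sum_ite_finite (e : ι → κ) (v : ι → V) :
    (Function.support fun r => ∑ g, if r = e g then v g else 0).Finite := by
  refine (Set.finite_range e).subset fun r hr => ?_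
  by_contra h
  exact hr (Finset.sum_eq_zero fun g _ => if_neg fun hg => h ⟨g, hg.symm⟩)

lemma finsum_sum_ite (e : ι → κ) (v : ι → V) :
    ∑ᶠ r, ∑ g, (if r = e g then v g else 0) = ∑ g, v g := by
  rw [finsum_sum_comm]
  · refine Finset.sum_congr rfl fun g _ => ?_
    rw [finsum_eq_single _ (e g) fun r hr => if_neg hr, if_pos rfl]
  · exact fun g _ => (Set.finite_singleton (e g)).subset fun r hr => by
      by_contra h
      exact hr (if_neg h)

end IndicatorSums

lemma isoK0_isoCls_image {C : Type u} [Category.{v} C] [Abelian C] {X Y : C} (g : Y ⟶ X) :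
    isoK0 (isoCls (Abelian.image g)) = k0Im g := by
  rw [isoK0_isoCls, k0Im_eq_image]

/-! ### The two sides of (D3) as sums over morphisms -/

section CrossSums

variable {A : Type u} [Category.{v} A] [Abelian A] [HereditaryFinite A]

attribute [local instance] homFintype

variable {V : Type*} [AddCommGroup V] [Module ℂ V] (F : ExtIdx A → ExtIdx A → V)

/-- The terms of the left side of the cross relation. -/
noncomputable def crossTermL (a b : ExtHall A) (r : (ExtIdx A × ExtIdx A) × (ExtIdx A × ExtIdx A)) :
    V := (coprod a r.1 * coprod b r.2 * hopfPairing r.1.2 r.2.1) • F r.1.1 r.2.2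

/-- The terms of the right side of the cross relation. -/
noncomputable def crossTermR (a b : ExtHall A) (r : (ExtIdx A × ExtIdx A) × (ExtIdx A × ExtIdx A)) :
    V := (coprod a r.1 * coprod b r.2 * hopfPairing r.1.1 r.2.2) • F r.2.1 r.1.2

/-- The index of the term of the left side of the cross relation given by a morphism. -/
noncomputable def crossIdxL {X Y : A} (α β : K0 A) (g : Y ⟶ X) :
    (ExtIdx A × ExtIdx A) × (ExtIdx A × ExtIdx A) :=
  (((isoCls (cokernel g), k0Im g + α), (isoCls (Abelian.image g), α)),
    ((isoCls (Abelian.image g), k0Cls (kernel g) + β), (isoCls (kernel g), β)))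

/-- The index of the term of the right side of the cross relation given by a morphism. -/
noncomputable def crossIdxR {X Y : A} (α β : K0 A) (f : X ⟶ Y) :
    (ExtIdx A × ExtIdx A) × (ExtIdx A × ExtIdx A) :=
  (((isoCls (Abelian.image f), k0Cls (kernel f) + α), (isoCls (kernel f), α)),
    ((isoCls (cokernel f), k0Im f + β), (isoCls (Abelian.image f), β)))

lemma coprod_extB (p : ExtIdx A) : coprod (extB p) = coprodCoeff p :=
  Module.Basis.constr_basis (extHallConst A).basis ℂ coprodCoeff p

lemma hallNum_mul_autNum (a b x : IsoClass A) :
    hallNum a b x * autNum x = Nat.card (SESPairs a.rep b.rep x.rep) := by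
  rw [hallNum_eq, div_mul_cancel₀ _ (autNum_ne_zero x)]

-- The coproducts contribute exact sequences 0 → I → X → A → 0 and 0 → K → Y → I' → 0, and the
-- pairing forces I = I'. Such data, up to automorphisms, are morphisms Y ⟶ X with cokernel A, image
-- I and kernel K. This also shows that only finitely many terms are nonzero.
open Classical in
lemma crossTermL_extB (p q : ExtIdx A) (r : (ExtIdx A × ExtIdx A) × (ExtIdx A × ExtIdx A)) :
    crossTermL F (extB p) (extB q) r = ∑ g : q.1.rep ⟶ p.1.rep, if r = crossIdxL p.2 q.2 g then
      crossWeightL p.2 q.2 g • F (isoCls (cokernel g), k0Im g + p.2) (isoCls (kernel g), q.2)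
        else 0 := by
  obtain ⟨x, α⟩ := p
  obtain ⟨y, β⟩ := q
  obtain ⟨⟨⟨a, γ₁⟩, ⟨i, γ₂⟩⟩, ⟨⟨i', δ₁⟩, ⟨k, δ₂⟩⟩⟩ := r
  rw [crossTermL, coprod_extB, coprod_extB]
  dsimp only [coprodCoeff, hopfPairing]
  by_cases H : (γ₁ = isoK0 i + α ∧ γ₂ = α) ∧ (δ₁ = isoK0 k + β ∧ δ₂ = β) ∧ i = i'
  · rw [if_pos H.1, if_pos H.2.1, if_pos H.2.2]
    obtain ⟨⟨rfl, rfl⟩, ⟨rfl, rfl⟩, rfl⟩ := H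
    have hc := card_SESPairs_mul_card_SESPairs a i k x y
    rw [← hallNum_mul_autNum, ← hallNum_mul_autNum] at hc
    have h1 : sqrtEuler (isoK0 a) (isoK0 i) * hallNum a i x * (autNum x / (autNum a * autNum i)) *
        (sqrtEuler (isoK0 i) (isoK0 k) * hallNum i k y * (autNum y / (autNum i * autNum k))) *
        (sqrtSym γ₂ (isoK0 k + δ₂) * autNum i) =
        (sqrtEuler (isoK0 a) (isoK0 i) * sqrtEuler (isoK0 i) (isoK0 k) *
          sqrtSym γ₂ (isoK0 k + δ₂)) * (hallNum a i x * autNum x * (hallNum i k y * autNum y) /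
            (autNum a * autNum i * autNum k)) := by
      have := autNum_ne_zero i
      field_simp
    rw [h1, hc, Finset.mul_sum, Finset.sum_smul]
    refine Finset.sum_congr rfl fun g _ => ?_
    by_cases hg : a = isoCls (cokernel g) ∧ i = isoCls (Abelian.image g) ∧ k = isoCls (kernel g)
    · rw [if_pos hg]
      obtain ⟨rfl, rfl, rfl⟩ := hg
      rw [if_pos, mul_one, isoK0_isoCls_image, isoK0_isoCls, isoK0_isoCls, crossWeightL]
      rw [crossIdxL, isoK0_isoCls_image, isoK0_isoCls]
    · rw [if_neg hg, mul_zero, zero_smul, if_neg]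
      intro h
      simp only [crossIdxL, Prod.mk.injEq] at h
      exact hg ⟨h.1.1.1, h.1.2.1, h.2.2.1⟩
  · rw [Finset.sum_eq_zero fun g _ => if_neg fun h => H ?_]
    · rcases not_and_or.1 H with H | H
      · rw [if_neg H, zero_mul, zero_mul, zero_smul]
      · rcases not_and_or.1 H with H | H
        · rw [if_neg H, mul_zero, zero_mul, zero_smul]
        · rw [if_neg H, mul_zero, zero_smul]
    · simp only [crossIdxL, Prod.mk.injEq] at h
      obtain ⟨⟨⟨rfl, rfl⟩, rfl, rfl⟩, ⟨rfl, rfl⟩, rfl, rfl⟩ := h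
      simp [isoK0_isoCls, k0Im_eq_image]

-- Here the pairing matches the quotient of X with the subobject of Y, so the sum runs over
-- morphisms in the opposite direction, X ⟶ Y.
open Classical in
lemma crossTermR_extB (p q : ExtIdx A) (r : (ExtIdx A × ExtIdx A) × (ExtIdx A × ExtIdx A)) :
    crossTermR F (extB p) (extB q) r = ∑ f : p.1.rep ⟶ q.1.rep, if r = crossIdxR p.2 q.2 f then
      crossWeightR p.2 q.2 f • F (isoCls (cokernel f), k0Im f + q.2) (isoCls (kernel f), p.2)
        else 0 := by
  obtain ⟨x, α⟩ := p
  obtain ⟨y, β⟩ := q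
  obtain ⟨⟨⟨i, γ₁⟩, ⟨k, γ₂⟩⟩, ⟨⟨a, δ₁⟩, ⟨i', δ₂⟩⟩⟩ := r
  rw [crossTermR, coprod_extB, coprod_extB]
  dsimp only [coprodCoeff, hopfPairing]
  by_cases H : (γ₁ = isoK0 k + α ∧ γ₂ = α) ∧ (δ₁ = isoK0 i' + β ∧ δ₂ = β) ∧ i = i'
  · rw [if_pos H.1, if_pos H.2.1, if_pos H.2.2]
    obtain ⟨⟨rfl, rfl⟩, ⟨rfl, rfl⟩, rfl⟩ := H
    have hc := card_SESPairs_mul_card_SESPairs a i k y x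
    rw [← hallNum_mul_autNum, ← hallNum_mul_autNum] at hc
    have h1 : sqrtEuler (isoK0 i) (isoK0 k) * hallNum i k x * (autNum x / (autNum i * autNum k)) *
        (sqrtEuler (isoK0 a) (isoK0 i) * hallNum a i y * (autNum y / (autNum a * autNum i))) *
        (sqrtSym (isoK0 k + γ₂) δ₂ * autNum i) =
        (sqrtEuler (isoK0 i) (isoK0 k) * sqrtEuler (isoK0 a) (isoK0 i) *
          sqrtSym (isoK0 k + γ₂) δ₂) * (hallNum a i y * autNum y * (hallNum i k x * autNum x) /
            (autNum a * autNum i * autNum k)) := by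
      have := autNum_ne_zero i
      field_simp
    rw [h1, hc, Finset.mul_sum, Finset.sum_smul]
    refine Finset.sum_congr rfl fun g _ => ?_
    by_cases hg : a = isoCls (cokernel g) ∧ i = isoCls (Abelian.image g) ∧ k = isoCls (kernel g)
    · rw [if_pos hg]
      obtain ⟨rfl, rfl, rfl⟩ := hg
      rw [if_pos, mul_one, isoK0_isoCls_image, isoK0_isoCls, isoK0_isoCls, crossWeightR]
      rw [crossIdxR, isoK0_isoCls_image, isoK0_isoCls]
    · rw [if_neg hg, mul_zero, zero_smul, if_neg]
      intro h
      simp only [crossIdxR, Prod.mk.injEq] at h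
      exact hg ⟨h.2.1.1, h.1.1.1, h.1.2.1⟩
  · rw [Finset.sum_eq_zero fun g _ => if_neg fun h => H ?_]
    · rcases not_and_or.1 H with H | H
      · rw [if_neg H, zero_mul, zero_mul, zero_smul]
      · rcases not_and_or.1 H with H | H
        · rw [if_neg H, mul_zero, zero_mul, zero_smul]
        · rw [if_neg H, mul_zero, zero_smul]
    · simp only [crossIdxR, Prod.mk.injEq] at h
      obtain ⟨⟨⟨rfl, rfl⟩, rfl, rfl⟩, ⟨rfl, rfl⟩, rfl, rfl⟩ := h
      simp [isoK0_isoCls, k0Im_eq_image]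

lemma crossTermL_extB_finite (p q : ExtIdx A) :
    (Function.support (crossTermL F (extB p) (extB q))).Finite := by
  classical
  rw [funext (crossTermL_extB F p q)]
  exact support_sum_ite_finite (V := V) (ι := q.1.rep ⟶ p.1.rep) _ _

lemma crossTermR_extB_finite (p q : ExtIdx A) :
    (Function.support (crossTermR F (extB p) (extB q))).Finite := by
  classical
  rw [funext (crossTermR_extB F p q)]
  exact support_sum_ite_finite (V := V) (ι := p.1.rep ⟶ q.1.rep) _ _

lemma finsum_crossTermL_extB (p q : ExtIdx A) : ∑ᶠ r, crossTermL F (extB p) (extB q) r =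
    ∑ g : q.1.rep ⟶ p.1.rep, crossWeightL p.2 q.2 g •
      F (isoCls (cokernel g), k0Im g + p.2) (isoCls (kernel g), q.2) := by
  classical
  rw [funext (crossTermL_extB F p q)]
  exact finsum_sum_ite (V := V) (ι := q.1.rep ⟶ p.1.rep) _ _

lemma finsum_crossTermR_extB (p q : ExtIdx A) : ∑ᶠ r, crossTermR F (extB p) (extB q) r =
    ∑ f : p.1.rep ⟶ q.1.rep, crossWeightR p.2 q.2 f •
      F (isoCls (cokernel f), k0Im f + q.2) (isoCls (kernel f), p.2) := by
  classical
  rw [funext (crossTermR_extB F p q)]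
  exact finsum_sum_ite (V := V) (ι := p.1.rep ⟶ q.1.rep) _ _

lemma crossTermL_add_left (a a' b : ExtHall A) :
    crossTermL F (a + a') b = crossTermL F a b + crossTermL F a' b := by
  funext r
  simp only [crossTermL, map_add, Pi.add_apply, add_mul, add_smul]

lemma crossTermL_add_right (a b b' : ExtHall A) :
    crossTermL F a (b + b') = crossTermL F a b + crossTermL F a b' := by
  funext r
  simp only [crossTermL, map_add, Pi.add_apply, mul_add, add_mul, add_smul]

lemma crossTermL_smul_left (c : ℂ) (a b : ExtHall A) :
    crossTermL F (c • a) b = c • crossTermL F a b := by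
  funext r
  simp only [crossTermL, map_smul, Pi.smul_apply, smul_mul_assoc, smul_assoc]

lemma crossTermL_smul_right (c : ℂ) (a b : ExtHall A) :
    crossTermL F a (c • b) = c • crossTermL F a b := by
  funext r
  simp only [crossTermL, map_smul, Pi.smul_apply, mul_smul_comm, smul_mul_assoc, smul_assoc]

lemma crossTermR_add_left (a a' b : ExtHall A) :
    crossTermR F (a + a') b = crossTermR F a b + crossTermR F a' b := by
  funext r
  simp only [crossTermR, map_add, Pi.add_apply, add_mul, add_smul]

lemma crossTermR_add_right (a b b' : ExtHall A) :
    crossTermR F a (b + b') = crossTermR F a b + crossTermR F a b' := by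
  funext r
  simp only [crossTermR, map_add, Pi.add_apply, mul_add, add_mul, add_smul]

lemma crossTermR_smul_left (c : ℂ) (a b : ExtHall A) :
    crossTermR F (c • a) b = c • crossTermR F a b := by
  funext r
  simp only [crossTermR, map_smul, Pi.smul_apply, smul_mul_assoc, smul_assoc]

lemma crossTermR_smul_right (c : ℂ) (a b : ExtHall A) :
    crossTermR F a (c • b) = c • crossTermR F a b := by
  funext r
  simp only [crossTermR, map_smul, Pi.smul_apply, mul_smul_comm, smul_mul_assoc, smul_assoc]

/-- The cross relation follows from the cross relation of the basis elements. -/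
lemma cross_of_basis (F G : ExtIdx A → ExtIdx A → V) (h : ∀ p q : ExtIdx A,
      ∑ᶠ r, crossTermL F (extB p) (extB q) r = ∑ᶠ r, crossTermR G (extB p) (extB q) r)
    (a b : ExtHall A) : ((Function.support (crossTermL F a b)).Finite ∧
      (Function.support (crossTermR G a b)).Finite) ∧
      ∑ᶠ r, crossTermL F a b r = ∑ᶠ r, crossTermR G a b r := by
  have hadd : ∀ {x x' y y' : (ExtIdx A × ExtIdx A) × (ExtIdx A × ExtIdx A) → V},
      ((Function.support x).Finite ∧ (Function.support y).Finite) ∧ ∑ᶠ r, x r = ∑ᶠ r, y r →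
      ((Function.support x').Finite ∧ (Function.support y').Finite) ∧ ∑ᶠ r, x' r = ∑ᶠ r, y' r →
      ((Function.support (x + x')).Finite ∧ (Function.support (y + y')).Finite) ∧
        ∑ᶠ r, (x + x') r = ∑ᶠ r, (y + y') r := fun {x x' y y'} h h' => by
    refine ⟨⟨(h.1.1.union h'.1.1).subset (Function.support_add _ _),
      (h.1.2.union h'.1.2).subset (Function.support_add _ _)⟩, ?_⟩
    simp only [Pi.add_apply]
    rw [finsum_add_distrib h.1.1 h'.1.1, finsum_add_distrib h.1.2 h'.1.2, h.2, h'.2]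
  have hsmul : ∀ (c : ℂ) {x y : (ExtIdx A × ExtIdx A) × (ExtIdx A × ExtIdx A) → V},
      ((Function.support x).Finite ∧ (Function.support y).Finite) ∧ ∑ᶠ r, x r = ∑ᶠ r, y r →
      ((Function.support (c • x)).Finite ∧ (Function.support (c • y)).Finite) ∧
        ∑ᶠ r, (c • x) r = ∑ᶠ r, (c • y) r := fun c {x y} h => by
    refine ⟨⟨h.1.1.subset (Function.support_const_smul_subset _ _),
      h.1.2.subset (Function.support_const_smul_subset _ _)⟩, ?_⟩
    simp only [Pi.smul_apply]
    rw [← smul_finsum, ← smul_finsum, h.2]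
  induction a using (extHallConst A).induction with
  | hadd x x' h1 h2 => rw [crossTermL_add_left, crossTermR_add_left]; exact hadd h1 h2
  | hsmul r x h1 => rw [crossTermL_smul_left, crossTermR_smul_left]; exact hsmul r h1
  | hb p =>
  induction b using (extHallConst A).induction with
  | hadd x x' h1 h2 => rw [crossTermL_add_right, crossTermR_add_right]; exact hadd h1 h2
  | hsmul r x h1 => rw [crossTermL_smul_right, crossTermR_smul_right]; exact hsmul r h1
  | hb q => exact ⟨⟨crossTermL_extB_finite F p q, crossTermR_extB_finite G p q⟩, h p q⟩

end CrossSums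

/-! ### Families triangular with respect to a basis -/

section Triangular

variable {ι V : Type*} [AddCommGroup V] [Module ℂ V]

/-- A family which is triangular with respect to a basis spans. -/
lemma span_of_triangular (t v : ι → V) (ht : ⊤ ≤ Submodule.span ℂ (Set.range t)) (m : ι → ℕ)
    (c : ι → ℂ) (hc : ∀ i, c i ≠ 0)
    (hv : ∀ i, v i - c i • t i ∈ Submodule.span ℂ (t '' {j | m j < m i})) :
    ⊤ ≤ Submodule.span ℂ (Set.range v) := by
  refine ht.trans (Submodule.span_le.2 ?_)
  rintro _ ⟨i, rfl⟩
  induction h : m i using Nat.strong_induction_on generalizing i with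
  | _ n ih =>
  have h1 : v i - c i • t i ∈ Submodule.span ℂ (Set.range v) := by
    refine Submodule.span_le.2 ?_ (hv i)
    rintro _ ⟨j, hj, rfl⟩
    exact ih (m j) (h ▸ hj) j rfl
  have h2 : c i • t i ∈ Submodule.span ℂ (Set.range v) := by
    have := Submodule.sub_mem _ (Submodule.subset_span (Set.mem_range_self i)) h1
    rwa [sub_sub_cancel] at this
  exact (Submodule.smul_mem_iff _ (hc i)).1 h2

/-- A family which is triangular with respect to a basis is linearly independent. -/
lemma linearIndependent_of_triangular (t : Module.Basis ι ℂ V) (v : ι → V) (m : ι → ℕ)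
    (c : ι → ℂ) (hc : ∀ i, c i ≠ 0)
    (hv : ∀ i, v i - c i • t i ∈ Submodule.span ℂ (t '' {j | m j < m i})) :
    LinearIndependent ℂ v := by
  have hcoord : ∀ i j, m i ≤ m j → t.coord j (v i - c i • t i) = 0 := fun i j hij => by
    have : Submodule.span ℂ (t '' {j | m j < m i}) ≤ LinearMap.ker (t.coord j) := by
      refine Submodule.span_le.2 ?_
      rintro _ ⟨l, hl, rfl⟩
      have hlj : l ≠ j := by
        rintro rfl
        exact absurd hij (not_le.2 hl)
      simp [hlj]
    exact this (hv i)
  rw [linearIndependent_iff']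
  intro s g hg i hi
  by_contra h0
  -- Among the indices with nonzero coefficient take one of largest measure; no other term of the
  -- relation contributes to its coordinate.
  obtain ⟨j, hj, hmax⟩ := Finset.exists_max_image (s.filter fun i => g i ≠ 0) m
    ⟨i, Finset.mem_filter.2 ⟨hi, h0⟩⟩
  rw [Finset.mem_filter] at hj
  have h1 := congrArg (t.coord j) hg
  rw [map_sum, map_zero, Finset.sum_eq_single j] at h1
  · have h2 := hcoord j j le_rfl
    rw [map_sub, sub_eq_zero] at h2
    rw [map_smul, h2, map_smul] at h1
    simp [hc j, hj.2] at h1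
  · intro l hl hlj
    by_cases hgl : g l = 0
    · rw [hgl, zero_smul, map_zero]
    · have h2 := hcoord l j (hmax l (Finset.mem_filter.2 ⟨hl, hgl⟩))
      rw [map_sub, sub_eq_zero] at h2
      rw [map_smul, h2, map_smul]
      simp [hlj]
  · exact fun h => absurd hj.1 h

end Triangular

/-! ### A measure that drops on passing to kernel and cokernel -/

section Measure

variable {A : Type u} [Category.{v} A] [Abelian A] [HereditaryFinite A]

lemma card_hom_pos (X Y : A) : 0 < Nat.card (X ⟶ Y) := by
  have : Nonempty (X ⟶ Y) := ⟨0⟩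
  exact Nat.card_pos

lemma card_ext_pos (X Y : A) : 0 < Nat.card (Ext X Y 1) := Nat.card_pos

variable {M X L : A} {f : M ⟶ X} {g : X ⟶ L} (h : IsSES f g) (Y : A)

include h

lemma card_hom_le_of_epi : Nat.card (L ⟶ Y) ≤ Nat.card (X ⟶ Y) := by
  have := h.epi
  exact Nat.card_le_card_of_injective (fun s => g ≫ s) fun _ _ h => (cancel_epi g).1 h

lemma card_hom_le_of_mono : Nat.card (Y ⟶ M) ≤ Nat.card (Y ⟶ X) := by
  have := h.mono
  exact Nat.card_le_card_of_injective (fun s => s ≫ f) fun _ _ h => (cancel_mono f).1 h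

/-- The identity of X does not factor through the proper subobject M. This is the only source of
strictness. -/
lemma card_hom_lt_of_mono (hg : g ≠ 0) : Nat.card (X ⟶ M) < Nat.card (X ⟶ X) := by
  have := h.mono
  let _ := Fintype.ofFinite (X ⟶ M)
  let _ := Fintype.ofFinite (X ⟶ X)
  rw [Nat.card_eq_fintype_card, Nat.card_eq_fintype_card]
  refine Fintype.card_lt_of_injective_of_notMem (fun s : X ⟶ M => s ≫ f) (b := 𝟙 X)
    (fun _ _ h => (cancel_mono f).1 h) ?_
  rintro ⟨s, hs⟩
  refine hg ?_
  rw [← Category.id_comp g, ← hs, Category.assoc, h.zero, comp_zero]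

lemma card_ext_le_of_mono : Nat.card (Ext M Y 1) ≤ Nat.card (Ext X Y 1) :=
  Nat.card_le_card_of_surjective ((Ext.mk₀ f).precomp Y (zero_add 1)) fun x =>
    Ext.contravariant_sequence_exact₁ h.2 Y x (by norm_num : 1 + 1 = 2) (Subsingleton.elim _ _)

lemma card_ext_le_of_epi : Nat.card (Ext Y L 1) ≤ Nat.card (Ext Y X 1) :=
  Nat.card_le_card_of_surjective ((Ext.mk₀ g).postcomp Y (add_zero 1)) fun x =>
    Ext.covariant_sequence_exact₃ Y h.2 x (by norm_num : 1 + 1 = 2) (Subsingleton.elim _ _)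

lemma card_hom_mul_card_hom_le : Nat.card (M ⟶ Y) * Nat.card (L ⟶ Y) ≤
    Nat.card (X ⟶ Y) * Nat.card (Ext L Y 1) := by
  refine Nat.le_of_mul_le_mul_right ?_ (card_ext_pos X Y)
  calc _ = Nat.card (X ⟶ Y) * Nat.card (Ext L Y 1) * Nat.card (Ext M Y 1) := by
        linear_combination -card_contravariant h Y
    _ ≤ _ := Nat.mul_le_mul_left _ (card_ext_le_of_mono h Y)

lemma card_ext_mul_card_ext_le : Nat.card (Ext L Y 1) * Nat.card (Ext M Y 1) ≤
    Nat.card (M ⟶ Y) * Nat.card (Ext X Y 1) := by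
  refine Nat.le_of_mul_le_mul_left ?_ (card_hom_pos X Y)
  calc _ = Nat.card (L ⟶ Y) * (Nat.card (M ⟶ Y) * Nat.card (Ext X Y 1)) := by
        linear_combination card_contravariant h Y
    _ ≤ _ := Nat.mul_le_mul_right _ (card_hom_le_of_epi h Y)

lemma card_hom_mul_card_hom_le' : Nat.card (Y ⟶ M) * Nat.card (Y ⟶ L) ≤
    Nat.card (Y ⟶ X) * Nat.card (Ext Y M 1) := by
  refine Nat.le_of_mul_le_mul_right ?_ (card_ext_pos Y X)
  calc _ = Nat.card (Y ⟶ X) * Nat.card (Ext Y M 1) * Nat.card (Ext Y L 1) := by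
        linear_combination -card_covariant h Y
    _ ≤ _ := Nat.mul_le_mul_left _ (card_ext_le_of_epi h Y)

lemma card_ext_mul_card_ext_le' : Nat.card (Ext Y M 1) * Nat.card (Ext Y L 1) ≤
    Nat.card (Y ⟶ L) * Nat.card (Ext Y X 1) := by
  refine Nat.le_of_mul_le_mul_left ?_ (card_hom_pos Y X)
  calc _ = Nat.card (Y ⟶ M) * (Nat.card (Y ⟶ L) * Nat.card (Ext Y X 1)) := by
        linear_combination card_covariant h Y
    _ ≤ _ := Nat.mul_le_mul_right _ (card_hom_le_of_mono h Y)

omit h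

/-- A measure of the size of a pair of objects. -/
noncomputable def pairMeasure (X Y : A) : ℕ :=
  Nat.card (X ⟶ X) * (Nat.card (Y ⟶ Y) * Nat.card (Ext Y X 1))

/-- Objects need not have finite length, so the size of a pair is measured by counting morphisms and
extensions. Each inequality follows from the six term counts after multiplying by terms involving I,
which are common to both sides and cancel. -/
lemma pairMeasure_lt {K X I Y C : A} {i : K ⟶ X} {p : X ⟶ I} {j : I ⟶ Y} {q : Y ⟶ C}
    (h : IsSES i p) (h' : IsSES j q) (hp : p ≠ 0) : pairMeasure K C < pairMeasure X Y := by
  have h1 : Nat.card (K ⟶ K) * Nat.card (Ext C K 1) ≤ Nat.card (X ⟶ K) * Nat.card (Ext Y K 1) := by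
    refine Nat.le_of_mul_le_mul_right ?_ (Nat.mul_pos (card_hom_pos I K) (card_ext_pos I K))
    calc _ = (Nat.card (K ⟶ K) * Nat.card (I ⟶ K)) *
          (Nat.card (Ext C K 1) * Nat.card (Ext I K 1)) := by ring
      _ ≤ (Nat.card (X ⟶ K) * Nat.card (Ext I K 1)) *
          (Nat.card (I ⟶ K) * Nat.card (Ext Y K 1)) :=
        Nat.mul_le_mul (card_hom_mul_card_hom_le h K) (card_ext_mul_card_ext_le h' K)
      _ = _ := by ring
  have h2 : Nat.card (Ext Y K 1) * Nat.card (Y ⟶ C) ≤ Nat.card (Y ⟶ Y) * Nat.card (Ext Y X 1) := by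
    refine Nat.le_of_mul_le_mul_right ?_ (Nat.mul_pos (card_ext_pos Y I) (card_hom_pos Y I))
    calc _ = (Nat.card (Ext Y K 1) * Nat.card (Ext Y I 1)) *
          (Nat.card (Y ⟶ I) * Nat.card (Y ⟶ C)) := by ring
      _ ≤ (Nat.card (Y ⟶ I) * Nat.card (Ext Y X 1)) *
          (Nat.card (Y ⟶ Y) * Nat.card (Ext Y I 1)) :=
        Nat.mul_le_mul (card_ext_mul_card_ext_le' h Y) (card_hom_mul_card_hom_le' h' Y)
      _ = _ := by ring
  calc pairMeasure K C = (Nat.card (K ⟶ K) * Nat.card (Ext C K 1)) * Nat.card (C ⟶ C) := by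
        rw [pairMeasure]; ring
    _ ≤ (Nat.card (X ⟶ K) * Nat.card (Ext Y K 1)) * Nat.card (Y ⟶ C) :=
        Nat.mul_le_mul h1 (card_hom_le_of_epi h' C)
    _ = Nat.card (X ⟶ K) * (Nat.card (Ext Y K 1) * Nat.card (Y ⟶ C)) := by ring
    _ ≤ Nat.card (X ⟶ K) * (Nat.card (Y ⟶ Y) * Nat.card (Ext Y X 1)) := Nat.mul_le_mul_left _ h2
    _ < pairMeasure X Y := Nat.mul_lt_mul_of_pos_right (card_hom_lt_of_mono h hp)
        (Nat.mul_pos (card_hom_pos _ _) (card_ext_pos _ _))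

lemma pairMeasure_kernel_cokernel_lt {X Y : A} {f : X ⟶ Y} (hf : f ≠ 0) :
    pairMeasure (isoCls (kernel f)).rep (isoCls (cokernel f)).rep < pairMeasure X Y := by
  obtain ⟨e⟩ := rep_isoCls (kernel f)
  obtain ⟨e'⟩ := rep_isoCls (cokernel f)
  have h : IsSES (e.hom ≫ kernel.ι f) (Abelian.factorThruImage f) := by
    refine isSES_of_lift inferInstance inferInstance ?_ fun t ht => ?_
    · rw [← cancel_mono (Abelian.image.ι f), Category.assoc, Category.assoc, Abelian.image.fac,
        kernel.condition, comp_zero, zero_comp]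
    · have ht' : t ≫ f = 0 := by
        rw [← Abelian.image.fac f, ← Category.assoc, ht, zero_comp]
      exact ⟨kernel.lift f t ht' ≫ e.inv, by simp⟩
  have h' : IsSES (Abelian.image.ι f) (cokernel.π f ≫ e'.inv) := by
    refine isSES_of_desc inferInstance inferInstance ?_ fun t ht => ?_
    · rw [← Category.assoc, kernel.condition, zero_comp]
    · have ht' : f ≫ t = 0 := by
        rw [← Abelian.image.fac f, Category.assoc, ht, comp_zero]
      exact ⟨e'.hom ≫ cokernel.desc f t ht', by simp⟩
  refine pairMeasure_lt h h' fun h0 => hf ?_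
  rw [← Abelian.image.fac f, h0, zero_comp]

end Measure

/-! ### Effective boundary classes -/

section EffectiveClasses

variable {A : Type u} [Category.{v} A] [Abelian A]

open ZeroObject in
variable (A) in
/-- The classes of boundaries of acyclic complexes. -/
def effBds : AddSubmonoid (K0 A × K0 A) where
  carrier := {κ | ∃ K : Cpx A, K.Acyclic ∧ cpxBds K = κ}
  zero_mem' := ⟨cpxD 0 (0 : A), cpxD_acyclic _ _, by
    rw [cpxBds_cpxD_zero, k0Cls_zero (isZero_zero A)]; rfl⟩
  add_mem' := by
    rintro _ _ ⟨K, hK, rfl⟩ ⟨K', hK', rfl⟩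
    exact ⟨K ⊞ K', acyclic_biprod hK hK', cpxBds_of_isSES (isSES_biprod K K') (Or.inl hK)⟩

lemma effBds_fst (X : A) : (k0Cls X, 0) ∈ effBds A := ⟨_, cpxD_acyclic 0 X, cpxBds_cpxD_zero X⟩

lemma effBds_snd (X : A) : (0, k0Cls X) ∈ effBds A := ⟨_, cpxD_acyclic 1 X, cpxBds_cpxD_one X⟩

/-- Every element of K₀ is a difference of classes of objects, and contractible complexes realize
the class of any object as a boundary class in either factor. -/
lemma exists_add_mem_effBds (κ : K0 A × K0 A) : ∃ e ∈ effBds A, κ + e ∈ effBds A := by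
  have hadd : ∀ κ κ' : K0 A × K0 A, (∃ e ∈ effBds A, κ + e ∈ effBds A) →
      (∃ e ∈ effBds A, κ' + e ∈ effBds A) → ∃ e ∈ effBds A, κ + κ' + e ∈ effBds A := by
    rintro κ κ' ⟨e, he, h⟩ ⟨e', he', h'⟩
    exact ⟨e + e', add_mem he he', by rw [add_add_add_comm]; exact add_mem h h'⟩
  have hneg : ∀ κ : K0 A × K0 A, (∃ e ∈ effBds A, κ + e ∈ effBds A) →
      ∃ e ∈ effBds A, -κ + e ∈ effBds A := by
    rintro κ ⟨e, he, h⟩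
    exact ⟨κ + e, h, by rwa [neg_add_cancel_left]⟩
  have hof : ∀ κ ∈ effBds A, ∃ e ∈ effBds A, κ + e ∈ effBds A :=
    fun κ h => ⟨0, zero_mem _, by rwa [add_zero]⟩
  obtain ⟨α, β⟩ := κ
  have h1 : ∃ e ∈ effBds A, ((α, 0) : K0 A × K0 A) + e ∈ effBds A := by
    induction α using k0_induction with
    | h0 => exact hof _ (zero_mem _)
    | hof X => exact hof _ (effBds_fst X)
    | hneg x hx => simpa only [Prod.neg_mk, neg_zero] using hneg _ hx
    | hadd x y hx hy => simpa only [Prod.mk_add_mk, add_zero] using hadd _ _ hx hy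
  have h2 : ∃ e ∈ effBds A, ((0, β) : K0 A × K0 A) + e ∈ effBds A := by
    induction β using k0_induction with
    | h0 => exact hof _ (zero_mem _)
    | hof X => exact hof _ (effBds_snd X)
    | hneg x hx => simpa only [Prod.neg_mk, neg_zero] using hneg _ hx
    | hadd x y hx hy => simpa only [Prod.mk_add_mk, add_zero] using hadd _ _ hx hy
  simpa only [Prod.mk_add_mk, add_zero, zero_add] using hadd _ _ h1 h2

lemma exists_forall_add_mem_effBds {ι : Type*} (s : Finset ι) (κ : ι → K0 A × K0 A) :
    ∃ e, ∀ i ∈ s, κ i + e ∈ effBds A := by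
  classical
  suffices ∃ e ∈ effBds A, ∀ i ∈ s, κ i + e ∈ effBds A from ⟨this.choose, this.choose_spec.2⟩
  induction s using Finset.induction_on with
  | empty => exact ⟨0, zero_mem _, by simp⟩
  | insert a s _ ih =>
    obtain ⟨e, he, h⟩ := ih
    obtain ⟨e', he', h'⟩ := exists_add_mem_effBds (κ a)
    refine ⟨e + e', add_mem he he', fun i hi => ?_⟩
    obtain rfl | hi := Finset.mem_insert.1 hi
    · rw [add_comm e, ← add_assoc]; exact add_mem h' he
    · rw [← add_assoc]; exact add_mem (h i hi) he'

end EffectiveClasses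

/-! ### A basis of the twisted modified Hall algebra -/

section ModifiedHallBasis

variable {A : Type u} [Category.{v} A] [Abelian A] [HereditaryFinite A]

/-- The class of a complex with zero differentials times the class of an acyclic complex. -/
noncomputable def zVal (p : CpxInv A) : ModHallTw A :=
  mhCls (cpxZ p.1.1.rep p.1.2.rep) * mhK p.2

lemma zVal_mul_mhK (p : CpxInv A) (κ : K0 A × K0 A) : zVal p * mhK κ = zVal (p.1, p.2 + κ) := by
  rw [zVal, zVal, mhK_add, mul_assoc]

lemma mhCls_eq_zVal (M : Cpx A) : ∃ c : ℂ, c ≠ 0 ∧ mhCls M = c • zVal (cpxInv M) :=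
  ⟨_, sqrtEuler_ne_zero _ _, mhCls_eq M (rep_isoCls (M.homology 0)).some.symm
    (rep_isoCls (M.homology 1)).some.symm⟩

/-- Effectiveness of the boundary class means that the unit is the class of an acyclic complex, so
the normal form is a multiple of the class of an actual complex and its invariants are known. -/
lemma modInvMap_zVal {p : CpxInv A} (hp : p.2 ∈ effBds A) : ∃ c : ℂ, c ≠ 0 ∧
    modInvMap A ((Twisted.mk (modHallGrading A) (cwForm A)).symm (zVal p)) =
      Finsupp.single p c := by
  obtain ⟨⟨x, y⟩, κ⟩ := p
  obtain ⟨K, hK, rfl⟩ : ∃ K : Cpx A, K.Acyclic ∧ cpxBds K = κ := hp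
  refine ⟨sqrtEuler ((cpxDeg (isoCls (cpxZ x.rep y.rep))).1 -
    (cpxDeg (isoCls (cpxZ x.rep y.rep))).2) ((cpxBds K).1 - (cpxBds K).2),
    sqrtEuler_ne_zero _ _, ?_⟩
  rw [zVal, ← mhCls_of_acyclic hK, mhCls_mul_acyclic _ hK, map_smul, map_smul, mhCls,
    LinearEquiv.symm_apply_apply, modInvMap_of,
    cpxInv_of_acyclic_left (isSES_biprod K (cpxZ x.rep y.rep)) hK, cpxInv_cpxZ, isoCls_rep,
    isoCls_rep, zero_add, Finsupp.smul_single, smul_eq_mul, mul_one]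

-- A linear relation involves finitely many indices, so multiplication by one unit makes all their
-- boundary classes effective. `modInvMap` then sends the terms to nonzero multiples of distinct
-- basis vectors.
variable (A) in
lemma linearIndependent_zVal : LinearIndependent ℂ (zVal : CpxInv A → ModHallTw A) := by
  rw [linearIndependent_iff']
  intro s g hg i hi
  obtain ⟨e, he⟩ := exists_forall_add_mem_effBds s fun p : CpxInv A => p.2
  choose! c hc hρ using fun (p : CpxInv A) (hp : p ∈ s) =>
    modInvMap_zVal (p := (p.1, p.2 + e)) (he p hp)
  have h1 := congrArg (fun z => modInvMap A
    ((Twisted.mk (modHallGrading A) (cwForm A)).symm (z * mhK e))) hg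
  rw [zero_mul, map_zero, map_zero, Finset.sum_mul, map_sum, map_sum, Finset.sum_congr rfl
    fun p hp => by rw [smul_mul_assoc, zVal_mul_mhK, map_smul, map_smul, hρ p hp]] at h1
  have h2 := congrArg (fun z : InvSpace A => z (i.1, i.2 + e)) h1
  rw [Finsupp.finsetSum_apply, Finset.sum_eq_single i] at h2
  · simpa [hc i hi] using h2
  · intro j _ hj
    have : (j.1, j.2 + e) ≠ (i.1, i.2 + e) := fun h =>
      hj (Prod.ext (Prod.ext_iff.1 h).1 (add_right_cancel (Prod.ext_iff.1 h).2))
    rw [Finsupp.smul_apply, Finsupp.single_eq_of_ne' this, smul_zero]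
  · exact fun h => absurd hi h

lemma span_zVal_mul_mhK {z : ModHallTw A} (hz : z ∈ Submodule.span ℂ (Set.range zVal))
    (κ : K0 A × K0 A) : z * mhK κ ∈ Submodule.span ℂ (Set.range (zVal (A := A))) := by
  induction hz using Submodule.span_induction with
  | mem z hz =>
    obtain ⟨p, rfl⟩ := hz
    rw [zVal_mul_mhK]
    exact Submodule.subset_span ⟨_, rfl⟩
  | zero => rw [zero_mul]; exact Submodule.zero_mem _
  | add x y _ _ hx hy => rw [add_mul]; exact Submodule.add_mem _ hx hy
  | smul c x _ hx => rw [smul_mul_assoc]; exact Submodule.smul_mem _ _ hx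

/-- Inverses in the untwisted and in the twisted algebra differ by a scalar only. The degree is
recorded so that the product with a class [M] can be computed in the twisted algebra. -/
lemma mk_inv_eq (s : acyclicSet A) : ∃ (c : ℂ) (κ : K0 A × K0 A) (g : K0 A × K0 A),
    (modHallGrading A).Homog g (UnivLoc.inv (acyclicSet A) s) ∧
    Twisted.mk (modHallGrading A) (cwForm A) (UnivLoc.inv (acyclicSet A) s) = c • mhK κ := by
  obtain ⟨g, hg⟩ := univLocCoact_inv (quotGrading A) (acyclicSet A) (acyclicSet_homog A) s
  obtain ⟨s, hs⟩ := s
  obtain ⟨c, K, hc, hK, rfl⟩ := id hs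
  have h1 := UnivLoc.inv_mul_of (acyclicSet A) ⟨_, hs⟩
  dsimp only at h1
  rw [map_smul, mul_smul_comm] at h1
  have h2 := Twisted.mk_mul_mk (D := modHallGrading A) (cwForm A) hg (modHallGrading_homog K)
  change _ * mhCls K = _ at h2
  rw [← inv_smul_smul₀ hc (_ * UnivLoc.of _ _), h1, map_smul, Twisted.mk_one,
    mhCls_of_acyclic hK, smul_smul] at h2
  refine ⟨(cwForm A).toFun g (cpxDeg (isoCls K)) * c⁻¹, -cpxBds K, g, hg, ?_⟩
  rw [← mul_one (Twisted.mk _ _ _), ← mhK_zero, ← add_neg_cancel (cpxBds K), mhK_add, ← mul_assoc,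
    h2, smul_mul_assoc, one_mul]

/-- By the right localization every element is a fraction. Its numerator is a combination of classes
[M], which are multiples of normal forms, and its denominator only shifts the unit. -/
lemma span_zVal : ⊤ ≤ Submodule.span ℂ (Set.range (zVal (A := A))) := by
  have hM : ∀ a : QuotHall A, ∀ s : acyclicSet A, Twisted.mk (modHallGrading A) (cwForm A)
      (UnivLoc.of (acyclicSet A) a * UnivLoc.inv (acyclicSet A) s) ∈
        Submodule.span ℂ (Set.range (zVal (A := A))) := fun a s => by
    obtain ⟨x, rfl⟩ := RingQuot.mkAlgHom_surjective ℂ (AcyclicRel A) a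
    induction x using hallAlg_induction with
    | hadd x y hx hy =>
      rw [map_add, map_add, add_mul, map_add]
      exact Submodule.add_mem _ hx hy
    | hsmul r x hx =>
      rw [map_smul, map_smul, smul_mul_assoc, map_smul]
      exact Submodule.smul_mem _ _ hx
    | hb M =>
      obtain ⟨c, κ, g, hg, h⟩ := mk_inv_eq s
      have h1 := Twisted.mk_mul_mk (cwForm A) (modHallGrading_homog M) hg
      rw [h, mul_smul_comm] at h1
      refine (Submodule.smul_mem_iff _ ((cwForm A).ne_zero (cpxDeg (isoCls M)) g)).1 ?_
      refine h1 ▸ Submodule.smul_mem _ _ (span_zVal_mul_mhK ?_ κ)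
      obtain ⟨c', -, h'⟩ := mhCls_eq_zVal M
      change mhCls M ∈ _
      rw [h']
      exact Submodule.smul_mem _ _ (Submodule.subset_span ⟨_, rfl⟩)
  intro z _
  obtain ⟨z, rfl⟩ := (Twisted.mk (modHallGrading A) (cwForm A)).surjective z
  obtain ⟨a, s, hs, rfl⟩ := (modHall_isRightLocalization A).surj z
  have h1 : Ring.inverse (UnivLoc.of (acyclicSet A) s) = UnivLoc.inv (acyclicSet A) ⟨s, hs⟩ := by
    have hu : IsUnit (UnivLoc.of (acyclicSet A) s) := UnivLoc.isUnit_of (acyclicSet A) ⟨s, hs⟩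
    refine hu.mul_left_cancel ?_
    rw [Ring.mul_inverse_cancel _ hu]
    exact (UnivLoc.of_mul_inv (acyclicSet A) ⟨s, hs⟩).symm
  have := hM a ⟨s, hs⟩
  rwa [← h1] at this

variable (A) in
/-- The basis of the twisted modified Hall algebra. -/
noncomputable def zBasis : Module.Basis (CpxInv A) ℂ (ModHallTw A) :=
  Module.Basis.mk (linearIndependent_zVal A) span_zVal

lemma zBasis_apply (p : CpxInv A) : zBasis A p = zVal p := Module.Basis.mk_apply _ _ _

end ModifiedHallBasis

/-! ### Bijectivity of a ⊗ b ↦ I₊(a) * I₋(b) -/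

section TensorMap

variable {A : Type u} [Category.{v} A] [Abelian A]

lemma cpxInv_cpxMk_zero {X Y : A} (f : X ⟶ Y) :
    cpxInv (cpxMk (0 : Y ⟶ X) f zero_comp comp_zero) =
      ((isoCls (cokernel f), isoCls (kernel f)), (0, k0Im f)) := by
  refine Prod.ext (Prod.ext (isoCls_eq_iff.2 ?_) (isoCls_eq_iff.2 ?_)) ?_
  · obtain ⟨e⟩ := homology_cpxMk_zero (0 : Y ⟶ X) f zero_comp comp_zero
    exact ⟨e ≪≫ (ShortComplex.HomologyData.ofIsColimitCokernelCofork (ShortComplex.mk f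
      (0 : Y ⟶ X) comp_zero) rfl _ (cokernelIsCokernel f)).left.homologyIso⟩
  · obtain ⟨e⟩ := homology_cpxMk_one (0 : Y ⟶ X) f zero_comp comp_zero
    exact ⟨e ≪≫ (ShortComplex.HomologyData.ofIsLimitKernelFork (ShortComplex.mk (0 : Y ⟶ X) f
      zero_comp) rfl _ (kernelIsKernel f)).left.homologyIso⟩
  · change cpxBds _ = _
    rw [cpxBds_cpxMk, k0Im_zero]

variable [HereditaryFinite A]

attribute [local instance] homFintype

/-- The measure of the index of a basis element. -/
noncomputable def idxMeasure (p : CpxInv A) : ℕ := pairMeasure p.1.2.rep p.1.1.rep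

/-- The product of the images of two basis elements. -/
noncomputable def prodVal (p : CpxInv A) : ModHallTw A :=
  stalkVal A 1 (p.1.2, p.2.1) * stalkVal A 0 (p.1.1, p.2.2)

lemma prodVal_eq (p : CpxInv A) : prodVal p = sqrtSym p.2.1 (-isoK0 p.1.1) •
    ∑ f : p.1.2.rep ⟶ p.1.1.rep, mhCls (cpxMk (0 : p.1.1.rep ⟶ p.1.2.rep) f zero_comp comp_zero) *
      mhK p.2 := by
  obtain ⟨⟨y, x⟩, ⟨α, β⟩⟩ := p
  dsimp only [prodVal, stalkVal]
  rw [← Finset.sum_mul, ← mhCls_stalk_one_mul_stalk_zero, stalkShift_one, stalkShift_zero,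
    mul_assoc, ← mul_assoc (mhK _), mhK_mul_mhCls, cpxDeg_stalk_zero, smul_mul_assoc,
    mul_smul_comm, zero_sub, sub_zero, mul_assoc, ← mhK_add, Prod.mk_add_mk, add_zero, zero_add,
    mul_assoc]
  rfl

/-- The product is a sum over morphisms f. The zero morphism gives the normal form with the same
index, and a nonzero f gives a complex with homology coker f and ker f, whose index has smaller
measure. -/
lemma prodVal_triangular (p : CpxInv A) : prodVal p - sqrtSym p.2.1 (-isoK0 p.1.1) • zVal p ∈
    Submodule.span ℂ (zVal '' {q | idxMeasure q < idxMeasure p}) := by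
  classical
  rw [prodVal_eq, ← smul_sub, ← Finset.add_sum_erase _ _ (Finset.mem_univ 0)]
  refine Submodule.smul_mem _ _ ?_
  have h0 : mhCls (cpxMk (0 : p.1.1.rep ⟶ p.1.2.rep) 0 zero_comp comp_zero) * mhK p.2 = zVal p :=
    rfl
  rw [h0, add_sub_cancel_left]
  refine Submodule.sum_mem _ fun f hf => ?_
  obtain ⟨c, -, hc⟩ := mhCls_eq_zVal (cpxMk (0 : p.1.1.rep ⟶ p.1.2.rep) f zero_comp comp_zero)
  rw [hc, smul_mul_assoc, zVal_mul_mhK, cpxInv_cpxMk_zero]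
  exact Submodule.smul_mem _ _ (Submodule.subset_span
    ⟨_, pairMeasure_kernel_cokernel_lt (Finset.ne_of_mem_erase hf), rfl⟩)

variable (A) in
/-- The products of the images of the basis elements form a basis. -/
noncomputable def prodBasis : Module.Basis (CpxInv A) ℂ (ModHallTw A) :=
  have hv : ∀ p : CpxInv A, prodVal p - sqrtSym p.2.1 (-isoK0 p.1.1) • zBasis A p ∈
      Submodule.span ℂ (zBasis A '' {q | idxMeasure q < idxMeasure p}) := by
    have h : ⇑(zBasis A) = zVal := funext zBasis_apply
    rw [h]
    exact prodVal_triangular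
  Module.Basis.mk (v := prodVal)
    (linearIndependent_of_triangular (zBasis A) _ idxMeasure _ (fun _ => sqrtSym_ne_zero _ _) hv)
    (span_of_triangular (zBasis A) _ (zBasis A).span_eq.ge idxMeasure _
      (fun _ => sqrtSym_ne_zero _ _) hv)

variable (A) in
/-- The indices of the tensor products of basis elements. -/
def tensorIdx : CpxInv A ≃ ExtIdx A × ExtIdx A where
  toFun p := ((p.1.2, p.2.1), (p.1.1, p.2.2))
  invFun r := ((r.2.1, r.1.1), (r.1.2, r.2.2))
  left_inv _ := rfl
  right_inv _ := rfl

open TensorProduct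

variable (A) in
/-- The linear map `a ⊗ b ↦ I₊(a) * I₋(b)`. -/
noncomputable def tensorMap : ExtHall2 A →ₗ[ℂ] ModHallTw A :=
  LinearMap.mul' ℂ (ModHallTw A) ∘ₗ
    TensorProduct.map (stalkHom A 1).toLinearMap (stalkHom A 0).toLinearMap

lemma tensorMap_tmul (a b : ExtHall A) :
    tensorMap A (a ⊗ₜ[ℂ] b) = stalkHom A 1 a * stalkHom A 0 b := rfl

variable (A) in
/-- The basis of the tensor square. -/
noncomputable def tensorBasis : Module.Basis (ExtIdx A × ExtIdx A) ℂ (ExtHall2 A) :=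
  (extHallConst A).basis.tensorProduct (extHallConst A).basis

lemma tensorBasis_apply (r : ExtIdx A × ExtIdx A) :
    tensorBasis A r = extB r.1 ⊗ₜ[ℂ] extB r.2 := Module.Basis.tensorProduct_apply' _ _ _

variable (A) in
/-- The linear isomorphism `a ⊗ b ↦ I₊(a) * I₋(b)`. -/
noncomputable def tensorEquiv : ExtHall2 A ≃ₗ[ℂ] ModHallTw A :=
  (tensorBasis A).equiv (prodBasis A) (tensorIdx A).symm

lemma tensorEquiv_apply (z : ExtHall2 A) : tensorEquiv A z = tensorMap A z := by
  suffices (tensorEquiv A).toLinearMap = tensorMap A from congrArg (fun f => f z) this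
  refine (tensorBasis A).ext fun r => ?_
  rw [LinearEquiv.coe_coe, tensorEquiv, Module.Basis.equiv_apply, prodBasis, Module.Basis.mk_apply,
    tensorBasis_apply, tensorMap_tmul, stalkHom_basis, stalkHom_basis]
  rfl

lemma tensorEquiv_tmul (a b : ExtHall A) :
    tensorEquiv A (a ⊗ₜ[ℂ] b) = stalkHom A 1 a * stalkHom A 0 b :=
  tensorEquiv_apply _

end TensorMap

/-! ### Existence and uniqueness of the Drinfeld double -/

section DoubleMultiplication

open TensorProduct

variable {A : Type u} [Category.{v} A] [Abelian A] [HereditaryFinite A]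

attribute [local instance] homFintype

variable (A) in
/-- The multiplication of the Drinfeld double, transported from the modified Hall algebra. -/
noncomputable def doubleMul : ExtHall2 A →ₗ[ℂ] ExtHall2 A →ₗ[ℂ] ExtHall2 A :=
  (LinearMap.mul ℂ (ModHallTw A)).compl₁₂ (tensorEquiv A).toLinearMap (tensorEquiv A).toLinearMap
    |>.compr₂ (tensorEquiv A).symm.toLinearMap

lemma tensorEquiv_doubleMul (x y : ExtHall2 A) :
    tensorEquiv A (doubleMul A x y) = tensorEquiv A x * tensorEquiv A y :=
  (tensorEquiv A).apply_symm_apply _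

instance : Nontrivial (ExtHall A) := ⟨⟨(extHallConst A).basis (extHallConst A).one, 0,
  (extHallConst A).basis.ne_zero _⟩⟩

variable (A) in
lemma tmul_one_injective :
    Function.Injective fun a : ExtHall A => (a ⊗ₜ[ℂ] 1 : ExtHall2 A) :=
  Algebra.TensorProduct.includeLeft_injective (S := ℂ) (algebraMap ℂ (ExtHall A)).injective

variable (A) in
lemma one_tmul_injective :
    Function.Injective fun b : ExtHall A => (1 ⊗ₜ[ℂ] b : ExtHall2 A) :=
  Algebra.TensorProduct.includeRight_injective (algebraMap ℂ (ExtHall A)).injective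

lemma crossLeft_eq : crossLeft (A := A) = crossTermL fun p q => extB p ⊗ₜ[ℂ] extB q := rfl

lemma crossRight_eq (μ : ExtHall2 A →ₗ[ℂ] ExtHall2 A →ₗ[ℂ] ExtHall2 A) :
    crossRight μ = crossTermR fun p q => μ (1 ⊗ₜ[ℂ] extB p) (extB q ⊗ₜ[ℂ] 1) := rfl

lemma doubleMul_cross (a b : ExtHall A) :
    ((Function.support (crossLeft a b)).Finite ∧
      (Function.support (crossRight (doubleMul A) a b)).Finite) ∧
      ∑ᶠ r, crossLeft a b r = ∑ᶠ r, crossRight (doubleMul A) a b r := by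
  rw [crossLeft_eq, crossRight_eq]
  refine cross_of_basis _ _ (fun p q => ?_) a b
  rw [finsum_crossTermL_extB, finsum_crossTermR_extB]
  apply (tensorEquiv A).injective
  simp only [map_sum, map_smul, tensorEquiv_doubleMul, tensorEquiv_tmul, map_one, one_mul, mul_one,
    stalkHom_basis]
  exact stalkVal_cross p.1.rep q.1.rep p.2 q.2

variable (A) in
lemma isDrinfeldDouble_doubleMul : IsDrinfeldDouble (doubleMul A) where
  assoc x y z := (tensorEquiv A).injective (by simp only [tensorEquiv_doubleMul, mul_assoc])
  one_left x := (tensorEquiv A).injective (by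
    rw [tensorEquiv_doubleMul, tensorEquiv_tmul, map_one, map_one, one_mul, one_mul])
  one_right x := (tensorEquiv A).injective (by
    rw [tensorEquiv_doubleMul, tensorEquiv_tmul, map_one, map_one, mul_one, mul_one])
  left_mul a a' := (tensorEquiv A).injective (by
    simp only [tensorEquiv_doubleMul, tensorEquiv_tmul, map_one, map_mul, mul_one])
  left_injective := tmul_one_injective A
  right_mul b b' := (tensorEquiv A).injective (by
    simp only [tensorEquiv_doubleMul, tensorEquiv_tmul, map_one, map_mul, one_mul])
  right_injective := one_tmul_injective A
  left_mul_right a b := (tensorEquiv A).injective (by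
    simp only [tensorEquiv_doubleMul, tensorEquiv_tmul, map_one, one_mul, mul_one])
  cross_left_finite a b := (doubleMul_cross a b).1.1
  cross_right_finite a b := (doubleMul_cross a b).1.2
  cross a b := (doubleMul_cross a b).2

lemma crossWeightR_ne_zero {X Y : A} (α β : K0 A) (f : X ⟶ Y) : crossWeightR α β f ≠ 0 :=
  mul_ne_zero (mul_ne_zero (sqrtEuler_ne_zero _ _) (sqrtEuler_ne_zero _ _)) (sqrtSym_ne_zero _ _)

variable {μ μ' : ExtHall2 A →ₗ[ℂ] ExtHall2 A →ₗ[ℂ] ExtHall2 A}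

/-- The left side of (D3) does not involve the multiplication. On the right, f = 0 gives the product
in question with a nonzero weight, and the other morphisms give products of smaller measure, known
by induction. -/
lemma IsDrinfeldDouble.mul_extB_eq (h : IsDrinfeldDouble μ) (h' : IsDrinfeldDouble μ')
    (p q : ExtIdx A) : μ (1 ⊗ₜ[ℂ] extB p) (extB q ⊗ₜ[ℂ] 1) =
      μ' (1 ⊗ₜ[ℂ] extB p) (extB q ⊗ₜ[ℂ] 1) := by
  classical
  induction hn : pairMeasure q.1.rep p.1.rep using Nat.strong_induction_on generalizing p q with
  | _ n ih =>
  have h1 := (h.cross (extB q) (extB p)).symm.trans (h'.cross (extB q) (extB p))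
  rw [crossRight_eq, crossRight_eq, finsum_crossTermR_extB, finsum_crossTermR_extB,
    ← Finset.add_sum_erase _ _ (Finset.mem_univ 0),
    ← Finset.add_sum_erase (a := 0) _ _ (Finset.mem_univ 0)] at h1
  rw [Finset.sum_congr rfl fun f hf => by
    rw [ih _ (hn ▸ pairMeasure_kernel_cokernel_lt (Finset.ne_of_mem_erase hf)) _ _ rfl]] at h1
  have h2 := smul_right_injective _ (crossWeightR_ne_zero _ _ _) (add_right_cancel h1)
  have e1 : isoCls (cokernel (0 : q.1.rep ⟶ p.1.rep)) = p.1 :=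
    (isoCls_eq_iff.2 ⟨cokernelZeroIsoTarget⟩).trans (isoCls_rep _)
  have e2 : isoCls (kernel (0 : q.1.rep ⟶ p.1.rep)) = q.1 :=
    (isoCls_eq_iff.2 ⟨kernelZeroIsoSource⟩).trans (isoCls_rep _)
  simpa only [e1, e2, k0Im_zero, zero_add] using h2

lemma IsDrinfeldDouble.mul_right_left_eq (h : IsDrinfeldDouble μ) (h' : IsDrinfeldDouble μ')
    (b a : ExtHall A) : μ (1 ⊗ₜ[ℂ] b) (a ⊗ₜ[ℂ] 1) = μ' (1 ⊗ₜ[ℂ] b) (a ⊗ₜ[ℂ] 1) := by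
  induction a using (extHallConst A).induction with
  | hadd x x' h1 h2 => simp only [TensorProduct.add_tmul, map_add, h1, h2]
  | hsmul r x h1 => simp only [← TensorProduct.smul_tmul', map_smul, h1]
  | hb p =>
  induction b using (extHallConst A).induction with
  | hadd x x' h1 h2 => simp only [TensorProduct.tmul_add, map_add, LinearMap.add_apply, h1, h2]
  | hsmul r x h1 => simp only [TensorProduct.tmul_smul, map_smul, LinearMap.smul_apply, h1]
  | hb q => exact h.mul_extB_eq h' q p

lemma IsDrinfeldDouble.left_mul_tmul (h : IsDrinfeldDouble μ) (a c d : ExtHall A) :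
    μ (a ⊗ₜ[ℂ] 1) (c ⊗ₜ[ℂ] d) = (a * c) ⊗ₜ[ℂ] d := by
  rw [← h.left_mul_right c, ← h.assoc, h.left_mul, h.left_mul_right]

lemma IsDrinfeldDouble.tmul_mul_right (h : IsDrinfeldDouble μ) (c d b : ExtHall A) :
    μ (c ⊗ₜ[ℂ] d) (1 ⊗ₜ[ℂ] b) = c ⊗ₜ[ℂ] (d * b) := by
  rw [← h.left_mul_right c d, h.assoc, h.right_mul, h.left_mul_right]

/-- The Drinfeld double is unique. -/
lemma IsDrinfeldDouble.unique (h : IsDrinfeldDouble μ) (h' : IsDrinfeldDouble μ') : μ = μ' := by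
  refine TensorProduct.ext' fun a b => TensorProduct.ext' fun a' b' => ?_
  -- Any product factors as (a ⊗ 1) times (1 ⊗ b)(a' ⊗ 1) times (1 ⊗ b'). The middle factor is
  -- determined by (D3), and the outer multiplications are determined by (D1) and (D2).
  have key : ∀ {ν : ExtHall2 A →ₗ[ℂ] ExtHall2 A →ₗ[ℂ] ExtHall2 A}, IsDrinfeldDouble ν →
      ν (a ⊗ₜ[ℂ] b) (a' ⊗ₜ[ℂ] b') =
        ν (a ⊗ₜ[ℂ] 1) (ν (ν (1 ⊗ₜ[ℂ] b) (a' ⊗ₜ[ℂ] 1)) (1 ⊗ₜ[ℂ] b')) := fun {ν} hν => by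
    rw [hν.assoc, hν.left_mul_right, ← hν.assoc, hν.left_mul_right]
  rw [key h, key h', h.mul_right_left_eq h']
  generalize μ' (1 ⊗ₜ[ℂ] b) (a' ⊗ₜ[ℂ] 1) = z
  induction z using TensorProduct.induction_on with
  | zero => simp only [map_zero, LinearMap.zero_apply]
  | add x y hx hy => simp only [map_add, LinearMap.add_apply, hx, hy]
  | tmul c d => rw [h.tmul_mul_right, h'.tmul_mul_right, h.left_mul_tmul, h'.left_mul_tmul]

end DoubleMultiplication

end ModifiedHall

theorem theorem4p11 {k : Type*} [Field k] [Finite k] {A : Type*} [Category A] [Abelian A]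
    [Linear k A] [HereditaryFinite A] :
    IsRightLocalization (acyclicSet A) (UnivLoc.of (acyclicSet A) : QuotHall A →+* ModHall A) ∧
    ∃ D : ExtHall2 A →ₗ[ℂ] ExtHall2 A →ₗ[ℂ] ExtHall2 A,
      IsDrinfeldDouble D ∧ (∀ D', IsDrinfeldDouble D' → D' = D) ∧
      ∃ Ip Im : ExtHall A →ₐ[ℂ] ModHallTw A,
        (∀ X : A, IsUnit (mhCls (cpxK X)) ∧ IsUnit (mhCls (cpxKs X))) ∧
        (∀ X : A, Ip (extCls X) = mhCls (cpxC X) ∧ Im (extCls X) = mhCls (cpxCs X)) ∧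
        (∀ X Y : A,
          Ip (extK (k0Cls X - k0Cls Y)) = mhCls (cpxK X) * Ring.inverse (mhCls (cpxK Y)) ∧
          Im (extK (k0Cls X - k0Cls Y)) = mhCls (cpxKs X) * Ring.inverse (mhCls (cpxKs Y))) ∧
        ∃ Φ : ExtHall2 A ≃ₗ[ℂ] ModHallTw A,
          (∀ a b : ExtHall A, Φ (a ⊗ₜ[ℂ] b) = Ip a * Im b) ∧
          ∀ x y : ExtHall2 A, Φ (D x y) = Φ x * Φ y :=
  ⟨modHall_isRightLocalization A, doubleMul A, isDrinfeldDouble_doubleMul A,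
    fun _ h => h.unique (isDrinfeldDouble_doubleMul A), stalkHom A 1, stalkHom A 0,
    fun X => ⟨isUnit_mhCls (cpxD_acyclic _ X), isUnit_mhCls (cpxD_acyclic _ X)⟩,
    fun X => ⟨stalkHom_extCls 1 X, stalkHom_extCls 0 X⟩,
    fun X Y => ⟨stalkHom_one_extK_sub X Y, stalkHom_zero_extK_sub X Y⟩,
    tensorEquiv A, tensorEquiv_tmul, tensorEquiv_doubleMul⟩
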